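/- **Notation.** For $x\in\mathbb R^2$ put $x^\perp=(-x_2,x_1)^\top$, let $B_R=\{|x|<R\}$ and $B_R^{\rm c}=\{|x|\ge R\}$, and let $O(\theta)=\begin{pmatrix}\cos\theta&-\sin\theta\\ \sin\theta&\cos\theta\end{pmatrix}$. For $s\ge 0$ and measurable $S\subset\mathbb R^2$, $\|g\|_{L^\infty_s(S)}=\operatorname{ess\,sup}_{x\in S}(1+|x|)^s|g(x)|$, and $L^\infty_s(\mathbb R^2)$ is the space of $g\in L^\infty(\mathbb R^2)$ with $\|g\|_{L^\infty_s(\mathbb R^2)}<\infty$ (matrices carry the Frobenius norm). Let $$G(x,t)=\frac1{4\pi t}e^{-|x|^2/(4t)},\qquad K(x,t)=G(x,t)\,\mathbb I+\int_t^\infty\nabla^2G(x,s)\,ds,$$ $$\Gamma_\alpha(x,y)=\int_0^\infty O(\alpha t)^\top K(O(\alpha t)x-y,t)\,dt=\lim_{T\to\infty}\int_0^T O(\alpha t)^\top K(O(\alpha t)x-y,t)\,dt\qquad(x\ne y),$$ $$L[f](x)=\lim_{\epsilon\to0+}\int_{\mathbb R^2}e^{-\epsilon|y|^2}\,\Gamma_\alpha(x,y)f(y)\,dy,$$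 $$c[f]=\lim_{\epsilon\to0+}\int_{\mathbb R^2}e^{-\epsilon|y|^2}y^\perp\cdot f(y)\,dy,\qquad \tilde c[F]=\lim_{\epsilon\to0+}\int_{\mathbb R^2}e^{-\epsilon|y|^2}\big(F_{12}(y)-F_{21}(y)\big)\,dy .$$ For $\alpha\in\mathbb R$ let $\mathcal L_\alpha u=-\Delta u-\alpha(x^\perp\cdot\nabla u-u^\perp)$. A weak solution of the rotating Stokes system $$-\Delta u-\alpha(x^\perp\cdot\nabla u-u^\perp)+\nabla p=f,\qquad \operatorname{div}u=0\qquad\text{in }\mathbb R^2$$ is a pair $(u,p)\in L^{q_1}(\mathbb R^2)^2\times L^{q_2}(\mathbb R^2)$, for some $q_1\in[2,\infty)$ and $q_2\in[1,\infty)$, such that $\operatorname{div}u=0$ in the sense of distributions and $$\int_{\mathbb R^2} u\cdot\mathcal L_{-\alpha}\phi\,dx-\int_{\mathbb R^2} p\,\operatorname{div}\phi\,dx=\int_{\mathbb R^2} f\cdot\phi\,dx\qquad\text{for all }\phi\in\mathcal S(\mathbb R^2)^2 ;$$ $u$ is called a weak solution if such a $p$ exists. **Theorem.** For every $\alpha\neq0$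 the improper integral defining $\Gamma_\alpha(x,y)$ converges for all $x\ne y$. There are numerical constants $C_1,C_2$ such that the following holds for every $\alpha\in\mathbb R\setminus\{0\}$ and every $\gamma\in[0,1)$. (i) Let $R\ge1$ and let $f\in L^2(\mathbb R^2)^2$ vanish almost everywhere outside $B_R$. Then the limits defining $L[f](x)$ (for every $x\in\mathbb R^2$, with absolutely convergent integrals for each $\epsilon>0$) and $c[f]$ exist, $u=L[f]$ is a weak solution, and $$u(x)=c[f]\frac{x^\perp}{4\pi|x|^2}+\mathcal R[f](x)\qquad(x\ne0),$$ where $$\|\mathcal R[f]\|_{L^\infty_{1+\gamma}(B_{2R}^{\rm c})}\le C_1\Big(|\alpha|^{-\frac{1+\gamma}2}\|f\|_{L^1(B_R)}+\big\||y|^{1+\gamma}f\big\|_{L^1(B_R)}\Big).$$ (ii) Let $f\in L^2(\mathbb R^2)^2$ be of the form $f=\operatorname{div}F$, i.e. $f_i=\sum_j\partial_jF_{ij}$ in the sense of distributions, with $F\in L^\infty_{2+\gamma}(\mathbb R^2)^{2\times2}$; if $\gamma=0$, assume in addition that the limit defining $\tilde c[F]$ exists. Then the limits defining $L[f](x)$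 (for every $x\in\mathbb R^2$, with absolutely convergent integrals for each $\epsilon>0$), $\tilde c[F]$, and $\lim_{\epsilon\to0+}\int_{|y|\ge r}e^{-\epsilon|y|^2}(F_{12}-F_{21})\,dy$ (for every $r$) exist, $u=L[f]$ is a weak solution, and $$u(x)=\tilde c[F]\frac{x^\perp}{4\pi|x|^2}+\mathcal R[f](x)\qquad(x\ne0),$$ where for every $R\ge1$ $$\begin{aligned}\|\mathcal R[f]\|_{L^\infty_{1+\gamma}(B_{2R}^{\rm c})}\le C_2\Big(&\|F\|_{L^\infty_{2+\gamma}(B_R^{\rm c})}+\sup_{|x|\ge2R}|x|^{-1+\gamma}\int_{B_{|x|/2}}|y|\,|F(y)|\,dy\\&+\sup_{|x|\ge2R}\min\Big\{\frac1{|\alpha||x|^{2-\gamma}},|x|^\gamma\Big\}\|F\|_{L^1(B_{|x|/2})}\\&+\sup_{|x|\ge2R}|x|^\gamma\Big|\lim_{\epsilon\to0+}\int_{2|y|\ge|x|}e^{-\epsilon|y|^2}\big(F_{12}(y)-F_{21}(y)\big)\,dy\Big|\Big).\end{aligned}$$ The constants $C_1,C_2$ do not depend on $\gamma,\alpha,R,f,F$.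 -/

import Mathlib

open MeasureTheory Filter Topology Set
open scoped NNReal ENNReal Matrix SchwartzMap

attribute [local instance] Matrix.frobeniusNormedAddCommGroup

noncomputable section

namespace RotStokes

/-- The plane `ℝ²` with its Euclidean norm. -/
abbrev Plane : Type := EuclideanSpace ℝ (Fin 2)

/-- `2 × 2` real matrices; their norm is the Frobenius norm. -/
abbrev Mat : Type := Matrix (Fin 2) (Fin 2) ℝ

/-- The standard basis vector `e_i`. -/
def e (i : Fin 2) : Plane := EuclideanSpace.single i 1

/-- `x^⊥ = (-x₂, x₁)`. -/
def perp (x : Plane) : Plane := !₂[-(x 1), x 0]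

/-- The product of a matrix and a vector. -/
def mulVec (M : Mat) (v : Plane) : Plane := WithLp.toLp 2 (M *ᵥ v.ofLp)

/-- The rotation matrix `O(θ)`. -/
def rot (θ : ℝ) : Mat := !![Real.cos θ, -Real.sin θ; Real.sin θ, Real.cos θ]

/-- The partial derivative `∂_i g` of a scalar function. -/
def pderiv (i : Fin 2) (g : Plane → ℝ) (x : Plane) : ℝ := fderiv ℝ g x (e i)

/-- The two-dimensional Gauss kernel `G(x,t)`. -/
def gauss (x : Plane) (t : ℝ) : ℝ :=
  1 / (4 * Real.pi * t) * Real.exp (-(‖x‖ ^ 2) / (4 * t))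

/-- The Hessian `∇²G(x,s)` with respect to the space variable. -/
def hessGauss (x : Plane) (s : ℝ) : Mat :=
  Matrix.of fun i j => pderiv i (pderiv j (fun z => gauss z s)) x

/-- `H(x,t) = ∫_t^∞ ∇²G(x,s) ds`, entry by entry. -/
def kernelH (x : Plane) (t : ℝ) : Mat :=
  Matrix.of fun i j => ∫ s in Ioi t, hessGauss x s i j

/-- `K(x,t) = G(x,t) I + H(x,t)`. -/
def kernelK (x : Plane) (t : ℝ) : Mat := gauss x t • (1 : Mat) + kernelH x t

/-- The integrand `O(αt)ᵀ K(O(αt)x - y, t)` of the fundamental solution. -/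
def gammaIntegrand (α : ℝ) (x y : Plane) (t : ℝ) : Mat :=
  (rot (α * t))ᵀ * kernelK (mulVec (rot (α * t)) x - y) t

/-- The fundamental solution `Γ_α(x,y) = ∫_0^∞ O(αt)ᵀ K(O(αt)x - y, t) dt`, entry by entry. The
integrand is of size `1/t` for large `t`, so the integral converges only as the improper integral
`lim_{T → ∞} ∫_0^T`. -/
def fundSol (α : ℝ) (x y : Plane) : Mat :=
  Matrix.of fun i j => limUnder atTop (fun T : ℝ => ∫ t in (0 : ℝ)..T, gammaIntegrand α x y t i j)

/-- The integrand `e^{-ε|y|²} Γ_α(x,y) f(y)`. -/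
def solIntegrand (α : ℝ) (f : Plane → Plane) (x : Plane) (ε : ℝ) (y : Plane) : Plane :=
  Real.exp (-(ε * ‖y‖ ^ 2)) • mulVec (fundSol α x y) (f y)

/-- `L[f](x) = lim_{ε → 0+} ∫ e^{-ε|y|²} Γ_α(x,y) f(y) dy`. -/
def L (α : ℝ) (f : Plane → Plane) (x : Plane) : Plane :=
  limUnder (𝓝[>] (0 : ℝ)) (fun ε => ∫ y, solIntegrand α f x ε y)

/-- `∫ e^{-ε|y|²} y^⊥ · f(y) dy`. -/
def regTorque (f : Plane → Plane) (ε : ℝ) : ℝ :=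
  ∫ y, Real.exp (-(ε * ‖y‖ ^ 2)) * inner ℝ (perp y) (f y)

/-- `c[f] = lim_{ε → 0+} ∫ e^{-ε|y|²} y^⊥ · f(y) dy`. -/
def c (f : Plane → Plane) : ℝ := limUnder (𝓝[>] (0 : ℝ)) (regTorque f)

/-- `∫_S e^{-ε|y|²} (F₁₂(y) - F₂₁(y)) dy`. -/
def regSkew (F : Plane → Mat) (S : Set Plane) (ε : ℝ) : ℝ :=
  ∫ y in S, Real.exp (-(ε * ‖y‖ ^ 2)) * (F y 0 1 - F y 1 0)

/-- `lim_{ε → 0+} ∫_S e^{-ε|y|²} (F₁₂(y) - F₂₁(y)) dy`. -/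
def skewLim (F : Plane → Mat) (S : Set Plane) : ℝ := limUnder (𝓝[>] (0 : ℝ)) (regSkew F S)

/-- `c̃[F] = lim_{ε → 0+} ∫ e^{-ε|y|²} (F₁₂(y) - F₂₁(y)) dy`. -/
def ctilde (F : Plane → Mat) : ℝ := skewLim F univ

/-- The circular flow `x^⊥ / (4π|x|²)`. -/
def vortex (x : Plane) : Plane := (1 / (4 * Real.pi * ‖x‖ ^ 2)) • perp x

/-- The complement `{x : |x| ≥ R}` of the open disk of radius `R` about the origin. -/
def ballCompl (R : ℝ) : Set Plane := {x | R ≤ ‖x‖}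

/-- The weighted norm `ess sup_{x ∈ S} (1+|x|)^s |g(x)|` of `L^∞_s(S)`. -/
def wNorm {E : Type*} [NormedAddCommGroup E] (s : ℝ) (S : Set Plane) (g : Plane → E) : ℝ≥0∞ :=
  eLpNorm (fun x => (1 + ‖x‖) ^ s * ‖g x‖) ⊤ (volume.restrict S)

/-- `g ∈ L^∞_s(ℝ²)`. -/
def MemWeighted {E : Type*} [NormedAddCommGroup E] (s : ℝ) (g : Plane → E) : Prop :=
  MemLp g ⊤ volume ∧ wNorm s univ g < ⊤

/-- `f = div F`, that is `f_i = ∑_j ∂_j F_ij`, in the sense of distributions on `ℝ²`. -/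
def IsDiv (f : Plane → Plane) (F : Plane → Mat) : Prop :=
  ∀ ψ : Plane → ℝ, ContDiff ℝ (⊤ : ℕ∞) ψ → HasCompactSupport ψ → ∀ i : Fin 2,
    ∫ x, f x i * ψ x = -∫ x, ∑ j : Fin 2, F x i j * pderiv j ψ x

/-- The divergence of a (differentiable) vector field. -/
def divergence (φ : Plane → Plane) (x : Plane) : ℝ := ∑ i : Fin 2, (fderiv ℝ φ x (e i)) i

/-- `𝓛_α u = -Δu - α (x^⊥ · ∇u - u^⊥)`. -/
def rotOp (α : ℝ) (u : Plane → Plane) (x : Plane) : Plane :=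
  -(Laplacian.laplacian u x) - α • (fderiv ℝ u x (perp x) - perp (u x))

/-- `(u,p)` is a weak solution of
`-Δu - α (x^⊥ · ∇u - u^⊥) + ∇p = f`, `div u = 0` in `ℝ²`. -/
def IsWeakSolution (α : ℝ) (f u : Plane → Plane) (p : Plane → ℝ) : Prop :=
  (∃ q₁ : ℝ≥0∞, 2 ≤ q₁ ∧ q₁ < ⊤ ∧ MemLp u q₁ volume) ∧
  (∃ q₂ : ℝ≥0∞, 1 ≤ q₂ ∧ q₂ < ⊤ ∧ MemLp p q₂ volume) ∧
  (∀ ψ : Plane → ℝ, ContDiff ℝ (⊤ : ℕ∞) ψ → HasCompactSupport ψ →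
    ∫ x, ∑ i : Fin 2, u x i * pderiv i ψ x = 0) ∧
  (∀ φ : 𝓢(Plane, Plane),
    (∫ x, inner ℝ (u x) (rotOp (-α) φ x)) - ∫ x, p x * divergence φ x
      = ∫ x, inner ℝ (f x) (φ x))

/-- The limit defining `L[f](x)` exists for every `x` (with absolutely convergent integrals). -/
def LConverges (α : ℝ) (f : Plane → Plane) : Prop :=
  ∀ x : Plane, (∀ ε : ℝ, 0 < ε → Integrable (solIntegrand α f x ε) volume) ∧
    Tendsto (fun ε => ∫ y, solIntegrand α f x ε y) (𝓝[>] (0 : ℝ)) (𝓝 (L α f x))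

end RotStokes

end

noncomputable section

namespace RotStokes

open LineDeriv Laplacian

local notation "⟪" x "," y "⟫" => inner ℝ x y

/-! All kernels are measured by the parabolic weight `sg z s` = (s+|z|²)^{-1/2}. Each space
derivative of the Gauss kernel costs one more power of it, a time derivative costs two, and
integrating over s > t gives two back. Hence K, ∇K and ∂ₜK are of orders 2, 3 and 4.

Convergence of Γ_α. For large t the integrand is close to its value at z = 0, a rotation divided by
8πt. This is not absolutely integrable, but the rotation oscillates, so one integration by parts in
time gives a factor 1/|α| (`abs_integral_mul_cos_le`). The deviation from z = 0 is at most √|z|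
t^{-5/4} (`abs_Kk_sub_le_sqrt`), which is integrable. Therefore Γ_α is bounded by a mild local
singularity plus a multiple of (1+√|x|)(1+√|y|), and it acts on L² densities with a weighted L¹
bound (`Adm`).

Far field. After rotating back, the integrand is K at x - O(αt)ᵀy, and it is expanded in y for |y| ≤
|x|/2. The zeroth term oscillates with frequency α. In the first term both the direction of
differentiation and the force rotate, so their product has a mean plus harmonics of frequency 2α. By
the heat equation the nonlocal part of the mean telescopes, leaving -(a·x^⊥)(b·y^⊥) G(x,t)/(4t)
(`K1_average`), and the time integral of G/(4t) is 1/(4π|x|²). This is the circular flow. The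
second-order remainder is (|y|/|x|)². Interpolating these bounds gives `abs_Gam_sub_vortex_le`, and
integration over the support gives (i).

Divergence form. When the divergence is moved onto the kernel, the integrand becomes ∇K, and the
space-time integral converges absolutely for F = O(|y|^{-2}) (`rpot_sg_le`). The Gaussian factor in
L[f] does not commute with the divergence; the commutator `corr` is O(|y|^{-3}) uniformly in ε and
tends to zero, so it contributes nothing in the limit (`DivForm.tendsto_vel`). For the asymptotics F
is cut at |x|/2. The outer part is estimated directly; in the inner part ∇K(x - ·) is frozen at x,
and the averaging above retains only the antisymmetric part of ∫F.

Equation. For a Schwartz field φ, integration by parts turns the time derivative of ∫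
kap(x,y,φ(x),b,t) dx into the same integral with -𝓛_{-α}φ in place of φ. The time integral thus
telescopes: it vanishes at infinity, and at t = 0 it gives φ(y)·b plus a gradient of a Newton
potential of div φ (`integral_Gam_rotS`). Fubini's theorem turns the potential term into the
pressure. Since each column of K is divergence free, so is the velocity. The pressure is split at s
= 1: the early times lie in L³ by a Hölder argument for L² densities (`lintegral_pot_near_lt_top`),
and the late times decay like 1/|x|. -/

theorem inner_eq (a b : Plane) : ⟪a, b⟫ = a 0 * b 0 + a 1 * b 1 := by
  simp [PiLp.inner_apply, Fin.sum_univ_two, mul_comm]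

theorem norm_sq_eq (a : Plane) : ‖a‖ ^ 2 = a 0 ^ 2 + a 1 ^ 2 := by
  rw [EuclideanSpace.real_norm_sq_eq, Fin.sum_univ_two]

@[simp] theorem perp_apply_zero (x : Plane) : perp x 0 = -x 1 := rfl
@[simp] theorem perp_apply_one (x : Plane) : perp x 1 = x 0 := rfl
@[simp] theorem e_apply (i j : Fin 2) : e i j = if j = i then 1 else 0 := by
  simp [e]

theorem norm_e (i : Fin 2) : ‖e i‖ = 1 := by simp [e]

theorem inner_e_left (i : Fin 2) (v : Plane) : ⟪e i, v⟫ = v i := by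
  fin_cases i <;> simp [inner_eq]

theorem inner_e_right (i : Fin 2) (v : Plane) : ⟪v, e i⟫ = v i := by
  fin_cases i <;> simp [inner_eq]

theorem sum_smul_e (v : Plane) : ∑ i, v i • e i = v := by
  ext j; fin_cases j <;> simp [Fin.sum_univ_two]

/-! ### Rotations of the plane -/

/-- `perp` as a linear map. -/
def perpL : Plane →L[ℝ] Plane :=
  LinearMap.toContinuousLinearMap
    { toFun := perp
      map_add' := fun x y => by ext i; fin_cases i <;> simp [perp, add_comm]
      map_smul' := fun c x => by ext i; fin_cases i <;> simp [perp] }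

@[simp] theorem perpL_apply (x : Plane) : perpL x = perp x := rfl

/-- The rotation by the angle `θ` acting on vectors. -/
def Rot (θ : ℝ) (v : Plane) : Plane := Real.cos θ • v + Real.sin θ • perp v

theorem mulVec_rot (θ : ℝ) (v : Plane) : mulVec (rot θ) v = Rot θ v := by
  ext i; fin_cases i <;>
    simp [mulVec, rot, Rot, dotProduct, Fin.sum_univ_two] ; ring

@[simp] theorem Rot_apply_zero (θ : ℝ) (v : Plane) :
    Rot θ v 0 = Real.cos θ * v 0 - Real.sin θ * v 1 := by
  simp [Rot]; ring

@[simp] theorem Rot_apply_one (θ : ℝ) (v : Plane) :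
    Rot θ v 1 = Real.cos θ * v 1 + Real.sin θ * v 0 := by
  simp [Rot]

theorem inner_Rot_left (θ : ℝ) (a b : Plane) : ⟪Rot θ a, b⟫ = ⟪a, Rot (-θ) b⟫ := by
  simp [inner_eq]; ring

theorem Rot_neg_Rot (θ : ℝ) (a : Plane) : Rot (-θ) (Rot θ a) = a := by
  ext i; fin_cases i <;> simp
  · linear_combination (a 0) * Real.sin_sq_add_cos_sq θ
  · linear_combination (a 1) * Real.sin_sq_add_cos_sq θ

theorem Rot_Rot_neg (θ : ℝ) (a : Plane) : Rot θ (Rot (-θ) a) = a := by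
  simpa using Rot_neg_Rot (-θ) a

theorem Rot_sub (θ : ℝ) (a b : Plane) : Rot θ (a - b) = Rot θ a - Rot θ b := by
  ext i; fin_cases i <;> simp <;> ring

theorem Rot_add (θ : ℝ) (a b : Plane) : Rot θ (a + b) = Rot θ a + Rot θ b := by
  ext i; fin_cases i <;> simp <;> ring

theorem Rot_smul (θ c : ℝ) (a : Plane) : Rot θ (c • a) = c • Rot θ a := by
  ext i; fin_cases i <;> simp <;> ring

theorem norm_Rot (θ : ℝ) (a : Plane) : ‖Rot θ a‖ = ‖a‖ := by
  rw [← sq_eq_sq₀ (norm_nonneg _) (norm_nonneg _), ← real_inner_self_eq_norm_sq,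
    inner_Rot_left, Rot_neg_Rot, real_inner_self_eq_norm_sq]

theorem norm_perp (a : Plane) : ‖perp a‖ = ‖a‖ := by
  rw [← sq_eq_sq₀ (norm_nonneg _) (norm_nonneg _), norm_sq_eq, norm_sq_eq]; simp; ring

theorem inner_Rot_Rot (θ : ℝ) (a b : Plane) : ⟪Rot θ a, Rot θ b⟫ = ⟪a, b⟫ := by
  rw [inner_Rot_left, Rot_neg_Rot]

@[simp] theorem Rot_zero (a : Plane) : Rot 0 a = a := by simp [Rot]

/-- The rotation as a linear isometry. -/
def rotE (θ : ℝ) : Plane ≃ₗᵢ[ℝ] Plane where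
  toFun := Rot θ
  invFun := Rot (-θ)
  left_inv := Rot_neg_Rot θ
  right_inv := Rot_Rot_neg θ
  map_add' := Rot_add θ
  map_smul' := fun c a => Rot_smul θ c a
  norm_map' := norm_Rot θ

@[simp] theorem rotE_apply (θ : ℝ) (a : Plane) : rotE θ a = Rot θ a := rfl

@[fun_prop] theorem continuous_perp : Continuous perp := perpL.continuous

@[fun_prop] theorem Continuous.Rot {X : Type*} [TopologicalSpace X] {θ : X → ℝ} {v : X → Plane}
    (hθ : Continuous θ) (hv : Continuous v) : Continuous fun x => Rot (θ x) (v x) := by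
  unfold RotStokes.Rot; fun_prop

@[fun_prop] theorem Measurable.Rot {X : Type*} [MeasurableSpace X] {θ : X → ℝ} {v : X → Plane}
    (hθ : Measurable θ) (hv : Measurable v) : Measurable fun x => Rot (θ x) (v x) := by
  exact ((Real.measurable_cos.comp hθ).smul hv).add
    ((Real.measurable_sin.comp hθ).smul (continuous_perp.measurable.comp hv))

/-! ### The Gauss kernel and its derivatives -/

/-- The derivative of the Gauss kernel in the direction `q`. -/
def d1 (q z : Plane) (s : ℝ) : ℝ := -(⟪q, z⟫ / (2 * s)) * gauss z s

/-- The second derivative of the Gauss kernel in the directions `p`, `q`. -/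
def d2 (p q z : Plane) (s : ℝ) : ℝ :=
  (⟪p, z⟫ * ⟪q, z⟫ / (4 * s ^ 2) - ⟪p, q⟫ / (2 * s)) * gauss z s

/-- The third derivative of the Gauss kernel in the directions `p`, `q`, `r`. -/
def d3 (p q r z : Plane) (s : ℝ) : ℝ :=
  (-(⟪p, z⟫ * ⟪q, z⟫ * ⟪r, z⟫ / (8 * s ^ 3)) +
    (⟪p, q⟫ * ⟪r, z⟫ + ⟪p, r⟫ * ⟪q, z⟫ + ⟪q, r⟫ * ⟪p, z⟫) / (4 * s ^ 2)) * gauss z s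

/-- The fourth derivative of the Gauss kernel in the directions `o`, `p`, `q`, `r`. -/
def d4 (o p q r z : Plane) (s : ℝ) : ℝ :=
  (⟪o, z⟫ * ⟪p, z⟫ * ⟪q, z⟫ * ⟪r, z⟫ / (16 * s ^ 4)
    - (⟪o, p⟫ * ⟪q, z⟫ * ⟪r, z⟫ + ⟪o, q⟫ * ⟪p, z⟫ * ⟪r, z⟫ + ⟪o, r⟫ * ⟪p, z⟫ * ⟪q, z⟫
      + ⟪p, q⟫ * ⟪o, z⟫ * ⟪r, z⟫ + ⟪p, r⟫ * ⟪o, z⟫ * ⟪q, z⟫ + ⟪q, r⟫ * ⟪o, z⟫ * ⟪p, z⟫)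
      / (8 * s ^ 3)
    + (⟪o, p⟫ * ⟪q, r⟫ + ⟪o, q⟫ * ⟪p, r⟫ + ⟪o, r⟫ * ⟪p, q⟫) / (4 * s ^ 2)) * gauss z s

/-- The Laplacian of the Gauss kernel, which is also its time derivative. -/
def lapG (z : Plane) (s : ℝ) : ℝ := (‖z‖ ^ 2 / (4 * s ^ 2) - 1 / s) * gauss z s

/-- The time derivative of `d1`. -/
def dt1 (q z : Plane) (s : ℝ) : ℝ :=
  (⟪q, z⟫ / (2 * s ^ 2) - ⟪q, z⟫ / (2 * s) * (‖z‖ ^ 2 / (4 * s ^ 2) - 1 / s)) * gauss z s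

theorem hasFDerivAt_inner (p z : Plane) :
    HasFDerivAt (fun z : Plane => ⟪p, z⟫) (innerSL ℝ p) z := (innerSL ℝ p).hasFDerivAt

theorem hasFDerivAt_gauss (z : Plane) (s : ℝ) :
    HasFDerivAt (fun z => gauss z s) ((-(gauss z s / (2 * s))) • innerSL ℝ z) z := by
  have h := ((((hasStrictFDerivAt_norm_sq z).hasFDerivAt.neg).mul_const ((4 * s)⁻¹)).exp).const_mul
    (1 / (4 * Real.pi * s))
  refine (h.congr_fderiv ?_).congr_of_eventuallyEq (Eventually.of_forall fun y => ?_)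
  · ext v
    simp [gauss]
    -- With division by zero equal to zero both sides vanish at s = 0, so the spatial derivative
    -- formulas need no sign condition on s.
    rcases eq_or_ne s 0 with rfl | hs
    · simp
    · field_simp; norm_num
  · simp [gauss, div_eq_mul_inv]

theorem contDiff_gauss (s : ℝ) : ContDiff ℝ (⊤ : ℕ∞) (fun z => gauss z s) := by
  unfold gauss
  exact contDiff_const.mul (((contDiff_norm_sq ℝ).neg.div_const _).exp)

@[fun_prop] theorem contDiff_inner_left (q : Plane) :
    ContDiff ℝ (⊤ : ℕ∞) (fun z : Plane => ⟪q, z⟫) := (innerSL ℝ q).contDiff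

theorem contDiff_d1 (q : Plane) (s : ℝ) : ContDiff ℝ (⊤ : ℕ∞) (fun z => d1 q z s) :=
  ((contDiff_inner_left q).div_const _).neg.mul (contDiff_gauss s)

theorem contDiff_d2 (p q : Plane) (s : ℝ) : ContDiff ℝ (⊤ : ℕ∞) (fun z => d2 p q z s) :=
  ((((contDiff_inner_left p).mul (contDiff_inner_left q)).div_const _).sub contDiff_const).mul
    (contDiff_gauss s)

theorem contDiff_d3 (p q r : Plane) (s : ℝ) : ContDiff ℝ (⊤ : ℕ∞) (fun z => d3 p q r z s) := by
  unfold d3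
  exact ContDiff.mul (by fun_prop) (contDiff_gauss s)

theorem fderiv_gauss (z v : Plane) (s : ℝ) : fderiv ℝ (fun z => gauss z s) z v = d1 v z s := by
  rw [(hasFDerivAt_gauss z s).fderiv]; simp [d1, real_inner_comm]; ring

theorem fderiv_d1 (q z v : Plane) (s : ℝ) : fderiv ℝ (fun z => d1 q z s) z v = d2 v q z s := by
  have h := ((hasFDerivAt_inner q z).mul_const (1 / (2 * s))).neg.mul (hasFDerivAt_gauss z s)
  rw [HasFDerivAt.fderiv (h.congr_of_eventuallyEq (Eventually.of_forall fun y => ?_))]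
  · simp [d2, real_inner_comm]
    rcases eq_or_ne s 0 with rfl | hs
    · simp
    · field_simp; ring
  · simp [d1, div_eq_mul_inv]

theorem fderiv_d2 (p q z v : Plane) (s : ℝ) :
    fderiv ℝ (fun z => d2 p q z s) z v = d3 v p q z s := by
  have h := ((((hasFDerivAt_inner p z).mul (hasFDerivAt_inner q z)).mul_const
    (1 / (4 * s ^ 2))).sub (hasFDerivAt_const (⟪p, q⟫ / (2 * s)) z)).mul (hasFDerivAt_gauss z s)
  rw [HasFDerivAt.fderiv (h.congr_of_eventuallyEq (Eventually.of_forall fun y => ?_))]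
  · simp [d3, real_inner_comm]
    rcases eq_or_ne s 0 with rfl | hs
    · simp
    · field_simp; ring
  · simp [d2, div_eq_mul_inv]

theorem fderiv_d3 (p q r z v : Plane) (s : ℝ) :
    fderiv ℝ (fun z => d3 p q r z s) z v = d4 v p q r z s := by
  have h := (((((hasFDerivAt_inner p z).mul (hasFDerivAt_inner q z)).mul
    (hasFDerivAt_inner r z)).mul_const (1 / (8 * s ^ 3))).neg.add
    (((((hasFDerivAt_inner r z).const_mul ⟪p, q⟫).add ((hasFDerivAt_inner q z).const_mul ⟪p, r⟫)).add
    ((hasFDerivAt_inner p z).const_mul ⟪q, r⟫)).mul_const (1 / (4 * s ^ 2)))).mul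
    (hasFDerivAt_gauss z s)
  rw [HasFDerivAt.fderiv (h.congr_of_eventuallyEq (Eventually.of_forall fun y => ?_))]
  · simp [d4, real_inner_comm]
    rcases eq_or_ne s 0 with rfl | hs
    · simp
    · field_simp; ring
  · simp [d3, div_eq_mul_inv]

theorem hasDerivAt_gauss (z : Plane) {s : ℝ} (hs : s ≠ 0) :
    HasDerivAt (fun s => gauss z s) (lapG z s) s := by
  have h1 : HasDerivAt (fun s : ℝ => 4 * Real.pi * s) (4 * Real.pi) s := by
    simpa using (hasDerivAt_id s).const_mul (4 * Real.pi)
  have h2 : HasDerivAt (fun s : ℝ => 4 * s) 4 s := by simpa using (hasDerivAt_id s).const_mul 4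
  have hp := Real.pi_pos
  have h := ((hasDerivAt_const s (1 : ℝ)).div h1 (by positivity)).mul
    (((hasDerivAt_const s (-‖z‖ ^ 2)).div h2 (by positivity)).exp)
  refine (h.congr_deriv ?_).congr_of_eventuallyEq (Eventually.of_forall fun y => ?_)
  · simp [lapG, gauss]; field_simp; ring
  · simp [gauss]

theorem hasDerivAt_d1 (q z : Plane) {s : ℝ} (hs : s ≠ 0) :
    HasDerivAt (fun s => d1 q z s) (dt1 q z s) s := by
  have h2 : HasDerivAt (fun s : ℝ => 2 * s) 2 s := by simpa using (hasDerivAt_id s).const_mul 2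
  have h := ((hasDerivAt_const s ⟪q, z⟫).div h2 (by positivity)).neg.mul (hasDerivAt_gauss z hs)
  refine (h.congr_deriv ?_).congr_of_eventuallyEq (Eventually.of_forall fun y => ?_)
  · simp [dt1, lapG]; field_simp; ring
  · simp [d1]

/-- A trace may be computed in any orthonormal frame. The rotated frame is needed because the
directions of differentiation turn with the angle αt. -/
theorem sum_d2_Rot (θ : ℝ) (z : Plane) {s : ℝ} (hs : s ≠ 0) :
    ∑ i, d2 (Rot θ (e i)) (Rot θ (e i)) z s = lapG z s := by
  simp only [Fin.sum_univ_two, d2, lapG, real_inner_self_eq_norm_sq, norm_e, norm_Rot,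
    norm_sq_eq z, ← add_mul]
  congr 1
  simp [inner_eq]
  field_simp
  linear_combination 2 * (z 0 ^ 2 + z 1 ^ 2) * Real.sin_sq_add_cos_sq θ

theorem gauss_Rot (θ : ℝ) (z : Plane) (s : ℝ) : gauss (Rot θ z) s = gauss z s := by
  simp [gauss, norm_Rot]

theorem d1_Rot (θ : ℝ) (q z : Plane) (s : ℝ) : d1 (Rot θ q) (Rot θ z) s = d1 q z s := by
  simp [d1, inner_Rot_Rot, gauss_Rot]

theorem d2_Rot (θ : ℝ) (p q z : Plane) (s : ℝ) :
    d2 (Rot θ p) (Rot θ q) (Rot θ z) s = d2 p q z s := by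
  simp [d2, inner_Rot_Rot, gauss_Rot]

theorem d3_Rot (θ : ℝ) (p q r z : Plane) (s : ℝ) :
    d3 (Rot θ p) (Rot θ q) (Rot θ r) (Rot θ z) s = d3 p q r z s := by
  simp [d3, inner_Rot_Rot, gauss_Rot]

theorem hessGauss_apply (z : Plane) (s : ℝ) (i j : Fin 2) :
    hessGauss z s i j = d2 (e i) (e j) z s := by
  have h : pderiv j (fun z => gauss z s) = fun z => d1 (e j) z s := by
    ext z; exact fderiv_gauss z (e j) s
  rw [hessGauss, Matrix.of_apply, h, pderiv, fderiv_d1]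

/-! ### Decay of the kernels -/

/-- The parabolic weight `(s + |z|²)^{-1/2}`. -/
def sg (z : Plane) (s : ℝ) : ℝ := (√(s + ‖z‖ ^ 2))⁻¹

theorem sg_nonneg (z : Plane) (s : ℝ) : 0 ≤ sg z s := by unfold sg; positivity

theorem sg_pos (z : Plane) {s : ℝ} (hs : 0 < s) : 0 < sg z s := by unfold sg; positivity

theorem sg_sq (z : Plane) {s : ℝ} (hs : 0 ≤ s) : sg z s ^ 2 = (s + ‖z‖ ^ 2)⁻¹ := by
  rw [sg, inv_pow, Real.sq_sqrt (by positivity)]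

theorem norm_mul_sg_le (z : Plane) {s : ℝ} (hs : 0 ≤ s) : ‖z‖ * sg z s ≤ 1 := by
  unfold sg
  rw [← div_eq_mul_inv]
  apply div_le_one_of_le₀ _ (Real.sqrt_nonneg _)
  exact Real.le_sqrt_of_sq_le (by linarith)

/-- The constant in the kernel bounds. -/
def CK : ℝ := 4 ^ 5 * 120 * Real.exp 1

theorem CK_pos : 0 < CK := by unfold CK; positivity

/-- With r = |z|²/(4s) the right-hand factor is (1+4r)^{-N}. The constant comes from (1+4r)⁵ ≤
4⁵(1+r)⁵ and the fifth term of the exponential series at 1+r; the fifth power suffices for fourth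
derivatives. -/
theorem exp_le_sg {z : Plane} {s : ℝ} (hs : 0 < s) {N : ℕ} (hN : N ≤ 5) :
    Real.exp (-(‖z‖ ^ 2) / (4 * s)) ≤ CK * (s * sg z s ^ 2) ^ N := by
  set r := ‖z‖ ^ 2 / (4 * s) with hr
  have hr0 : 0 ≤ r := by positivity
  have h1 : s * sg z s ^ 2 = (1 + 4 * r)⁻¹ := by
    rw [sg_sq z hs.le, hr]; field_simp
  have h2 : (1 + 4 * r) ^ N ≤ (1 + 4 * r) ^ 5 := pow_le_pow_right₀ (by linarith) hN
  have h3 : (1 + 4 * r) ^ 5 ≤ 4 ^ 5 * (1 + r) ^ 5 := by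
    rw [← mul_pow]; gcongr; linarith
  have h4 : (1 + r) ^ 5 ≤ 120 * Real.exp (1 + r) := by
    have := Real.pow_div_factorial_le_exp (1 + r) (by linarith) 5
    rw [div_le_iff₀ (by positivity)] at this
    simpa [Nat.factorial, mul_comm] using this
  have h5 : Real.exp (-(‖z‖ ^ 2) / (4 * s)) = (Real.exp r)⁻¹ := by
    rw [← Real.exp_neg, hr]; ring_nf
  rw [h1, h5, inv_pow, ← div_eq_mul_inv, le_div_iff₀ (by positivity), inv_mul_le_iff₀ (by positivity)]
  calc (1 + 4 * r) ^ N ≤ 4 ^ 5 * (120 * Real.exp (1 + r)) := by linarith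
    _ = Real.exp r * CK := by rw [Real.exp_add, CK]; ring

theorem gauss_nonneg (z : Plane) {s : ℝ} (hs : 0 ≤ s) : 0 ≤ gauss z s := by
  unfold gauss; have := Real.pi_pos; positivity

/-- The relation between the exponents is parabolic homogeneity: powers of s are absorbed by the
exponential and powers of |z| by |z| sg ≤ 1. The factor 1/12 comes from 4π > 12 and leaves room to
add up all the terms of a derivative without exceeding `CK`. -/
theorem norm_pow_mul_gauss_le (z : Plane) {s : ℝ} (hs : 0 < s) {a k n : ℕ} (hk : k ≤ 4)
    (ha : a + n = 2 * k + 2) : ‖z‖ ^ a * gauss z s / s ^ k ≤ CK / 12 * sg z s ^ n := by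
  have h1 := exp_le_sg (z := z) hs (show k + 1 ≤ 5 by omega)
  have hpi := Real.pi_gt_three
  have h0 := sg_pos z hs
  have hC := CK_pos
  have h2 : gauss z s ≤ CK / 12 * (s ^ k * sg z s ^ (2 * k + 2)) := by
    rw [gauss]
    calc 1 / (4 * Real.pi * s) * Real.exp (-(‖z‖ ^ 2) / (4 * s))
        ≤ 1 / (4 * 3 * s) * (CK * (s * sg z s ^ 2) ^ (k + 1)) := by gcongr
      _ = _ := by field_simp; ring
  have h3 : (‖z‖ * sg z s) ^ a ≤ 1 := pow_le_one₀ (by positivity) (norm_mul_sg_le z hs.le)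
  calc ‖z‖ ^ a * gauss z s / s ^ k
      ≤ ‖z‖ ^ a * (CK / 12 * (s ^ k * sg z s ^ (2 * k + 2))) / s ^ k := by gcongr
    _ = CK / 12 * sg z s ^ n * (‖z‖ * sg z s) ^ a := by
        rw [← ha, pow_add, mul_pow]; field_simp
    _ ≤ CK / 12 * sg z s ^ n * 1 := by gcongr
    _ = _ := mul_one _

theorem abs_term_le {z : Plane} {s : ℝ} (hs : 0 < s) {A P c : ℝ} {a k n : ℕ} (hk : k ≤ 4)
    (ha : a + n = 2 * k + 2) (hP : 0 ≤ P) (hc : 0 < c) (hA : |A| ≤ P * ‖z‖ ^ a) :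
    |A / (c * s ^ k) * gauss z s| ≤ P / c * (CK / 12 * sg z s ^ n) := by
  rw [abs_mul, abs_div, abs_of_pos (show 0 < c * s ^ k by positivity),
    abs_of_nonneg (gauss_nonneg z hs.le)]
  calc |A| / (c * s ^ k) * gauss z s ≤ (P * ‖z‖ ^ a) / (c * s ^ k) * gauss z s := by
        have := gauss_nonneg z hs.le
        gcongr
    _ = P / c * (‖z‖ ^ a * gauss z s / s ^ k) := by field_simp
    _ ≤ _ := by gcongr; exact norm_pow_mul_gauss_le z hs hk ha

theorem gauss_le (z : Plane) {s : ℝ} (hs : 0 < s) : gauss z s ≤ CK * sg z s ^ 2 := by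
  have := norm_pow_mul_gauss_le z hs (a := 0) (k := 0) (n := 2) (by norm_num) (by norm_num)
  have h2 : 0 ≤ CK * sg z s ^ 2 := by have := CK_pos; positivity
  simp at this; linarith

theorem abs_inner_le (p z : Plane) : |⟪p, z⟫| ≤ ‖p‖ * ‖z‖ := abs_real_inner_le_norm p z

theorem abs_mul_le {a b A B : ℝ} (h1 : |a| ≤ A) (h2 : |b| ≤ B) : |a * b| ≤ A * B := by
  rw [abs_mul]; exact mul_le_mul h1 h2 (abs_nonneg _) ((abs_nonneg _).trans h1)

theorem abs_d1_le (q z : Plane) {s : ℝ} (hs : 0 < s) : |d1 q z s| ≤ CK * ‖q‖ * sg z s ^ 3 := by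
  have h := abs_term_le (z := z) hs (A := -⟪q, z⟫) (P := ‖q‖) (c := 2) (a := 1) (k := 1) (n := 3)
    (by norm_num) (by norm_num) (norm_nonneg _) (by norm_num)
    (by simpa using abs_inner_le q z)
  have e : d1 q z s = -⟪q, z⟫ / (2 * s ^ 1) * gauss z s := by rw [d1]; ring
  have h2 : 0 ≤ CK * ‖q‖ * sg z s ^ 3 := by have := CK_pos; have := sg_pos z hs; positivity
  rw [e]
  refine h.trans ?_
  nlinarith

theorem abs_d2_le (p q z : Plane) {s : ℝ} (hs : 0 < s) :
    |d2 p q z s| ≤ CK * (‖p‖ * ‖q‖) * sg z s ^ 4 := by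
  have h1 := abs_term_le (z := z) hs (A := ⟪p, z⟫ * ⟪q, z⟫) (P := ‖p‖ * ‖q‖) (c := 4) (a := 2)
    (k := 2) (n := 4) (by norm_num) (by norm_num) (by positivity) (by norm_num)
    ((abs_mul_le (abs_inner_le p z) (abs_inner_le q z)).trans (le_of_eq (by ring)))
  have h2 := abs_term_le (z := z) hs (A := ⟪p, q⟫) (P := ‖p‖ * ‖q‖) (c := 2) (a := 0)
    (k := 1) (n := 4) (by norm_num) (by norm_num) (by positivity) (by norm_num)
    (by simpa using abs_inner_le p q)
  have e : d2 p q z s = ⟪p, z⟫ * ⟪q, z⟫ / (4 * s ^ 2) * gauss z s -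
      ⟪p, q⟫ / (2 * s ^ 1) * gauss z s := by rw [d2]; ring
  have h3 : 0 ≤ CK * (‖p‖ * ‖q‖) * sg z s ^ 4 := by
    have := CK_pos; have := sg_pos z hs; positivity
  rw [abs_le] at h1 h2 ⊢
  rw [e]
  constructor <;> linarith

theorem abs_dt1_le (q z : Plane) {s : ℝ} (hs : 0 < s) :
    |dt1 q z s| ≤ CK * ‖q‖ * sg z s ^ 5 := by
  have h1 := abs_term_le (z := z) hs (A := ⟪q, z⟫) (P := ‖q‖) (c := 1) (a := 1)
    (k := 2) (n := 5) (by norm_num) (by norm_num) (by positivity) (by norm_num)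
    (by simpa using abs_inner_le q z)
  have h2 := abs_term_le (z := z) hs (A := ⟪q, z⟫ * ‖z‖ ^ 2) (P := ‖q‖) (c := 8) (a := 3)
    (k := 3) (n := 5) (by norm_num) (by norm_num) (by positivity) (by norm_num)
    ((abs_mul_le (abs_inner_le q z) (abs_of_nonneg (sq_nonneg ‖z‖)).le).trans (le_of_eq (by ring)))
  have e : dt1 q z s = ⟪q, z⟫ / (1 * s ^ 2) * gauss z s -
      ⟪q, z⟫ * ‖z‖ ^ 2 / (8 * s ^ 3) * gauss z s := by rw [dt1]; field_simp; ring
  have h3 : 0 ≤ CK * ‖q‖ * sg z s ^ 5 := by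
    have := CK_pos; have := sg_pos z hs; positivity
  rw [abs_le] at h1 h2 ⊢
  rw [e]
  constructor <;> linarith

theorem abs_lapG_le (z : Plane) {s : ℝ} (hs : 0 < s) : |lapG z s| ≤ CK * sg z s ^ 4 := by
  have h1 := abs_term_le (z := z) hs (A := ‖z‖ ^ 2) (P := 1) (c := 4) (a := 2)
    (k := 2) (n := 4) (by norm_num) (by norm_num) (by positivity) (by norm_num) (by simp)
  have h2 := abs_term_le (z := z) hs (A := 1) (P := 1) (c := 1) (a := 0)
    (k := 1) (n := 4) (by norm_num) (by norm_num) (by positivity) (by norm_num) (by simp)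
  have e : lapG z s = ‖z‖ ^ 2 / (4 * s ^ 2) * gauss z s - 1 / (1 * s ^ 1) * gauss z s := by
    rw [lapG]; ring
  have h3 : 0 ≤ CK * sg z s ^ 4 := by have := CK_pos; have := sg_pos z hs; positivity
  rw [abs_le] at h1 h2 ⊢
  rw [e]
  constructor <;> linarith

theorem abs_d3_le (p q r z : Plane) {s : ℝ} (hs : 0 < s) :
    |d3 p q r z s| ≤ CK * (‖p‖ * ‖q‖ * ‖r‖) * sg z s ^ 5 := by
  have hP : 0 ≤ ‖p‖ * ‖q‖ * ‖r‖ := by positivity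
  have h1 := abs_term_le (z := z) hs (A := ⟪p, z⟫ * ⟪q, z⟫ * ⟪r, z⟫) (P := ‖p‖ * ‖q‖ * ‖r‖)
    (c := 8) (a := 3) (k := 3) (n := 5) (by norm_num) (by norm_num) hP (by norm_num)
    ((abs_mul_le (abs_mul_le (abs_inner_le p z) (abs_inner_le q z)) (abs_inner_le r z)).trans
      (le_of_eq (by ring)))
  have H : ∀ a b c : Plane, ‖a‖ * ‖b‖ * ‖c‖ = ‖p‖ * ‖q‖ * ‖r‖ →
      |⟪a, b⟫ * ⟪c, z⟫ / (4 * s ^ 2) * gauss z s| ≤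
        ‖p‖ * ‖q‖ * ‖r‖ / 4 * (CK / 12 * sg z s ^ 5) := fun a b c h =>
    abs_term_le (z := z) hs (c := 4) (a := 1) (k := 2) (n := 5) (by norm_num) (by norm_num) hP
      (by norm_num) ((abs_mul_le (abs_inner_le a b) (abs_inner_le c z)).trans
        (le_of_eq (by rw [← h]; ring)))
  have h2 := H p q r rfl
  have h4 := H p r q (by ring)
  have h5 := H q r p (by ring)
  have e : d3 p q r z s = -(⟪p, z⟫ * ⟪q, z⟫ * ⟪r, z⟫ / (8 * s ^ 3) * gauss z s) +
      ⟪p, q⟫ * ⟪r, z⟫ / (4 * s ^ 2) * gauss z s + ⟪p, r⟫ * ⟪q, z⟫ / (4 * s ^ 2) * gauss z s +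
      ⟪q, r⟫ * ⟪p, z⟫ / (4 * s ^ 2) * gauss z s := by rw [d3]; ring
  have h3 : 0 ≤ CK * (‖p‖ * ‖q‖ * ‖r‖) * sg z s ^ 5 := by
    have := CK_pos; have := sg_pos z hs; positivity
  rw [abs_le] at h1 h2 h4 h5 ⊢
  rw [e]
  constructor <;> linarith

/-- The ten monomials have coefficients 1/16, six times 1/8 and three times 1/4, whose sum stays
well below the available factor 12. -/
theorem abs_d4_le (o p q r z : Plane) {s : ℝ} (hs : 0 < s) :
    |d4 o p q r z s| ≤ CK * (‖o‖ * ‖p‖ * ‖q‖ * ‖r‖) * sg z s ^ 6 := by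
  have hP : 0 ≤ ‖o‖ * ‖p‖ * ‖q‖ * ‖r‖ := by positivity
  have h1 := abs_term_le (z := z) hs (A := ⟪o, z⟫ * ⟪p, z⟫ * ⟪q, z⟫ * ⟪r, z⟫)
    (P := ‖o‖ * ‖p‖ * ‖q‖ * ‖r‖)
    (c := 16) (a := 4) (k := 4) (n := 6) (by norm_num) (by norm_num) hP (by norm_num)
    ((abs_mul_le (abs_mul_le (abs_mul_le (abs_inner_le o z) (abs_inner_le p z))
      (abs_inner_le q z)) (abs_inner_le r z)).trans (le_of_eq (by ring)))
  have H : ∀ a b c d : Plane, ‖a‖ * ‖b‖ * ‖c‖ * ‖d‖ = ‖o‖ * ‖p‖ * ‖q‖ * ‖r‖ →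
      |⟪a, b⟫ * ⟪c, z⟫ * ⟪d, z⟫ / (8 * s ^ 3) * gauss z s| ≤
        ‖o‖ * ‖p‖ * ‖q‖ * ‖r‖ / 8 * (CK / 12 * sg z s ^ 6) := fun a b c d h =>
    abs_term_le (z := z) hs (c := 8) (a := 2) (k := 3) (n := 6) (by norm_num) (by norm_num) hP
      (by norm_num) ((abs_mul_le (abs_mul_le (abs_inner_le a b) (abs_inner_le c z))
        (abs_inner_le d z)).trans (le_of_eq (by rw [← h]; ring)))
  have H' : ∀ a b c d : Plane, ‖a‖ * ‖b‖ * ‖c‖ * ‖d‖ = ‖o‖ * ‖p‖ * ‖q‖ * ‖r‖ →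
      |⟪a, b⟫ * ⟪c, d⟫ / (4 * s ^ 2) * gauss z s| ≤
        ‖o‖ * ‖p‖ * ‖q‖ * ‖r‖ / 4 * (CK / 12 * sg z s ^ 6) := fun a b c d h =>
    abs_term_le (z := z) hs (c := 4) (a := 0) (k := 2) (n := 6) (by norm_num) (by norm_num) hP
      (by norm_num) ((abs_mul_le (abs_inner_le a b) (abs_inner_le c d)).trans
        (le_of_eq (by rw [← h]; ring)))
  have a1 := abs_le.1 (H o p q r rfl)
  have a2 := abs_le.1 (H o q p r (by ring))
  have a3 := abs_le.1 (H o r p q (by ring))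
  have a4 := abs_le.1 (H p q o r (by ring))
  have a5 := abs_le.1 (H p r o q (by ring))
  have a6 := abs_le.1 (H q r o p (by ring))
  have b1 := abs_le.1 (H' o p q r rfl)
  have b2 := abs_le.1 (H' o q p r (by ring))
  have b3 := abs_le.1 (H' o r p q (by ring))
  have e : d4 o p q r z s =
      ⟪o, z⟫ * ⟪p, z⟫ * ⟪q, z⟫ * ⟪r, z⟫ / (16 * s ^ 4) * gauss z s
      - (⟪o, p⟫ * ⟪q, z⟫ * ⟪r, z⟫ / (8 * s ^ 3) * gauss z s
        + ⟪o, q⟫ * ⟪p, z⟫ * ⟪r, z⟫ / (8 * s ^ 3) * gauss z s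
        + ⟪o, r⟫ * ⟪p, z⟫ * ⟪q, z⟫ / (8 * s ^ 3) * gauss z s
        + ⟪p, q⟫ * ⟪o, z⟫ * ⟪r, z⟫ / (8 * s ^ 3) * gauss z s
        + ⟪p, r⟫ * ⟪o, z⟫ * ⟪q, z⟫ / (8 * s ^ 3) * gauss z s
        + ⟪q, r⟫ * ⟪o, z⟫ * ⟪p, z⟫ / (8 * s ^ 3) * gauss z s)
      + (⟪o, p⟫ * ⟪q, r⟫ / (4 * s ^ 2) * gauss z s + ⟪o, q⟫ * ⟪p, r⟫ / (4 * s ^ 2) * gauss z s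
        + ⟪o, r⟫ * ⟪p, q⟫ / (4 * s ^ 2) * gauss z s) := by rw [d4]; ring
  have h3 : 0 ≤ CK * (‖o‖ * ‖p‖ * ‖q‖ * ‖r‖) * sg z s ^ 6 := by
    have := CK_pos; have := sg_pos z hs; positivity
  have h1 := abs_le.1 h1
  rw [abs_le, e]
  constructor <;> linarith

/-! ### Integrals of the weight -/

/-- All comparisons of weights at two points go through this one inequality between the squared
parabolic distances. -/
theorem sg_le_sg {z w : Plane} {s t c : ℝ} (ht : 0 < t) (hc : 0 < c)
    (h : t + ‖w‖ ^ 2 ≤ c ^ 2 * (s + ‖z‖ ^ 2)) : sg z s ≤ c * sg w t := by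
  have h1 : 0 < t + ‖w‖ ^ 2 := by positivity
  have h2 : √(t + ‖w‖ ^ 2) ≤ c * √(s + ‖z‖ ^ 2) := by
    rw [Real.sqrt_le_left (by positivity), mul_pow, Real.sq_sqrt]
    · exact h
    · by_contra h3
      push Not at h3
      nlinarith [sq_nonneg c, mul_pos hc hc]
  have h4 : 0 < √(t + ‖w‖ ^ 2) := Real.sqrt_pos.2 h1
  have h5 : 0 < √(s + ‖z‖ ^ 2) := by
    by_contra h; push Not at h; nlinarith
  unfold sg
  rw [← div_eq_mul_inv, le_div_iff₀ h4, inv_mul_le_iff₀ h5]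
  linarith

theorem sg_Rot (θ : ℝ) (z : Plane) (s : ℝ) : sg (Rot θ z) s = sg z s := by simp [sg, norm_Rot]

theorem sg_pow_eq (z : Plane) (s : ℝ) (n : ℕ) (hs : 0 ≤ s) :
    sg z s ^ n = (s + ‖z‖ ^ 2) ^ (-(n / 2 : ℝ)) := by
  have h : 0 ≤ s + ‖z‖ ^ 2 := by positivity
  rw [sg, Real.sqrt_eq_rpow, ← Real.rpow_neg h, ← Real.rpow_natCast, ← Real.rpow_mul h]
  congr 1; ring

theorem hasDerivAt_sg_pow (z : Plane) {s : ℝ} (n : ℕ) (hs : 0 < s) :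
    HasDerivAt (fun s => sg z s ^ n) (-(n / 2) * sg z s ^ (n + 2)) s := by
  have h : 0 < s + ‖z‖ ^ 2 := by positivity
  have h1 := ((hasDerivAt_id s).add_const (‖z‖ ^ 2)).rpow_const (p := -(n / 2 : ℝ)) (Or.inl h.ne')
  refine (h1.congr_deriv ?_).congr_of_eventuallyEq ?_
  · have e : -(((n + 2 : ℕ) : ℝ) / 2) = -(n / 2) - 1 := by push_cast; ring
    rw [sg_pow_eq z s _ hs.le, e]; simp
  · filter_upwards [lt_mem_nhds hs] with t ht
    simp [sg_pow_eq z t n ht.le]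

theorem tendsto_sg_pow (z : Plane) {n : ℕ} (hn : n ≠ 0) :
    Tendsto (fun s => sg z s ^ n) atTop (𝓝 0) := by
  have h1 : Tendsto (fun s => sg z s) atTop (𝓝 0) := by
    unfold sg
    exact tendsto_inv_atTop_zero.comp (Real.tendsto_sqrt_atTop.comp
      (tendsto_atTop_add_const_right _ _ tendsto_id))
  simpa [zero_pow hn] using h1.pow n

theorem continuousAt_sg_pow (z : Plane) (n : ℕ) {t : ℝ} (ht : 0 < t + ‖z‖ ^ 2) :
    ContinuousAt (fun s => sg z s ^ n) t := by
  unfold sg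
  have : √(t + ‖z‖ ^ 2) ≠ 0 := (Real.sqrt_pos.2 ht).ne'
  fun_prop (disch := assumption)

/-- A power of the weight is, up to a constant, the time derivative of the power lower by two. The
value t = 0 is allowed away from the origin, where the weight is |z|^{-1}. -/
theorem integrableOn_sg_pow (z : Plane) (n : ℕ) {t : ℝ} (ht : 0 ≤ t) (h : 0 < t + ‖z‖ ^ 2) :
    IntegrableOn (fun s => sg z s ^ (n + 3)) (Ioi t) ∧
      ∫ s in Ioi t, sg z s ^ (n + 3) = 2 / (n + 1) * sg z t ^ (n + 1) := by
  have hd : ∀ x ∈ Ioi t, HasDerivAt (fun s => -(2 / (n + 1 : ℝ)) * sg z s ^ (n + 1))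
      (sg z x ^ (n + 3)) x := fun x hx => by
    refine ((hasDerivAt_sg_pow z (n + 1) (lt_of_le_of_lt ht hx)).const_mul _).congr_deriv ?_
    push_cast; field_simp
  have hc : ContinuousWithinAt (fun s => -(2 / (n + 1 : ℝ)) * sg z s ^ (n + 1)) (Ici t) t :=
    ((continuousAt_sg_pow z _ h).const_mul _).continuousWithinAt
  have hl : Tendsto (fun s => -(2 / (n + 1 : ℝ)) * sg z s ^ (n + 1)) atTop (𝓝 0) := by
    simpa using (tendsto_sg_pow z (n := n + 1) (by omega)).const_mul (-(2 / (n + 1 : ℝ)))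
  refine ⟨integrableOn_Ioi_deriv_of_nonneg hc hd (fun x _ => pow_nonneg (sg_nonneg _ _) _) hl, ?_⟩
  rw [integral_Ioi_of_hasDerivAt_of_nonneg hc hd (fun x _ => pow_nonneg (sg_nonneg _ _) _) hl]
  ring

theorem sg_zero_left (s : ℝ) : sg 0 s = (√s)⁻¹ := by simp [sg]

theorem sg_zero_right (z : Plane) : sg z 0 = ‖z‖⁻¹ := by simp [sg]

/-! ### The tensor `K` and its gradient as integrals of derivatives of the Gauss kernel -/

/-- The bilinear form of the matrix `K(z,t)`. -/
def Kk (p q z : Plane) (t : ℝ) : ℝ := gauss z t * ⟪p, q⟫ + ∫ s in Ioi t, d2 p q z s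

/-- The derivative in the direction `q` of `z ↦ Kk p r z t`. -/
def K1 (q p r z : Plane) (t : ℝ) : ℝ := d1 q z t * ⟪p, r⟫ + ∫ s in Ioi t, d3 q p r z s

section measurability
variable {X : Type*} [MeasurableSpace X] {o p q r z : X → Plane} {s : X → ℝ}

@[fun_prop] theorem Measurable.gauss (hz : Measurable z) (hs : Measurable s) :
    Measurable fun x => gauss (z x) (s x) := by
  unfold RotStokes.gauss; fun_prop

@[fun_prop] theorem Measurable.d1 (hq : Measurable q) (hz : Measurable z) (hs : Measurable s) :
    Measurable fun x => d1 (q x) (z x) (s x) := by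
  unfold RotStokes.d1; fun_prop

@[fun_prop] theorem Measurable.d2 (hp : Measurable p) (hq : Measurable q) (hz : Measurable z)
    (hs : Measurable s) : Measurable fun x => d2 (p x) (q x) (z x) (s x) := by
  unfold RotStokes.d2; fun_prop

@[fun_prop] theorem Measurable.d3 (hp : Measurable p) (hq : Measurable q) (hr : Measurable r)
    (hz : Measurable z) (hs : Measurable s) :
    Measurable fun x => d3 (p x) (q x) (r x) (z x) (s x) := by
  unfold RotStokes.d3; fun_prop

@[fun_prop] theorem Measurable.sg (hz : Measurable z) (hs : Measurable s) :
    Measurable fun x => sg (z x) (s x) := by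
  unfold RotStokes.sg; fun_prop

end measurability

/-- A fixed domain of integration makes the tail integrals jointly measurable in all parameters and
allows differentiation under the integral sign. -/
theorem integral_Ioi_shift (f : ℝ → ℝ) (t : ℝ) :
    ∫ s in Ioi t, f s = ∫ s in Ioi (0 : ℝ), f (t + s) := by
  have h := (measurePreserving_add_left volume t).setIntegral_preimage_emb
    (measurableEmbedding_addLeft t) f (Ioi t)
  rw [← h]; congr 2; ext x; simp

theorem integrableOn_Ioi_shift (f : ℝ → ℝ) (t : ℝ) :
    IntegrableOn (fun s => f (t + s)) (Ioi 0) ↔ IntegrableOn f (Ioi t) := by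
  have h := (measurePreserving_add_left volume t).integrableOn_comp_preimage
    (measurableEmbedding_addLeft t) (f := f) (s := Ioi t)
  rw [← h]
  have : (fun x => t + x) ⁻¹' Ioi t = Ioi 0 := by ext x; simp
  rw [this]; rfl

section measurability
variable {X : Type*} [MeasurableSpace X] {o p q r z : X → Plane} {t : X → ℝ}

@[fun_prop] theorem Measurable.Kk (hp : Measurable p) (hq : Measurable q) (hz : Measurable z)
    (ht : Measurable t) : Measurable fun x => Kk (p x) (q x) (z x) (t x) := by
  have h : ∀ x, ∫ s in Ioi (t x), RotStokes.d2 (p x) (q x) (z x) s =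
      ∫ σ in Ioi (0 : ℝ), RotStokes.d2 (p x) (q x) (z x) (t x + σ) :=
    fun x => integral_Ioi_shift _ _
  simp only [RotStokes.Kk, h]
  refine ((Measurable.gauss hz ht).mul (hp.inner hq)).add ?_
  refine (StronglyMeasurable.integral_prod_right
    (f := fun x σ => RotStokes.d2 (p x) (q x) (z x) (t x + σ)) ?_).measurable
  refine Measurable.stronglyMeasurable ?_
  simp only [Function.uncurry_def]
  fun_prop

@[fun_prop] theorem Measurable.K1 (hp : Measurable p) (hq : Measurable q) (hr : Measurable r)
    (hz : Measurable z)
    (ht : Measurable t) : Measurable fun x => K1 (p x) (q x) (r x) (z x) (t x) := by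
  have h : ∀ x, ∫ s in Ioi (t x), RotStokes.d3 (p x) (q x) (r x) (z x) s =
      ∫ σ in Ioi (0 : ℝ), RotStokes.d3 (p x) (q x) (r x) (z x) (t x + σ) :=
    fun x => integral_Ioi_shift _ _
  simp only [RotStokes.K1, h]
  refine ((Measurable.d1 hp hz ht).mul (hq.inner hr)).add ?_
  refine (StronglyMeasurable.integral_prod_right
    (f := fun x σ => RotStokes.d3 (p x) (q x) (r x) (z x) (t x + σ)) ?_).measurable
  refine Measurable.stronglyMeasurable ?_
  simp only [Function.uncurry_def]
  fun_prop

end measurability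

/-- Integration over later times gains two powers of the weight, so the nonlocal part of K obeys the
same bounds as the local part. -/
theorem integrableOn_of_le_sg {f : ℝ → ℝ} {z : Plane} {M t : ℝ} {n : ℕ} (hf : Measurable f)
    (ht : 0 < t) (h : ∀ s, t < s → |f s| ≤ M * sg z s ^ (n + 3)) :
    IntegrableOn f (Ioi t) ∧ |∫ s in Ioi t, f s| ≤ M * (2 / (n + 1) * sg z t ^ (n + 1)) := by
  obtain ⟨h1, h2⟩ := integrableOn_sg_pow z n ht.le (by positivity)
  have h3 : ∀ᵐ s ∂(volume.restrict (Ioi t)), ‖f s‖ ≤ M * sg z s ^ (n + 3) := by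
    filter_upwards [ae_restrict_mem measurableSet_Ioi] with s hs using h s hs
  refine ⟨(h1.const_mul M).mono' hf.aestronglyMeasurable h3, ?_⟩
  rw [← h2, ← integral_const_mul]
  exact norm_integral_le_of_norm_le (h1.const_mul M) h3

theorem integrableOn_d2 (p q z : Plane) {t : ℝ} (ht : 0 < t) :
    IntegrableOn (d2 p q z) (Ioi t) ∧
      |∫ s in Ioi t, d2 p q z s| ≤ CK * (‖p‖ * ‖q‖) * sg z t ^ 2 := by
  have h := integrableOn_of_le_sg (f := d2 p q z) (z := z) (n := 1) (by fun_prop) ht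
    (fun s hs => abs_d2_le p q z (ht.trans hs))
  refine ⟨h.1, h.2.trans (le_of_eq ?_)⟩
  norm_num

theorem integrableOn_d3 (p q r z : Plane) {t : ℝ} (ht : 0 < t) :
    IntegrableOn (d3 p q r z) (Ioi t) ∧
      |∫ s in Ioi t, d3 p q r z s| ≤ CK * (‖p‖ * ‖q‖ * ‖r‖) * sg z t ^ 3 := by
  have h := integrableOn_of_le_sg (f := d3 p q r z) (z := z) (n := 2) (by fun_prop) ht
    (fun s hs => abs_d3_le p q r z (ht.trans hs))
  refine ⟨h.1, h.2.trans ?_⟩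
  have := CK_pos
  have := sg_pos z ht
  gcongr
  norm_num
  have : 0 < sg z t ^ 3 := by positivity
  linarith

theorem abs_Kk_le (p q z : Plane) {t : ℝ} (ht : 0 < t) :
    |Kk p q z t| ≤ 2 * CK * (‖p‖ * ‖q‖) * sg z t ^ 2 := by
  have h1 := (integrableOn_d2 p q z ht).2
  have h2 := abs_mul_le ((abs_of_nonneg (gauss_nonneg z ht.le)).trans_le (gauss_le z ht))
    (abs_inner_le p q)
  unfold Kk
  refine (abs_add_le _ _).trans ?_
  linarith

theorem abs_K1_le (q p r z : Plane) {t : ℝ} (ht : 0 < t) :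
    |K1 q p r z t| ≤ 2 * CK * (‖q‖ * ‖p‖ * ‖r‖) * sg z t ^ 3 := by
  have h1 := (integrableOn_d3 q p r z ht).2
  have h2 := abs_mul_le (abs_d1_le q z ht) (abs_inner_le p r)
  unfold K1
  refine (abs_add_le _ _).trans ?_
  linarith

theorem Kk_Rot (θ : ℝ) (p q z : Plane) (t : ℝ) :
    Kk (Rot θ p) (Rot θ q) (Rot θ z) t = Kk p q z t := by
  simp only [Kk, gauss_Rot, inner_Rot_Rot, d2_Rot]

theorem K1_Rot (θ : ℝ) (q p r z : Plane) (t : ℝ) :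
    K1 (Rot θ q) (Rot θ p) (Rot θ r) (Rot θ z) t = K1 q p r z t := by
  simp only [K1, d1_Rot, inner_Rot_Rot, d3_Rot]

/-- By isotropy the rotation is transferred from x and a to y and b. Then x is fixed in time, and
the rotation acts linearly on b, where it oscillates. -/
theorem Kk_Rot_left (θ : ℝ) (a b x y : Plane) (t : ℝ) :
    Kk (Rot θ a) b (Rot θ x - y) t = Kk a (Rot (-θ) b) (x - Rot (-θ) y) t := by
  rw [← Kk_Rot θ a, Rot_Rot_neg, Rot_sub, Rot_Rot_neg]

theorem K1_Rot_left (θ : ℝ) (q a b x y : Plane) (t : ℝ) :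
    K1 q (Rot θ a) b (Rot θ x - y) t = K1 (Rot (-θ) q) a (Rot (-θ) b) (x - Rot (-θ) y) t := by
  rw [← K1_Rot θ _ a, Rot_Rot_neg, Rot_Rot_neg, Rot_sub, Rot_Rot_neg]

/-! #### Linearity in the vector arguments -/

theorem Kk_lin_right (p q q' z : Plane) (c c' : ℝ) {t : ℝ} (ht : 0 < t) :
    Kk p (c • q + c' • q') z t = c * Kk p q z t + c' * Kk p q' z t := by
  have h : ∀ s, d2 p (c • q + c' • q') z s = c * d2 p q z s + c' * d2 p q' z s := fun s => by
    simp only [d2, inner_add_left, inner_add_right, real_inner_smul_left, real_inner_smul_right]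
    ring
  simp only [Kk, h]
  rw [integral_add ((integrableOn_d2 p q z ht).1.const_mul c)
    ((integrableOn_d2 p q' z ht).1.const_mul c'), integral_const_mul, integral_const_mul,
    inner_add_right, real_inner_smul_right, real_inner_smul_right]
  ring

theorem Kk_comm (p q z : Plane) (t : ℝ) : Kk p q z t = Kk q p z t := by
  have h : ∀ s, d2 p q z s = d2 q p z s := fun s => by
    simp only [d2, real_inner_comm q p]; ring
  simp only [Kk, h, real_inner_comm q p]

theorem Kk_lin_left (p p' q z : Plane) (c c' : ℝ) {t : ℝ} (ht : 0 < t) :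
    Kk (c • p + c' • p') q z t = c * Kk p q z t + c' * Kk p' q z t := by
  rw [Kk_comm, Kk_lin_right _ _ _ _ _ _ ht, Kk_comm q p, Kk_comm q p']

theorem K1_lin_right (q p r r' z : Plane) (c c' : ℝ) {t : ℝ} (ht : 0 < t) :
    K1 q p (c • r + c' • r') z t = c * K1 q p r z t + c' * K1 q p r' z t := by
  have h : ∀ s, d3 q p (c • r + c' • r') z s = c * d3 q p r z s + c' * d3 q p r' z s := fun s => by
    simp only [d3, inner_add_left, inner_add_right, real_inner_smul_left, real_inner_smul_right]
    ring
  simp only [K1, h]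
  rw [integral_add ((integrableOn_d3 q p r z ht).1.const_mul c)
    ((integrableOn_d3 q p r' z ht).1.const_mul c'), integral_const_mul, integral_const_mul,
    inner_add_right, real_inner_smul_right, real_inner_smul_right]
  ring

theorem K1_lin_left (q q' p r z : Plane) (c c' : ℝ) {t : ℝ} (ht : 0 < t) :
    K1 (c • q + c' • q') p r z t = c * K1 q p r z t + c' * K1 q' p r z t := by
  have h : ∀ s, d3 (c • q + c' • q') p r z s = c * d3 q p r z s + c' * d3 q' p r z s := fun s => by
    simp only [d3, inner_add_left, real_inner_smul_left]
    ring
  simp only [K1, h]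
  rw [integral_add ((integrableOn_d3 q p r z ht).1.const_mul c)
    ((integrableOn_d3 q' p r z ht).1.const_mul c'), integral_const_mul, integral_const_mul]
  simp only [d1, inner_add_left, real_inner_smul_left]
  ring

/-! #### Time derivatives -/

theorem hasDerivAt_integral_Ioi {f : ℝ → ℝ} {a t : ℝ} (hat : a < t) (hm : Measurable f)
    (hi : IntegrableOn f (Ioi a)) (hc : ContinuousAt f t) :
    HasDerivAt (fun t => ∫ s in Ioi t, f s) (-f t) t := by
  have hi' : IntervalIntegrable f volume a t :=
    (intervalIntegrable_iff_integrableOn_Ioc_of_le hat.le).2 (hi.mono_set Ioc_subset_Ioi_self)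
  have h := (intervalIntegral.integral_hasDerivAt_right hi'
    hm.stronglyMeasurable.stronglyMeasurableAtFilter hc).const_sub (∫ s in Ioi a, f s)
  refine h.congr_of_eventuallyEq ?_
  filter_upwards [lt_mem_nhds hat] with u hu
  rw [eq_sub_iff_add_eq', intervalIntegral.integral_of_le hu.le,
    ← setIntegral_union (by rw [Set.disjoint_left]; intro x hx hx'; exact absurd hx.2 (not_le.2 hx'))
      measurableSet_Ioi (hi.mono_set Ioc_subset_Ioi_self)
      (hi.mono_set (Ioi_subset_Ioi hu.le)), Ioc_union_Ioi_eq_Ioi hu.le]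

theorem continuousAt_d2 (p q z : Plane) {t : ℝ} (ht : t ≠ 0) : ContinuousAt (d2 p q z) t := by
  have h := (hasDerivAt_gauss z ht).continuousAt
  unfold d2
  fun_prop (disch := positivity)

theorem continuousAt_d3 (p q r z : Plane) {t : ℝ} (ht : t ≠ 0) :
    ContinuousAt (d3 p q r z) t := by
  have h := (hasDerivAt_gauss z ht).continuousAt
  unfold d3
  fun_prop (disch := positivity)

theorem hasDerivAt_Kk (p q z : Plane) {t : ℝ} (ht : 0 < t) :
    HasDerivAt (fun t => Kk p q z t) (lapG z t * ⟪p, q⟫ - d2 p q z t) t := by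
  have h2 := hasDerivAt_integral_Ioi (half_lt_self ht) (f := d2 p q z) (by fun_prop)
    (integrableOn_d2 p q z (half_pos ht)).1 (continuousAt_d2 p q z ht.ne')
  exact ((hasDerivAt_gauss z ht.ne').mul_const ⟪p, q⟫).add h2

theorem hasDerivAt_K1 (q p r z : Plane) {t : ℝ} (ht : 0 < t) :
    HasDerivAt (fun t => K1 q p r z t) (dt1 q z t * ⟪p, r⟫ - d3 q p r z t) t := by
  have h2 := hasDerivAt_integral_Ioi (half_lt_self ht) (f := d3 q p r z) (by fun_prop)
    (integrableOn_d3 q p r z (half_pos ht)).1 (continuousAt_d3 q p r z ht.ne')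
  exact ((hasDerivAt_d1 q z ht.ne').mul_const ⟪p, r⟫).add h2

/-- The two extra powers of the weight make the time derivative integrable at infinity, which is
what integration by parts against the rotation requires. -/
theorem abs_deriv_Kk_le (p q z : Plane) {t : ℝ} (ht : 0 < t) :
    |lapG z t * ⟪p, q⟫ - d2 p q z t| ≤ 2 * CK * (‖p‖ * ‖q‖) * sg z t ^ 4 := by
  have h1 := abs_d2_le p q z ht
  have h2 := abs_mul_le (abs_lapG_le z ht) (abs_inner_le p q)
  refine (abs_sub _ _).trans ?_
  linarith

theorem abs_deriv_K1_le (q p r z : Plane) {t : ℝ} (ht : 0 < t) :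
    |dt1 q z t * ⟪p, r⟫ - d3 q p r z t| ≤ 2 * CK * (‖q‖ * ‖p‖ * ‖r‖) * sg z t ^ 5 := by
  have h1 := abs_d3_le q p r z ht
  have h2 := abs_mul_le (abs_dt1_le q z ht) (abs_inner_le p r)
  refine (abs_sub _ _).trans ?_
  linarith

/-! #### Taylor expansion in space -/

theorem abs_sub_le_of_fderiv {f : Plane → ℝ} {S : Set Plane} {M : ℝ} (hf : Differentiable ℝ f)
    (hS : Convex ℝ S) (hM : 0 ≤ M) (hb : ∀ w ∈ S, ∀ v, |fderiv ℝ f w v| ≤ M * ‖v‖) {x y : Plane}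
    (hx : x ∈ S) (hy : y ∈ S) : |f y - f x| ≤ M * ‖y - x‖ :=
  hS.norm_image_sub_le_of_norm_fderiv_le (fun w _ => hf w)
    (fun w hw => ContinuousLinearMap.opNorm_le_bound _ hM (hb w hw)) hx hy

/-- The mean value inequality is used twice: for the derivative, and then for f minus its linear
part. The second use is on the segment only, so that the increment of the derivative is controlled
by the length of that segment. -/
theorem abs_taylor_le {f : Plane → ℝ} {S : Set Plane} {M : ℝ} (hf : ContDiff ℝ (⊤ : ℕ∞) f)
    (hS : Convex ℝ S) (hM : 0 ≤ M)
    (hb : ∀ u, ∀ w ∈ S, ∀ v, |fderiv ℝ (fun z => fderiv ℝ f z u) w v| ≤ M * ‖u‖ * ‖v‖)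
    {x y : Plane} (hx : x ∈ S) (hy : y ∈ S) :
    |f y - f x - fderiv ℝ f x (y - x)| ≤ M * ‖y - x‖ ^ 2 := by
  have hd : Differentiable ℝ f := hf.differentiable (by simp)
  have hd2 : ∀ u, Differentiable ℝ (fun z => fderiv ℝ f z u) := fun u =>
    (((contDiff_infty.1 hf 2).fderiv_right (m := 1) (by norm_num)).clm_apply
      contDiff_const).differentiable (by simp)
  set g : Plane → ℝ := fun z => f z - fderiv ℝ f x z
  have hg : ∀ z, HasFDerivAt g (fderiv ℝ f z - fderiv ℝ f x) z := fun z =>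
    (hd z).hasFDerivAt.sub (fderiv ℝ f x).hasFDerivAt
  have hseg : segment ℝ x y ⊆ S := hS.segment_subset hx hy
  have h := abs_sub_le_of_fderiv (f := g) (S := segment ℝ x y) (M := M * ‖y - x‖)
    (fun z => (hg z).differentiableAt) (convex_segment x y) (by positivity) (fun w hw v => by
      rw [(hg w).fderiv]
      have h1 := abs_sub_le_of_fderiv (hd2 v) hS (M := M * ‖v‖) (by positivity) (hb v) hx (hseg hw)
      have h2 : ‖w - x‖ ≤ ‖y - x‖ := by
        obtain ⟨a, b, ha, hb, hab, rfl⟩ := hw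
        have : a • x + b • y - x = b • (y - x) := by
          rw [show a = 1 - b by linarith, smul_sub, sub_smul, one_smul]; abel
        rw [this, norm_smul, Real.norm_of_nonneg hb]
        exact mul_le_of_le_one_left (norm_nonneg _) (by linarith)
      refine h1.trans ?_
      calc M * ‖v‖ * ‖w - x‖ ≤ M * ‖v‖ * ‖y - x‖ := by gcongr
        _ = _ := by ring) (left_mem_segment ℝ x y) (right_mem_segment ℝ x y)
  have e : g y - g x = f y - f x - fderiv ℝ f x (y - x) := by
    simp only [g, map_sub]; ring
  rw [← e]
  exact h.trans (le_of_eq (by ring))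

/-- On a ball of half the radius |x| the norm is at least |x|/2, so derivatives there are controlled
by the weight at the centre. -/
theorem sg_le_of_mem {x w : Plane} {s : ℝ} (hs : 0 < s)
    (hw : w ∈ Metric.closedBall x (‖x‖ / 2)) : sg w s ≤ 2 * sg x s := by
  refine sg_le_sg hs (by norm_num) ?_
  rw [mem_closedBall_iff_norm] at hw
  have h1 : ‖x‖ ≤ 2 * ‖w‖ := by
    have := norm_sub_norm_le x w
    rw [norm_sub_rev] at this
    linarith
  nlinarith [norm_nonneg x]

theorem sub_mem_closedBall {x v : Plane} (hv : ‖v‖ ≤ ‖x‖ / 2) :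
    x - v ∈ Metric.closedBall x (‖x‖ / 2) := by
  simpa [mem_closedBall_iff_norm] using hv

/-- The factor 2 between weights gives 2⁴ = 16 for the local part and 2⁶ = 64 for the nonlocal one;
the time integral halves the latter, whence 16 + 32 = 48. -/
theorem abs_K1_sub_le (q p r : Plane) {x v : Plane} {t : ℝ} (ht : 0 < t) (hv : ‖v‖ ≤ ‖x‖ / 2) :
    |K1 q p r (x - v) t - K1 q p r x t| ≤
      48 * CK * (‖q‖ * ‖p‖ * ‖r‖) * ‖v‖ * sg x t ^ 4 := by
  have hx : x ∈ Metric.closedBall x (‖x‖ / 2) := Metric.mem_closedBall_self (by positivity)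
  have hC := CK_pos
  have h1 : |d1 q (x - v) t - d1 q x t| ≤ 16 * CK * ‖q‖ * ‖v‖ * sg x t ^ 4 := by
    have h := abs_sub_le_of_fderiv (f := fun z => d1 q z t)
      ((contDiff_d1 q t).differentiable (by simp)) (convex_closedBall x (‖x‖ / 2))
      (M := CK * ‖q‖ * (2 * sg x t) ^ 4) (by have := sg_pos x ht; positivity)
      (fun w hw u => by
        rw [fderiv_d1]
        refine (abs_d2_le u q w ht).trans ?_
        have := sg_le_of_mem ht hw
        have := sg_pos w ht
        calc CK * (‖u‖ * ‖q‖) * sg w t ^ 4 ≤ CK * (‖u‖ * ‖q‖) * (2 * sg x t) ^ 4 := by gcongr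
          _ = _ := by ring) hx (sub_mem_closedBall hv)
    refine h.trans (le_of_eq ?_)
    rw [sub_sub_cancel_left, norm_neg]; ring
  have h2 : ∀ s, t < s → |d3 q p r (x - v) s - d3 q p r x s| ≤
      64 * CK * (‖q‖ * ‖p‖ * ‖r‖) * ‖v‖ * sg x s ^ (3 + 3) := fun s hs => by
    have hs0 := ht.trans hs
    have h := abs_sub_le_of_fderiv (f := fun z => d3 q p r z s)
      ((contDiff_d3 q p r s).differentiable (by simp)) (convex_closedBall x (‖x‖ / 2))
      (M := CK * (‖q‖ * ‖p‖ * ‖r‖) * (2 * sg x s) ^ 6) (by have := sg_pos x hs0; positivity)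
      (fun w hw u => by
        rw [fderiv_d3]
        refine (abs_d4_le u q p r w hs0).trans ?_
        have := sg_le_of_mem hs0 hw
        have := sg_pos w hs0
        calc CK * (‖u‖ * ‖q‖ * ‖p‖ * ‖r‖) * sg w s ^ 6
            ≤ CK * (‖u‖ * ‖q‖ * ‖p‖ * ‖r‖) * (2 * sg x s) ^ 6 := by gcongr
          _ = _ := by ring) hx (sub_mem_closedBall hv)
    refine h.trans (le_of_eq ?_)
    rw [sub_sub_cancel_left, norm_neg]; ring
  have h3 := (integrableOn_of_le_sg (f := fun s => d3 q p r (x - v) s - d3 q p r x s)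
    (by fun_prop) ht h2).2
  rw [integral_sub (integrableOn_d3 q p r (x - v) ht).1 (integrableOn_d3 q p r x ht).1] at h3
  have h4 := abs_mul_le h1 (abs_inner_le p r)
  have e : K1 q p r (x - v) t - K1 q p r x t = (d1 q (x - v) t - d1 q x t) * ⟪p, r⟫ +
      ((∫ s in Ioi t, d3 q p r (x - v) s) - ∫ s in Ioi t, d3 q p r x s) := by
    rw [K1, K1]; ring
  rw [e]
  refine (abs_add_le _ _).trans ((add_le_add h4 h3).trans (le_of_eq ?_))
  norm_num
  ring

theorem abs_Kk_taylor_le (p q : Plane) {x v : Plane} {t : ℝ} (ht : 0 < t)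
    (hv : ‖v‖ ≤ ‖x‖ / 2) :
    |Kk p q (x - v) t - Kk p q x t + K1 v p q x t| ≤
      48 * CK * (‖p‖ * ‖q‖) * ‖v‖ ^ 2 * sg x t ^ 4 := by
  have hx : x ∈ Metric.closedBall x (‖x‖ / 2) := Metric.mem_closedBall_self (by positivity)
  have hC := CK_pos
  have h1 : |gauss (x - v) t - gauss x t + d1 v x t| ≤ 16 * CK * ‖v‖ ^ 2 * sg x t ^ 4 := by
    have h := abs_taylor_le (contDiff_gauss t) (convex_closedBall x (‖x‖ / 2))
      (M := CK * (2 * sg x t) ^ 4) (by have := sg_pos x ht; positivity)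
      (fun u w hw u' => by
        simp_rw [fderiv_gauss]
        rw [fderiv_d1]
        refine (abs_d2_le u' u w ht).trans ?_
        have := sg_le_of_mem ht hw
        have := sg_pos w ht
        calc CK * (‖u'‖ * ‖u‖) * sg w t ^ 4 ≤ CK * (‖u'‖ * ‖u‖) * (2 * sg x t) ^ 4 := by gcongr
          _ = _ := by ring) hx (sub_mem_closedBall hv)
    rw [sub_sub_cancel_left, norm_neg, map_neg, fderiv_gauss, sub_neg_eq_add] at h
    exact h.trans (le_of_eq (by ring))
  have h2 : ∀ s, t < s → |d2 p q (x - v) s - d2 p q x s + d3 v p q x s| ≤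
      64 * CK * (‖p‖ * ‖q‖) * ‖v‖ ^ 2 * sg x s ^ (3 + 3) := fun s hs => by
    have hs0 := ht.trans hs
    have h := abs_taylor_le (contDiff_d2 p q s) (convex_closedBall x (‖x‖ / 2))
      (M := CK * (‖p‖ * ‖q‖) * (2 * sg x s) ^ 6) (by have := sg_pos x hs0; positivity)
      (fun u w hw u' => by
        simp_rw [fderiv_d2]
        rw [fderiv_d3]
        refine (abs_d4_le u' u p q w hs0).trans ?_
        have := sg_le_of_mem hs0 hw
        have := sg_pos w hs0
        calc CK * (‖u'‖ * ‖u‖ * ‖p‖ * ‖q‖) * sg w s ^ 6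
            ≤ CK * (‖u'‖ * ‖u‖ * ‖p‖ * ‖q‖) * (2 * sg x s) ^ 6 := by gcongr
          _ = _ := by ring) hx (sub_mem_closedBall hv)
    rw [sub_sub_cancel_left, norm_neg, map_neg, fderiv_d2, sub_neg_eq_add] at h
    exact h.trans (le_of_eq (by ring))
  have h3 := (integrableOn_of_le_sg (f := fun s => d2 p q (x - v) s - d2 p q x s + d3 v p q x s)
    (by fun_prop) ht h2).2
  rw [integral_add (f := fun s => d2 p q (x - v) s - d2 p q x s)
    ((integrableOn_d2 p q (x - v) ht).1.sub (integrableOn_d2 p q x ht).1) (integrableOn_d3 v p q x ht).1,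
    integral_sub (integrableOn_d2 p q (x - v) ht).1 (integrableOn_d2 p q x ht).1] at h3
  have h4 := abs_mul_le h1 (abs_inner_le p q)
  have e : Kk p q (x - v) t - Kk p q x t + K1 v p q x t =
      (gauss (x - v) t - gauss x t + d1 v x t) * ⟪p, q⟫ +
      ((∫ s in Ioi t, d2 p q (x - v) s) - (∫ s in Ioi t, d2 p q x s) +
        ∫ s in Ioi t, d3 v p q x s) := by
    rw [Kk, Kk, K1]; ring
  rw [e]
  refine (abs_add_le _ _).trans ((add_le_add h4 h3).trans (le_of_eq ?_))
  norm_num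
  ring

theorem sg_le_sg_zero (z : Plane) {s : ℝ} (hs : 0 < s) : sg z s ≤ sg 0 s := by
  simpa using sg_le_sg (z := z) (w := 0) hs one_pos (by simp)

/-- The weight is largest at the origin, so a gradient bound uniform in space holds and no
restriction on z is needed. -/
theorem abs_Kk_sub_zero_le (p q z : Plane) {t : ℝ} (ht : 0 < t) :
    |Kk p q z t - Kk p q 0 t| ≤ 2 * CK * (‖p‖ * ‖q‖) * ‖z‖ * sg 0 t ^ 3 := by
  have hC := CK_pos
  have h1 : |gauss z t - gauss 0 t| ≤ CK * ‖z‖ * sg 0 t ^ 3 := by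
    have h := abs_sub_le_of_fderiv (f := fun z => gauss z t)
      ((contDiff_gauss t).differentiable (by simp)) convex_univ
      (M := CK * sg 0 t ^ 3) (by have := sg_pos 0 ht; positivity)
      (fun w _ u => by
        rw [fderiv_gauss]
        refine (abs_d1_le u w ht).trans ?_
        have := sg_le_sg_zero w ht
        have := sg_pos w ht
        calc CK * ‖u‖ * sg w t ^ 3 ≤ CK * ‖u‖ * sg 0 t ^ 3 := by gcongr
          _ = _ := by ring) (mem_univ 0) (mem_univ z)
    exact h.trans (le_of_eq (by rw [sub_zero]; ring))
  have h2 : ∀ s, t < s → |d2 p q z s - d2 p q 0 s| ≤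
      CK * (‖p‖ * ‖q‖) * ‖z‖ * sg 0 s ^ (2 + 3) := fun s hs => by
    have hs0 := ht.trans hs
    have h := abs_sub_le_of_fderiv (f := fun z => d2 p q z s)
      ((contDiff_d2 p q s).differentiable (by simp)) convex_univ
      (M := CK * (‖p‖ * ‖q‖) * sg 0 s ^ 5) (by have := sg_pos 0 hs0; positivity)
      (fun w _ u => by
        rw [fderiv_d2]
        refine (abs_d3_le u p q w hs0).trans ?_
        have := sg_le_sg_zero w hs0
        have := sg_pos w hs0
        calc CK * (‖u‖ * ‖p‖ * ‖q‖) * sg w s ^ 5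
            ≤ CK * (‖u‖ * ‖p‖ * ‖q‖) * sg 0 s ^ 5 := by gcongr
          _ = _ := by ring) (mem_univ 0) (mem_univ z)
    exact h.trans (le_of_eq (by rw [sub_zero]; ring))
  have h3 := (integrableOn_of_le_sg (f := fun s => d2 p q z s - d2 p q 0 s)
    (by fun_prop) ht h2).2
  rw [integral_sub (integrableOn_d2 p q z ht).1 (integrableOn_d2 p q 0 ht).1] at h3
  have h4 := abs_mul_le h1 (abs_inner_le p q)
  have e : Kk p q z t - Kk p q 0 t = (gauss z t - gauss 0 t) * ⟪p, q⟫ +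
      ((∫ s in Ioi t, d2 p q z s) - ∫ s in Ioi t, d2 p q 0 s) := by
    rw [Kk, Kk]; ring
  rw [e]
  refine (abs_add_le _ _).trans ((add_le_add h4 h3).trans ?_)
  have h5 : 0 ≤ CK * (‖p‖ * ‖q‖) * ‖z‖ * sg 0 t ^ 3 := by have := sg_pos 0 ht; positivity
  norm_num
  linarith

/-- At the origin the Hessian is isotropic, and its time integral removes half of 1/(4πt). The
remaining 1/(8πt) is the reason why the fundamental solution converges only conditionally. -/
theorem Kk_zero (p q : Plane) {t : ℝ} (ht : 0 < t) :
    Kk p q 0 t = ⟪p, q⟫ / (8 * Real.pi) * sg 0 t ^ 2 := by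
  have hpi := Real.pi_pos
  have h1 : ∀ s ∈ Ioi t, d2 p q 0 s = -(⟪p, q⟫ / (8 * Real.pi)) * sg 0 s ^ 4 := fun s hs => by
    have hs0 : 0 < s := ht.trans hs
    rw [show sg 0 s ^ 4 = (sg 0 s ^ 2) ^ 2 by ring, sg_sq 0 hs0.le]
    simp [d2, gauss]
    field_simp
    ring
  have h2 := (integrableOn_sg_pow 0 1 ht.le (by simpa)).2
  norm_num at h2
  rw [Kk, setIntegral_congr_fun measurableSet_Ioi h1, integral_const_mul, h2, sg_sq 0 ht.le]
  simp [gauss]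
  field_simp
  ring

/-- This is the geometric mean of the Lipschitz bound |z| t^{-3/2} and the trivial bound t^{-1}. The
result is integrable at infinity yet grows only like √|z|; linear growth would exclude densities of
size |y|^{-3}, whose first moment diverges in the plane. -/
theorem abs_Kk_sub_le_sqrt {p q : Plane} (z : Plane) {t : ℝ} (ht : 0 < t) :
    |Kk p q z t - ⟪p, q⟫ / (8 * Real.pi) * sg 0 t ^ 2| ≤
      4 * CK * (‖p‖ * ‖q‖) * (√‖z‖ * t ^ (-(5 / 4) : ℝ)) := by
  have hC := CK_pos
  have h1 := abs_Kk_sub_zero_le p q z ht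
  have h2 : |Kk p q z t - Kk p q 0 t| ≤ 4 * CK * (‖p‖ * ‖q‖) * sg 0 t ^ 2 := by
    have a := abs_Kk_le p q z ht
    have b := abs_Kk_le p q 0 ht
    have c : sg z t ^ 2 ≤ sg 0 t ^ 2 := pow_le_pow_left₀ (sg_nonneg _ _) (sg_le_sg_zero z ht) 2
    refine (abs_sub _ _).trans ?_
    calc _ ≤ 2 * CK * (‖p‖ * ‖q‖) * sg 0 t ^ 2 + 2 * CK * (‖p‖ * ‖q‖) * sg 0 t ^ 2 := by
          refine add_le_add (a.trans ?_) b
          gcongr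
      _ = _ := by ring
  rw [← Kk_zero p q ht]
  -- The square of the difference is bounded by the product of the two estimates.
  refine abs_le_of_sq_le_sq ?_ (by positivity)
  have h3 := mul_le_mul h1 h2 (abs_nonneg _) (by have := sg_pos 0 ht; positivity)
  have h4 : t ^ (-(5 / 4) : ℝ) * t ^ (-(5 / 4) : ℝ) = sg 0 t ^ 5 := by
    rw [sg_pow_eq 0 t 5 ht.le, ← Real.rpow_add ht]; norm_num
  have h5 : 0 ≤ CK ^ 2 * (‖p‖ * ‖q‖) ^ 2 * ‖z‖ * sg 0 t ^ 5 := by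
    have := sg_pos 0 ht; positivity
  calc (Kk p q z t - Kk p q 0 t) ^ 2
      ≤ 2 * CK * (‖p‖ * ‖q‖) * ‖z‖ * sg 0 t ^ 3 * (4 * CK * (‖p‖ * ‖q‖) * sg 0 t ^ 2) := by
        rw [← sq_abs, sq]; exact h3
    _ ≤ 16 * CK ^ 2 * (‖p‖ * ‖q‖) ^ 2 * ‖z‖ * sg 0 t ^ 5 := by nlinarith
    _ = _ := by
      rw [← h4]
      have := Real.mul_self_sqrt (norm_nonneg z)
      linear_combination (-16 * CK ^ 2 * (‖p‖ * ‖q‖) ^ 2 * (t ^ (-(5 / 4) : ℝ)) ^ 2) * this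

/-! ### Oscillatory integrals and convergence of the fundamental solution -/

theorem sg_anti (z : Plane) {s t : ℝ} (hs : 0 < s) (h : s ≤ t) : sg z t ≤ sg z s := by
  simpa using sg_le_sg (z := z) (w := z) (s := t) (t := s) hs one_pos (by linarith)

/-- One integration by parts against sin(βt+δ)/β. The two boundary terms contribute one unit each
and the integral of the derivative at most two, which gives the 4. -/
theorem abs_integral_mul_cos_le {b b' : ℝ → ℝ} {z : Plane} {M β δ t₀ T : ℝ} {n : ℕ}
    (h0 : 0 < t₀) (hT : t₀ ≤ T) (hβ : β ≠ 0) (hM : 0 ≤ M)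
    (hb : ∀ t, 0 < t → |b t| ≤ M * sg z t ^ (n + 1))
    (hd : ∀ t, 0 < t → HasDerivAt b (b' t) t)
    (hb' : ∀ t, 0 < t → |b' t| ≤ M * sg z t ^ (n + 3)) (hm : Measurable b') :
    |∫ t in t₀..T, b t * Real.cos (β * t + δ)| ≤ 4 * M / |β| * sg z t₀ ^ (n + 1) := by
  obtain ⟨hi, hbd⟩ := integrableOn_of_le_sg (f := fun t => |b' t|) (z := z) (M := M) (n := n)
    hm.abs h0 (fun s hs => by simpa using hb' s (h0.trans hs))
  have hi' : IntegrableOn b' (Ioi t₀) := (integrable_norm_iff hm.aestronglyMeasurable).1 hi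
  have hii : IntervalIntegrable b' volume t₀ T :=
    (intervalIntegrable_iff_integrableOn_Ioc_of_le hT).2 (hi'.mono_set Ioc_subset_Ioi_self)
  have hv : ∀ t, HasDerivAt (fun t => Real.sin (β * t + δ) / β) (Real.cos (β * t + δ)) t :=
    fun t => by
      have h := ((((hasDerivAt_id t).const_mul β).add_const δ).sin).div_const β
      refine h.congr_deriv ?_
      simp; field_simp
  have hv1 : ∀ t, |Real.sin (β * t + δ) / β| ≤ 1 / |β| := fun t => by
    rw [abs_div]; gcongr; exact Real.abs_sin_le_one _
  have key := intervalIntegral.integral_mul_deriv_eq_deriv_mul (a := t₀) (b := T)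
    (u := b) (u' := b') (v := fun t => Real.sin (β * t + δ) / β)
    (v' := fun t => Real.cos (β * t + δ))
    (fun t ht => hd t (h0.trans_le (by rw [uIcc_of_le hT] at ht; exact ht.1)))
    (fun t _ => hv t) hii (Continuous.intervalIntegrable (by fun_prop) _ _)
  rw [key]
  have hβ' : 0 < |β| := abs_pos.2 hβ
  have hs := sg_nonneg z t₀
  have e1 : |b T * (Real.sin (β * T + δ) / β)| ≤ M * sg z t₀ ^ (n + 1) * (1 / |β|) := by
    refine abs_mul_le ((hb T (h0.trans_le hT)).trans ?_) (hv1 T)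
    have := sg_anti z h0 hT
    have := sg_nonneg z T
    gcongr
  have e2 : |b t₀ * (Real.sin (β * t₀ + δ) / β)| ≤ M * sg z t₀ ^ (n + 1) * (1 / |β|) :=
    abs_mul_le (hb t₀ h0) (hv1 t₀)
  have e3 : |∫ t in t₀..T, b' t * (Real.sin (β * t + δ) / β)| ≤
      2 * (M * sg z t₀ ^ (n + 1)) * (1 / |β|) := by
    rw [intervalIntegral.integral_of_le hT]
    calc |∫ t in Ioc t₀ T, b' t * (Real.sin (β * t + δ) / β)|
        ≤ ∫ t in Ioc t₀ T, |b' t| * (1 / |β|) := by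
          rw [← Real.norm_eq_abs]
          refine norm_integral_le_of_norm_le ((hi.mono_set Ioc_subset_Ioi_self).mul_const _) ?_
          refine Eventually.of_forall fun t => ?_
          exact abs_mul_le (le_refl |b' t|) (hv1 t)
      _ ≤ ∫ t in Ioi t₀, |b' t| * (1 / |β|) :=
          setIntegral_mono_set (hi.mul_const _)
            (Eventually.of_forall fun t => by simp only [Pi.zero_apply]; positivity)
            (Ioc_subset_Ioi_self.eventuallyLE)
      _ = (∫ t in Ioi t₀, |b' t|) * (1 / |β|) := integral_mul_const _ _
      _ ≤ _ := by
          refine mul_le_mul_of_nonneg_right ?_ (by positivity)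
          refine (le_abs_self _).trans (hbd.trans ?_)
          have : 2 / ((n : ℝ) + 1) ≤ 2 := by
            rw [div_le_iff₀ (by positivity)]; linarith [(Nat.cast_nonneg n : (0 : ℝ) ≤ n)]
          calc M * (2 / ((n : ℝ) + 1) * sg z t₀ ^ (n + 1)) ≤ M * (2 * sg z t₀ ^ (n + 1)) := by
                gcongr
            _ = _ := by ring
  refine (abs_sub _ _).trans ((add_le_add (abs_sub _ _) e3).trans ?_)
  calc _ ≤ M * sg z t₀ ^ (n + 1) * (1 / |β|) + M * sg z t₀ ^ (n + 1) * (1 / |β|) +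
      2 * (M * sg z t₀ ^ (n + 1)) * (1 / |β|) := by gcongr
    _ = _ := by ring

theorem abs_integral_mul_sin_le {b b' : ℝ → ℝ} {z : Plane} {M β t₀ T : ℝ} {n : ℕ}
    (h0 : 0 < t₀) (hT : t₀ ≤ T) (hβ : β ≠ 0) (hM : 0 ≤ M)
    (hb : ∀ t, 0 < t → |b t| ≤ M * sg z t ^ (n + 1))
    (hd : ∀ t, 0 < t → HasDerivAt b (b' t) t)
    (hb' : ∀ t, 0 < t → |b' t| ≤ M * sg z t ^ (n + 3)) (hm : Measurable b') :
    |∫ t in t₀..T, b t * Real.sin (β * t)| ≤ 4 * M / |β| * sg z t₀ ^ (n + 1) := by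
  have h := abs_integral_mul_cos_le (δ := -(Real.pi / 2)) h0 hT hβ hM hb hd hb' hm
  simpa [← sub_eq_add_neg, Real.cos_sub_pi_div_two] using h

theorem Rot_neg_eq (θ : ℝ) (b : Plane) :
    Rot (-θ) b = Real.cos θ • b + (-Real.sin θ) • perp b := by simp [Rot]

theorem Kk_Rot_neg (a b z : Plane) (θ : ℝ) {t : ℝ} (ht : 0 < t) :
    Kk a (Rot (-θ) b) z t = Kk a b z t * Real.cos θ - Kk a (perp b) z t * Real.sin θ := by
  rw [Rot_neg_eq, Kk_lin_right _ _ _ _ _ _ ht]; ring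

theorem intervalIntegrable_of_pos {f : ℝ → ℝ} (hf : ∀ t, 0 < t → ContinuousAt f t) {t₀ T : ℝ}
    (h0 : 0 < t₀) (hT : t₀ ≤ T) : IntervalIntegrable f volume t₀ T :=
  ContinuousOn.intervalIntegrable fun t ht =>
    (hf t (h0.trans_le (by rw [uIcc_of_le hT] at ht; exact ht.1))).continuousWithinAt

/-- With z fixed the rotation splits into a cosine and a sine with slowly varying amplitudes, and
each is estimated by integration by parts. -/
theorem abs_integral_Kk_Rot_le (a b z : Plane) {α t₀ T : ℝ} (hα : α ≠ 0) (h0 : 0 < t₀)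
    (hT : t₀ ≤ T) :
    |∫ t in t₀..T, Kk a (Rot (-(α * t)) b) z t| ≤
      16 * CK * (‖a‖ * ‖b‖) / |α| * sg z t₀ ^ 2 := by
  have hC := CK_pos
  have h1 : ∫ t in t₀..T, Kk a (Rot (-(α * t)) b) z t =
      (∫ t in t₀..T, Kk a b z t * Real.cos (α * t + 0)) -
        ∫ t in t₀..T, Kk a (perp b) z t * Real.sin (α * t) := by
    have hk : ∀ b', ∀ t, 0 < t → ContinuousAt (fun t => Kk a b' z t) t :=
      fun b' t ht => (hasDerivAt_Kk a b' z ht).continuousAt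
    rw [← intervalIntegral.integral_sub]
    · refine intervalIntegral.integral_congr fun t ht => ?_
      rw [uIcc_of_le hT] at ht
      simp only [add_zero]
      exact Kk_Rot_neg a b z _ (h0.trans_le ht.1)
    · exact intervalIntegrable_of_pos (fun t ht => (hk b t ht).mul (by fun_prop)) h0 hT
    · exact intervalIntegrable_of_pos (fun t ht => (hk _ t ht).mul (by fun_prop)) h0 hT
  have m : ∀ b', Measurable fun t => lapG z t * ⟪a, b'⟫ - d2 a b' z t := fun b' => by
    unfold lapG; fun_prop
  have e1 := abs_integral_mul_cos_le (z := z) (δ := 0) (n := 1) h0 hT hα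
    (M := 2 * CK * (‖a‖ * ‖b‖)) (by positivity)
    (fun t ht => abs_Kk_le a b z ht) (fun t ht => hasDerivAt_Kk a b z ht)
    (fun t ht => abs_deriv_Kk_le a b z ht) (m b)
  have e2 := abs_integral_mul_sin_le (z := z) (n := 1) h0 hT hα
    (M := 2 * CK * (‖a‖ * ‖perp b‖)) (by positivity)
    (fun t ht => abs_Kk_le a (perp b) z ht) (fun t ht => hasDerivAt_Kk a (perp b) z ht)
    (fun t ht => abs_deriv_Kk_le a (perp b) z ht) (m _)
  rw [h1]
  refine (abs_sub _ _).trans ((add_le_add e1 e2).trans (le_of_eq ?_))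
  rw [norm_perp]; ring

/-- The integrand of the bilinear form of the fundamental solution. -/
def kap (α : ℝ) (x y a b : Plane) (t : ℝ) : ℝ := Kk (Rot (α * t) a) b (Rot (α * t) x - y) t

/-- The bilinear form of the truncated fundamental solution. -/
def AT (α T : ℝ) (x y a b : Plane) : ℝ := ∫ t in (0 : ℝ)..T, kap α x y a b t

theorem kap_eq (α : ℝ) (x y a b : Plane) (t : ℝ) :
    kap α x y a b t = Kk a (Rot (-(α * t)) b) (x - Rot (-(α * t)) y) t := Kk_Rot_left _ _ _ _ _ _

theorem abs_kap_le (α : ℝ) (x y a b : Plane) {t : ℝ} (ht : 0 < t) :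
    |kap α x y a b t| ≤ 2 * CK * (‖a‖ * ‖b‖) * sg (Rot (α * t) x - y) t ^ 2 := by
  have := abs_Kk_le (Rot (α * t) a) b (Rot (α * t) x - y) ht
  rwa [norm_Rot] at this

theorem measurable_kap (α : ℝ) (x y a b : Plane) : Measurable (kap α x y a b) := by
  unfold kap; fun_prop

/-- The squared parabolic distance along the orbit is continuous on a compact interval. It is
positive for t > 0 because of t, and at t = 0 because x ≠ y. The orbit may pass through y at later
times without harm. -/
theorem exists_pos_le_of_ne (α T : ℝ) {x y : Plane} (h : x ≠ y) :
    ∃ m > 0, ∀ t ∈ Icc 0 T, m ≤ t + ‖Rot (α * t) x - y‖ ^ 2 := by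
  rcases lt_or_ge T 0 with hT | hT
  · exact ⟨1, one_pos, fun t ht => absurd (ht.1.trans ht.2) (not_le.2 hT)⟩
  · obtain ⟨t, ht, hmin⟩ := (isCompact_Icc (a := (0 : ℝ)) (b := T)).exists_isMinOn
      (nonempty_Icc.2 hT) (f := fun t => t + ‖Rot (α * t) x - y‖ ^ 2)
      (Continuous.continuousOn (by fun_prop))
    refine ⟨_, ?_, fun s hs => hmin hs⟩
    rcases ht.1.eq_or_lt with h0 | h0
    · rw [← h0]
      have : 0 < ‖x - y‖ := norm_pos_iff.2 (sub_ne_zero.2 h)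
      simp; positivity
    · positivity

theorem integrableOn_kap (α T : ℝ) {x y : Plane} (h : x ≠ y) (a b : Plane) :
    IntegrableOn (kap α x y a b) (Ioc 0 T) := by
  obtain ⟨m, hm, hle⟩ := exists_pos_le_of_ne α T h
  have hC := CK_pos
  refine Measure.integrableOn_of_bounded (M := 2 * CK * (‖a‖ * ‖b‖) * m⁻¹) (by simp)
    (measurable_kap α x y a b).aestronglyMeasurable ?_
  filter_upwards [ae_restrict_mem measurableSet_Ioc] with t ht
  refine (abs_kap_le α x y a b ht.1).trans ?_
  rw [sg_sq _ ht.1.le]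
  gcongr
  exact hle t ⟨ht.1.le, ht.2⟩

theorem intervalIntegrable_kap (α : ℝ) {s T : ℝ} (hs : 0 ≤ s) (hT : s ≤ T) {x y : Plane}
    (h : x ≠ y) (a b : Plane) : IntervalIntegrable (kap α x y a b) volume s T :=
  (intervalIntegrable_iff_integrableOn_Ioc_of_le hT).2
    ((integrableOn_kap α T h a b).mono_set (Ioc_subset_Ioc_left hs))

/-- The bound for the tails of the integral defining the fundamental solution. -/
def tailBd (α : ℝ) (x y : Plane) : ℝ := 16 * CK * (1 / |α| + √(‖x‖ + ‖y‖))

/-- The integrand is compared with its value at z = 0: that part is controlled by oscillation, and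
the difference by √(|x|+|y|) t^{-5/4}, whose tail is 4 T₁^{-1/4}. The condition T₁ ≥ 1 allows one
common power for both. -/
theorem abs_integral_kap_tail_le {α : ℝ} (hα : α ≠ 0) (x y a b : Plane) {T₁ T₂ : ℝ} (h1 : 1 ≤ T₁)
    (h2 : T₁ ≤ T₂) :
    |∫ t in T₁..T₂, kap α x y a b t| ≤ ‖a‖ * ‖b‖ * tailBd α x y * T₁ ^ (-(1 / 4) : ℝ) := by
  have hC := CK_pos
  have h0 : 0 < T₁ := one_pos.trans_le h1
  have hα' := abs_pos.2 hα
  set F : ℝ → ℝ := fun t => Kk a (Rot (-(α * t)) b) 0 t with hF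
  have hbd : ∀ t, 0 < t → |kap α x y a b t - F t| ≤
      4 * CK * (‖a‖ * ‖b‖) * √(‖x‖ + ‖y‖) * t ^ (-(5 / 4) : ℝ) := fun t ht => by
    rw [kap_eq, hF]
    have h := abs_Kk_sub_le_sqrt (p := a) (q := Rot (-(α * t)) b) (x - Rot (-(α * t)) y) ht
    rw [← Kk_zero _ _ ht, norm_Rot] at h
    refine h.trans ?_
    have : ‖x - Rot (-(α * t)) y‖ ≤ ‖x‖ + ‖y‖ := by
      simpa [norm_Rot] using norm_sub_le x (Rot (-(α * t)) y)
    rw [mul_assoc _ (√(‖x‖ + ‖y‖))]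
    gcongr
  have hmF : Measurable F := by rw [hF]; fun_prop
  have hiF : IntervalIntegrable F volume T₁ T₂ := by
    refine (intervalIntegrable_iff_integrableOn_Ioc_of_le h2).2 ?_
    refine Measure.integrableOn_of_bounded (M := 2 * CK * (‖a‖ * ‖b‖)) (by simp)
      hmF.aestronglyMeasurable ?_
    filter_upwards [ae_restrict_mem measurableSet_Ioc] with t ht
    have ht0 := h0.trans ht.1
    refine (abs_Kk_le a _ 0 ht0).trans ?_
    rw [norm_Rot, sg_sq _ ht0.le]
    refine mul_le_of_le_one_right (by positivity) ?_
    simpa using inv_le_one_of_one_le₀ (h1.trans ht.1.le)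
  have hpw : IntegrableOn (fun t : ℝ => t ^ (-(5 / 4) : ℝ)) (Ioi T₁) :=
    integrableOn_Ioi_rpow_of_lt (by norm_num) h0
  have hE : IntegrableOn (fun t => kap α x y a b t - F t) (Ioi T₁) := by
    refine (hpw.const_mul (4 * CK * (‖a‖ * ‖b‖) * √(‖x‖ + ‖y‖))).mono'
      ((measurable_kap α x y a b).sub hmF).aestronglyMeasurable ?_
    filter_upwards [ae_restrict_mem measurableSet_Ioi] with t ht
    exact hbd t (h0.trans ht)
  have hiE : IntervalIntegrable (fun t => kap α x y a b t - F t) volume T₁ T₂ :=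
    (intervalIntegrable_iff_integrableOn_Ioc_of_le h2).2 (hE.mono_set Ioc_subset_Ioi_self)
  have e1 : |∫ t in T₁..T₂, F t| ≤ 16 * CK * (‖a‖ * ‖b‖) / |α| * T₁ ^ (-(1 / 4) : ℝ) := by
    refine (abs_integral_Kk_Rot_le a b 0 hα h0 h2).trans ?_
    gcongr
    rw [sg_pow_eq _ _ _ h0.le]
    simp only [norm_zero]
    norm_num
    exact Real.rpow_le_rpow_of_exponent_le h1 (by norm_num)
  have e2 : |∫ t in T₁..T₂, (kap α x y a b t - F t)| ≤
      16 * CK * (‖a‖ * ‖b‖) * √(‖x‖ + ‖y‖) * T₁ ^ (-(1 / 4) : ℝ) := by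
    rw [intervalIntegral.integral_of_le h2]
    calc _ ≤ ∫ t in Ioc T₁ T₂, 4 * CK * (‖a‖ * ‖b‖) * √(‖x‖ + ‖y‖) * t ^ (-(5 / 4) : ℝ) := by
          rw [← Real.norm_eq_abs]
          refine norm_integral_le_of_norm_le ((hpw.mono_set Ioc_subset_Ioi_self).const_mul _) ?_
          filter_upwards [ae_restrict_mem measurableSet_Ioc] with t ht
          exact hbd t (h0.trans ht.1)
      _ ≤ ∫ t in Ioi T₁, 4 * CK * (‖a‖ * ‖b‖) * √(‖x‖ + ‖y‖) * t ^ (-(5 / 4) : ℝ) := by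
          refine setIntegral_mono_set (hpw.const_mul _) ?_ Ioc_subset_Ioi_self.eventuallyLE
          filter_upwards [ae_restrict_mem measurableSet_Ioi] with t ht
          have : 0 < t := h0.trans ht
          simp only [Pi.zero_apply]; positivity
      _ = _ := by
          rw [integral_const_mul, integral_Ioi_rpow_of_lt (by norm_num) h0]
          norm_num; ring
  have e : ∫ t in T₁..T₂, kap α x y a b t =
      (∫ t in T₁..T₂, F t) + ∫ t in T₁..T₂, (kap α x y a b t - F t) := by
    rw [← intervalIntegral.integral_add hiF hiE]; simp
  rw [e]
  refine (abs_add_le _ _).trans ((add_le_add e1 e2).trans (le_of_eq ?_))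
  unfold tailBd; ring

theorem exists_tendsto_AT {α : ℝ} (hα : α ≠ 0) {x y : Plane} (h : x ≠ y) (a b : Plane) :
    ∃ l, Tendsto (fun T => AT α T x y a b) atTop (𝓝 l) := by
  have hc : CauchySeq (fun T => AT α T x y a b) := by
    rw [Metric.cauchySeq_iff']
    intro ε hε
    set M := ‖a‖ * ‖b‖ * tailBd α x y
    have hl : Tendsto (fun T : ℝ => M * T ^ (-(1 / 4) : ℝ)) atTop (𝓝 0) := by
      simpa using (tendsto_rpow_neg_atTop (y := 1 / 4) (by norm_num)).const_mul M
    obtain ⟨N, hN1, hN⟩ := ((eventually_ge_atTop 1).and (hl.eventually (gt_mem_nhds hε))).exists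
    refine ⟨N, fun T hT => ?_⟩
    have h0 : (0 : ℝ) ≤ N := zero_le_one.trans hN1
    rw [Real.dist_eq, AT, AT, intervalIntegral.integral_interval_sub_left
      (intervalIntegrable_kap α le_rfl (h0.trans hT) h a b)
      (intervalIntegrable_kap α le_rfl h0 h a b)]
    exact (abs_integral_kap_tail_le hα x y a b hN1 hT).trans_lt hN
  exact cauchySeq_tendsto_of_complete hc

/-! ### From the bilinear form to the matrix entries of the fundamental solution -/

theorem kernelK_apply (z : Plane) (t : ℝ) (i j : Fin 2) :
    kernelK z t i j = Kk (e i) (e j) z t := by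
  simp only [kernelK, kernelH, Matrix.add_apply, Matrix.smul_apply, Matrix.of_apply,
    hessGauss_apply, Kk, inner_e_left, smul_eq_mul]
  congr 2
  simp [Matrix.one_apply]

/-- The transposed rotation in front of K acts on the left test vector; positive time is needed for
the linearity of the tail integral. -/
theorem gammaIntegrand_apply (α : ℝ) (x y : Plane) {t : ℝ} (ht : 0 < t) (i j : Fin 2) :
    gammaIntegrand α x y t i j = kap α x y (e i) (e j) t := by
  have h : Rot (α * t) (e i) = rot (α * t) 0 i • e 0 + rot (α * t) 1 i • e 1 := by
    ext k; fin_cases i <;> fin_cases k <;> simp [rot]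
  rw [kap, h, Kk_lin_left _ _ _ _ _ _ ht]
  simp [gammaIntegrand, Matrix.mul_apply, Fin.sum_univ_two, kernelK_apply, mulVec_rot]

theorem integral_gammaIntegrand (α : ℝ) (x y : Plane) {T : ℝ} (hT : 0 ≤ T) (i j : Fin 2) :
    ∫ t in (0 : ℝ)..T, gammaIntegrand α x y t i j = AT α T x y (e i) (e j) := by
  rw [AT, intervalIntegral.integral_of_le hT, intervalIntegral.integral_of_le hT]
  exact setIntegral_congr_fun measurableSet_Ioc
    fun t ht => gammaIntegrand_apply α x y ht.1 i j

theorem tendsto_gammaIntegrand {α : ℝ} (hα : α ≠ 0) {x y : Plane} (h : x ≠ y) (i j : Fin 2) :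
    Tendsto (fun T : ℝ => ∫ t in (0 : ℝ)..T, gammaIntegrand α x y t i j) atTop
      (𝓝 (fundSol α x y i j)) := by
  obtain ⟨l, hl⟩ := exists_tendsto_AT hα h (e i) (e j)
  have h1 : Tendsto (fun T : ℝ => ∫ t in (0 : ℝ)..T, gammaIntegrand α x y t i j) atTop (𝓝 l) := by
    refine hl.congr' ?_
    filter_upwards [eventually_ge_atTop 0] with T hT using
      (integral_gammaIntegrand α x y hT i j).symm
  exact tendsto_nhds_limUnder ⟨l, h1⟩

theorem kap_expand (α : ℝ) (x y a b : Plane) {t : ℝ} (ht : 0 < t) :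
    kap α x y a b t = ∑ i, ∑ j, a i * b j * kap α x y (e i) (e j) t := by
  have ha : Rot (α * t) a = a 0 • Rot (α * t) (e 0) + a 1 • Rot (α * t) (e 1) := by
    rw [← Rot_smul, ← Rot_smul, ← Rot_add]; congr 1
    simpa [Fin.sum_univ_two] using (sum_smul_e a).symm
  have hb : b = b 0 • e 0 + b 1 • e 1 := by
    simpa [Fin.sum_univ_two] using (sum_smul_e b).symm
  simp only [kap, Fin.sum_univ_two]
  rw [ha, Kk_lin_left _ _ _ _ _ _ ht]
  conv_lhs => rw [hb]
  rw [Kk_lin_right _ _ _ _ _ _ ht, Kk_lin_right _ _ _ _ _ _ ht]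
  ring

theorem AT_expand (α : ℝ) {T : ℝ} (hT : 0 ≤ T) {x y : Plane} (h : x ≠ y) (a b : Plane) :
    AT α T x y a b = ∑ i, ∑ j, a i * b j * AT α T x y (e i) (e j) := by
  simp only [AT, intervalIntegral.integral_of_le hT]
  rw [setIntegral_congr_fun measurableSet_Ioc fun t ht => kap_expand α x y a b ht.1,
    integral_finsetSum _ fun i _ => integrable_finsetSum _ fun j _ =>
      (integrableOn_kap α T h _ _).const_mul _]
  refine Finset.sum_congr rfl fun i _ => ?_
  rw [integral_finsetSum _ fun j _ => (integrableOn_kap α T h _ _).const_mul _]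
  simp_rw [integral_const_mul]

theorem inner_mulVec (M : Mat) (a b : Plane) :
    ⟪a, mulVec M b⟫ = ∑ i, ∑ j, a i * b j * M i j := by
  simp [inner_eq, mulVec, Fin.sum_univ_two]; ring

theorem tendsto_AT {α : ℝ} (hα : α ≠ 0) {x y : Plane} (h : x ≠ y) (a b : Plane) :
    Tendsto (fun T => AT α T x y a b) atTop (𝓝 ⟪a, mulVec (fundSol α x y) b⟫) := by
  rw [inner_mulVec]
  have h1 : Tendsto (fun T => ∑ i, ∑ j, a i * b j * AT α T x y (e i) (e j)) atTop
      (𝓝 (∑ i, ∑ j, a i * b j * fundSol α x y i j)) := by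
    refine tendsto_finsetSum _ fun i _ => tendsto_finsetSum _ fun j _ => Tendsto.const_mul _ ?_
    refine (tendsto_gammaIntegrand hα h i j).congr' ?_
    filter_upwards [eventually_ge_atTop 0] with T hT using integral_gammaIntegrand α x y hT i j
  refine h1.congr' ?_
  filter_upwards [eventually_ge_atTop 0] with T hT using (AT_expand α hT h a b).symm

/-! #### The dominating function -/

/-- The singular part of the bound for the fundamental solution. -/
def Gsing (α : ℝ) (x y : Plane) : ℝ≥0∞ :=
  ∫⁻ t in Ioc (0 : ℝ) 1, ENNReal.ofReal (sg (Rot (α * t) x - y) t ^ 2)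

/-- A bound for the fundamental solution. -/
def Gbd (α : ℝ) (x y : Plane) : ℝ≥0∞ :=
  ENNReal.ofReal (2 * CK) * Gsing α x y + ENNReal.ofReal (tailBd α x y)

/-- Before time 1 the singularity is bounded in absolute value, afterwards by the oscillatory tail
estimate. The bound is independent of T and so serves as dominating function for T → ∞. -/
theorem enorm_AT_le {α : ℝ} (hα : α ≠ 0) {x y : Plane} (h : x ≠ y) (a b : Plane) {T : ℝ}
    (hT : 1 ≤ T) : ‖AT α T x y a b‖ₑ ≤ ‖a‖ₑ * ‖b‖ₑ * Gbd α x y := by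
  have hC := CK_pos
  have e : AT α T x y a b = (∫ t in (0 : ℝ)..1, kap α x y a b t) + ∫ t in (1 : ℝ)..T, kap α x y a b t :=
    (intervalIntegral.integral_add_adjacent_intervals
      (intervalIntegrable_kap α le_rfl zero_le_one h a b)
      (intervalIntegrable_kap α zero_le_one hT h a b)).symm
  have h2 := abs_integral_kap_tail_le hα x y a b le_rfl hT
  rw [Real.one_rpow, mul_one] at h2
  have hab : ENNReal.ofReal (‖a‖ * ‖b‖) = ‖a‖ₑ * ‖b‖ₑ := by
    rw [ENNReal.ofReal_mul (norm_nonneg _), ofReal_norm, ofReal_norm]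
  rw [e, Gbd, mul_add]
  refine (enorm_add_le _ _).trans (add_le_add ?_ ?_)
  · rw [intervalIntegral.integral_of_le zero_le_one]
    refine (enorm_integral_le_lintegral_enorm _).trans ?_
    rw [Gsing, ← mul_assoc, ← hab, ← ENNReal.ofReal_mul (by positivity),
      ← lintegral_const_mul _ (by fun_prop)]
    refine setLIntegral_mono (by fun_prop) fun t ht => ?_
    rw [← ENNReal.ofReal_mul (by positivity), Real.enorm_eq_ofReal_abs]
    refine ENNReal.ofReal_le_ofReal ((abs_kap_le α x y a b ht.1).trans (le_of_eq (by ring)))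
  · rw [Real.enorm_eq_ofReal_abs, ← hab, ← ENNReal.ofReal_mul (by positivity)]
    exact ENNReal.ofReal_le_ofReal h2

theorem enorm_inner_fundSol_le {α : ℝ} (hα : α ≠ 0) {x y : Plane} (h : x ≠ y) (a b : Plane) :
    ‖⟪a, mulVec (fundSol α x y) b⟫‖ₑ ≤ ‖a‖ₑ * ‖b‖ₑ * Gbd α x y :=
  le_of_tendsto (tendsto_AT hα h a b).enorm
    ((eventually_ge_atTop 1).mono fun _ hT => enorm_AT_le hα h a b hT)

/-! ### Integrals of the weight over the plane -/

/-- The integral of `(1 + |z|²)^{-n/2}`. -/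
def Jc (n : ℕ) : ℝ := ∫ z : Plane, sg z 1 ^ n

theorem Jc_nonneg (n : ℕ) : 0 ≤ Jc n := integral_nonneg fun _ => pow_nonneg (sg_nonneg _ _) _

theorem integrable_sg_one {n : ℕ} (hn : 3 ≤ n) : Integrable fun z : Plane => sg z 1 ^ n := by
  have h := integrable_rpow_neg_one_add_norm_sq (E := Plane) (μ := volume) (r := n)
    (by simp; omega)
  refine h.congr (Eventually.of_forall fun z => ?_)
  simp only
  rw [sg_pow_eq _ _ _ zero_le_one, neg_div]

/-- Parabolic scaling, which reduces every spatial integral of the weight to its value at time 1. -/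
theorem sg_eq_smul (z : Plane) {t : ℝ} (ht : 0 < t) : sg z t = sg 0 t * sg (sg 0 t • z) 1 := by
  have h := Real.sq_sqrt ht.le
  have h0 := Real.sqrt_pos.2 ht
  rw [sg_zero_left, sg, sg, norm_smul, Real.norm_of_nonneg (by positivity), ← mul_inv,
    ← Real.sqrt_mul' _ (by positivity)]
  congr 2
  rw [mul_pow, inv_pow, h]; field_simp

theorem integrable_sg (n : ℕ) (hn : 3 ≤ n) {t : ℝ} (ht : 0 < t) :
    Integrable fun z : Plane => sg z t ^ n := by
  have h : Integrable fun z : Plane => sg (sg 0 t • z) 1 ^ n :=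
    (integrable_sg_one hn).comp_smul (sg_pos 0 ht).ne'
  refine (h.const_mul (sg 0 t ^ n)).congr (Eventually.of_forall fun z => ?_)
  simp only
  rw [sg_eq_smul z ht, mul_pow]

theorem integral_sg (n : ℕ) {t : ℝ} (ht : 0 < t) :
    ∫ z : Plane, sg z t ^ (n + 2) = Jc (n + 2) * sg 0 t ^ n := by
  have h0 := sg_pos 0 ht
  have h : ∀ z : Plane, sg z t ^ (n + 2) = sg 0 t ^ (n + 2) * (fun w => sg w 1 ^ (n + 2)) (sg 0 t • z) :=
    fun z => by simp only; rw [← mul_pow, ← sg_eq_smul z ht]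
  have h2 := Measure.integral_comp_smul_of_nonneg volume (fun w : Plane => sg w 1 ^ (n + 2))
    (sg 0 t) (hR := h0.le)
  rw [integral_congr_ae (Eventually.of_forall h), integral_const_mul, h2, Jc]
  simp
  field_simp
  ring

theorem lintegral_sg {τ : Plane → Plane} (hτ : MeasurePreserving τ volume volume) (n : ℕ) (hn : 1 ≤ n)
    {t : ℝ} (ht : 0 < t) :
    ∫⁻ y, ENNReal.ofReal (sg (τ y) t ^ (n + 2)) = ENNReal.ofReal (Jc (n + 2) * sg 0 t ^ n) := by
  rw [hτ.lintegral_comp (f := fun z => ENNReal.ofReal (sg z t ^ (n + 2))) (by fun_prop),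
    ← ofReal_integral_eq_lintegral_ofReal (integrable_sg _ (by omega) ht)
      (Eventually.of_forall fun z => pow_nonneg (sg_nonneg _ _) _), integral_sg n ht]

/-- The second power of the weight is exactly nonintegrable in the plane. Young's inequality sg²h ≤
√t sg⁴ + t^{-1/2}h² replaces it by an integrable power, and both resulting terms are of order
t^{-1/2}, integrable at t = 0. -/
theorem lintegral_sg_sq_mul_le {τ : Plane → Plane} (hτ : MeasurePreserving τ volume volume)
    {t : ℝ} (ht : 0 < t) (h : Plane → ℝ≥0∞) :
    ∫⁻ y, ENNReal.ofReal (sg (τ y) t ^ 2) * h y ≤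
      ENNReal.ofReal (sg 0 t) * (ENNReal.ofReal (Jc 4) + ∫⁻ y, h y ^ 2) := by
  have h0 := sg_pos 0 ht
  have hm : Measurable fun y => ENNReal.ofReal (sg (τ y) t ^ (2 + 2)) :=
    (by fun_prop : Measurable fun z => ENNReal.ofReal (sg z t ^ (2 + 2))).comp hτ.measurable
  calc ∫⁻ y, ENNReal.ofReal (sg (τ y) t ^ 2) * h y
      ≤ ∫⁻ y, (ENNReal.ofReal ((sg 0 t)⁻¹) * ENNReal.ofReal (sg (τ y) t ^ (2 + 2)) +
          ENNReal.ofReal (sg 0 t) * h y ^ 2) := by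
        refine lintegral_mono fun y => ?_
        have hs := sg_nonneg (τ y) t
        rcases le_total (h y) (ENNReal.ofReal ((sg 0 t)⁻¹ * sg (τ y) t ^ 2)) with H | H
        · refine le_add_right ?_
          calc _ ≤ ENNReal.ofReal (sg (τ y) t ^ 2) * ENNReal.ofReal ((sg 0 t)⁻¹ * sg (τ y) t ^ 2) := by
                gcongr
            _ = _ := by
                rw [← ENNReal.ofReal_mul (by positivity), ← ENNReal.ofReal_mul (by positivity)]
                congr 1; ring
        · refine le_add_left ?_
          have : ENNReal.ofReal (sg (τ y) t ^ 2) =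
              ENNReal.ofReal (sg 0 t) * ENNReal.ofReal ((sg 0 t)⁻¹ * sg (τ y) t ^ 2) := by
            rw [← ENNReal.ofReal_mul (by positivity)]
            congr 1; field_simp
          rw [this, mul_assoc, sq (h y)]
          gcongr
    _ = ENNReal.ofReal ((sg 0 t)⁻¹) * ENNReal.ofReal (Jc (2 + 2) * sg 0 t ^ 2) +
          ENNReal.ofReal (sg 0 t) * ∫⁻ y, h y ^ 2 := by
        rw [lintegral_add_left (hm.const_mul _), lintegral_const_mul _ hm,
          lintegral_sg hτ 2 (by norm_num) ht, lintegral_const_mul' _ _ ENNReal.ofReal_ne_top]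
    _ = _ := by
        rw [mul_add, ← ENNReal.ofReal_mul (by positivity), ← ENNReal.ofReal_mul (by positivity)]
        congr 2
        field_simp

theorem measurePreserving_Rot_sub (θ : ℝ) (x : Plane) :
    MeasurePreserving (fun y => Rot θ x - y) volume volume :=
  volume.measurePreserving_sub_left (Rot θ x)

theorem measurePreserving_Rot_sub' (θ : ℝ) (y : Plane) :
    MeasurePreserving (fun x => Rot θ x - y) volume volume :=
  (measurePreserving_sub_right volume y).comp (rotE θ).measurePreserving

theorem lintegral_sg_zero_Ioc (T : ℝ) (hT : 0 ≤ T) :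
    ∫⁻ t in Ioc 0 T, ENNReal.ofReal (sg 0 t) = ENNReal.ofReal (2 * √T) := by
  have h : ∀ t ∈ Ioc 0 T, ENNReal.ofReal (sg 0 t) = ENNReal.ofReal (t ^ (-(1 / 2) : ℝ)) :=
    fun t ht => by
      have := sg_pow_eq 0 t 1 ht.1.le
      simp only [pow_one] at this
      rw [this]; simp
  rw [setLIntegral_congr_fun measurableSet_Ioc h, ← ofReal_integral_eq_lintegral_ofReal]
  · rw [← intervalIntegral.integral_of_le hT, integral_rpow (Or.inl (by norm_num)),
      Real.sqrt_eq_rpow]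
    congr 1
    norm_num
    ring
  · exact (intervalIntegrable_iff_integrableOn_Ioc_of_le hT).1
      (intervalIntegral.intervalIntegrable_rpow' (by norm_num))
  · filter_upwards [ae_restrict_mem measurableSet_Ioc] with t ht
    have := ht.1
    simp only [Pi.zero_apply]; positivity

theorem lintegral_lintegral_sg_le {τ : ℝ → Plane → Plane}
    (hτ : ∀ t, MeasurePreserving (τ t) volume volume) {T : ℝ} (hT : 0 ≤ T) (h : Plane → ℝ≥0∞) :
    ∫⁻ t in Ioc 0 T, ∫⁻ y, ENNReal.ofReal (sg (τ t y) t ^ 2) * h y ≤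
      ENNReal.ofReal (2 * √T) * (ENNReal.ofReal (Jc 4) + ∫⁻ y, h y ^ 2) := by
  rw [← lintegral_sg_zero_Ioc T hT, ← lintegral_mul_const _ (by fun_prop)]
  exact setLIntegral_mono (by fun_prop) fun t ht => lintegral_sg_sq_mul_le (hτ t) ht.1 h

theorem measurable_sg_Rot (α : ℝ) :
    Measurable fun q : (Plane × Plane) × ℝ =>
      ENNReal.ofReal (sg (Rot (α * q.2) q.1.1 - q.1.2) q.2 ^ 2) := by fun_prop

theorem measurable_Gsing (α : ℝ) : Measurable fun q : Plane × Plane => Gsing α q.1 q.2 :=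
  (measurable_sg_Rot α).lintegral_prod_right'

theorem measurable_Gbd (α : ℝ) : Measurable fun q : Plane × Plane => Gbd α q.1 q.2 := by
  unfold Gbd tailBd
  have := measurable_Gsing α
  fun_prop

theorem lintegral_Gsing_le (α : ℝ) (x : Plane) {h : Plane → ℝ≥0∞} (hm : AEMeasurable h) :
    ∫⁻ y, Gsing α x y * h y ≤ ENNReal.ofReal 2 * (ENNReal.ofReal (Jc 4) + ∫⁻ y, h y ^ 2) := by
  have h1 := lintegral_lintegral_sg_le (fun t => measurePreserving_Rot_sub (α * t) x) zero_le_one h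
  rw [Real.sqrt_one, mul_one] at h1
  refine le_trans (le_of_eq ?_) h1
  have e : ∀ y, Gsing α x y * h y =
      ∫⁻ t in Ioc (0 : ℝ) 1, ENNReal.ofReal (sg (Rot (α * t) x - y) t ^ 2) * h y := fun y => by
    rw [Gsing, lintegral_mul_const _ (by fun_prop)]
  simp_rw [e]
  refine lintegral_lintegral_swap ?_
  exact (Measurable.aemeasurable (by fun_prop)).mul hm.comp_fst

/-- The transposed estimate, integrated over x. Rotations also preserve the measure, so the same
argument applies; it is needed for testing the equation. -/
theorem lintegral_Gsing_le' (α : ℝ) (y : Plane) {h : Plane → ℝ≥0∞} (hm : AEMeasurable h) :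
    ∫⁻ x, Gsing α x y * h x ≤ ENNReal.ofReal 2 * (ENNReal.ofReal (Jc 4) + ∫⁻ y, h y ^ 2) := by
  have h1 := lintegral_lintegral_sg_le (fun t => measurePreserving_Rot_sub' (α * t) y) zero_le_one h
  rw [Real.sqrt_one, mul_one] at h1
  refine le_trans (le_of_eq ?_) h1
  have e : ∀ x, Gsing α x y * h x =
      ∫⁻ t in Ioc (0 : ℝ) 1, ENNReal.ofReal (sg (Rot (α * t) x - y) t ^ 2) * h x := fun x => by
    rw [Gsing, lintegral_mul_const _ (by fun_prop)]
  simp_rw [e]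
  refine lintegral_lintegral_swap ?_
  exact (Measurable.aemeasurable (by fun_prop)).mul hm.comp_fst

/-! ### The weight and the admissible densities -/

/-- The weight `1 + |x|^{1/2}`. -/
def wt (x : Plane) : ℝ≥0∞ := ENNReal.ofReal (1 + √‖x‖)

@[fun_prop] theorem measurable_wt : Measurable wt := by unfold wt; fun_prop

theorem wt_ne_top (x : Plane) : wt x ≠ ⊤ := ENNReal.ofReal_ne_top

theorem one_le_wt (x : Plane) : 1 ≤ wt x := by
  rw [wt, ENNReal.one_le_ofReal]; linarith [Real.sqrt_nonneg ‖x‖]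

/-- The constant in the bound for the tails. -/
def tailC (α : ℝ) : ℝ := 16 * CK * (1 / |α| + 1)

theorem tailC_nonneg (α : ℝ) : 0 ≤ tailC α := by have := CK_pos; unfold tailC; positivity

theorem ofReal_tailBd_le (α : ℝ) (x y : Plane) :
    ENNReal.ofReal (tailBd α x y) ≤ ENNReal.ofReal (tailC α) * (wt x * wt y) := by
  have hC := CK_pos
  rw [wt, wt, ← ENNReal.ofReal_mul (by positivity), ← ENNReal.ofReal_mul (tailC_nonneg α)]
  refine ENNReal.ofReal_le_ofReal ?_
  have h1 : √(‖x‖ + ‖y‖) ≤ √‖x‖ + √‖y‖ := by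
    refine Real.sqrt_le_iff.2 ⟨by positivity, ?_⟩
    nlinarith [Real.sq_sqrt (norm_nonneg x), Real.sq_sqrt (norm_nonneg y),
      Real.sqrt_nonneg ‖x‖, Real.sqrt_nonneg ‖y‖]
  have hx := Real.sqrt_nonneg ‖x‖
  have hy := Real.sqrt_nonneg ‖y‖
  have ha : 0 ≤ 1 / |α| := by positivity
  rw [tailBd, tailC, mul_assoc (16 * CK)]
  gcongr
  nlinarith [mul_nonneg hx hy, mul_nonneg ha hx, mul_nonneg ha hy, mul_nonneg ha (mul_nonneg hx hy)]

/-- Admissible densities: square integrable with a weighted `L¹` bound. -/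
structure Adm (h : Plane → Plane) : Prop where
  memLp : MemLp h 2 volume
  weighted : ∫⁻ y, wt y * ‖h y‖ₑ < ⊤

/-- The constant in the bound for the velocity generated by `h`. -/
def admC (α : ℝ) (h : Plane → Plane) : ℝ≥0∞ :=
  ENNReal.ofReal (2 * CK) * (ENNReal.ofReal 2 * (ENNReal.ofReal (Jc 4) + ∫⁻ y, ‖h y‖ₑ ^ 2)) +
    ENNReal.ofReal (tailC α) * ∫⁻ y, wt y * ‖h y‖ₑ

theorem lintegral_enorm_sq_lt_top {E : Type*} [NormedAddCommGroup E] {h : Plane → E} (hh : MemLp h 2 volume) :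
    ∫⁻ y, ‖h y‖ₑ ^ 2 < ⊤ := by
  have := (eLpNorm_lt_top_iff_lintegral_rpow_enorm_lt_top (by norm_num) (by norm_num)).1 hh.2
  simpa using this

theorem Adm.admC_lt_top {h : Plane → Plane} (hh : Adm h) (α : ℝ) : admC α h < ⊤ := by
  unfold admC
  have := lintegral_enorm_sq_lt_top hh.memLp
  have := hh.weighted
  finiteness

/-- The two conditions on an admissible density match the two parts of the kernel bound: square
integrability for the early times, the weighted L¹ bound for the tails. The growth in x is again
only the weight. -/
theorem lintegral_Gbd_le (α : ℝ) {h : Plane → Plane} (hh : AEStronglyMeasurable h volume)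
    (x : Plane) : ∫⁻ y, Gbd α x y * ‖h y‖ₑ ≤ wt x * admC α h := by
  have hm := hh.enorm
  have m1 : AEMeasurable (fun y => Gsing α x y * ‖h y‖ₑ) volume :=
    (((measurable_Gsing α).comp (measurable_const.prodMk measurable_id)).aemeasurable).mul hm
  calc ∫⁻ y, Gbd α x y * ‖h y‖ₑ
      ≤ ∫⁻ y, (ENNReal.ofReal (2 * CK) * (Gsing α x y * ‖h y‖ₑ) +
          ENNReal.ofReal (tailC α) * wt x * (wt y * ‖h y‖ₑ)) := by
        refine lintegral_mono fun y => ?_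
        rw [Gbd, add_mul, mul_assoc]
        refine add_le_add le_rfl ?_
        calc _ ≤ ENNReal.ofReal (tailC α) * (wt x * wt y) * ‖h y‖ₑ :=
              mul_le_mul' (ofReal_tailBd_le α x y) le_rfl
          _ = _ := by ring
    _ = ENNReal.ofReal (2 * CK) * (∫⁻ y, Gsing α x y * ‖h y‖ₑ) +
          ENNReal.ofReal (tailC α) * wt x * ∫⁻ y, wt y * ‖h y‖ₑ := by
        rw [lintegral_add_left' (m1.const_mul _), lintegral_const_mul'' _ m1,
          lintegral_const_mul' _ _ (ENNReal.mul_ne_top ENNReal.ofReal_ne_top (wt_ne_top x))]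
    _ ≤ wt x * (ENNReal.ofReal (2 * CK) * (ENNReal.ofReal 2 *
          (ENNReal.ofReal (Jc 4) + ∫⁻ y, ‖h y‖ₑ ^ 2))) +
          ENNReal.ofReal (tailC α) * wt x * ∫⁻ y, wt y * ‖h y‖ₑ := by
        refine add_le_add ?_ le_rfl
        exact le_trans (mul_le_mul' le_rfl (lintegral_Gsing_le α x hm))
          (le_mul_of_one_le_left' (one_le_wt x))
    _ = _ := by rw [admC]; ring

theorem lintegral_Gbd_le' (α : ℝ) {h : Plane → Plane} (hh : AEStronglyMeasurable h volume)
    (y : Plane) : ∫⁻ x, Gbd α x y * ‖h x‖ₑ ≤ wt y * admC α h := by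
  have hm := hh.enorm
  have m1 : AEMeasurable (fun x => Gsing α x y * ‖h x‖ₑ) volume :=
    (((measurable_Gsing α).comp (measurable_id.prodMk measurable_const)).aemeasurable).mul hm
  calc ∫⁻ x, Gbd α x y * ‖h x‖ₑ
      ≤ ∫⁻ x, (ENNReal.ofReal (2 * CK) * (Gsing α x y * ‖h x‖ₑ) +
          ENNReal.ofReal (tailC α) * wt y * (wt x * ‖h x‖ₑ)) := by
        refine lintegral_mono fun x => ?_
        rw [Gbd, add_mul, mul_assoc]
        refine add_le_add le_rfl ?_
        calc _ ≤ ENNReal.ofReal (tailC α) * (wt x * wt y) * ‖h x‖ₑ :=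
              mul_le_mul' (ofReal_tailBd_le α x y) le_rfl
          _ = _ := by ring
    _ = ENNReal.ofReal (2 * CK) * (∫⁻ x, Gsing α x y * ‖h x‖ₑ) +
          ENNReal.ofReal (tailC α) * wt y * ∫⁻ x, wt x * ‖h x‖ₑ := by
        rw [lintegral_add_left' (m1.const_mul _), lintegral_const_mul'' _ m1,
          lintegral_const_mul' _ _ (ENNReal.mul_ne_top ENNReal.ofReal_ne_top (wt_ne_top y))]
    _ ≤ wt y * (ENNReal.ofReal (2 * CK) * (ENNReal.ofReal 2 *
          (ENNReal.ofReal (Jc 4) + ∫⁻ y, ‖h y‖ₑ ^ 2))) +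
          ENNReal.ofReal (tailC α) * wt y * ∫⁻ y, wt y * ‖h y‖ₑ := by
        refine add_le_add ?_ le_rfl
        exact le_trans (mul_le_mul' le_rfl (lintegral_Gsing_le' α y hm))
          (le_mul_of_one_le_left' (one_le_wt y))
    _ = _ := by rw [admC]; ring

/-! ### The bilinear form of the fundamental solution -/

open scoped Classical in
/-- The bilinear form of the fundamental solution, set to zero on the diagonal. -/
def Gam (α : ℝ) (x y a b : Plane) : ℝ := if x = y then 0 else ⟪a, mulVec (fundSol α x y) b⟫

open scoped Classical in
/-- The truncated form, set to zero on the diagonal. -/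
def GamT (α T : ℝ) (x y a b : Plane) : ℝ := if x = y then 0 else AT α T x y a b

section measurability
variable {X : Type*} [MeasurableSpace X] {x y a b : X → Plane}

@[fun_prop] theorem Measurable.kap {t : X → ℝ} (α : ℝ) (hx : Measurable x) (hy : Measurable y)
    (ha : Measurable a) (hb : Measurable b) (ht : Measurable t) :
    Measurable fun ω => kap α (x ω) (y ω) (a ω) (b ω) (t ω) := by
  unfold RotStokes.kap; fun_prop

theorem Measurable.GamT (α : ℝ) {T : ℝ} (hT : 0 ≤ T) (hx : Measurable x) (hy : Measurable y)
    (ha : Measurable a) (hb : Measurable b) :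
    Measurable fun ω => GamT α T (x ω) (y ω) (a ω) (b ω) := by
  unfold RotStokes.GamT
  refine Measurable.ite (measurableSet_eq_fun hx hy) measurable_const ?_
  simp only [AT, intervalIntegral.integral_of_le hT]
  refine (StronglyMeasurable.integral_prod_right
    (f := fun ω t => RotStokes.kap α (x ω) (y ω) (a ω) (b ω) t) ?_).measurable
  refine Measurable.stronglyMeasurable ?_
  simp only [Function.uncurry_def]
  fun_prop

/-- Integer truncation times exhibit the kernel as a sequential limit of measurable functions.
Setting the diagonal to zero makes the limit hold everywhere and changes no integral, points being
null sets. -/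
theorem tendsto_GamT {α : ℝ} (hα : α ≠ 0) (x y a b : Plane) :
    Tendsto (fun n : ℕ => GamT α n x y a b) atTop (𝓝 (Gam α x y a b)) := by
  unfold GamT Gam
  split_ifs with h
  · exact tendsto_const_nhds
  · exact (tendsto_AT hα h a b).comp tendsto_natCast_atTop_atTop

theorem Measurable.Gam {α : ℝ} (hα : α ≠ 0) (hx : Measurable x) (hy : Measurable y)
    (ha : Measurable a) (hb : Measurable b) :
    Measurable fun ω => Gam α (x ω) (y ω) (a ω) (b ω) :=
  measurable_of_tendsto_metrizable
    (fun n : ℕ => Measurable.GamT α (Nat.cast_nonneg n) hx hy ha hb)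
    (tendsto_pi_nhds.2 fun _ => tendsto_GamT hα _ _ _ _)

end measurability

theorem enorm_GamT_le {α : ℝ} (hα : α ≠ 0) (x y a b : Plane) {T : ℝ} (hT : 1 ≤ T) :
    ‖GamT α T x y a b‖ₑ ≤ ‖a‖ₑ * ‖b‖ₑ * Gbd α x y := by
  unfold GamT
  split_ifs with h
  · simp
  · exact enorm_AT_le hα h a b hT

theorem enorm_Gam_le {α : ℝ} (hα : α ≠ 0) (x y a b : Plane) :
    ‖Gam α x y a b‖ₑ ≤ ‖a‖ₑ * ‖b‖ₑ * Gbd α x y := by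
  unfold Gam
  split_ifs with h
  · simp
  · exact enorm_inner_fundSol_le hα h a b

/-! ### The velocity generated by an admissible density -/

theorem ae_ne (x : Plane) : ∀ᵐ y ∂(volume : Measure Plane), x ≠ y := by
  have : ({x} : Set Plane)ᶜ ∈ ae (volume : Measure Plane) := compl_mem_ae_iff.2 (by simp)
  filter_upwards [this] with y hy h
  exact hy (by simp [h])

theorem Gam_of_ne (α : ℝ) {x y : Plane} (h : x ≠ y) (a b : Plane) :
    Gam α x y a b = ⟪a, mulVec (fundSol α x y) b⟫ := if_neg h

theorem GamT_of_ne (α T : ℝ) {x y : Plane} (h : x ≠ y) (a b : Plane) :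
    GamT α T x y a b = AT α T x y a b := if_neg h

theorem aestronglyMeasurable_Gam {α : ℝ} (hα : α ≠ 0) {h : Plane → Plane}
    (hh : AEStronglyMeasurable h volume) (x a : Plane) :
    AEStronglyMeasurable (fun y => Gam α x y a (h y)) volume := by
  refine ⟨fun y => Gam α x y a (hh.mk h y), Measurable.stronglyMeasurable ?_, ?_⟩
  · exact Measurable.Gam hα measurable_const measurable_id measurable_const
      hh.stronglyMeasurable_mk.measurable
  · filter_upwards [hh.ae_eq_mk] with y hy
    rw [hy]

theorem lintegral_enorm_Gam_le {α : ℝ} (hα : α ≠ 0) {h : Plane → Plane}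
    (hh : AEStronglyMeasurable h volume) (x a : Plane) :
    ∫⁻ y, ‖Gam α x y a (h y)‖ₑ ≤ ‖a‖ₑ * (wt x * admC α h) := by
  calc ∫⁻ y, ‖Gam α x y a (h y)‖ₑ ≤ ∫⁻ y, ‖a‖ₑ * (Gbd α x y * ‖h y‖ₑ) :=
        lintegral_mono fun y => (enorm_Gam_le hα x y a (h y)).trans (le_of_eq (by ring))
    _ = ‖a‖ₑ * ∫⁻ y, Gbd α x y * ‖h y‖ₑ := lintegral_const_mul' _ _ enorm_ne_top
    _ ≤ _ := mul_le_mul' le_rfl (lintegral_Gbd_le α hh x)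

theorem Adm.integrable_Gam {α : ℝ} (hα : α ≠ 0) {h : Plane → Plane} (hh : Adm h) (x a : Plane) :
    Integrable (fun y => Gam α x y a (h y)) :=
  ⟨aestronglyMeasurable_Gam hα hh.memLp.1 x a,
    (lintegral_enorm_Gam_le hα hh.memLp.1 x a).trans_lt (by
      have := hh.admC_lt_top α
      have := wt_ne_top x
      finiteness)⟩

/-- The velocity generated by the density `h`. -/
def vel (α : ℝ) (h : Plane → Plane) (x : Plane) : Plane := ∫ y, mulVec (fundSol α x y) (h y)

theorem integrable_of_inner {X : Type*} [MeasurableSpace X] {μ : Measure X} {v : X → Plane}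
    (h : ∀ i, Integrable (fun y => ⟪e i, v y⟫) μ) : Integrable v μ := by
  have : v = fun y => ∑ i, ⟪e i, v y⟫ • e i := by
    ext1 y; simp_rw [inner_e_left]; exact (sum_smul_e _).symm
  rw [this]
  exact integrable_finsetSum _ fun i _ => (h i).smul_const _

theorem Adm.integrable_mulVec {α : ℝ} (hα : α ≠ 0) {h : Plane → Plane} (hh : Adm h) (x : Plane) :
    Integrable (fun y => mulVec (fundSol α x y) (h y)) := by
  refine integrable_of_inner fun i => (hh.integrable_Gam hα x (e i)).congr ?_
  filter_upwards [ae_ne x] with y hy using Gam_of_ne α hy _ _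

theorem Adm.inner_vel {α : ℝ} (hα : α ≠ 0) {h : Plane → Plane} (hh : Adm h) (x a : Plane) :
    ⟪a, vel α h x⟫ = ∫ y, Gam α x y a (h y) := by
  rw [vel, ← integral_inner (hh.integrable_mulVec hα x)]
  refine integral_congr_ae ?_
  filter_upwards [ae_ne x] with y hy using (Gam_of_ne α hy _ _).symm

theorem Adm.enorm_vel_le {α : ℝ} (hα : α ≠ 0) {h : Plane → Plane} (hh : Adm h) (x : Plane) :
    ‖vel α h x‖ₑ ≤ wt x * admC α h := by
  -- Testing with the velocity itself gives a bound for its square, and one factor cancels.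
  have h1 : ‖⟪vel α h x, vel α h x⟫‖ₑ ≤ ‖vel α h x‖ₑ * (wt x * admC α h) := by
    rw [hh.inner_vel hα]
    exact (enorm_integral_le_lintegral_enorm _).trans (lintegral_enorm_Gam_le hα hh.memLp.1 x _)
  rw [real_inner_self_eq_norm_sq, enorm_pow, enorm_norm, sq] at h1
  rcases eq_or_ne (vel α h x) 0 with h0 | h0
  · simp [h0]
  · exact (ENNReal.mul_le_mul_iff_right (by simpa using h0) enorm_ne_top).1 h1

theorem Adm.measurable_vel {α : ℝ} (hα : α ≠ 0) {h : Plane → Plane} (hh : Adm h) :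
    Measurable (vel α h) := by
  have hc : ∀ i, Measurable fun x => ⟪e i, vel α h x⟫ := fun i => by
    have : (fun x => ⟪e i, vel α h x⟫) =
        fun x => ∫ y, Gam α x y (e i) (hh.memLp.1.mk h y) := by
      ext x
      rw [hh.inner_vel hα]
      refine integral_congr_ae ?_
      filter_upwards [hh.memLp.1.ae_eq_mk] with y hy
      rw [hy]
    rw [this]
    refine (StronglyMeasurable.integral_prod_right
      (f := fun x y => Gam α x y (e i) (hh.memLp.1.mk h y)) ?_).measurable
    refine Measurable.stronglyMeasurable ?_
    exact Measurable.Gam hα measurable_fst measurable_snd measurable_const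
      (hh.memLp.1.stronglyMeasurable_mk.measurable.comp measurable_snd)
  have : vel α h = fun x => ∑ i, ⟪e i, vel α h x⟫ • e i := by
    ext1 y; simp_rw [inner_e_left]; exact (sum_smul_e _).symm
  rw [this]
  exact Finset.measurable_sum _ fun i _ => (hc i).smul_const _

/-! #### Interchanging the time integral -/

theorem enorm_kap_le (α : ℝ) (x y a b : Plane) {t : ℝ} (ht : 0 < t) :
    ‖kap α x y a b t‖ₑ ≤ ENNReal.ofReal (2 * CK) * ‖a‖ₑ * ‖b‖ₑ *
      ENNReal.ofReal (sg (Rot (α * t) x - y) t ^ 2) := by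
  have hC := CK_pos
  rw [Real.enorm_eq_ofReal_abs, ← ofReal_norm, ← ofReal_norm, ← ENNReal.ofReal_mul (by positivity),
    ← ENNReal.ofReal_mul (by positivity), ← ENNReal.ofReal_mul (by positivity)]
  exact ENNReal.ofReal_le_ofReal ((abs_kap_le α x y a b ht).trans (le_of_eq (by ring)))

theorem aestronglyMeasurable_kap_left {h : Plane → Plane} (hh : AEStronglyMeasurable h volume)
    (α : ℝ) (x a : Plane) (μ : Measure ℝ) [SFinite μ] :
    AEStronglyMeasurable (fun q : ℝ × Plane => kap α x q.2 a (h q.2) q.1) (μ.prod volume) := by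
  refine ⟨fun q => kap α x q.2 a (hh.mk h q.2) q.1, Measurable.stronglyMeasurable ?_, ?_⟩
  · have : Measurable fun q : ℝ × Plane => hh.mk h q.2 :=
      hh.stronglyMeasurable_mk.measurable.comp measurable_snd
    exact Measurable.kap α measurable_const measurable_snd measurable_const this measurable_fst
  · have := (Measure.quasiMeasurePreserving_snd (μ := μ)
      (ν := (volume : Measure Plane))).ae hh.ae_eq_mk
    filter_upwards [this] with q hq
    rw [hq]

theorem aestronglyMeasurable_kap_right {h : Plane → Plane} (hh : AEStronglyMeasurable h volume)
    (α : ℝ) (y b : Plane) (μ : Measure ℝ) [SFinite μ] :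
    AEStronglyMeasurable (fun q : ℝ × Plane => kap α q.2 y (h q.2) b q.1) (μ.prod volume) := by
  refine ⟨fun q => kap α q.2 y (hh.mk h q.2) b q.1, Measurable.stronglyMeasurable ?_, ?_⟩
  · have : Measurable fun q : ℝ × Plane => hh.mk h q.2 :=
      hh.stronglyMeasurable_mk.measurable.comp measurable_snd
    exact Measurable.kap α measurable_snd measurable_const this measurable_const measurable_fst
  · have := (Measure.quasiMeasurePreserving_snd (μ := μ)
      (ν := (volume : Measure Plane))).ae hh.ae_eq_mk
    filter_upwards [this] with q hq
    rw [hq]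

/-- Up to a finite time T the kernel is absolutely integrable against L² densities, so Fubini's
theorem applies at finite T even though it fails for the full time integral. -/
theorem integrable_prod_of_sg {k : ℝ × Plane → ℝ} {h : Plane → Plane} {τ : ℝ → Plane → Plane}
    {T : ℝ} (hT : 0 ≤ T) (hτ : ∀ t, MeasurePreserving (τ t) volume volume)
    (hk : AEStronglyMeasurable k ((volume.restrict (Ioc 0 T)).prod volume)) {C : ℝ≥0∞} (hC : C ≠ ⊤)
    (hb : ∀ t, 0 < t → ∀ y, ‖k (t, y)‖ₑ ≤ C * (ENNReal.ofReal (sg (τ t y) t ^ 2) * ‖h y‖ₑ))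
    (hh : MemLp h 2 volume) :
    Integrable k ((volume.restrict (Ioc 0 T)).prod volume) := by
  refine ⟨hk, ?_⟩
  rw [HasFiniteIntegral, lintegral_prod _ hk.enorm]
  calc ∫⁻ t in Ioc 0 T, ∫⁻ y, ‖k (t, y)‖ₑ
      ≤ ∫⁻ t in Ioc 0 T, C * ∫⁻ y, ENNReal.ofReal (sg (τ t y) t ^ 2) * ‖h y‖ₑ := by
        refine lintegral_mono_ae ?_
        filter_upwards [ae_restrict_mem measurableSet_Ioc] with t ht
        rw [← lintegral_const_mul' _ _ hC]
        exact lintegral_mono fun y => hb t ht.1 y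
    _ = C * ∫⁻ t in Ioc 0 T, ∫⁻ y, ENNReal.ofReal (sg (τ t y) t ^ 2) * ‖h y‖ₑ :=
        lintegral_const_mul' _ _ hC
    _ ≤ C * _ := mul_le_mul' le_rfl (lintegral_lintegral_sg_le hτ hT _)
    _ < ⊤ := by
        have := lintegral_enorm_sq_lt_top hh
        finiteness

theorem integrable_kap_left {h : Plane → Plane} (hh : MemLp h 2 volume) (α : ℝ) (x a : Plane)
    {T : ℝ} (hT : 0 ≤ T) :
    Integrable (fun q : ℝ × Plane => kap α x q.2 a (h q.2) q.1)
      ((volume.restrict (Ioc 0 T)).prod volume) :=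
  integrable_prod_of_sg hT (fun t => measurePreserving_Rot_sub (α * t) x)
    (aestronglyMeasurable_kap_left hh.1 α x a _)
    (C := ENNReal.ofReal (2 * CK) * ‖a‖ₑ) (by finiteness)
    (fun t ht y => (enorm_kap_le α x y a (h y) ht).trans (le_of_eq (by ring))) hh

theorem integrable_kap_right {h : Plane → Plane} (hh : MemLp h 2 volume) (α : ℝ) (y b : Plane)
    {T : ℝ} (hT : 0 ≤ T) :
    Integrable (fun q : ℝ × Plane => kap α q.2 y (h q.2) b q.1)
      ((volume.restrict (Ioc 0 T)).prod volume) :=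
  integrable_prod_of_sg hT (fun t => measurePreserving_Rot_sub' (α * t) y)
    (aestronglyMeasurable_kap_right hh.1 α y b _)
    (C := ENNReal.ofReal (2 * CK) * ‖b‖ₑ) (by finiteness)
    (fun t ht x => (enorm_kap_le α x y (h x) b ht).trans (le_of_eq (by ring))) hh

theorem integral_GamT_left {h : Plane → Plane} (hh : MemLp h 2 volume) (α : ℝ) (x a : Plane)
    {T : ℝ} (hT : 0 ≤ T) :
    ∫ y, GamT α T x y a (h y) = ∫ t in Ioc 0 T, ∫ y, kap α x y a (h y) t := by
  rw [integral_integral_swap (f := fun t y => kap α x y a (h y) t)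
    (integrable_kap_left hh α x a hT)]
  refine integral_congr_ae ?_
  filter_upwards [ae_ne x] with y hy
  rw [GamT_of_ne α T hy, AT, intervalIntegral.integral_of_le hT]

theorem integral_GamT_right {h : Plane → Plane} (hh : MemLp h 2 volume) (α : ℝ) (y b : Plane)
    {T : ℝ} (hT : 0 ≤ T) :
    ∫ x, GamT α T x y (h x) b = ∫ t in Ioc 0 T, ∫ x, kap α x y (h x) b t := by
  rw [integral_integral_swap (f := fun t x => kap α x y (h x) b t)
    (integrable_kap_right hh α y b hT)]
  refine integral_congr_ae ?_
  filter_upwards [ae_ne y] with x hx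
  rw [GamT_of_ne α T hx.symm, AT, intervalIntegral.integral_of_le hT]

theorem aestronglyMeasurable_GamT_left {h : Plane → Plane} (hh : AEStronglyMeasurable h volume)
    (α : ℝ) (x a : Plane) {T : ℝ} (hT : 0 ≤ T) :
    AEStronglyMeasurable (fun y => GamT α T x y a (h y)) volume := by
  refine ⟨fun y => GamT α T x y a (hh.mk h y), Measurable.stronglyMeasurable ?_, ?_⟩
  · exact Measurable.GamT α hT measurable_const measurable_id measurable_const
      hh.stronglyMeasurable_mk.measurable
  · filter_upwards [hh.ae_eq_mk] with y hy
    rw [hy]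

theorem aestronglyMeasurable_GamT_right {h : Plane → Plane} (hh : AEStronglyMeasurable h volume)
    (α : ℝ) (y b : Plane) {T : ℝ} (hT : 0 ≤ T) :
    AEStronglyMeasurable (fun x => GamT α T x y (h x) b) volume := by
  refine ⟨fun x => GamT α T x y (hh.mk h x) b, Measurable.stronglyMeasurable ?_, ?_⟩
  · exact Measurable.GamT α hT measurable_id measurable_const
      hh.stronglyMeasurable_mk.measurable measurable_const
  · filter_upwards [hh.ae_eq_mk] with y hy
    rw [hy]

theorem tendsto_integral_of_enorm_le {X : Type*} [MeasurableSpace X] {μ : Measure X}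
    {F : ℕ → X → ℝ} {f : X → ℝ} {B : X → ℝ≥0∞} (hF : ∀ᶠ n in atTop, AEStronglyMeasurable (F n) μ)
    (hB : ∀ᶠ n in atTop, ∀ᵐ x ∂μ, ‖F n x‖ₑ ≤ B x) (hBi : ∫⁻ x, B x ∂μ < ⊤)
    (hBm : AEMeasurable B μ)
    (hl : ∀ᵐ x ∂μ, Tendsto (fun n => F n x) atTop (𝓝 (f x))) :
    Tendsto (fun n => ∫ x, F n x ∂μ) atTop (𝓝 (∫ x, f x ∂μ)) := by
  have hfin : ∀ᵐ x ∂μ, B x < ⊤ := ae_lt_top' hBm hBi.ne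
  refine tendsto_integral_filter_of_dominated_convergence (fun x => (B x).toReal) hF ?_
    (integrable_toReal_of_lintegral_ne_top hBm hBi.ne) hl
  filter_upwards [hB] with n hn
  filter_upwards [hn, hfin] with x hx hx'
  rw [← toReal_enorm]
  exact ENNReal.toReal_mono hx'.ne hx

theorem aemeasurable_Gbd_left (α : ℝ) (x : Plane) {h : Plane → Plane}
    (hh : AEStronglyMeasurable h volume) : AEMeasurable (fun y => Gbd α x y * ‖h y‖ₑ) volume :=
  ((measurable_Gbd α).comp (measurable_const.prodMk measurable_id)).aemeasurable.mul hh.enorm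

theorem aemeasurable_Gbd_right (α : ℝ) (y : Plane) {h : Plane → Plane}
    (hh : AEStronglyMeasurable h volume) : AEMeasurable (fun x => Gbd α x y * ‖h x‖ₑ) volume :=
  ((measurable_Gbd α).comp (measurable_id.prodMk measurable_const)).aemeasurable.mul hh.enorm

/-- Space is integrated first at every fixed time and the conditionally convergent time integral is
taken last. The T-independent kernel bound justifies the exchange. -/
theorem Adm.tendsto_left {α : ℝ} (hα : α ≠ 0) {h : Plane → Plane} (hh : Adm h) (x a : Plane) :
    Tendsto (fun n : ℕ => ∫ t in Ioc (0 : ℝ) n, ∫ y, kap α x y a (h y) t) atTop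
      (𝓝 ⟪a, vel α h x⟫) := by
  rw [hh.inner_vel hα]
  simp_rw [← integral_GamT_left hh.memLp α x a (Nat.cast_nonneg _)]
  refine tendsto_integral_of_enorm_le (B := fun y => ‖a‖ₑ * (Gbd α x y * ‖h y‖ₑ)) ?_ ?_ ?_ ?_ ?_
  · exact Eventually.of_forall fun n =>
      aestronglyMeasurable_GamT_left hh.memLp.1 α x a (Nat.cast_nonneg n)
  · filter_upwards [eventually_ge_atTop 1] with n hn
    exact Eventually.of_forall fun y =>
      (enorm_GamT_le hα x y a (h y) (by exact_mod_cast hn)).trans (le_of_eq (by ring))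
  · rw [lintegral_const_mul' _ _ enorm_ne_top]
    refine (mul_le_mul' le_rfl (lintegral_Gbd_le α hh.memLp.1 x)).trans_lt ?_
    have := hh.admC_lt_top α
    have := wt_ne_top x
    finiteness
  · exact (aemeasurable_Gbd_left α x hh.memLp.1).const_mul _
  · exact Eventually.of_forall fun y => tendsto_GamT hα x y a (h y)

theorem Adm.tendsto_right {α : ℝ} (hα : α ≠ 0) {h : Plane → Plane} (hh : Adm h) (y b : Plane) :
    Tendsto (fun n : ℕ => ∫ t in Ioc (0 : ℝ) n, ∫ x, kap α x y (h x) b t) atTop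
      (𝓝 (∫ x, Gam α x y (h x) b)) := by
  simp_rw [← integral_GamT_right hh.memLp α y b (Nat.cast_nonneg _)]
  refine tendsto_integral_of_enorm_le (B := fun x => ‖b‖ₑ * (Gbd α x y * ‖h x‖ₑ)) ?_ ?_ ?_ ?_ ?_
  · exact Eventually.of_forall fun n =>
      aestronglyMeasurable_GamT_right hh.memLp.1 α y b (Nat.cast_nonneg n)
  · filter_upwards [eventually_ge_atTop 1] with n hn
    exact Eventually.of_forall fun x =>
      (enorm_GamT_le hα x y (h x) b (by exact_mod_cast hn)).trans (le_of_eq (by ring))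
  · rw [lintegral_const_mul' _ _ enorm_ne_top]
    refine (mul_le_mul' le_rfl (lintegral_Gbd_le' α hh.memLp.1 y)).trans_lt ?_
    have := hh.admC_lt_top α
    have := wt_ne_top y
    finiteness
  · exact (aemeasurable_Gbd_right α y hh.memLp.1).const_mul _
  · exact Eventually.of_forall fun x => tendsto_GamT hα x y (h x) b

/-- Admissibility of both densities makes the double integral absolute, because the kernel bound
factors through the product of the two weights. -/
theorem Adm.integral_inner_vel {α : ℝ} (hα : α ≠ 0) {h ψ : Plane → Plane} (hh : Adm h)
    (hψ : Adm ψ) :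
    ∫ x, ⟪vel α h x, ψ x⟫ = ∫ y, ∫ x, Gam α x y (ψ x) (h y) := by
  have e : ∀ x, ⟪vel α h x, ψ x⟫ = ∫ y, Gam α x y (ψ x) (h y) := fun x => by
    rw [real_inner_comm, hh.inner_vel hα]
  simp_rw [e]
  refine integral_integral_swap (f := fun x y => Gam α x y (ψ x) (h y)) ?_
  have hm : AEStronglyMeasurable (Function.uncurry fun x y => Gam α x y (ψ x) (h y))
      ((volume : Measure Plane).prod volume) := by
    refine ⟨fun q => Gam α q.1 q.2 (hψ.memLp.1.mk ψ q.1) (hh.memLp.1.mk h q.2),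
      Measurable.stronglyMeasurable ?_, ?_⟩
    · exact Measurable.Gam hα measurable_fst measurable_snd
        (hψ.memLp.1.stronglyMeasurable_mk.measurable.comp measurable_fst)
        (hh.memLp.1.stronglyMeasurable_mk.measurable.comp measurable_snd)
    · filter_upwards [(Measure.quasiMeasurePreserving_fst (μ := (volume : Measure Plane))
        (ν := (volume : Measure Plane))).ae hψ.memLp.1.ae_eq_mk,
        (Measure.quasiMeasurePreserving_snd (μ := (volume : Measure Plane))
        (ν := (volume : Measure Plane))).ae hh.memLp.1.ae_eq_mk] with q h1 h2
      rw [Function.uncurry, h1, h2]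
  refine ⟨hm, ?_⟩
  rw [HasFiniteIntegral, lintegral_prod _ hm.enorm]
  simp only [Function.uncurry]
  calc ∫⁻ x, ∫⁻ y, ‖Gam α x y (ψ x) (h y)‖ₑ ≤ ∫⁻ x, admC α h * (wt x * ‖ψ x‖ₑ) :=
        lintegral_mono fun x => (lintegral_enorm_Gam_le hα hh.memLp.1 x (ψ x)).trans
          (le_of_eq (by ring))
    _ = admC α h * ∫⁻ x, wt x * ‖ψ x‖ₑ := lintegral_const_mul' _ _ (hh.admC_lt_top α).ne
    _ < ⊤ := ENNReal.mul_lt_top (hh.admC_lt_top α) hψ.weighted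

/-! ### Gaussian regularization -/

/-- The density `e^{-ε|y|²} f(y)`. -/
def reg (ε : ℝ) (f : Plane → Plane) (y : Plane) : Plane := Real.exp (-(ε * ‖y‖ ^ 2)) • f y

theorem mulVec_smul (M : Mat) (c : ℝ) (v : Plane) : mulVec M (c • v) = c • mulVec M v := by
  ext i; fin_cases i <;> simp [mulVec, Matrix.mulVec_smul]

theorem solIntegrand_eq (α : ℝ) (f : Plane → Plane) (x : Plane) (ε : ℝ) :
    solIntegrand α f x ε = fun y => mulVec (fundSol α x y) (reg ε f y) := by
  ext1 y; rw [solIntegrand, reg, mulVec_smul]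

theorem exp_reg_le_one {ε : ℝ} (hε : 0 ≤ ε) (y : Plane) : Real.exp (-(ε * ‖y‖ ^ 2)) ≤ 1 := by
  rw [Real.exp_le_one_iff]; have : 0 ≤ ε * ‖y‖ ^ 2 := by positivity
  linarith

theorem norm_reg_le {ε : ℝ} (hε : 0 ≤ ε) (f : Plane → Plane) (y : Plane) :
    ‖reg ε f y‖ ≤ ‖f y‖ := by
  rw [reg, norm_smul, Real.norm_of_nonneg (Real.exp_pos _).le]
  exact mul_le_of_le_one_left (norm_nonneg _) (exp_reg_le_one hε y)

theorem memLp_reg {ε : ℝ} (hε : 0 ≤ ε) {f : Plane → Plane} (hf : MemLp f 2 volume) :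
    MemLp (reg ε f) 2 volume :=
  hf.mono ((show Continuous fun y : Plane => Real.exp (-(ε * ‖y‖ ^ 2)) by
    fun_prop).aestronglyMeasurable.smul hf.1) (Eventually.of_forall fun y => norm_reg_le hε f y)

/-- Gaussians decay faster than any power of the weight. -/
theorem exists_exp_le {ε : ℝ} (hε : 0 < ε) :
    ∃ C, 0 ≤ C ∧ ∀ y : Plane, Real.exp (-(ε * ‖y‖ ^ 2)) ≤ C * sg y 1 ^ 6 := by
  refine ⟨Real.exp ε * (6 / ε ^ 3), by positivity, fun y => ?_⟩
  have h1 := Real.pow_div_factorial_le_exp (ε * (1 + ‖y‖ ^ 2)) (by positivity) 3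
  have h2 : sg y 1 ^ 6 = ((1 + ‖y‖ ^ 2) ^ 3)⁻¹ := by
    rw [show sg y 1 ^ 6 = (sg y 1 ^ 2) ^ 3 by ring, sg_sq y zero_le_one, inv_pow]
  have h3 : Real.exp (-(ε * ‖y‖ ^ 2)) = Real.exp ε * (Real.exp (ε * (1 + ‖y‖ ^ 2)))⁻¹ := by
    rw [← Real.exp_neg, ← Real.exp_add]; congr 1; ring
  rw [h2, h3, mul_assoc]
  gcongr
  rw [inv_le_comm₀ (Real.exp_pos _) (by positivity)]
  refine le_trans (le_of_eq ?_) h1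
  rw [mul_inv, inv_inv, inv_div, mul_pow]
  norm_num [Nat.factorial]
  ring

theorem wt_sq_le (y : Plane) : wt y ^ 2 ≤ ENNReal.ofReal (4 * (1 + ‖y‖ ^ 2)) := by
  rw [wt, ← ENNReal.ofReal_pow (by positivity)]
  refine ENNReal.ofReal_le_ofReal ?_
  have h := Real.sq_sqrt (norm_nonneg y)
  have h0 := Real.sqrt_nonneg ‖y‖
  nlinarith [sq_nonneg (√‖y‖ - 1), sq_nonneg (‖y‖ - 1)]

theorem mul_le_sq_add_sq (a b : ℝ≥0∞) : a * b ≤ a ^ 2 + b ^ 2 := by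
  rcases le_total a b with h | h
  · exact le_add_left (by rw [sq b]; gcongr)
  · exact le_add_right (by rw [sq a]; gcongr)

/-- The product of weight, Gaussian and |f| is bounded by the square of weight times Gaussian, which
is integrable, plus |f|². -/
theorem adm_reg {ε : ℝ} (hε : 0 < ε) {f : Plane → Plane} (hf : MemLp f 2 volume) :
    Adm (reg ε f) := by
  refine ⟨memLp_reg hε.le hf, ?_⟩
  obtain ⟨C, hC, h⟩ := exists_exp_le hε
  have hb : ∀ y, wt y * ‖reg ε f y‖ₑ ≤
      ENNReal.ofReal (4 * C) * ENNReal.ofReal (sg y 1 ^ 4) + ‖f y‖ₑ ^ 2 := fun y => by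
    have hr : ‖reg ε f y‖ₑ = ENNReal.ofReal (Real.exp (-(ε * ‖y‖ ^ 2))) * ‖f y‖ₑ := by
      rw [reg, enorm_smul, Real.enorm_eq_ofReal (Real.exp_pos _).le]
    rw [hr, ← mul_assoc]
    refine (mul_le_sq_add_sq _ _).trans (add_le_add ?_ le_rfl)
    rw [mul_pow]
    refine (mul_le_mul' (wt_sq_le y) le_rfl).trans ?_
    rw [← ENNReal.ofReal_pow (Real.exp_pos _).le, ← ENNReal.ofReal_mul (by positivity),
      ← ENNReal.ofReal_mul (by positivity)]
    refine ENNReal.ofReal_le_ofReal ?_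
    have h1 : Real.exp (-(ε * ‖y‖ ^ 2)) ^ 2 ≤ Real.exp (-(ε * ‖y‖ ^ 2)) := by
      rw [sq]; exact mul_le_of_le_one_left (Real.exp_pos _).le (exp_reg_le_one hε.le y)
    have h2 := sg_sq y zero_le_one
    have h3 : 0 < 1 + ‖y‖ ^ 2 := by positivity
    calc 4 * (1 + ‖y‖ ^ 2) * Real.exp (-(ε * ‖y‖ ^ 2)) ^ 2
        ≤ 4 * (1 + ‖y‖ ^ 2) * (C * sg y 1 ^ 6) := by gcongr; exact h1.trans (h y)
      _ = 4 * C * sg y 1 ^ 4 * ((1 + ‖y‖ ^ 2) * sg y 1 ^ 2) := by ring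
      _ = _ := by rw [h2, mul_inv_cancel₀ h3.ne', mul_one]
  refine (lintegral_mono hb).trans_lt ?_
  have h4 : ∫⁻ y, ENNReal.ofReal (sg y 1 ^ 4) ≠ ⊤ := by
    have := lintegral_sg (MeasurePreserving.id volume) 2 (by norm_num) one_pos
    simp only [id] at this
    rw [this]; simp
  have h5 := lintegral_enorm_sq_lt_top hf
  rw [lintegral_add_left (by fun_prop), lintegral_const_mul _ (by fun_prop)]
  finiteness

theorem adm_of_support {R : ℝ} {f : Plane → Plane} (hf : MemLp f 2 volume)
    (h0 : ∀ᵐ y ∂(volume : Measure Plane), R ≤ ‖y‖ → f y = 0) : Adm f := by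
  refine ⟨hf, ?_⟩
  have hb : ∀ᵐ y ∂(volume : Measure Plane), wt y * ‖f y‖ₑ ≤
      (Metric.ball (0 : Plane) R).indicator (fun _ => ENNReal.ofReal (4 * (1 + R ^ 2))) y +
        ‖f y‖ₑ ^ 2 := by
    filter_upwards [h0] with y hy
    by_cases hR : R ≤ ‖y‖
    · simp [hy hR]
    · push Not at hR
      rw [indicator_of_mem (by simpa using hR)]
      refine (mul_le_sq_add_sq _ _).trans (add_le_add ((wt_sq_le y).trans ?_) le_rfl)
      exact ENNReal.ofReal_le_ofReal (by gcongr)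
  refine (lintegral_mono_ae hb).trans_lt ?_
  rw [lintegral_add_left (measurable_const.indicator Metric.isOpen_ball.measurableSet),
    lintegral_indicator Metric.isOpen_ball.measurableSet]
  have := lintegral_enorm_sq_lt_top hf
  have : volume (Metric.ball (0 : Plane) R) < ⊤ := measure_ball_lt_top
  simp only [lintegral_const, Measure.restrict_apply_univ]
  finiteness

theorem tendsto_exp_reg (y : Plane) :
    Tendsto (fun ε : ℝ => Real.exp (-(ε * ‖y‖ ^ 2))) (𝓝[>] 0) (𝓝 1) := by
  have : Continuous fun ε : ℝ => Real.exp (-(ε * ‖y‖ ^ 2)) := by fun_prop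
  simpa using (this.tendsto 0).mono_left nhdsWithin_le_nhds

theorem tendsto_integral_reg {E : Type*} [NormedAddCommGroup E] [NormedSpace ℝ E]
    {μ : Measure Plane} {g : Plane → E} (hg : Integrable g μ) :
    Tendsto (fun ε : ℝ => ∫ y, Real.exp (-(ε * ‖y‖ ^ 2)) • g y ∂μ) (𝓝[>] 0) (𝓝 (∫ y, g y ∂μ)) := by
  refine tendsto_integral_filter_of_dominated_convergence (fun y => ‖g y‖) ?_ ?_ hg.norm ?_
  · exact Eventually.of_forall fun ε => (Continuous.aestronglyMeasurable (by fun_prop)).smul hg.1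
  · filter_upwards [self_mem_nhdsWithin] with ε hε
    refine Eventually.of_forall fun y => ?_
    rw [norm_smul, Real.norm_of_nonneg (Real.exp_pos _).le]
    exact mul_le_of_le_one_left (norm_nonneg _) (exp_reg_le_one (le_of_lt hε) y)
  · exact Eventually.of_forall fun y => by simpa using (tendsto_exp_reg y).smul_const (g y)

theorem Adm.tendsto_vel {α : ℝ} (hα : α ≠ 0) {f : Plane → Plane} (hf : Adm f) (x : Plane) :
    Tendsto (fun ε => vel α (reg ε f) x) (𝓝[>] 0) (𝓝 (vel α f x)) := by
  simp only [vel, reg, mulVec_smul]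
  exact tendsto_integral_reg (hf.integrable_mulVec hα x)

/-- The Gaussian factor is moved from the kernel onto the density. Absolute convergence for each ε
then follows from square integrability, and only the limit of the regularised velocities remains to
be found. -/
theorem LConverges_of_tendsto {α : ℝ} (hα : α ≠ 0) {f v : Plane → Plane} (hf : MemLp f 2 volume)
    (hv : ∀ x, Tendsto (fun ε => vel α (reg ε f) x) (𝓝[>] 0) (𝓝 (v x))) :
    LConverges α f ∧ L α f = v := by
  have h1 : L α f = v := by
    ext1 x
    refine Tendsto.limUnder_eq ?_
    simp only [solIntegrand_eq]
    exact hv x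
  refine ⟨fun x => ⟨fun ε hε => ?_, ?_⟩, h1⟩
  · rw [solIntegrand_eq]
    exact (adm_reg hε hf).integrable_mulVec hα x
  · rw [h1]
    simp only [solIntegrand_eq]
    exact hv x

/-! ### The leading term -/

theorem tendsto_integral_Ioi_zero {f : ℝ → ℝ} (hf : IntegrableOn f (Ioi 0)) :
    Tendsto (fun t₀ => ∫ t in Ioi t₀, f t) (𝓝[>] 0) (𝓝 (∫ t in Ioi 0, f t)) := by
  have h := (aecover_Ioi_of_Ioi (μ := volume) (A := (0 : ℝ)) (l := 𝓝[>] (0 : ℝ)) (a := fun t => t)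
    (tendsto_id.mono_left nhdsWithin_le_nhds)).integral_tendsto_of_countably_generated hf
  refine h.congr' ?_
  filter_upwards [self_mem_nhdsWithin] with t ht
  rw [Measure.restrict_restrict measurableSet_Ioi, inter_eq_left.2 (Ioi_subset_Ioi (le_of_lt ht))]

/-- Integration by parts is available only on intervals away from t = 0; a bound uniform in both
endpoints passes to the full half line. -/
theorem abs_integral_Ioi_le {f : ℝ → ℝ} {C : ℝ} (hf : IntegrableOn f (Ioi 0))
    (h : ∀ t₀ T, 0 < t₀ → t₀ ≤ T → |∫ t in t₀..T, f t| ≤ C) : |∫ t in Ioi 0, f t| ≤ C := by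
  refine le_of_tendsto (tendsto_integral_Ioi_zero hf).abs ?_
  filter_upwards [self_mem_nhdsWithin] with t₀ ht₀
  refine le_of_tendsto (intervalIntegral_tendsto_integral_Ioi t₀
    (hf.mono_set (Ioi_subset_Ioi (le_of_lt ht₀))) tendsto_id).abs ?_
  filter_upwards [eventually_ge_atTop t₀] with T hT using h t₀ T ht₀ hT

theorem abs_integral_Ioc_le {f : ℝ → ℝ} {C T : ℝ} (hC : 0 ≤ C) (hT : 0 ≤ T)
    (hf : IntegrableOn f (Ioc 0 T))
    (h : ∀ t₀, 0 < t₀ → t₀ ≤ T → |∫ t in t₀..T, f t| ≤ C) : |∫ t in Ioc 0 T, f t| ≤ C := by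
  rcases hT.eq_or_lt with rfl | hT'
  · simpa using hC
  have hi : IntegrableOn ((Iic T).indicator f) (Ioi 0) := by
    rw [IntegrableOn, integrable_indicator_iff measurableSet_Iic, IntegrableOn,
      Measure.restrict_restrict measurableSet_Iic, inter_comm, Ioi_inter_Iic]
    exact hf
  have hl := tendsto_integral_Ioi_zero hi
  simp only [setIntegral_indicator measurableSet_Iic, Ioi_inter_Iic] at hl
  refine le_of_tendsto hl.abs ?_
  filter_upwards [Ioc_mem_nhdsGT hT'] with t₀ ht₀
  rw [← intervalIntegral.integral_of_le ht₀.2]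
  exact h t₀ ht₀.1 ht₀.2

/-- The function exp(-|x|²/(4t))/(4π|x|²) is an antiderivative, with limits 0 at t = 0 and
1/(4π|x|²) at infinity. This is the source of the normalisation of the circular flow. -/
theorem integral_gauss_div {x : Plane} (hx : x ≠ 0) :
    IntegrableOn (fun t => gauss x t / (4 * t)) (Ioi 0) ∧
      ∫ t in Ioi 0, gauss x t / (4 * t) = 1 / (4 * Real.pi * ‖x‖ ^ 2) := by
  have hr : 0 < ‖x‖ := norm_pos_iff.2 hx
  have hpi := Real.pi_pos
  have hi : IntegrableOn (fun t => gauss x t / (4 * t)) (Ioi 0) := by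
    have h := (integrableOn_sg_pow x 1 le_rfl (by positivity)).1
    refine (h.const_mul CK).mono' (Measurable.aestronglyMeasurable (by fun_prop)) ?_
    filter_upwards [ae_restrict_mem measurableSet_Ioi] with t ht
    have ht : 0 < t := ht
    have h1 := norm_pow_mul_gauss_le x ht (a := 0) (k := 1) (n := 4) (by norm_num) (by norm_num)
    have h2 := gauss_nonneg x ht.le
    have h3 := sg_pos x ht
    have hC := CK_pos
    rw [Real.norm_of_nonneg (by positivity)]
    have e : gauss x t / (4 * t) = ‖x‖ ^ 0 * gauss x t / t ^ 1 / 4 := by simp; field_simp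
    rw [e]
    have h4 : 0 ≤ CK * sg x t ^ (1 + 3) := by positivity
    norm_num at h1 h4 ⊢
    linarith
  refine ⟨hi, ?_⟩
  set P : ℝ → ℝ := fun t => 1 / (4 * Real.pi * ‖x‖ ^ 2) * Real.exp (-(‖x‖ ^ 2) / (4 * t)) with hP
  have hd : ∀ t, 0 < t → HasDerivAt P (gauss x t / (4 * t)) t := fun t ht => by
    have h2 : HasDerivAt (fun s : ℝ => 4 * s) 4 t := by simpa using (hasDerivAt_id t).const_mul 4
    have h := ((((hasDerivAt_const t (-‖x‖ ^ 2)).div h2 (by positivity)).exp).const_mul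
      (1 / (4 * Real.pi * ‖x‖ ^ 2)))
    refine h.congr_deriv ?_
    simp [gauss]; field_simp
  have hl : Tendsto P atTop (𝓝 (1 / (4 * Real.pi * ‖x‖ ^ 2))) := by
    have h1 : Tendsto (fun t : ℝ => -(‖x‖ ^ 2) / (4 * t)) atTop (𝓝 0) :=
      Tendsto.div_atTop tendsto_const_nhds (tendsto_id.const_mul_atTop (by norm_num))
    have h2 := (Real.continuous_exp.tendsto 0).comp h1
    have := h2.const_mul (1 / (4 * Real.pi * ‖x‖ ^ 2))
    rw [Real.exp_zero, mul_one] at this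
    exact this
  have hl0 : Tendsto P (𝓝[>] 0) (𝓝 0) := by
    have h1 : Tendsto (fun t : ℝ => -(‖x‖ ^ 2) / (4 * t)) (𝓝[>] 0) atBot := by
      have : (fun t : ℝ => -(‖x‖ ^ 2) / (4 * t)) = fun t => -(‖x‖ ^ 2 / 4) * t⁻¹ := by
        ext t; rw [div_eq_mul_inv, mul_inv]; ring
      rw [this]
      exact tendsto_inv_nhdsGT_zero.const_mul_atTop_of_neg (by
        have : 0 < ‖x‖ ^ 2 / 4 := by positivity
        linarith)
    have := (Real.tendsto_exp_atBot.comp h1).const_mul (1 / (4 * Real.pi * ‖x‖ ^ 2))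
    rw [mul_zero] at this
    exact this
  refine tendsto_nhds_unique (tendsto_integral_Ioi_zero hi) ?_
  have h3 := hl0.const_sub (1 / (4 * Real.pi * ‖x‖ ^ 2))
  rw [sub_zero] at h3
  refine h3.congr' ?_
  filter_upwards [self_mem_nhdsWithin] with t ht
  have ht : 0 < t := ht
  exact (integral_Ioi_of_hasDerivAt_of_tendsto' (fun s hs => hd s (ht.trans_le hs))
    (hi.mono_set (Ioi_subset_Ioi ht.le)) hl).symm

/-- The symmetric part of q⊗b + q^⊥⊗b^⊥ is (q·b) times the identity, so the two third derivatives
add up to (q·b) times the Laplacian of the derivative along a, which is a time derivative by the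
heat equation. -/
theorem d3_add_d3 (q a b z : Plane) {s : ℝ} (hs : s ≠ 0) :
    d3 q a b z s + d3 (perp q) a (perp b) z s = ⟪q, b⟫ * dt1 a z s := by
  simp only [d3, dt1, inner_eq, norm_sq_eq, perp_apply_zero, perp_apply_one]
  field_simp
  ring

theorem integral_dt1 (a z : Plane) {t : ℝ} (ht : 0 < t) :
    IntegrableOn (dt1 a z) (Ioi t) ∧ ∫ s in Ioi t, dt1 a z s = -d1 a z t := by
  have hi := (integrableOn_of_le_sg (f := dt1 a z) (z := z) (n := 2) (by unfold dt1; fun_prop) ht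
    (fun s hs => abs_dt1_le a z (ht.trans hs))).1
  refine ⟨hi, ?_⟩
  have hl : Tendsto (d1 a z) atTop (𝓝 0) := by
    refine squeeze_zero_norm' (a := fun s => CK * ‖a‖ * sg z s ^ 3) ?_ ?_
    · filter_upwards [eventually_gt_atTop 0] with s hs using abs_d1_le a z hs
    · simpa using (tendsto_sg_pow z (n := 3) (by norm_num)).const_mul (CK * ‖a‖)
  rw [integral_Ioi_of_hasDerivAt_of_tendsto' (fun s hs => hasDerivAt_d1 a z (ht.trans_le hs).ne')
    hi hl, zero_sub]

/-- Twice the angular mean of ∇K when q and b rotate together. The nonlocal integral telescopes into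
a boundary term at time t, and the remaining local terms combine into a multiple of (a·x^⊥)(b·q^⊥).
-/
theorem K1_average (q a b x : Plane) {t : ℝ} (ht : 0 < t) :
    K1 q a b x t + K1 (perp q) a (perp b) x t =
      -2 * (⟪a, perp x⟫ * ⟪b, perp q⟫) * (gauss x t / (4 * t)) := by
  have h : (∫ s in Ioi t, d3 q a b x s) + ∫ s in Ioi t, d3 (perp q) a (perp b) x s =
      ⟪q, b⟫ * -d1 a x t := by
    rw [← (integral_dt1 a x ht).2, ← integral_const_mul, ← integral_add
      (integrableOn_d3 q a b x ht).1 (integrableOn_d3 (perp q) a (perp b) x ht).1]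
    refine setIntegral_congr_fun measurableSet_Ioi fun s hs => ?_
    exact d3_add_d3 q a b x (ht.trans hs).ne'
  have e : K1 q a b x t + K1 (perp q) a (perp b) x t =
      d1 q x t * ⟪a, b⟫ + d1 (perp q) x t * ⟪a, perp b⟫ + ⟪q, b⟫ * -d1 a x t := by
    rw [← h, K1, K1]; ring
  rw [e]
  simp only [d1, inner_eq, perp_apply_zero, perp_apply_one]
  field_simp
  ring

/-- Bilinearity in (q, b) leaves only the mean and the second harmonics of the angle. The mean is
the circular flow before time integration; the harmonics oscillate with frequency 2α. -/
theorem K1_Rot_neg (q a b x : Plane) (θ : ℝ) {t : ℝ} (ht : 0 < t) :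
    K1 (Rot (-θ) q) a (Rot (-θ) b) x t =
      -(⟪a, perp x⟫ * ⟪b, perp q⟫) * (gauss x t / (4 * t)) +
      (1 / 2 * (K1 q a b x t - K1 (perp q) a (perp b) x t)) * Real.cos (2 * θ) -
      (1 / 2 * (K1 q a (perp b) x t + K1 (perp q) a b x t)) * Real.sin (2 * θ) := by
  have h := K1_average q a b x ht
  rw [Rot_neg_eq, Rot_neg_eq, K1_lin_left _ _ _ _ _ _ _ ht, K1_lin_right _ _ _ _ _ _ _ ht,
    K1_lin_right _ _ _ _ _ _ _ ht, Real.cos_two_mul, Real.sin_two_mul]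
  have hs := Real.sin_sq_add_cos_sq θ
  linear_combination (1 / 2) * h + K1 (perp q) a (perp b) x t * hs

/-! ### The leading term of the far field -/

theorem sg_le_inv {z : Plane} (hz : z ≠ 0) {s : ℝ} (hs : 0 ≤ s) : sg z s ≤ ‖z‖⁻¹ := by
  rw [← one_div, le_div_iff₀ (norm_pos_iff.2 hz), mul_comm]
  exact norm_mul_sg_le z hs

/-- The integrand of the leading term. -/
def rotK1 (α : ℝ) (q a b x : Plane) (t : ℝ) : ℝ :=
  K1 (Rot (-(α * t)) q) a (Rot (-(α * t)) b) x t

theorem measurable_rotK1 (α : ℝ) (q a b x : Plane) : Measurable (rotK1 α q a b x) := by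
  unfold rotK1; fun_prop

theorem abs_rotK1_le (α : ℝ) (q a b x : Plane) {t : ℝ} (ht : 0 < t) :
    |rotK1 α q a b x t| ≤ 2 * CK * (‖q‖ * ‖a‖ * ‖b‖) * sg x t ^ 3 := by
  have := abs_K1_le (Rot (-(α * t)) q) a (Rot (-(α * t)) b) x ht
  rwa [norm_Rot, norm_Rot] at this

theorem integrableOn_rotK1 (α : ℝ) (q a b : Plane) {x : Plane} (hx : x ≠ 0) :
    IntegrableOn (rotK1 α q a b x) (Ioi 0) := by
  have hr : 0 < ‖x‖ := norm_pos_iff.2 hx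
  refine ((integrableOn_sg_pow x 0 le_rfl (by positivity)).1.const_mul
    (2 * CK * (‖q‖ * ‖a‖ * ‖b‖))).mono' (measurable_rotK1 α q a b x).aestronglyMeasurable ?_
  filter_upwards [ae_restrict_mem measurableSet_Ioi] with t ht using abs_rotK1_le α q a b x ht

theorem lead_error (α : ℝ) (q a b : Plane) {x : Plane} (hx : x ≠ 0) :
    IntegrableOn (fun t => rotK1 α q a b x t + ⟪a, perp x⟫ * ⟪b, perp q⟫ * (gauss x t / (4 * t)))
      (Ioi 0) ∧
    ∫ t in Ioi 0, (rotK1 α q a b x t + ⟪a, perp x⟫ * ⟪b, perp q⟫ * (gauss x t / (4 * t))) =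
      (∫ t in Ioi 0, rotK1 α q a b x t) +
        ⟪a, perp x⟫ * ⟪b, perp q⟫ * (1 / (4 * Real.pi * ‖x‖ ^ 2)) := by
  have h1 := integrableOn_rotK1 α q a b hx
  have h2 := (integral_gauss_div hx).1.const_mul (⟪a, perp x⟫ * ⟪b, perp q⟫)
  refine ⟨h1.add h2, ?_⟩
  rw [integral_add h1 h2, integral_const_mul, (integral_gauss_div hx).2]

theorem rotK1_add_eq (α : ℝ) (q a b x : Plane) {t : ℝ} (ht : 0 < t) :
    rotK1 α q a b x t + ⟪a, perp x⟫ * ⟪b, perp q⟫ * (gauss x t / (4 * t)) =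
      (1 / 2 * (K1 q a b x t - K1 (perp q) a (perp b) x t)) * Real.cos (2 * α * t + 0) -
      (1 / 2 * (K1 q a (perp b) x t + K1 (perp q) a b x t)) * Real.sin (2 * α * t) := by
  rw [rotK1, K1_Rot_neg _ _ _ _ _ ht, add_zero, mul_assoc 2 α t]; ring

theorem lead_bounds (q a b x : Plane) {t : ℝ} (ht : 0 < t) :
    |1 / 2 * (K1 q a b x t - K1 (perp q) a (perp b) x t)| ≤
      2 * CK * (‖q‖ * ‖a‖ * ‖b‖) * sg x t ^ 3 ∧
    |1 / 2 * (K1 q a (perp b) x t + K1 (perp q) a b x t)| ≤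
      2 * CK * (‖q‖ * ‖a‖ * ‖b‖) * sg x t ^ 3 := by
  have h1 := abs_le.1 (abs_K1_le q a b x ht)
  have h2 := abs_le.1 (abs_K1_le (perp q) a (perp b) x ht)
  have h3 := abs_le.1 (abs_K1_le q a (perp b) x ht)
  have h4 := abs_le.1 (abs_K1_le (perp q) a b x ht)
  simp only [norm_perp] at h2 h3 h4
  constructor <;> rw [abs_le] <;> constructor <;> linarith [h1.1, h1.2, h2.1, h2.2, h3.1, h3.2,
    h4.1, h4.2]

theorem lead_deriv_bounds (q a b x : Plane) {t : ℝ} (ht : 0 < t) :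
    |1 / 2 * ((dt1 q x t * ⟪a, b⟫ - d3 q a b x t) -
      (dt1 (perp q) x t * ⟪a, perp b⟫ - d3 (perp q) a (perp b) x t))| ≤
      2 * CK * (‖q‖ * ‖a‖ * ‖b‖) * sg x t ^ 5 ∧
    |1 / 2 * ((dt1 q x t * ⟪a, perp b⟫ - d3 q a (perp b) x t) +
      (dt1 (perp q) x t * ⟪a, b⟫ - d3 (perp q) a b x t))| ≤
      2 * CK * (‖q‖ * ‖a‖ * ‖b‖) * sg x t ^ 5 := by
  have h1 := abs_le.1 (abs_deriv_K1_le q a b x ht)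
  have h2 := abs_le.1 (abs_deriv_K1_le (perp q) a (perp b) x ht)
  have h3 := abs_le.1 (abs_deriv_K1_le q a (perp b) x ht)
  have h4 := abs_le.1 (abs_deriv_K1_le (perp q) a b x ht)
  simp only [norm_perp] at h2 h3 h4
  constructor <;> rw [abs_le] <;> constructor <;> linarith [h1.1, h1.2, h2.1, h2.2, h3.1, h3.2,
    h4.1, h4.2]

/-- After the mean is subtracted only the second harmonics remain. Integration by parts with weight
exponent 3, taken down to t = 0, gives |x|^{-3}/|α|. -/
theorem abs_lead_le_osc {α : ℝ} (hα : α ≠ 0) (q a b : Plane) {x : Plane} (hx : x ≠ 0) :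
    |(∫ t in Ioi 0, rotK1 α q a b x t) +
        ⟪a, perp x⟫ * ⟪b, perp q⟫ * (1 / (4 * Real.pi * ‖x‖ ^ 2))| ≤
      8 * CK * (‖q‖ * ‖a‖ * ‖b‖) * (1 / (|α| * ‖x‖ ^ 3)) := by
  obtain ⟨hi, he⟩ := lead_error α q a b hx
  have hC := CK_pos
  have hr : 0 < ‖x‖ := norm_pos_iff.2 hx
  have hα' : 0 < |α| := abs_pos.2 hα
  rw [← he]
  refine abs_integral_Ioi_le hi fun t₀ T h0 hT => ?_
  have hpos : ∀ t ∈ uIcc t₀ T, 0 < t := fun t ht => by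
    rw [uIcc_of_le hT] at ht; exact h0.trans_le ht.1
  rw [intervalIntegral.integral_congr fun t ht => rotK1_add_eq α q a b x (hpos t ht)]
  have dK : ∀ (q a b : Plane) t, 0 < t → HasDerivAt (fun t => K1 q a b x t)
    (dt1 q x t * ⟪a, b⟫ - d3 q a b x t) t := fun q a b t ht => hasDerivAt_K1 q a b x ht
  have i1 := intervalIntegrable_of_pos (T := T)
    (f := fun t => (1 / 2 * (K1 q a b x t - K1 (perp q) a (perp b) x t)) *
      Real.cos (2 * α * t + 0)) (fun t ht =>
      ((((dK q a b t ht).continuousAt.sub (dK _ _ _ t ht).continuousAt).const_mul _).mul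
        (by fun_prop))) h0 hT
  have i2 := intervalIntegrable_of_pos (T := T)
    (f := fun t => (1 / 2 * (K1 q a (perp b) x t + K1 (perp q) a b x t)) *
      Real.sin (2 * α * t)) (fun t ht =>
      ((((dK q a (perp b) t ht).continuousAt.add (dK _ _ _ t ht).continuousAt).const_mul _).mul
        (by fun_prop))) h0 hT
  rw [intervalIntegral.integral_sub i1 i2]
  have hM : 0 ≤ 2 * CK * (‖q‖ * ‖a‖ * ‖b‖) := by positivity
  have hβ : 2 * α ≠ 0 := by positivity
  have o1 := abs_integral_mul_cos_le (δ := 0) (n := 2) h0 hT hβ hM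
    (fun t ht => (lead_bounds q a b x ht).1)
    (fun t ht => ((dK q a b t ht).sub (dK (perp q) a (perp b) t ht)).const_mul (1 / 2))
    (fun t ht => (lead_deriv_bounds q a b x ht).1) (by unfold dt1; fun_prop)
  have o2 := abs_integral_mul_sin_le (n := 2) h0 hT hβ hM
    (fun t ht => (lead_bounds q a b x ht).2)
    (fun t ht => ((dK q a (perp b) t ht).add (dK (perp q) a b t ht)).const_mul (1 / 2))
    (fun t ht => (lead_deriv_bounds q a b x ht).2) (by unfold dt1; fun_prop)
  have hs : sg x t₀ ^ 3 ≤ 1 / ‖x‖ ^ 3 := by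
    rw [one_div, ← inv_pow]
    exact pow_le_pow_left₀ (sg_nonneg _ _) (sg_le_inv hx h0.le) 3
  refine (abs_sub _ _).trans ((add_le_add o1 o2).trans ?_)
  rw [abs_mul, abs_two]
  calc _ = 8 * CK * (‖q‖ * ‖a‖ * ‖b‖) * (1 / |α| * sg x t₀ ^ 3) := by field_simp; ring
    _ ≤ 8 * CK * (‖q‖ * ‖a‖ * ‖b‖) * (1 / |α| * (1 / ‖x‖ ^ 3)) := by gcongr
    _ = _ := by rw [one_div_mul_one_div]

/-- The companion bound without oscillation, from the absolute integral of the cubed weight. It is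
uniform in α and useful where |α||x|² is small. -/
theorem abs_lead_le_abs (α : ℝ) (q a b : Plane) {x : Plane} (hx : x ≠ 0) :
    |(∫ t in Ioi 0, rotK1 α q a b x t) +
        ⟪a, perp x⟫ * ⟪b, perp q⟫ * (1 / (4 * Real.pi * ‖x‖ ^ 2))| ≤
      8 * CK * (‖q‖ * ‖a‖ * ‖b‖) * (1 / ‖x‖) := by
  obtain ⟨hi, he⟩ := lead_error α q a b hx
  have hr : 0 < ‖x‖ := norm_pos_iff.2 hx
  obtain ⟨h1, h2⟩ := integrableOn_sg_pow x 0 le_rfl (t := 0) (by positivity)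
  rw [← he, ← Real.norm_eq_abs]
  refine (norm_integral_le_of_norm_le (h1.const_mul (4 * CK * (‖q‖ * ‖a‖ * ‖b‖))) ?_).trans ?_
  · filter_upwards [ae_restrict_mem measurableSet_Ioi] with t ht
    obtain ⟨b1, b2⟩ := lead_bounds q a b x ht
    rw [rotK1_add_eq _ _ _ _ _ ht, Real.norm_eq_abs]
    have c1 := abs_mul_le b1 (Real.abs_cos_le_one (2 * α * t + 0))
    have c2 := abs_mul_le b2 (Real.abs_sin_le_one (2 * α * t))
    refine (abs_sub _ _).trans ((add_le_add c1 c2).trans (le_of_eq ?_))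
    ring
  · rw [integral_const_mul, h2, sg_zero_right]
    norm_num
    exact le_of_eq (by ring)

theorem abs_lead_le {α : ℝ} (hα : α ≠ 0) (q a b : Plane) {x : Plane} (hx : x ≠ 0) :
    |(∫ t in Ioi 0, rotK1 α q a b x t) +
        ⟪a, perp x⟫ * ⟪b, perp q⟫ * (1 / (4 * Real.pi * ‖x‖ ^ 2))| ≤
      8 * CK * (‖q‖ * ‖a‖ * ‖b‖) * min (1 / (|α| * ‖x‖ ^ 3)) (1 / ‖x‖) := by
  have hC := CK_pos
  rw [mul_min_of_nonneg _ _ (by positivity)]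
  exact le_min (abs_lead_le_osc hα q a b hx) (abs_lead_le_abs α q a b hx)

/-! ### The far field of the fundamental solution -/

theorem abs_integral_Ioc_Kk_le (a b : Plane) {x : Plane} (hx : x ≠ 0) {α T : ℝ} (hα : α ≠ 0)
    (hT : 0 ≤ T) :
    IntegrableOn (fun t => Kk a (Rot (-(α * t)) b) x t) (Ioc 0 T) ∧
    |∫ t in Ioc 0 T, Kk a (Rot (-(α * t)) b) x t| ≤
      16 * CK * (‖a‖ * ‖b‖) * (1 / (|α| * ‖x‖ ^ 2)) := by
  have hC := CK_pos
  have hr : 0 < ‖x‖ := norm_pos_iff.2 hx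
  have hα' : 0 < |α| := abs_pos.2 hα
  have hi : IntegrableOn (fun t => Kk a (Rot (-(α * t)) b) x t) (Ioc 0 T) := by
    have h := integrableOn_kap α T (x := x) (y := 0) hx a b
    refine h.congr_fun (fun t _ => ?_) measurableSet_Ioc
    simp only [kap_eq]
    simp [Rot, perp]
    congr 1
    ext i; fin_cases i <;> simp
  refine ⟨hi, abs_integral_Ioc_le (by positivity) hT hi fun t₀ h0 h1 => ?_⟩
  refine (abs_integral_Kk_Rot_le a b x hα h0 h1).trans ?_
  have hs : sg x t₀ ^ 2 ≤ 1 / ‖x‖ ^ 2 := by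
    rw [one_div, ← inv_pow]
    exact pow_le_pow_left₀ (sg_nonneg _ _) (sg_le_inv hx h0.le) 2
  calc _ = 16 * CK * (‖a‖ * ‖b‖) * (1 / |α| * sg x t₀ ^ 2) := by ring
    _ ≤ 16 * CK * (‖a‖ * ‖b‖) * (1 / |α| * (1 / ‖x‖ ^ 2)) := by gcongr
    _ = _ := by rw [one_div_mul_one_div]

theorem integral_sg_zero_Ioc {T : ℝ} (hT : 0 ≤ T) :
    IntegrableOn (sg 0) (Ioc 0 T) ∧ ∫ t in Ioc 0 T, sg 0 t = 2 * √T := by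
  have h := lintegral_sg_zero_Ioc T hT
  have hm : AEStronglyMeasurable (sg 0) (volume.restrict (Ioc 0 T)) :=
    Measurable.aestronglyMeasurable (by fun_prop)
  have h0 : 0 ≤ᵐ[volume.restrict (Ioc 0 T)] sg 0 := Eventually.of_forall fun _ => sg_nonneg _ _
  constructor
  · refine ⟨hm, ?_⟩
    rw [hasFiniteIntegral_iff_ofReal h0, h]
    exact ENNReal.ofReal_lt_top
  · rw [integral_eq_lintegral_of_nonneg_ae h0 hm, h, ENNReal.toReal_ofReal (by positivity)]

/-- For small |α||x|² the time is split at 1/|α|. Earlier, one factor of the weight is bounded by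
1/|x| and the other by t^{-1/2}, which gives the square root; later, the oscillation costs only a
constant. -/
theorem abs_integral_Ioc_Kk_le_sqrt (a b : Plane) {x : Plane} (hx : x ≠ 0) {α T : ℝ} (hα : α ≠ 0)
    (hT : |α|⁻¹ ≤ T) :
    |∫ t in Ioc 0 T, Kk a (Rot (-(α * t)) b) x t| ≤
      16 * CK * (‖a‖ * ‖b‖) + 4 * CK * (‖a‖ * ‖b‖) * √(1 / (|α| * ‖x‖ ^ 2)) := by
  have hC := CK_pos
  have hr : 0 < ‖x‖ := norm_pos_iff.2 hx
  have hα' : 0 < |α| := abs_pos.2 hα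
  set T₀ := |α|⁻¹ with hT₀
  have h0 : 0 < T₀ := inv_pos.2 hα'
  have hi := (abs_integral_Ioc_Kk_le a b hx hα (h0.le.trans hT)).1
  rw [← Ioc_union_Ioc_eq_Ioc h0.le hT, setIntegral_union (Ioc_disjoint_Ioc_of_le le_rfl)
    measurableSet_Ioc (hi.mono_set (Ioc_subset_Ioc_right hT))
    (hi.mono_set (Ioc_subset_Ioc_left h0.le)), ← intervalIntegral.integral_of_le hT, add_comm]
  refine (abs_add_le _ _).trans (add_le_add ?_ ?_)
  · refine (abs_integral_Kk_Rot_le a b x hα h0 hT).trans ?_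
    have h1 : sg x T₀ ^ 2 ≤ T₀⁻¹ := by
      rw [sg_sq x h0.le]; gcongr; nlinarith [sq_nonneg ‖x‖]
    calc _ ≤ 16 * CK * (‖a‖ * ‖b‖) / |α| * T₀⁻¹ := by gcongr
      _ = _ := by rw [hT₀]; field_simp
  · obtain ⟨g1, g2⟩ := integral_sg_zero_Ioc h0.le
    rw [← Real.norm_eq_abs]
    refine (norm_integral_le_of_norm_le
      (g1.const_mul (2 * CK * (‖a‖ * ‖b‖) * ‖x‖⁻¹)) ?_).trans (le_of_eq ?_)
    · filter_upwards [ae_restrict_mem measurableSet_Ioc] with t ht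
      have k1 := abs_Kk_le a (Rot (-(α * t)) b) x ht.1
      rw [norm_Rot] at k1
      have k2 := sg_le_inv hx ht.1.le
      have k3 := sg_le_sg_zero x ht.1
      have k4 := sg_nonneg x t
      calc _ ≤ _ := k1
        _ = 2 * CK * (‖a‖ * ‖b‖) * (sg x t * sg x t) := by ring
        _ ≤ 2 * CK * (‖a‖ * ‖b‖) * (‖x‖⁻¹ * sg 0 t) := by gcongr
        _ = _ := by ring
    · rw [integral_const_mul, g2, hT₀, Real.sqrt_div zero_le_one, Real.sqrt_mul hα'.le,
        Real.sqrt_sq hr.le, Real.sqrt_inv, Real.sqrt_one]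
      field_simp
      ring

/-- Taylor expansion in y at each time: the first-order term is minus `rotK1`, hence the plus sign;
the zeroth-order term is left to the assumed bound A; the quadratic remainder integrates to
(|y|/|x|)², because the fourth power of the weight has time integral |x|^{-2}. -/
theorem abs_Gam_add_le {α : ℝ} (hα : α ≠ 0) {x y : Plane} (hx : x ≠ 0) (hy : ‖y‖ ≤ ‖x‖ / 2)
    (a b : Plane) {A : ℝ}
    (hA : ∀ T, |α|⁻¹ ≤ T → |∫ t in Ioc 0 T, Kk a (Rot (-(α * t)) b) x t| ≤ A) :
    |Gam α x y a b + ∫ t in Ioi 0, rotK1 α y a b x t| ≤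
      A + 48 * CK * (‖a‖ * ‖b‖) * (‖y‖ / ‖x‖) ^ 2 := by
  have hC := CK_pos
  have hr : 0 < ‖x‖ := norm_pos_iff.2 hx
  have hne : x ≠ y := by
    rintro rfl; linarith
  rw [Gam_of_ne α hne]
  have hS := integrableOn_rotK1 α y a b hx
  have l1 := (tendsto_AT hα hne a b).add
    (intervalIntegral_tendsto_integral_Ioi 0 hS tendsto_id)
  refine le_of_tendsto l1.abs ?_
  filter_upwards [eventually_ge_atTop |α|⁻¹] with T hT
  have hT0 : 0 ≤ T := (inv_pos.2 (abs_pos.2 hα)).le.trans hT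
  have i1 := integrableOn_kap α T hne a b
  have i2 := hS.mono_set (Ioc_subset_Ioi_self : Ioc 0 T ⊆ Ioi 0)
  have i3 := (abs_integral_Ioc_Kk_le a b hx hα hT0).1
  obtain ⟨g1, g2⟩ := integrableOn_sg_pow x 1 le_rfl (t := 0) (by positivity)
  rw [AT, id, intervalIntegral.integral_of_le hT0, intervalIntegral.integral_of_le hT0,
    ← integral_add i1 i2]
  have e : ∫ t in Ioc 0 T, (kap α x y a b t + rotK1 α y a b x t) =
      (∫ t in Ioc 0 T, Kk a (Rot (-(α * t)) b) x t) + ∫ t in Ioc 0 T,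
        (kap α x y a b t + rotK1 α y a b x t - Kk a (Rot (-(α * t)) b) x t) := by
    refine Eq.trans (integral_congr_ae (Eventually.of_forall fun t => ?_))
      (integral_add i3 ((i1.add i2).sub i3))
    simp
  rw [e]
  refine (abs_add_le _ _).trans (add_le_add (hA T hT) ?_)
  rw [← Real.norm_eq_abs]
  have g3 : IntegrableOn (fun t => sg x t ^ 4) (Ioi 0) := g1
  refine (norm_integral_le_of_norm_le
    ((g3.mono_set Ioc_subset_Ioi_self).const_mul (48 * CK * (‖a‖ * ‖b‖) * ‖y‖ ^ 2)) ?_).trans ?_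
  · filter_upwards [ae_restrict_mem measurableSet_Ioc] with t ht
    have := abs_Kk_taylor_le a (Rot (-(α * t)) b) (x := x) (v := Rot (-(α * t)) y) ht.1
      (by rwa [norm_Rot])
    rw [norm_Rot, norm_Rot] at this
    rw [Real.norm_eq_abs, kap_eq, rotK1]
    convert this using 2
    ring
  · rw [integral_const_mul]
    have : ∫ t in Ioc 0 T, sg x t ^ 4 ≤ ∫ t in Ioi 0, sg x t ^ 4 :=
      setIntegral_mono_set g3 (Eventually.of_forall fun t => pow_nonneg (sg_nonneg _ _) _)
        Ioc_subset_Ioi_self.eventuallyLE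
    calc _ ≤ 48 * CK * (‖a‖ * ‖b‖) * ‖y‖ ^ 2 * ∫ t in Ioi 0, sg x t ^ 4 := by gcongr
      _ = _ := by rw [show (∫ t in Ioi 0, sg x t ^ 4) = _ from g2, sg_zero_right]; norm_num; ring

theorem inner_vortex (a x : Plane) :
    ⟪a, vortex x⟫ = ⟪a, perp x⟫ * (1 / (4 * Real.pi * ‖x‖ ^ 2)) := by
  rw [vortex, real_inner_smul_right, mul_comm]

theorem min_le_rpow {s θ : ℝ} (hs : 0 < s) (h0 : 0 ≤ θ) (h1 : θ ≤ 1) : min s 1 ≤ s ^ θ := by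
  rcases le_total s 1 with h | h
  · refine (min_le_left _ _).trans ?_
    simpa using Real.rpow_le_rpow_of_exponent_ge hs h h1
  · exact (min_le_right _ _).trans (Real.one_le_rpow h h0)

/-- With s = 1/(|α||x|²), the exponent (1+γ)/2 lies between 1/2 and 1. The bound s for small s and
the bound with √s for large s are therefore both dominated by the same power of s. -/
theorem abs_Gam_sub_vortex_le {α γ : ℝ} (hα : α ≠ 0) (hγ : 0 ≤ γ) (hγ' : γ < 1) {x y : Plane}
    (hx : x ≠ 0) (hy : ‖y‖ ≤ ‖x‖ / 2) (a b : Plane) :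
    |Gam α x y a b - ⟪a, vortex x⟫ * ⟪perp y, b⟫| ≤
      48 * CK * (‖a‖ * ‖b‖) *
        ((1 / (|α| * ‖x‖ ^ 2)) ^ ((1 + γ) / 2) + (‖y‖ / ‖x‖) ^ (1 + γ)) := by
  have hC := CK_pos
  have hr : 0 < ‖x‖ := norm_pos_iff.2 hx
  have hα' : 0 < |α| := abs_pos.2 hα
  set s := 1 / (|α| * ‖x‖ ^ 2) with hs
  have hs0 : 0 < s := by positivity
  have hA : ∀ T, |α|⁻¹ ≤ T → |∫ t in Ioc 0 T, Kk a (Rot (-(α * t)) b) x t| ≤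
      20 * CK * (‖a‖ * ‖b‖) * s ^ ((1 + γ) / 2) := fun T hT => by
    rcases le_total s 1 with h | h
    · refine (abs_integral_Ioc_Kk_le a b hx hα ((inv_pos.2 hα').le.trans hT)).2.trans ?_
      rw [← hs]
      have : s ≤ s ^ ((1 + γ) / 2) := by
        simpa using Real.rpow_le_rpow_of_exponent_ge hs0 h (show (1 + γ) / 2 ≤ 1 by linarith)
      gcongr
      norm_num
    · refine (abs_integral_Ioc_Kk_le_sqrt a b hx hα hT).trans ?_
      rw [← hs]
      have h1 : √s ≤ s ^ ((1 + γ) / 2) := by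
        rw [Real.sqrt_eq_rpow]
        exact Real.rpow_le_rpow_of_exponent_le h (by linarith)
      have h2 : 1 ≤ s ^ ((1 + γ) / 2) := Real.one_le_rpow h (by linarith)
      calc _ ≤ 16 * CK * (‖a‖ * ‖b‖) * s ^ ((1 + γ) / 2) +
            4 * CK * (‖a‖ * ‖b‖) * s ^ ((1 + γ) / 2) := by
            refine add_le_add (le_mul_of_one_le_right (by positivity) h2) ?_
            gcongr
        _ = _ := by ring
  have h1 := abs_Gam_add_le hα hx hy a b hA
  have h2 := abs_lead_le hα y a b hx
  have hw0 : 0 ≤ ‖y‖ / ‖x‖ := by positivity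
  have hw1 : ‖y‖ / ‖x‖ ≤ 1 := by rw [div_le_one hr]; linarith
  -- The factor |y| is spent on |y|/|x| ≤ 1, so the error of the first-order term is absorbed by the
  -- α-dependent term.
  have h3 : ‖y‖ * min (1 / (|α| * ‖x‖ ^ 3)) (1 / ‖x‖) ≤ s ^ ((1 + γ) / 2) := by
    calc _ = ‖y‖ / ‖x‖ * min s 1 := by
          rw [mul_min_of_nonneg _ _ (norm_nonneg y), mul_min_of_nonneg _ _ hw0, hs]
          congr 1 <;> field_simp
      _ ≤ 1 * min s 1 := by gcongr
      _ ≤ _ := by rw [one_mul]; exact min_le_rpow hs0 (by linarith) (by linarith)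
  have h4 : (‖y‖ / ‖x‖) ^ 2 ≤ (‖y‖ / ‖x‖) ^ (1 + γ) := by
    rcases hw0.eq_or_lt with h | h
    · rw [← h, Real.zero_rpow (by linarith)]; norm_num
    · rw [← Real.rpow_two]
      exact Real.rpow_le_rpow_of_exponent_ge h hw1 (by linarith)
  have e : Gam α x y a b - ⟪a, vortex x⟫ * ⟪perp y, b⟫ =
      (Gam α x y a b + ∫ t in Ioi 0, rotK1 α y a b x t) - ((∫ t in Ioi 0, rotK1 α y a b x t) +
        ⟪a, perp x⟫ * ⟪b, perp y⟫ * (1 / (4 * Real.pi * ‖x‖ ^ 2))) := by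
    rw [inner_vortex, real_inner_comm b (perp y)]; ring
  rw [e]
  have hp : 0 ≤ CK * (‖a‖ * ‖b‖) := by positivity
  have h0 : 0 ≤ s ^ ((1 + γ) / 2) := by positivity
  refine (abs_sub _ _).trans ((add_le_add h1 h2).trans ?_)
  calc _ = 20 * (CK * (‖a‖ * ‖b‖)) * s ^ ((1 + γ) / 2) +
        48 * (CK * (‖a‖ * ‖b‖)) * (‖y‖ / ‖x‖) ^ 2 +
        8 * (CK * (‖a‖ * ‖b‖)) * (‖y‖ * min (1 / (|α| * ‖x‖ ^ 3)) (1 / ‖x‖)) := by ring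
    _ ≤ 20 * (CK * (‖a‖ * ‖b‖)) * s ^ ((1 + γ) / 2) +
        48 * (CK * (‖a‖ * ‖b‖)) * (‖y‖ / ‖x‖) ^ (1 + γ) +
        8 * (CK * (‖a‖ * ‖b‖)) * s ^ ((1 + γ) / 2) := by gcongr
    _ ≤ _ := by nlinarith [mul_nonneg hp h0]

/-! ### Compactly supported forces -/

theorem enorm_le_of_inner {v : Plane} {B : ℝ≥0∞} (h : ∀ a : Plane, ‖⟪a, v⟫‖ₑ ≤ ‖a‖ₑ * B) :
    ‖v‖ₑ ≤ B := by
  have h1 := h v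
  rw [real_inner_self_eq_norm_sq, enorm_pow, enorm_norm, sq] at h1
  rcases eq_or_ne ‖v‖ₑ 0 with h0 | h0
  · rw [h0]; exact zero_le
  · exact (ENNReal.mul_le_mul_iff_right h0 enorm_ne_top).1 h1

theorem Adm.integrable {h : Plane → Plane} (hh : Adm h) : Integrable h :=
  ⟨hh.memLp.1, (lintegral_mono fun y => le_mul_of_one_le_left' (one_le_wt y)).trans_lt hh.weighted⟩

theorem integrable_inner_perp {R : ℝ} {f : Plane → Plane} (hf : MemLp f 2 volume)
    (h0 : ∀ᵐ y ∂(volume : Measure Plane), R ≤ ‖y‖ → f y = 0) :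
    Integrable (fun y => ⟪perp y, f y⟫) := by
  refine ((adm_of_support hf h0).integrable.norm.const_mul R).mono'
    (continuous_perp.aestronglyMeasurable.inner hf.1) ?_
  filter_upwards [h0] with y hy
  rcases le_or_gt R ‖y‖ with h | h
  · simp [hy h]
  · refine (norm_inner_le_norm _ _).trans ?_
    rw [norm_perp]
    gcongr

theorem tendsto_regTorque {R : ℝ} {f : Plane → Plane} (hf : MemLp f 2 volume)
    (h0 : ∀ᵐ y ∂(volume : Measure Plane), R ≤ ‖y‖ → f y = 0) :
    Tendsto (regTorque f) (𝓝[>] 0) (𝓝 (∫ y, ⟪perp y, f y⟫)) :=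
  tendsto_integral_reg (integrable_inner_perp hf h0)

theorem enorm_vel_sub_vortex_le {α γ R : ℝ} (hα : α ≠ 0) (hγ : 0 ≤ γ) (hγ' : γ < 1)
    {f : Plane → Plane} (hf : MemLp f 2 volume)
    (h0 : ∀ᵐ y ∂(volume : Measure Plane), R ≤ ‖y‖ → f y = 0) {x : Plane} (hx : x ≠ 0)
    (hR : 2 * R ≤ ‖x‖) :
    ‖vel α f x - (∫ y, ⟪perp y, f y⟫) • vortex x‖ₑ ≤
      ENNReal.ofReal (48 * CK) * ∫⁻ y in Metric.ball 0 R,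
        (ENNReal.ofReal ((1 / (|α| * ‖x‖ ^ 2)) ^ ((1 + γ) / 2)) * ‖f y‖ₑ +
          ENNReal.ofReal (‖x‖ ^ (-(1 + γ))) * ‖‖y‖ ^ (1 + γ) * ‖f y‖‖ₑ) := by
  have hC := CK_pos
  have hr : 0 < ‖x‖ := norm_pos_iff.2 hx
  refine enorm_le_of_inner fun a => ?_
  have e : ⟪a, vel α f x - (∫ y, ⟪perp y, f y⟫) • vortex x⟫ =
      ∫ y, (Gam α x y a (f y) - ⟪a, vortex x⟫ * ⟪perp y, f y⟫) := by
    rw [inner_sub_right, (adm_of_support hf h0).inner_vel hα, real_inner_smul_right,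
      integral_sub ((adm_of_support hf h0).integrable_Gam hα x a)
      ((integrable_inner_perp hf h0).const_mul _), integral_const_mul, mul_comm]
  rw [e]
  refine (enorm_integral_le_lintegral_enorm _).trans ?_
  rw [← lintegral_const_mul' _ _ (by finiteness), ← lintegral_const_mul' _ _ (by finiteness),
    ← lintegral_indicator Metric.isOpen_ball.measurableSet]
  refine lintegral_mono_ae ?_
  filter_upwards [h0] with y hy
  rcases le_or_gt R ‖y‖ with h | h
  · have h1 : ∀ a, Gam α x y a 0 = 0 := fun a => by
      unfold Gam
      have : mulVec (fundSol α x y) 0 = 0 := by ext i; simp [mulVec]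
      simp [this]
    simp [hy h, h1]
  · rw [indicator_of_mem (by simpa using h)]
    have k := abs_Gam_sub_vortex_le hα hγ hγ' (y := y) hx (by linarith) a (f y)
    rw [← Real.norm_eq_abs] at k
    rw [← ofReal_norm, ← ofReal_norm, ← ofReal_norm,
      ← ofReal_norm, ← ENNReal.ofReal_mul (by positivity),
      ← ENNReal.ofReal_mul (by positivity), ← ENNReal.ofReal_add (by positivity) (by positivity),
      ← ENNReal.ofReal_mul (by positivity), ← ENNReal.ofReal_mul (by positivity)]
    refine ENNReal.ofReal_le_ofReal (k.trans (le_of_eq ?_))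
    rw [Real.norm_of_nonneg (by positivity), Real.div_rpow (norm_nonneg y) hr.le,
      Real.rpow_neg hr.le]
    field_simp

theorem weight_le {γ : ℝ} (hγ : 0 ≤ γ) (hγ' : γ < 1) {r : ℝ} (hr : 1 ≤ r) :
    (1 + r) ^ (1 + γ) ≤ 4 * r ^ (1 + γ) := by
  calc (1 + r) ^ (1 + γ) ≤ (2 * r) ^ (1 + γ) := by
        apply Real.rpow_le_rpow <;> linarith
    _ = 2 ^ (1 + γ) * r ^ (1 + γ) := Real.mul_rpow (by norm_num) (by linarith)
    _ ≤ 2 ^ (2 : ℝ) * r ^ (1 + γ) := by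
        gcongr
        · norm_num
        · linarith
    _ = _ := by norm_num

theorem wNorm_le_of_forall {γ R : ℝ} (hγ : 0 ≤ γ) (hγ' : γ < 1) (hR : 1 ≤ R) {g : Plane → Plane}
    {B : ℝ≥0∞} (h : ∀ x, 2 * R ≤ ‖x‖ → ENNReal.ofReal (‖x‖ ^ (1 + γ)) * ‖g x‖ₑ ≤ B) :
    wNorm (1 + γ) (ballCompl (2 * R)) g ≤ 4 * B := by
  rw [wNorm, eLpNorm_exponent_top]
  refine eLpNormEssSup_le_of_ae_enorm_bound ?_
  have hm : MeasurableSet (ballCompl (2 * R)) := measurableSet_le measurable_const measurable_norm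
  filter_upwards [ae_restrict_mem hm] with x hx
  have hx' : 2 * R ≤ ‖x‖ := hx
  rw [enorm_mul, enorm_norm, Real.enorm_eq_ofReal (by positivity)]
  calc _ ≤ ENNReal.ofReal (4 * ‖x‖ ^ (1 + γ)) * ‖g x‖ₑ := by
        gcongr
        exact weight_le hγ hγ' (by linarith)
    _ = 4 * (ENNReal.ofReal (‖x‖ ^ (1 + γ)) * ‖g x‖ₑ) := by
        rw [ENNReal.ofReal_mul (by norm_num), mul_assoc]; norm_num
    _ ≤ _ := by gcongr; exact h x hx'

/-- Both terms of the kernel estimate carry exactly |x|^{-(1+γ)}, which the weight cancels. The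
constant is 48 times the factor 4 from replacing |x| by 1+|x|. -/
theorem wNorm_rem_le {α γ R : ℝ} (hα : α ≠ 0) (hγ : 0 ≤ γ) (hγ' : γ < 1) (hR : 1 ≤ R)
    {f : Plane → Plane} (hf : MemLp f 2 volume)
    (h0 : ∀ᵐ y ∂(volume : Measure Plane), R ≤ ‖y‖ → f y = 0) :
    wNorm (1 + γ) (ballCompl (2 * R)) (fun x => vel α f x - (∫ y, ⟪perp y, f y⟫) • vortex x) ≤
      ((192 * CK).toNNReal : ℝ≥0∞) * (ENNReal.ofReal (|α| ^ (-(1 + γ) / 2)) *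
          eLpNorm f 1 (volume.restrict (Metric.ball 0 R)) +
        eLpNorm (fun y => ‖y‖ ^ (1 + γ) * ‖f y‖) 1 (volume.restrict (Metric.ball 0 R))) := by
  have hC := CK_pos
  have hα' : 0 < |α| := abs_pos.2 hα
  have key := wNorm_le_of_forall hγ hγ' hR
    (g := fun x => vel α f x - (∫ y, ⟪perp y, f y⟫) • vortex x)
    (B := ENNReal.ofReal (48 * CK) * (ENNReal.ofReal (|α| ^ (-(1 + γ) / 2)) *
          eLpNorm f 1 (volume.restrict (Metric.ball 0 R)) +
        eLpNorm (fun y => ‖y‖ ^ (1 + γ) * ‖f y‖) 1 (volume.restrict (Metric.ball 0 R)))) ?_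
  · refine key.trans (le_of_eq ?_)
    rw [← mul_assoc]
    congr 1
    rw [show (192 * CK) = 4 * (48 * CK) by ring]
    change _ = ENNReal.ofReal _
    rw [ENNReal.ofReal_mul (by norm_num : (0:ℝ) ≤ 4)]
    norm_num
  · intro x hx
    have hr : 0 < ‖x‖ := by linarith
    have hx0 : x ≠ 0 := norm_pos_iff.1 hr
    refine (mul_le_mul' le_rfl (enorm_vel_sub_vortex_le hα hγ hγ' hf h0 hx0 hx)).trans
      (le_of_eq ?_)
    rw [lintegral_add_left' (hf.1.enorm.restrict.const_mul _), lintegral_const_mul' _ _ (by finiteness),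
      lintegral_const_mul' _ _ (by finiteness), eLpNorm_one_eq_lintegral_enorm,
      eLpNorm_one_eq_lintegral_enorm, mul_left_comm]
    congr 1
    rw [mul_add, ← mul_assoc, ← mul_assoc, ← ENNReal.ofReal_mul (by positivity),
      ← ENNReal.ofReal_mul (by positivity), ← Real.rpow_add hr, add_neg_cancel, Real.rpow_zero,
      ENNReal.ofReal_one, one_mul]
    congr 3
    rw [one_div, mul_inv, Real.mul_rpow (by positivity) (by positivity), ← Real.rpow_neg_one,
      ← Real.rpow_mul hα'.le, ← Real.rpow_natCast, ← Real.rpow_neg hr.le, ← Real.rpow_mul hr.le,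
      mul_left_comm, ← Real.rpow_add hr]
    rw [show 1 + γ + -((2 : ℕ) : ℝ) * ((1 + γ) / 2) = 0 by push_cast; ring, Real.rpow_zero, mul_one]
    congr 1; ring

/-! ### Calculus of `Kk` along curves -/

/-- The time derivative of `d2`. -/
def dt2 (p q z : Plane) (s : ℝ) : ℝ := d4 (e 0) (e 0) p q z s + d4 (e 1) (e 1) p q z s

/-- The second derivative in the directions `o`, `q` of `z ↦ Kk p r z t`. -/
def K2 (o q p r z : Plane) (t : ℝ) : ℝ := d2 o q z t * ⟪p, r⟫ + ∫ s in Ioi t, d4 o q p r z s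

/-- The trace over two of the four slots does not depend on the orthonormal frame. This identifies
the Laplacian in the fixed x coordinates with the one in rotating coordinates. -/
theorem sum_d4_Rot (θ : ℝ) (p q z : Plane) (s : ℝ) :
    d4 (Rot θ (e 0)) (Rot θ (e 0)) p q z s + d4 (Rot θ (e 1)) (Rot θ (e 1)) p q z s =
      dt2 p q z s := by
  have h := Real.sin_sq_add_cos_sq θ
  have h1 : ∀ u v : Plane, ⟪Rot θ (e 0), u⟫ * ⟪Rot θ (e 0), v⟫ + ⟪Rot θ (e 1), u⟫ * ⟪Rot θ (e 1), v⟫ =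
      ⟪e 0, u⟫ * ⟪e 0, v⟫ + ⟪e 1, u⟫ * ⟪e 1, v⟫ := fun u v => by
    simp [inner_eq]
    linear_combination (u 0 * v 0 + u 1 * v 1) * h
  have h2 : ∀ i, ⟪Rot θ (e i), Rot θ (e i)⟫ = ⟪e i, e i⟫ := fun i => inner_Rot_Rot _ _ _
  simp only [dt2, d4, h2]
  linear_combination (⟪p, z⟫ * ⟪q, z⟫ / (16 * s ^ 4) * h1 z z - (⟪q, z⟫ * h1 p z + ⟪p, z⟫ * h1 q z +
    ⟪p, z⟫ * h1 q z + ⟪q, z⟫ * h1 p z + ⟪p, q⟫ * h1 z z) / (8 * s ^ 3) +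
    2 * h1 p q / (4 * s ^ 2)) * gauss z s

theorem hasDerivAt_gauss_curve {z : ℝ → Plane} {s : ℝ → ℝ} {z' : Plane} {s' t : ℝ}
    (hz : HasDerivAt z z' t) (hs : HasDerivAt s s' t) (h0 : s t ≠ 0) :
    HasDerivAt (fun τ => gauss (z τ) (s τ)) (d1 z' (z t) (s t) + s' * lapG (z t) (s t)) t := by
  have hp := Real.pi_pos
  have h := ((hasDerivAt_const t (1 : ℝ)).div (hs.const_mul (4 * Real.pi)) (by positivity)).mul
    (((hz.norm_sq.neg).div (hs.const_mul 4) (by positivity)).exp)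
  refine (h.congr_deriv ?_).congr_of_eventuallyEq (Eventually.of_forall fun y => ?_)
  · simp [d1, lapG, gauss, real_inner_comm]; field_simp; ring
  · simp [gauss]

theorem hasDerivAt_d2_curve {p z : ℝ → Plane} {s : ℝ → ℝ} {p' z' : Plane} (q : Plane) {s' t : ℝ}
    (hp : HasDerivAt p p' t) (hz : HasDerivAt z z' t) (hs : HasDerivAt s s' t) (h0 : s t ≠ 0) :
    HasDerivAt (fun τ => d2 (p τ) q (z τ) (s τ))
      (d2 p' q (z t) (s t) + d3 z' (p t) q (z t) (s t) + s' * dt2 (p t) q (z t) (s t)) t := by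
  have i1 := hp.inner ℝ hz
  have i2 := (hasDerivAt_const t q).inner ℝ hz
  have i3 := hp.inner ℝ (hasDerivAt_const t q)
  have h := (((i1.mul i2).div ((hs.pow 2).const_mul 4) (mul_ne_zero four_ne_zero (pow_ne_zero 2 h0))).sub
    (i3.div (hs.const_mul 2) (by positivity))).mul (hasDerivAt_gauss_curve hz hs h0)
  refine (h.congr_deriv ?_).congr_of_eventuallyEq (Eventually.of_forall fun y => ?_)
  · simp only [d2, d3, dt2, d4, d1, lapG, Pi.mul_apply, Pi.sub_apply, Pi.div_apply, Pi.pow_apply]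
    generalize gauss (z t) (s t) = G
    generalize s t = S at *
    simp only [inner_eq, norm_sq_eq, e]
    simp
    field_simp
    ring
  · simp [d2]

theorem Kk_eq_shift (p q z : Plane) (t : ℝ) :
    Kk p q z t = gauss z t * ⟪p, q⟫ + ∫ σ in Ioi (0 : ℝ), d2 p q z (t + σ) := by
  rw [Kk, integral_Ioi_shift]

theorem K1_eq_shift (q p r z : Plane) (t : ℝ) :
    K1 q p r z t = d1 q z t * ⟪p, r⟫ + ∫ σ in Ioi (0 : ℝ), d3 q p r z (t + σ) := by
  rw [K1, integral_Ioi_shift]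

theorem integrableOn_d4 (o p q r z : Plane) {t : ℝ} (ht : 0 < t) :
    IntegrableOn (d4 o p q r z) (Ioi t) ∧
      |∫ s in Ioi t, d4 o p q r z s| ≤ CK * (‖o‖ * ‖p‖ * ‖q‖ * ‖r‖) * sg z t ^ 4 := by
  have h := integrableOn_of_le_sg (f := d4 o p q r z) (z := z) (n := 3)
    (by unfold d4; fun_prop) ht (fun s hs => abs_d4_le o p q r z (ht.trans hs))
  refine ⟨h.1, h.2.trans ?_⟩
  have := CK_pos
  have := sg_pos z ht
  gcongr
  norm_num
  have : 0 < sg z t ^ 4 := by positivity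
  linarith

theorem sum_K2_Rot (θ : ℝ) (p q z : Plane) {t : ℝ} (ht : 0 < t) :
    K2 (Rot θ (e 0)) (Rot θ (e 0)) p q z t + K2 (Rot θ (e 1)) (Rot θ (e 1)) p q z t =
      lapG z t * ⟪p, q⟫ + ∫ σ in Ioi (0 : ℝ), dt2 p q z (t + σ) := by
  have h := sum_d2_Rot θ z ht.ne'
  rw [Fin.sum_univ_two] at h
  rw [← integral_Ioi_shift (dt2 p q z), ← h, K2, K2]
  have : ∫ s in Ioi t, dt2 p q z s = (∫ s in Ioi t, d4 (Rot θ (e 0)) (Rot θ (e 0)) p q z s) +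
      ∫ s in Ioi t, d4 (Rot θ (e 1)) (Rot θ (e 1)) p q z s := by
    rw [← integral_add (integrableOn_d4 _ _ _ _ _ ht).1 (integrableOn_d4 _ _ _ _ _ ht).1]
    simp only [sum_d4_Rot]
  rw [this]; ring

/-- The pointwise bounds for the derivatives of the Gauss kernel, uniform in space. -/
theorem sg_zero_anti {c s : ℝ} (hc : 0 < c) (h : c ≤ s) (z : Plane) : sg z s ≤ sg 0 c :=
  (sg_le_sg_zero z (hc.trans_le h)).trans (sg_anti 0 hc h)

theorem integrableOn_sg_zero_shift (n : ℕ) {c : ℝ} (hc : 0 < c) :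
    IntegrableOn (fun σ => sg 0 (c + σ) ^ (n + 3)) (Ioi 0) :=
  (integrableOn_Ioi_shift (fun s => sg 0 s ^ (n + 3)) c).2
    (integrableOn_sg_pow 0 n hc.le (by positivity)).1

/-- The chain rule when direction, position and time all move. It covers both the rotating frame and
straight lines. By the heat equation the time contribution is a Laplacian, so no separate time
derivative of K appears. -/
theorem hasDerivAt_Kk_curve {p z : ℝ → Plane} {s : ℝ → ℝ} {p' z' : ℝ → Plane} (q : Plane)
    {s' t δ B c : ℝ} (hδ : 0 < δ) (hc : 0 < c)
    (hp : ∀ τ, HasDerivAt p (p' τ) τ) (hz : ∀ τ, HasDerivAt z (z' τ) τ)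
    (hs : ∀ τ, HasDerivAt s s' τ) (hsc : ∀ τ ∈ Metric.ball t δ, c ≤ s τ) (hs' : |s'| ≤ 1)
    (bp : ∀ τ ∈ Metric.ball t δ, ‖p τ‖ ≤ B) (bp' : ∀ τ ∈ Metric.ball t δ, ‖p' τ‖ ≤ B)
    (bz' : ∀ τ ∈ Metric.ball t δ, ‖z' τ‖ ≤ B) :
    HasDerivAt (fun τ => Kk (p τ) q (z τ) (s τ))
      (Kk (p' t) q (z t) (s t) + K1 (z' t) (p t) q (z t) (s t) + s' *
        (K2 (e 0) (e 0) (p t) q (z t) (s t) + K2 (e 1) (e 1) (p t) q (z t) (s t))) t := by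
  have hC := CK_pos
  have ht : t ∈ Metric.ball t δ := Metric.mem_ball_self hδ
  have hst : 0 < s t := hc.trans_le (hsc t ht)
  have hB : 0 ≤ B := (norm_nonneg _).trans (bp t ht)
  have hcz : Continuous z := continuous_iff_continuousAt.2 fun τ => (hz τ).continuousAt
  have hcp : Continuous p := continuous_iff_continuousAt.2 fun τ => (hp τ).continuousAt
  set bound : ℝ → ℝ := fun σ => CK * (B * ‖q‖) * sg 0 (c + σ) ^ 4 +
    CK * (B * B * ‖q‖) * sg 0 (c + σ) ^ 5 + 2 * CK * (B * ‖q‖) * sg 0 (c + σ) ^ 6 with hbound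
  have key := hasDerivAt_integral_of_dominated_loc_of_deriv_le (μ := volume.restrict (Ioi (0 : ℝ)))
    (F := fun τ σ => d2 (p τ) q (z τ) (s τ + σ))
    (F' := fun τ σ => d2 (p' τ) q (z τ) (s τ + σ) + d3 (z' τ) (p τ) q (z τ) (s τ + σ) +
      s' * dt2 (p τ) q (z τ) (s τ + σ)) (bound := bound) (Metric.ball_mem_nhds t hδ)
    (Eventually.of_forall fun τ => Measurable.aestronglyMeasurable (by fun_prop))
    ((integrableOn_Ioi_shift (d2 (p t) q (z t)) (s t)).2 (integrableOn_d2 _ _ _ hst).1)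
    (Measurable.aestronglyMeasurable (by unfold dt2 d4; fun_prop)) ?_ ?_ ?_
  · have h1 := (((hp t).inner ℝ (hasDerivAt_const t q)))
    have h2 := ((hasDerivAt_gauss_curve (hz t) (hs t) hst.ne').mul h1).add key.2
    have e1 : (fun τ => Kk (p τ) q (z τ) (s τ)) = fun τ =>
        gauss (z τ) (s τ) * ⟪p τ, q⟫ + ∫ σ in Ioi (0 : ℝ), d2 (p τ) q (z τ) (s τ + σ) :=
      funext fun τ => Kk_eq_shift _ _ _ _
    rw [e1]
    refine h2.congr_deriv ?_
    have i2 := (integrableOn_Ioi_shift (d2 (p' t) q (z t)) (s t)).2 (integrableOn_d2 _ _ _ hst).1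
    have i3 := (integrableOn_Ioi_shift (d3 (z' t) (p t) q (z t)) (s t)).2
      (integrableOn_d3 _ _ _ _ hst).1
    have i4 : IntegrableOn (fun σ => dt2 (p t) q (z t) (s t + σ)) (Ioi 0) :=
      (integrableOn_Ioi_shift (dt2 (p t) q (z t)) (s t)).2
        ((integrableOn_d4 _ _ _ _ _ hst).1.add (integrableOn_d4 _ _ _ _ _ hst).1)
    have h3 := sum_K2_Rot 0 (p t) q (z t) hst
    simp only [Rot_zero] at h3
    have eI := integral_add (f := fun σ => d2 (p' t) q (z t) (s t + σ) +
      d3 (z' t) (p t) q (z t) (s t + σ)) (i2.add i3) (i4.const_mul s')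
    have eJ := integral_add (f := fun σ => d2 (p' t) q (z t) (s t + σ))
      (g := fun σ => d3 (z' t) (p t) q (z t) (s t + σ)) i2 i3
    rw [h3, Kk_eq_shift, K1_eq_shift, eI, eJ, integral_const_mul]
    simp
    ring
  · filter_upwards [ae_restrict_mem measurableSet_Ioi] with σ hσ τ hτ
    have hσ : 0 < σ := hσ
    have hle : c + σ ≤ s τ + σ := by linarith [hsc τ hτ]
    have h0 : 0 < s τ + σ := by linarith [hsc τ hτ]
    have hsg := sg_zero_anti (by linarith) hle (z τ)
    have hsg0 := sg_nonneg (z τ) (s τ + σ)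
    have b1 := abs_d2_le (p' τ) q (z τ) h0
    have b2 := abs_d3_le (z' τ) (p τ) q (z τ) h0
    have b3 : |dt2 (p τ) q (z τ) (s τ + σ)| ≤ 2 * CK * (‖p τ‖ * ‖q‖) * sg (z τ) (s τ + σ) ^ 6 := by
      have c1 := abs_d4_le (e 0) (e 0) (p τ) q (z τ) h0
      have c2 := abs_d4_le (e 1) (e 1) (p τ) q (z τ) h0
      simp only [norm_e, one_mul] at c1 c2
      refine (abs_add_le _ _).trans ?_
      linarith
    have b3' : |s' * dt2 (p τ) q (z τ) (s τ + σ)| ≤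
        2 * CK * (‖p τ‖ * ‖q‖) * sg (z τ) (s τ + σ) ^ 6 := by
      rw [abs_mul]
      exact (mul_le_of_le_one_left (abs_nonneg _) hs').trans b3
    have hp1 := bp τ hτ
    have hp2 := bp' τ hτ
    have hz2 := bz' τ hτ
    refine (norm_add_le _ _).trans (add_le_add ((norm_add_le _ _).trans (add_le_add ?_ ?_)) ?_)
    · refine b1.trans ?_; gcongr
    · refine b2.trans ?_; gcongr
    · refine b3'.trans ?_; gcongr
  · exact (((integrableOn_sg_zero_shift 1 hc).const_mul _).add
      ((integrableOn_sg_zero_shift 2 hc).const_mul _)).add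
      ((integrableOn_sg_zero_shift 3 hc).const_mul _)
  · filter_upwards [ae_restrict_mem measurableSet_Ioi] with σ hσ τ hτ
    have hσ : 0 < σ := hσ
    exact hasDerivAt_d2_curve q (hp τ) (hz τ) ((hs τ).add_const σ)
      (ne_of_gt (by have := hsc τ hτ; linarith))

theorem hasDerivAt_line (z o : Plane) (τ : ℝ) : HasDerivAt (fun τ : ℝ => z + τ • o) o τ := by
  simpa using ((hasDerivAt_id τ).smul_const o).const_add z

theorem hasLineDerivAt_Kk (v p q z : Plane) {t : ℝ} (ht : 0 < t) :
    HasLineDerivAt ℝ (fun z => Kk p q z t) (K1 v p q z t) z v := by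
  have h := hasDerivAt_Kk_curve q (p := fun _ => p) (p' := fun _ => 0) (s := fun _ => t) (s' := 0)
    (t := 0) (δ := 1) (B := max ‖p‖ ‖v‖) one_pos ht (fun τ => hasDerivAt_const τ p)
    (hasDerivAt_line z v) (fun τ => hasDerivAt_const τ t) (fun _ _ => le_rfl) (by simp) (fun _ _ => le_max_left _ _)
    (fun _ _ => by simp) (fun _ _ => le_max_right _ _)
  have h0 : Kk 0 q (z + (0 : ℝ) • v) t = 0 := by
    have := Kk_lin_left 0 0 q (z + (0 : ℝ) • v) 0 0 ht
    simpa using this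
  rw [HasLineDerivAt]
  exact h.congr_deriv (by rw [h0]; simp)

theorem hasDerivAt_comp_line {f : Plane → ℝ} (hf : ContDiff ℝ (⊤ : ℕ∞) f) (z o : Plane) (τ : ℝ) :
    HasDerivAt (fun τ : ℝ => f (z + τ • o)) (fderiv ℝ f (z + τ • o) o) τ :=
  (hf.differentiable (by simp) (z + τ • o)).hasFDerivAt.comp_hasDerivAt τ (hasDerivAt_line z o τ)

theorem hasLineDerivAt_integral_d3 (o q p r z : Plane) {t : ℝ} (ht : 0 < t) :
    HasDerivAt (fun τ : ℝ => ∫ s in Ioi t, d3 q p r (z + τ • o) s)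
      (∫ s in Ioi t, d4 o q p r (z + (0 : ℝ) • o) s) 0 := by
  have hC := CK_pos
  have D : ∀ s τ, HasDerivAt (fun τ : ℝ => d3 q p r (z + τ • o) s) (d4 o q p r (z + τ • o) s) τ :=
    fun s τ => (hasDerivAt_comp_line (contDiff_d3 q p r s) z o τ).congr_deriv (fderiv_d3 _ _ _ _ _ _)
  have hm : Measurable (d4 o q p r (z + (0 : ℝ) • o)) := by unfold d4; fun_prop
  refine (hasDerivAt_integral_of_dominated_loc_of_deriv_le (μ := volume.restrict (Ioi t))
    (x₀ := (0 : ℝ)) (F := fun (τ : ℝ) s => d3 q p r (z + τ • o) s)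
    (F' := fun (τ : ℝ) s => d4 o q p r (z + τ • o) s)
    (bound := fun s => CK * (‖o‖ * ‖q‖ * ‖p‖ * ‖r‖) * sg 0 s ^ 6) (s := univ) univ_mem
    (Eventually.of_forall fun τ => Measurable.aestronglyMeasurable (by fun_prop))
    (integrableOn_d3 _ _ _ _ ht).1 hm.aestronglyMeasurable ?_
    ((integrableOn_sg_pow 0 3 ht.le (by positivity)).1.const_mul _)
    (Eventually.of_forall fun s τ _ => D s τ)).2
  filter_upwards [ae_restrict_mem measurableSet_Ioi] with s hs τ _
  have h0 : 0 < s := ht.trans hs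
  refine (abs_d4_le _ _ _ _ _ h0).trans ?_
  gcongr
  · exact sg_nonneg _ _
  · exact sg_le_sg_zero _ h0

theorem hasLineDerivAt_K1 (o q p r z : Plane) {t : ℝ} (ht : 0 < t) :
    HasLineDerivAt ℝ (fun z => K1 q p r z t) (K2 o q p r z t) z o := by
  have D1 := (hasDerivAt_comp_line (contDiff_d1 q t) z o 0).congr_deriv (fderiv_d1 _ _ _ _)
  have h := (D1.mul_const ⟪p, r⟫).add (hasLineDerivAt_integral_d3 o q p r z ht)
  exact h.congr_deriv (by simp [K2])

/-! ### Schwartz fields -/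

/-- The Schwartz field `(x^⊥)_i φ(x)`. -/
def mulPerp (i : Fin 2) (φ : 𝓢(Plane, Plane)) : 𝓢(Plane, Plane) :=
  SchwartzMap.smulLeftCLM Plane (fun x : Plane => perp x i) φ

theorem mulPerp_apply (i : Fin 2) (φ : 𝓢(Plane, Plane)) (x : Plane) :
    mulPerp i φ x = perp x i • φ x := by
  have h : Function.HasTemperateGrowth (fun x : Plane => perp x i) :=
    ((EuclideanSpace.proj i : Plane →L[ℝ] ℝ).comp perpL).hasTemperateGrowth
  rw [mulPerp, SchwartzMap.smulLeftCLM_apply_apply h]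

/-- The i-th component of x^⊥ does not depend on the i-th coordinate. Thus x^⊥·∇φ can be written as
a sum of derivatives of Schwartz fields, ready for integration by parts. -/
theorem lineDeriv_mulPerp (i : Fin 2) (φ : 𝓢(Plane, Plane)) (x : Plane) :
    ∂_{e i} (mulPerp i φ) x = perp x i • fderiv ℝ φ x (e i) := by
  have h1 : HasFDerivAt (fun x : Plane => perp x i)
    ((EuclideanSpace.proj i : Plane →L[ℝ] ℝ).comp perpL) x :=
    ((EuclideanSpace.proj i : Plane →L[ℝ] ℝ).comp perpL).hasFDerivAt
  have h2 := h1.smul (φ.hasFDerivAt x)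
  have h3 : HasFDerivAt (mulPerp i φ) _ x :=
    h2.congr_of_eventuallyEq (Eventually.of_forall fun y => mulPerp_apply i φ y)
  rw [SchwartzMap.lineDerivOp_apply_eq_fderiv, h3.fderiv]
  fin_cases i <;> simp [perp, e]

theorem sum_lineDeriv_mulPerp (φ : 𝓢(Plane, Plane)) (x : Plane) :
    ∂_{e 0} (mulPerp 0 φ) x + ∂_{e 1} (mulPerp 1 φ) x = fderiv ℝ φ x (perp x) := by
  rw [lineDeriv_mulPerp, lineDeriv_mulPerp, ← map_smul, ← map_smul, ← map_add]
  have := sum_smul_e (perp x)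
  rw [Fin.sum_univ_two] at this
  rw [this]

/-- The basis `e_i` as an orthonormal basis. -/
theorem laplacian_eq (φ : 𝓢(Plane, Plane)) (x : Plane) :
    Laplacian.laplacian (φ : Plane → Plane) x = ∂_{e 0} (∂_{e 0} φ) x + ∂_{e 1} (∂_{e 1} φ) x := by
  rw [← SchwartzMap.laplacian_apply, SchwartzMap.laplacian_eq_sum (EuclideanSpace.basisFun (Fin 2) ℝ)]
  simp [Fin.sum_univ_two, e]

/-- The operator `𝓛_α` on Schwartz fields. -/
def rotS (α : ℝ) (φ : 𝓢(Plane, Plane)) : 𝓢(Plane, Plane) :=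
  -(∂_{e 0} (∂_{e 0} φ) + ∂_{e 1} (∂_{e 1} φ)) -
    α • (∂_{e 0} (mulPerp 0 φ) + ∂_{e 1} (mulPerp 1 φ) - SchwartzMap.postcompCLM perpL φ)

theorem rotS_apply (α : ℝ) (φ : 𝓢(Plane, Plane)) (x : Plane) :
    rotS α φ x = rotOp α φ x := by
  rw [rotOp, laplacian_eq, ← sum_lineDeriv_mulPerp]
  simp [rotS]

theorem integrable_form (X : 𝓢(Plane, Plane)) {κ : Plane → Plane → ℝ} {M : ℝ}
    (hl : ∀ p x, κ p x = ∑ j, p j * κ (e j) x) (hm : ∀ j, Measurable (κ (e j)))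
    (hb : ∀ j x, |κ (e j) x| ≤ M) :
    Integrable (fun x => κ (X x) x) ∧ ∀ j, Integrable fun x => X x j * κ (e j) x := by
  have hj : ∀ j, Integrable fun x => X x j * κ (e j) x := fun j => by
    refine ((X.integrable (μ := volume)).norm.mul_const M).mono' ?_ ?_
    · have : Measurable fun x => X x j := by
        have := X.continuous; fun_prop
      exact (this.mul (hm j)).aestronglyMeasurable
    · refine Eventually.of_forall fun x => ?_
      rw [norm_mul]
      exact mul_le_mul (PiLp.norm_apply_le _ _) (hb j x) (norm_nonneg _) (norm_nonneg _)
  refine ⟨?_, hj⟩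
  simp_rw [hl (X _)]
  exact integrable_finsetSum _ fun j _ => hj j

/-- Linearity in the vector argument reduces the claim to scalar coordinates, where bounded kernels
against Schwartz functions leave no boundary terms. -/
theorem integral_form_lineDeriv (X : 𝓢(Plane, Plane)) (v : Plane) {κ κ' : Plane → Plane → ℝ} {M : ℝ}
    (hl : ∀ p x, κ p x = ∑ j, p j * κ (e j) x) (hl' : ∀ p x, κ' p x = ∑ j, p j * κ' (e j) x)
    (hd : ∀ j x, HasLineDerivAt ℝ (κ (e j)) (κ' (e j) x) x v)
    (hm : ∀ j, Measurable (κ (e j))) (hm' : ∀ j, Measurable (κ' (e j)))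
    (hb : ∀ j x, |κ (e j) x| ≤ M) (hb' : ∀ j x, |κ' (e j) x| ≤ M) :
    ∫ x, κ (∂_{v} X x) x = -∫ x, κ' (X x) x := by
  obtain ⟨-, i1⟩ := integrable_form (∂_{v} X) hl hm hb
  obtain ⟨-, i2⟩ := integrable_form X hl' hm' hb'
  obtain ⟨-, i3⟩ := integrable_form X hl hm hb
  simp_rw [hl (∂_{v} X _), hl' (X _)]
  rw [integral_finsetSum _ fun j _ => i1 j, integral_finsetSum _ fun j _ => i2 j,
    ← Finset.sum_neg_distrib]
  refine Finset.sum_congr rfl fun j _ => ?_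
  have hX : ∀ x, HasLineDerivAt ℝ (fun x => X x j) (∂_{v} X x j) x v := fun x =>
    ((EuclideanSpace.proj j : Plane →L[ℝ] ℝ).hasFDerivAt.comp x (X.hasFDerivAt x)).hasLineDerivAt v
  have key := integral_bilinear_hasLineDerivAt_right_eq_neg_left_of_integrable
    (B := ContinuousLinearMap.mul ℝ ℝ) (μ := volume) (f := fun x => X x j) (f' := fun x => ∂_{v} X x j)
    (g := κ (e j)) (g' := κ' (e j)) (v := v) (i1 j) (i2 j) (i3 j) (fun x _ => hX x) (fun x _ => hd j x)
  simp only [ContinuousLinearMap.mul_apply'] at key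
  rw [key, neg_neg]

/-! ### The rotating kernel and its derivatives -/

/-- The derivative in the direction `v` of `x ↦ kap α x y a b t`. -/
def kap1 (α : ℝ) (x y v a b : Plane) (t : ℝ) : ℝ :=
  K1 (Rot (α * t) v) (Rot (α * t) a) b (Rot (α * t) x - y) t

/-- The derivative in the direction `w` of `x ↦ kap1 α x y v a b t`. -/
def kap2 (α : ℝ) (x y w v a b : Plane) (t : ℝ) : ℝ :=
  K2 (Rot (α * t) w) (Rot (α * t) v) (Rot (α * t) a) b (Rot (α * t) x - y) t

theorem hasDerivAt_Rot (α : ℝ) (v : Plane) (t : ℝ) :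
    HasDerivAt (fun t => Rot (α * t) v) (Rot (α * t) (α • perp v)) t := by
  have h1 : HasDerivAt (fun t : ℝ => α * t) α t := by simpa using (hasDerivAt_id t).const_mul α
  refine ((h1.cos.smul_const v).add (h1.sin.smul_const (perp v))).congr_deriv ?_
  ext i; fin_cases i <;> simp <;> ring

/-- Differentiating O(αt)a and O(αt)x yields the zeroth-order and transport terms of the rotating
operator, and the explicit time dependence yields the Laplacian. -/
theorem hasDerivAt_kap (α : ℝ) (x y a b : Plane) {t : ℝ} (ht : 0 < t) :
    HasDerivAt (kap α x y a b) (kap α x y (α • perp a) b t + kap1 α x y (α • perp x) a b t +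
      (kap2 α x y (e 0) (e 0) a b t + kap2 α x y (e 1) (e 1) a b t)) t := by
  -- The radius t/2 keeps the time at least t/2 in the neighbourhood; rotations preserve norms, so
  -- one bound serves all angles.
  have h := hasDerivAt_Kk_curve b (p := fun t => Rot (α * t) a)
    (p' := fun t => Rot (α * t) (α • perp a)) (z := fun t => Rot (α * t) x - y)
    (z' := fun t => Rot (α * t) (α • perp x)) (s := fun t => t) (s' := 1) (t := t) (δ := t / 2)
    (B := max ‖a‖ (max ‖α • perp a‖ ‖α • perp x‖)) (c := t / 2) (half_pos ht) (half_pos ht)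
    (hasDerivAt_Rot α a) (fun τ => (hasDerivAt_Rot α x τ).sub_const y) (fun τ => hasDerivAt_id τ)
    (fun τ hτ => by
      rw [Metric.mem_ball, Real.dist_eq] at hτ
      linarith [(abs_lt.1 hτ).1]) (by simp) (fun τ _ => by rw [norm_Rot]; exact le_max_left _ _)
    (fun τ _ => by rw [norm_Rot]; exact (le_max_left _ _).trans (le_max_right _ _))
    (fun τ _ => by rw [norm_Rot]; exact (le_max_right _ _).trans (le_max_right _ _))
  refine h.congr_deriv ?_
  have h3 := sum_K2_Rot 0 (Rot (α * t) a) b (Rot (α * t) x - y) ht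
  simp only [Rot_zero] at h3
  rw [h3, kap2, kap2, sum_K2_Rot _ _ _ _ ht, one_mul]
  rfl

theorem hasLineDerivAt_comp_Rot {f : Plane → ℝ} {f' : ℝ} {θ : ℝ} {x y v : Plane}
    (h : HasLineDerivAt ℝ f f' (Rot θ x - y) (Rot θ v)) :
    HasLineDerivAt ℝ (fun x => f (Rot θ x - y)) f' x v := by
  rw [HasLineDerivAt] at h ⊢
  convert h using 2 with τ
  rw [Rot_add, Rot_smul]
  abel_nf

theorem hasLineDerivAt_kap (α : ℝ) (x y v a b : Plane) {t : ℝ} (ht : 0 < t) :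
    HasLineDerivAt ℝ (fun x => kap α x y a b t) (kap1 α x y v a b t) x v :=
  hasLineDerivAt_comp_Rot (f := fun z => Kk (Rot (α * t) a) b z t) (hasLineDerivAt_Kk _ _ _ _ ht)

theorem hasLineDerivAt_kap1 (α : ℝ) (x y w v a b : Plane) {t : ℝ} (ht : 0 < t) :
    HasLineDerivAt ℝ (fun x => kap1 α x y v a b t) (kap2 α x y w v a b t) x w :=
  hasLineDerivAt_comp_Rot (f := fun z => K1 (Rot (α * t) v) (Rot (α * t) a) b z t)
    (hasLineDerivAt_K1 _ _ _ _ _ ht)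

theorem abs_K2_le (o q p r z : Plane) {t : ℝ} (ht : 0 < t) :
    |K2 o q p r z t| ≤ 2 * CK * (‖o‖ * ‖q‖ * ‖p‖ * ‖r‖) * sg z t ^ 4 := by
  have h1 := (integrableOn_d4 o q p r z ht).2
  have h2 := abs_mul_le (abs_d2_le o q z ht) (abs_inner_le p r)
  unfold K2
  refine (abs_add_le _ _).trans ?_
  linarith

theorem Rot_expand (θ : ℝ) (a : Plane) : Rot θ a = a 0 • Rot θ (e 0) + a 1 • Rot θ (e 1) := by
  have := sum_smul_e a
  rw [Fin.sum_univ_two] at this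
  conv_lhs => rw [← this]
  rw [Rot_add, Rot_smul, Rot_smul]

theorem K1_lin_mid (q p p' r z : Plane) (c c' : ℝ) {t : ℝ} (ht : 0 < t) :
    K1 q (c • p + c' • p') r z t = c * K1 q p r z t + c' * K1 q p' r z t := by
  have h : ∀ s, d3 q (c • p + c' • p') r z s = c * d3 q p r z s + c' * d3 q p' r z s := fun s => by
    simp only [d3, inner_add_left, inner_add_right, real_inner_smul_left, real_inner_smul_right]
    ring
  simp only [K1, h]
  rw [integral_add ((integrableOn_d3 q p r z ht).1.const_mul c)
    ((integrableOn_d3 q p' r z ht).1.const_mul c'), integral_const_mul, integral_const_mul]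
  simp only [inner_add_left, real_inner_smul_left]
  ring

theorem K2_lin_mid (o q p p' r z : Plane) (c c' : ℝ) {t : ℝ} (ht : 0 < t) :
    K2 o q (c • p + c' • p') r z t = c * K2 o q p r z t + c' * K2 o q p' r z t := by
  have h : ∀ s, d4 o q (c • p + c' • p') r z s = c * d4 o q p r z s + c' * d4 o q p' r z s :=
    fun s => by
      simp only [d4, inner_add_left, inner_add_right, real_inner_smul_left, real_inner_smul_right]
      ring
  simp only [K2, h]
  rw [integral_add ((integrableOn_d4 o q p r z ht).1.const_mul c)
    ((integrableOn_d4 o q p' r z ht).1.const_mul c'), integral_const_mul, integral_const_mul]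
  simp only [inner_add_left, real_inner_smul_left]
  ring

section forms
variable (α : ℝ) (x y w v a b : Plane) {t : ℝ}

theorem kap_lin (ht : 0 < t) : kap α x y a b t = ∑ j, a j * kap α x y (e j) b t := by
  simp only [Fin.sum_univ_two, kap]; rw [Rot_expand, Kk_lin_left _ _ _ _ _ _ ht]

theorem kap1_lin (ht : 0 < t) : kap1 α x y v a b t = ∑ j, a j * kap1 α x y v (e j) b t := by
  simp only [Fin.sum_univ_two, kap1]; rw [Rot_expand _ a, K1_lin_mid _ _ _ _ _ _ _ ht]

theorem kap1_lin_left (ht : 0 < t) : kap1 α x y v a b t = ∑ j, v j * kap1 α x y (e j) a b t := by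
  simp only [Fin.sum_univ_two, kap1]; rw [Rot_expand _ v, K1_lin_left _ _ _ _ _ _ _ ht]

theorem kap2_lin (ht : 0 < t) : kap2 α x y w v a b t = ∑ j, a j * kap2 α x y w v (e j) b t := by
  simp only [Fin.sum_univ_two, kap2]; rw [Rot_expand _ a, K2_lin_mid _ _ _ _ _ _ _ _ ht]

theorem abs_kap_le_of_le {c : ℝ} (hc : 0 < c) (h : c ≤ t) :
    |kap α x y a b t| ≤ 2 * CK * (‖a‖ * ‖b‖) * sg 0 c ^ 2 := by
  have hC := CK_pos
  refine (abs_kap_le α x y a b (hc.trans_le h)).trans ?_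
  gcongr
  · exact sg_nonneg _ _
  · exact sg_zero_anti hc h _

theorem abs_kap1_le_of_le {c : ℝ} (hc : 0 < c) (h : c ≤ t) :
    |kap1 α x y v a b t| ≤ 2 * CK * (‖v‖ * ‖a‖ * ‖b‖) * sg 0 c ^ 3 := by
  have hC := CK_pos
  have := abs_K1_le (Rot (α * t) v) (Rot (α * t) a) b (Rot (α * t) x - y) (hc.trans_le h)
  rw [norm_Rot, norm_Rot] at this
  refine this.trans ?_
  gcongr
  · exact sg_nonneg _ _
  · exact sg_zero_anti hc h _

theorem abs_kap2_le_of_le {c : ℝ} (hc : 0 < c) (h : c ≤ t) :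
    |kap2 α x y w v a b t| ≤ 2 * CK * (‖w‖ * ‖v‖ * ‖a‖ * ‖b‖) * sg 0 c ^ 4 := by
  have hC := CK_pos
  have := abs_K2_le (Rot (α * t) w) (Rot (α * t) v) (Rot (α * t) a) b (Rot (α * t) x - y)
    (hc.trans_le h)
  rw [norm_Rot, norm_Rot, norm_Rot] at this
  refine this.trans ?_
  gcongr
  · exact sg_nonneg _ _
  · exact sg_zero_anti hc h _

end forms

section measurability
variable {X : Type*} [MeasurableSpace X] {o p q r z : X → Plane} {t : X → ℝ}

@[fun_prop] theorem Measurable.d4 (ho : Measurable o) (hp : Measurable p) (hq : Measurable q)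
    (hr : Measurable r) (hz : Measurable z) (ht : Measurable t) :
    Measurable fun x => d4 (o x) (p x) (q x) (r x) (z x) (t x) := by
  unfold RotStokes.d4; fun_prop

@[fun_prop] theorem Measurable.K2 (ho : Measurable o) (hp : Measurable p) (hq : Measurable q)
    (hr : Measurable r) (hz : Measurable z) (ht : Measurable t) :
    Measurable fun x => K2 (o x) (p x) (q x) (r x) (z x) (t x) := by
  have h : ∀ x, ∫ s in Ioi (t x), RotStokes.d4 (o x) (p x) (q x) (r x) (z x) s =
      ∫ σ in Ioi (0 : ℝ), RotStokes.d4 (o x) (p x) (q x) (r x) (z x) (t x + σ) :=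
    fun x => integral_Ioi_shift _ _
  simp only [RotStokes.K2, h]
  refine ((Measurable.d2 ho hp hz ht).mul (hq.inner hr)).add ?_
  refine (StronglyMeasurable.integral_prod_right
    (f := fun x σ => RotStokes.d4 (o x) (p x) (q x) (r x) (z x) (t x + σ)) ?_).measurable
  refine Measurable.stronglyMeasurable ?_
  simp only [Function.uncurry_def]
  fun_prop

end measurability

@[fun_prop] theorem measurable_schwartz {F : Type*} [NormedAddCommGroup F] [NormedSpace ℝ F]
    [MeasurableSpace F] [BorelSpace F] (φ : 𝓢(Plane, F)) : Measurable φ := φ.continuous.measurable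

/-! ### The semigroup identity -/

/-- The time derivative of `kap α x y (φ x) b t`. -/
def kapD (α : ℝ) (φ : Plane → Plane) (y b x : Plane) (t : ℝ) : ℝ :=
  kap α x y (α • perp (φ x)) b t + kap1 α x y (α • perp x) (φ x) b t +
    (kap2 α x y (e 0) (e 0) (φ x) b t + kap2 α x y (e 1) (e 1) (φ x) b t)

section schwartz
variable (α : ℝ) (φ : 𝓢(Plane, Plane)) (y b : Plane) {t : ℝ}

theorem integrable_kap_schwartz (ht : 0 < t) : Integrable (fun x => kap α x y (φ x) b t) :=
  (integrable_form φ (κ := fun p x => kap α x y p b t) (M := 2 * CK * (1 * ‖b‖) * sg 0 t ^ 2)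
    (fun p x => kap_lin α x y p b ht) (fun j => by unfold kap; fun_prop)
    (fun j x => by have := abs_kap_le_of_le α x y (e j) b ht le_rfl; rwa [norm_e] at this)).1

theorem integrable_kap1_schwartz (i : Fin 2) (ht : 0 < t) :
    Integrable (fun x => kap1 α x y (e i) (φ x) b t) :=
  (integrable_form φ (κ := fun p x => kap1 α x y (e i) p b t)
    (M := 2 * CK * (1 * 1 * ‖b‖) * sg 0 t ^ 3)
    (fun p x => kap1_lin α x y (e i) p b ht) (fun j => by unfold kap1; fun_prop)
    (fun j x => by
      have := abs_kap1_le_of_le α x y (e i) (e j) b ht le_rfl; rwa [norm_e, norm_e] at this)).1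

theorem integrable_kap2_schwartz (i : Fin 2) (ht : 0 < t) :
    Integrable (fun x => kap2 α x y (e i) (e i) (φ x) b t) :=
  (integrable_form φ (κ := fun p x => kap2 α x y (e i) (e i) p b t)
    (M := 2 * CK * (1 * 1 * 1 * ‖b‖) * sg 0 t ^ 4)
    (fun p x => kap2_lin α x y (e i) (e i) p b ht) (fun j => by unfold kap2; fun_prop)
    (fun j x => by
      have := abs_kap2_le_of_le α x y (e i) (e i) (e j) b ht le_rfl
      rwa [norm_e, norm_e] at this)).1

theorem integral_kap_lineDeriv (i : Fin 2) (ht : 0 < t) :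
    ∫ x, kap α x y (∂_{e i} φ x) b t = -∫ x, kap1 α x y (e i) (φ x) b t :=
  integral_form_lineDeriv φ (e i) (κ := fun p x => kap α x y p b t)
    (κ' := fun p x => kap1 α x y (e i) p b t)
    (M := max (2 * CK * (1 * ‖b‖) * sg 0 t ^ 2) (2 * CK * (1 * 1 * ‖b‖) * sg 0 t ^ 3))
    (fun p x => kap_lin α x y p b ht) (fun p x => kap1_lin α x y (e i) p b ht)
    (fun j x => hasLineDerivAt_kap α x y (e i) (e j) b ht) (fun j => by unfold kap; fun_prop)
    (fun j => by unfold kap1; fun_prop)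
    (fun j x => by
      have := abs_kap_le_of_le α x y (e j) b ht le_rfl
      rw [norm_e] at this; exact this.trans (le_max_left _ _))
    (fun j x => by
      have := abs_kap1_le_of_le α x y (e i) (e j) b ht le_rfl
      rw [norm_e, norm_e] at this; exact this.trans (le_max_right _ _))

theorem integral_kap1_lineDeriv (i : Fin 2) (ht : 0 < t) :
    ∫ x, kap1 α x y (e i) (∂_{e i} φ x) b t = -∫ x, kap2 α x y (e i) (e i) (φ x) b t :=
  integral_form_lineDeriv φ (e i) (κ := fun p x => kap1 α x y (e i) p b t)
    (κ' := fun p x => kap2 α x y (e i) (e i) p b t)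
    (M := max (2 * CK * (1 * 1 * ‖b‖) * sg 0 t ^ 3) (2 * CK * (1 * 1 * 1 * ‖b‖) * sg 0 t ^ 4))
    (fun p x => kap1_lin α x y (e i) p b ht) (fun p x => kap2_lin α x y (e i) (e i) p b ht)
    (fun j x => hasLineDerivAt_kap1 α x y (e i) (e i) (e j) b ht)
    (fun j => by unfold kap1; fun_prop) (fun j => by unfold kap2; fun_prop)
    (fun j x => by
      have := abs_kap1_le_of_le α x y (e i) (e j) b ht le_rfl
      rw [norm_e, norm_e] at this; exact this.trans (le_max_left _ _))
    (fun j x => by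
      have := abs_kap2_le_of_le α x y (e i) (e i) (e j) b ht le_rfl
      rw [norm_e, norm_e] at this; exact this.trans (le_max_right _ _))

theorem kap_smul (x a : Plane) (c : ℝ) (ht : 0 < t) :
    kap α x y (c • a) b t = c * kap α x y a b t := by
  rw [kap_lin _ _ _ _ _ ht, kap_lin α x y a b ht]; simp [Fin.sum_univ_two]; ring

/-- The coefficient x^⊥ is shifted from the direction of differentiation onto the test field, so
that the transport term has constant directions. -/
theorem kap1_perp (x : Plane) (ht : 0 < t) :
    kap1 α x y (α • perp x) (φ x) b t =
      α * (kap1 α x y (e 0) (mulPerp 0 φ x) b t + kap1 α x y (e 1) (mulPerp 1 φ x) b t) := by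
  have h : ∀ i, kap1 α x y (e i) (mulPerp i φ x) b t = perp x i * kap1 α x y (e i) (φ x) b t := by
    intro i
    rw [kap1_lin _ _ _ _ _ _ ht, kap1_lin α x y (e i) (φ x) b ht, mulPerp_apply]
    simp [Fin.sum_univ_two]; ring
  rw [h, h, kap1_lin_left _ _ _ _ _ _ ht]
  simp [Fin.sum_univ_two]; ring

theorem kap_rotS (x : Plane) (ht : 0 < t) :
    kap α x y (rotS (-α) φ x) b t =
      -(kap α x y (∂_{e 0} (∂_{e 0} φ) x) b t + kap α x y (∂_{e 1} (∂_{e 1} φ) x) b t) +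
      α * (kap α x y (∂_{e 0} (mulPerp 0 φ) x) b t + kap α x y (∂_{e 1} (mulPerp 1 φ) x) b t) -
      α * kap α x y (SchwartzMap.postcompCLM perpL φ x) b t := by
  have hl := fun p => kap_lin α x y p b ht
  rw [hl (rotS _ _ _), hl (∂_{e 0} (∂_{e 0} φ) x), hl (∂_{e 1} (∂_{e 1} φ) x),
    hl (∂_{e 0} (mulPerp 0 φ) x), hl (∂_{e 1} (mulPerp 1 φ) x), hl (SchwartzMap.postcompCLM _ _ _)]
  simp only [Fin.sum_univ_two]
  simp [rotS]
  ring

/-- Adjointness: two integrations by parts for the Laplacian and one for the transport term move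
every derivative from the kernel onto the test field. The sign of α is reversed in the process. -/
theorem integral_kapD (ht : 0 < t) :
    Integrable (fun x => kapD α φ y b x t) ∧
      ∫ x, kapD α φ y b x t = -∫ x, kap α x y (rotS (-α) φ x) b t := by
  have e0 : ∀ x, kapD α φ y b x t = α * kap α x y (SchwartzMap.postcompCLM perpL φ x) b t +
      α * (kap1 α x y (e 0) (mulPerp 0 φ x) b t + kap1 α x y (e 1) (mulPerp 1 φ x) b t) +
      (kap2 α x y (e 0) (e 0) (φ x) b t + kap2 α x y (e 1) (e 1) (φ x) b t) := fun x => by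
    rw [kapD, kap1_perp _ _ _ _ _ ht, kap_smul _ _ _ _ _ _ ht]; rfl
  have i0 := (integrable_kap_schwartz α (SchwartzMap.postcompCLM perpL φ) y b ht).const_mul α
  have i1 := (((integrable_kap1_schwartz α (mulPerp 0 φ) y b 0 ht).add
    (integrable_kap1_schwartz α (mulPerp 1 φ) y b 1 ht))).const_mul α
  have i2 := (integrable_kap2_schwartz α φ y b 0 ht).add (integrable_kap2_schwartz α φ y b 1 ht)
  have j1 : Integrable (fun x => -(kap α x y (∂_{e 0} (∂_{e 0} φ) x) b t +
      kap α x y (∂_{e 1} (∂_{e 1} φ) x) b t)) :=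
    ((integrable_kap_schwartz α (∂_{e 0} (∂_{e 0} φ)) y b ht).add
    (integrable_kap_schwartz α (∂_{e 1} (∂_{e 1} φ)) y b ht)).neg
  have j2 := ((integrable_kap_schwartz α (∂_{e 0} (mulPerp 0 φ)) y b ht).add
    (integrable_kap_schwartz α (∂_{e 1} (mulPerp 1 φ)) y b ht)).const_mul α
  simp only [Pi.add_apply] at i1 j2
  simp_rw [e0]
  refine ⟨(i0.add i1).add i2, ?_⟩
  simp_rw [kap_rotS _ _ _ _ _ ht]
  have s1 : ∫ x, (α * kap α x y (SchwartzMap.postcompCLM perpL φ x) b t +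
      α * (kap1 α x y (e 0) (mulPerp 0 φ x) b t + kap1 α x y (e 1) (mulPerp 1 φ x) b t) +
      (kap2 α x y (e 0) (e 0) (φ x) b t + kap2 α x y (e 1) (e 1) (φ x) b t)) =
      α * (∫ x, kap α x y (SchwartzMap.postcompCLM perpL φ x) b t) +
      α * ((∫ x, kap1 α x y (e 0) (mulPerp 0 φ x) b t) +
        ∫ x, kap1 α x y (e 1) (mulPerp 1 φ x) b t) +
      ((∫ x, kap2 α x y (e 0) (e 0) (φ x) b t) + ∫ x, kap2 α x y (e 1) (e 1) (φ x) b t) := by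
    rw [← integral_add (integrable_kap1_schwartz α (mulPerp 0 φ) y b 0 ht)
      (integrable_kap1_schwartz α (mulPerp 1 φ) y b 1 ht),
      ← integral_add (integrable_kap2_schwartz α φ y b 0 ht) (integrable_kap2_schwartz α φ y b 1 ht),
      ← integral_const_mul, ← integral_const_mul, ← integral_add i0 i1]
    exact integral_add (i0.add i1) i2
  have s2 : ∫ x, (-(kap α x y (∂_{e 0} (∂_{e 0} φ) x) b t + kap α x y (∂_{e 1} (∂_{e 1} φ) x) b t) +
      α * (kap α x y (∂_{e 0} (mulPerp 0 φ) x) b t + kap α x y (∂_{e 1} (mulPerp 1 φ) x) b t) -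
      α * kap α x y (SchwartzMap.postcompCLM perpL φ x) b t) =
      -((∫ x, kap α x y (∂_{e 0} (∂_{e 0} φ) x) b t) + ∫ x, kap α x y (∂_{e 1} (∂_{e 1} φ) x) b t) +
      α * ((∫ x, kap α x y (∂_{e 0} (mulPerp 0 φ) x) b t) +
        ∫ x, kap α x y (∂_{e 1} (mulPerp 1 φ) x) b t) -
      α * ∫ x, kap α x y (SchwartzMap.postcompCLM perpL φ x) b t := by
    rw [← integral_add (integrable_kap_schwartz α (∂_{e 0} (∂_{e 0} φ)) y b ht)
      (integrable_kap_schwartz α (∂_{e 1} (∂_{e 1} φ)) y b ht),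
      ← integral_add (integrable_kap_schwartz α (∂_{e 0} (mulPerp 0 φ)) y b ht)
      (integrable_kap_schwartz α (∂_{e 1} (mulPerp 1 φ)) y b ht),
      ← integral_const_mul, ← integral_const_mul, ← integral_neg, ← integral_add j1 j2]
    exact integral_sub (j1.add j2) i0
  rw [s1, s2, integral_kap_lineDeriv _ _ _ _ _ ht, integral_kap_lineDeriv _ _ _ _ _ ht,
    integral_kap_lineDeriv _ _ _ _ _ ht, integral_kap_lineDeriv _ _ _ _ _ ht,
    integral_kap1_lineDeriv _ _ _ _ _ ht, integral_kap1_lineDeriv _ _ _ _ _ ht]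
  ring

theorem integrable_norm_mul (φ : 𝓢(Plane, Plane)) : Integrable (fun x => ‖x‖ * ‖φ x‖) := by
  simpa using φ.integrable_pow_mul volume 1

theorem abs_kapD_le {c : ℝ} (hc : 0 < c) (h : c ≤ t) (x : Plane) :
    |kapD α φ y b x t| ≤ (2 * CK * (|α| * ‖b‖) * sg 0 c ^ 2 + 4 * CK * ‖b‖ * sg 0 c ^ 4) * ‖φ x‖ +
      2 * CK * (|α| * ‖b‖) * sg 0 c ^ 3 * (‖x‖ * ‖φ x‖) := by
  have h1 := abs_kap_le_of_le α x y (α • perp (φ x)) b hc h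
  have h2 := abs_kap1_le_of_le α x y (α • perp x) (φ x) b hc h
  have h3 := abs_kap2_le_of_le α x y (e 0) (e 0) (φ x) b hc h
  have h4 := abs_kap2_le_of_le α x y (e 1) (e 1) (φ x) b hc h
  rw [norm_smul, norm_perp, Real.norm_eq_abs] at h1 h2
  rw [norm_e] at h3 h4
  unfold kapD
  refine (abs_add_le _ _).trans ((add_le_add (abs_add_le _ _) (abs_add_le _ _)).trans ?_)
  refine (add_le_add (add_le_add h1 h2) (add_le_add h3 h4)).trans (le_of_eq ?_)
  ring

/-- The fundamental theorem of calculus at each x, followed by Fubini. The starting time c > 0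
avoids the singularity; its limit is taken separately. -/
theorem integral_kap_rotS {c T : ℝ} (hc : 0 < c) (hT : c ≤ T) :
    ∫ t in c..T, ∫ x, kap α x y (rotS (-α) φ x) b t =
      (∫ x, kap α x y (φ x) b c) - ∫ x, kap α x y (φ x) b T := by
  have hm : Measurable (Function.uncurry fun (x : Plane) (t : ℝ) => kapD α φ y b x t) := by
    unfold kapD kap kap1 kap2 Function.uncurry
    fun_prop
  have hg : Integrable (fun x => (2 * CK * (|α| * ‖b‖) * sg 0 c ^ 2 + 4 * CK * ‖b‖ * sg 0 c ^ 4) *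
      ‖φ x‖ + 2 * CK * (|α| * ‖b‖) * sg 0 c ^ 3 * (‖x‖ * ‖φ x‖)) :=
    (φ.integrable.norm.const_mul _).add ((integrable_norm_mul φ).const_mul _)
  have hprod : Integrable (Function.uncurry fun (x : Plane) (t : ℝ) => kapD α φ y b x t)
      (volume.prod (volume.restrict (Ioc c T))) := by
    refine (hg.mul_prod (integrable_const (μ := volume.restrict (Ioc c T)) (1 : ℝ))).mono'
      hm.aestronglyMeasurable ?_
    have : ∀ᵐ q ∂(volume.prod (volume.restrict (Ioc c T)) : Measure (Plane × ℝ)), q.2 ∈ Ioc c T :=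
      Measure.quasiMeasurePreserving_snd.ae (ae_restrict_mem measurableSet_Ioc)
    filter_upwards [this] with q hq
    rw [mul_one]
    exact abs_kapD_le α φ y b hc hq.1.le q.1
  have hx : ∀ x, ∫ t in Ioc c T, kapD α φ y b x t = kap α x y (φ x) b T - kap α x y (φ x) b c := by
    intro x
    rw [← intervalIntegral.integral_of_le hT]
    refine intervalIntegral.integral_eq_sub_of_hasDerivAt (fun t ht => ?_) ?_
    · rw [uIcc_of_le hT] at ht
      exact hasDerivAt_kap α x y (φ x) b (hc.trans_le ht.1)
    · rw [intervalIntegrable_iff_integrableOn_Ioc_of_le hT]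
      refine Measure.integrableOn_of_bounded (M := (2 * CK * (|α| * ‖b‖) * sg 0 c ^ 2 +
        4 * CK * ‖b‖ * sg 0 c ^ 4) * ‖φ x‖ + 2 * CK * (|α| * ‖b‖) * sg 0 c ^ 3 * (‖x‖ * ‖φ x‖))
        (by simp) (hm.comp measurable_prodMk_left).aestronglyMeasurable ?_
      filter_upwards [ae_restrict_mem measurableSet_Ioc] with t ht
      exact abs_kapD_le α φ y b hc ht.1.le x
  have key := integral_integral_swap hprod
  simp_rw [hx] at key
  rw [integral_sub (integrable_kap_schwartz α φ y b (hc.trans_le hT))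
    (integrable_kap_schwartz α φ y b hc)] at key
  rw [← neg_sub, key, intervalIntegral.integral_of_le hT, ← integral_neg]
  refine setIntegral_congr_fun measurableSet_Ioc fun t ht => ?_
  rw [(integral_kapD α φ y b (hc.trans ht.1)).2, neg_neg]

end schwartz

/-! ### The pressure functional -/

/-- The divergence of a Schwartz field. -/
def divS (φ : 𝓢(Plane, Plane)) : 𝓢(Plane, ℝ) :=
  SchwartzMap.postcompCLM (EuclideanSpace.proj 0 : Plane →L[ℝ] ℝ) (∂_{e 0} φ) +
    SchwartzMap.postcompCLM (EuclideanSpace.proj 1 : Plane →L[ℝ] ℝ) (∂_{e 1} φ)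

theorem divS_apply_eq (φ : 𝓢(Plane, Plane)) (x : Plane) :
    divS φ x = (∂_{e 0} φ x) 0 + (∂_{e 1} φ x) 1 := rfl

theorem divS_apply (φ : 𝓢(Plane, Plane)) (x : Plane) : divS φ x = divergence φ x := by
  rw [divergence, Fin.sum_univ_two]; rfl

/-- The convolution of `g` with a derivative of the Gauss kernel, in rotated coordinates. -/
def convD1 (g : Plane → ℝ) (y b : Plane) (θ s : ℝ) : ℝ := ∫ x, g x * d1 b (Rot θ x - y) s

/-- The gradient of the Newton potential of `g`. -/
def newton (g : Plane → ℝ) (y b : Plane) : ℝ := -∫ s in Ioi (0 : ℝ), convD1 g y b 0 s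

theorem abs_convD1_le_one {g : Plane → ℝ} (hg : Integrable g) (y b : Plane) (θ : ℝ) {s : ℝ}
    (hs : 0 < s) : |convD1 g y b θ s| ≤ CK * ‖b‖ * ((∫ x, |g x|) * sg 0 s ^ 3) := by
  have hC := CK_pos
  rw [convD1, ← Real.norm_eq_abs]
  refine (norm_integral_le_of_norm_le (hg.norm.mul_const (CK * ‖b‖ * sg 0 s ^ 3)) ?_).trans
    (le_of_eq ?_)
  · refine Eventually.of_forall fun x => ?_
    rw [norm_mul]
    gcongr
    refine (abs_d1_le _ _ hs).trans ?_
    gcongr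
    · exact sg_nonneg _ _
    · exact sg_le_sg_zero _ hs
  · rw [integral_mul_const]
    simp only [Real.norm_eq_abs]
    ring

theorem integrable_sg_comp {τ : Plane → Plane} (hτ : MeasurePreserving τ volume volume) (n : ℕ)
    {s : ℝ} (hs : 0 < s) : Integrable (fun x => sg (τ x) s ^ (n + 3)) ∧
      ∫ x, sg (τ x) s ^ (n + 3) = Jc (n + 3) * sg 0 s ^ (n + 1) := by
  have hi := integrable_sg (n + 3) (by omega) hs
  refine ⟨hτ.integrable_comp_of_integrable hi, ?_⟩
  have hm : AEStronglyMeasurable (fun z : Plane => sg z s ^ (n + 3)) (Measure.map τ volume) := by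
    rw [hτ.map_eq]; exact hi.1
  rw [← integral_sg (n + 1) hs]
  conv_rhs => rw [← hτ.map_eq]
  rw [integral_map hτ.measurable.aemeasurable hm]

theorem abs_convD1_le_sup {g : Plane → ℝ} {A : ℝ} (hA : ∀ x, |g x| ≤ A) (y b : Plane) (θ : ℝ)
    {s : ℝ} (hs : 0 < s) : |convD1 g y b θ s| ≤ CK * ‖b‖ * (A * Jc 3 * sg 0 s) := by
  have hC := CK_pos
  have hA0 : 0 ≤ A := (abs_nonneg _).trans (hA 0)
  obtain ⟨h1, h2⟩ := integrable_sg_comp (measurePreserving_Rot_sub' θ y) 0 hs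
  rw [convD1, ← Real.norm_eq_abs]
  refine (norm_integral_le_of_norm_le (h1.const_mul (A * (CK * ‖b‖))) ?_).trans (le_of_eq ?_)
  · refine Eventually.of_forall fun x => ?_
    rw [norm_mul, mul_assoc]
    exact mul_le_mul (hA x) (abs_d1_le _ _ hs) (norm_nonneg _) hA0
  · rw [integral_const_mul, h2]; ring

/-- The sup bound is of order s^{-1/2}, good near zero; the L¹ bound is of order s^{-3/2}, good at
infinity. Their minimum makes the gradient of the Newton potential absolutely convergent. -/
theorem integrableOn_min_sg {A B : ℝ} (hA : 0 ≤ A) (hB : 0 ≤ B) :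
    IntegrableOn (fun s => min (A * sg 0 s) (B * sg 0 s ^ 3)) (Ioi 0) := by
  have hm : Measurable fun s => min (A * sg 0 s) (B * sg 0 s ^ 3) := by fun_prop
  have h0 : ∀ s, 0 ≤ min (A * sg 0 s) (B * sg 0 s ^ 3) := fun s => by
    have := sg_nonneg 0 s
    positivity
  rw [← Ioc_union_Ioi_eq_Ioi zero_le_one]
  refine IntegrableOn.union ?_ ?_
  · refine ((integral_sg_zero_Ioc zero_le_one).1.const_mul A).mono' hm.aestronglyMeasurable ?_
    refine Eventually.of_forall fun s => ?_
    rw [Real.norm_of_nonneg (h0 s)]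
    exact min_le_left _ _
  · refine ((integrableOn_sg_pow 0 0 zero_le_one (by positivity)).1.const_mul B).mono'
      hm.aestronglyMeasurable ?_
    refine Eventually.of_forall fun s => ?_
    rw [Real.norm_of_nonneg (h0 s)]
    exact min_le_right _ _

theorem abs_convD1_le {g : Plane → ℝ} (hg : Integrable g) {A : ℝ} (hA : ∀ x, |g x| ≤ A)
    (y b : Plane) (θ : ℝ) {s : ℝ} (hs : 0 < s) :
    |convD1 g y b θ s| ≤ CK * ‖b‖ * min (A * Jc 3 * sg 0 s) ((∫ x, |g x|) * sg 0 s ^ 3) := by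
  have hC := CK_pos
  rw [mul_min_of_nonneg _ _ (by positivity)]
  exact le_min (abs_convD1_le_sup hA y b θ hs) (abs_convD1_le_one hg y b θ hs)

section measurability
variable {X : Type*} [MeasurableSpace X] {y b : X → Plane} {θ s : X → ℝ}

@[fun_prop] theorem Measurable.convD1 {g : Plane → ℝ} (hg : Measurable g) (hy : Measurable y)
    (hb : Measurable b) (hθ : Measurable θ) (hs : Measurable s) :
    Measurable fun ω => convD1 g (y ω) (b ω) (θ ω) (s ω) := by
  unfold RotStokes.convD1
  refine (StronglyMeasurable.integral_prod_right
    (f := fun ω x => g x * RotStokes.d1 (b ω) (RotStokes.Rot (θ ω) x - y ω) (s ω)) ?_).measurable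
  refine Measurable.stronglyMeasurable ?_
  simp only [Function.uncurry_def]
  fun_prop

@[fun_prop] theorem Measurable.newton {g : Plane → ℝ} (hg : Measurable g) (hy : Measurable y)
    (hb : Measurable b) : Measurable fun ω => newton g (y ω) (b ω) := by
  unfold RotStokes.newton
  refine (StronglyMeasurable.integral_prod_right
    (f := fun ω s => RotStokes.convD1 g (y ω) (b ω) 0 s) ?_).measurable.neg
  refine Measurable.stronglyMeasurable ?_
  simp only [Function.uncurry_def]
  fun_prop

end measurability

/-- The constant in the uniform bound of `newton g`. -/
def newtonC (A B : ℝ) : ℝ := CK * ∫ s in Ioi (0 : ℝ), min (A * Jc 3 * sg 0 s) (B * sg 0 s ^ 3)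

theorem abs_newton_le {g : Plane → ℝ} (hg : Integrable g) {A : ℝ}
    (hA : ∀ x, |g x| ≤ A) (y b : Plane) :
    |newton g y b| ≤ newtonC A (∫ x, |g x|) * ‖b‖ := by
  have hA0 : 0 ≤ A := (abs_nonneg _).trans (hA 0)
  have := integrableOn_min_sg (A := A * Jc 3) (B := ∫ x, |g x|) (mul_nonneg hA0 (Jc_nonneg 3))
    (integral_nonneg fun _ => abs_nonneg _)
  rw [newton, abs_neg, ← Real.norm_eq_abs]
  refine (norm_integral_le_of_norm_le (this.const_mul (CK * ‖b‖)) ?_).trans (le_of_eq ?_)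
  · filter_upwards [ae_restrict_mem measurableSet_Ioi] with s hs
    exact abs_convD1_le hg hA y b 0 hs
  · rw [integral_const_mul, newtonC]; ring

theorem d2_lin_left (p p' q z : Plane) (c c' s : ℝ) :
    d2 (c • p + c' • p') q z s = c * d2 p q z s + c' * d2 p' q z s := by
  simp only [d2, inner_add_left, real_inner_smul_left]; ring

/-- In the rotated variable the direction O(θ)φ(x) is differentiation in x along φ(x). One
integration by parts therefore produces the divergence with respect to the original x. -/
theorem integral_d2_schwartz (φ : 𝓢(Plane, Plane)) (y b : Plane) (θ : ℝ) {s : ℝ} (hs : 0 < s) :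
    ∫ x, d2 (Rot θ (φ x)) b (Rot θ x - y) s = -convD1 (divS φ) y b θ s := by
  have hC := CK_pos
  set M := max (CK * ‖b‖ * sg 0 s ^ 3) (CK * (1 * ‖b‖) * sg 0 s ^ 4) with hM
  have hM0 : 0 ≤ M := le_max_of_le_left (by have := sg_nonneg 0 s; positivity)
  have he : ∀ i j : Fin 2, |(e j) i| ≤ 1 := fun i j => by
    have := PiLp.norm_apply_le (e j) i
    rwa [norm_e] at this
  have b1 : ∀ x, |d1 b (Rot θ x - y) s| ≤ M := fun x => by
    refine le_trans ((abs_d1_le _ _ hs).trans ?_) (le_max_left _ _)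
    gcongr
    · exact sg_nonneg _ _
    · exact sg_le_sg_zero _ hs
  have b2 : ∀ i x, |d2 (Rot θ (e i)) b (Rot θ x - y) s| ≤ M := fun i x => by
    refine le_trans ((abs_d2_le _ _ _ hs).trans ?_) (le_max_right _ _)
    rw [norm_Rot, norm_e]
    gcongr
    · exact sg_nonneg _ _
    · exact sg_le_sg_zero _ hs
  have key : ∀ i : Fin 2, ∫ x, (∂_{e i} φ x) i * d1 b (Rot θ x - y) s =
      -∫ x, φ x i * d2 (Rot θ (e i)) b (Rot θ x - y) s := fun i => by
    refine integral_form_lineDeriv φ (e i) (κ := fun p x => p i * d1 b (Rot θ x - y) s)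
      (κ' := fun p x => p i * d2 (Rot θ (e i)) b (Rot θ x - y) s) (M := 1 * M) ?_ ?_ ?_ ?_ ?_ ?_ ?_
    · intro p x; fin_cases i <;> simp [e]
    · intro p x; fin_cases i <;> simp [e]
    · intro j x
      have h := (hasDerivAt_comp_line (contDiff_d1 b s) (Rot θ x - y) (Rot θ (e i)) 0).congr_deriv
        (fderiv_d1 _ _ _ _)
      rw [zero_smul, add_zero] at h
      have h2 := hasLineDerivAt_comp_Rot (f := fun z => d1 b z s) (θ := θ) (x := x) (y := y) h
      exact HasDerivAt.const_mul ((e j) i) h2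
    · intro j; fun_prop
    · intro j; fun_prop
    · intro j x
      rw [abs_mul]; exact mul_le_mul (he i j) (b1 x) (abs_nonneg _) zero_le_one
    · intro j x
      rw [abs_mul]; exact mul_le_mul (he i j) (b2 i x) (abs_nonneg _) zero_le_one
  have hi : ∀ i : Fin 2, Integrable fun x => φ x i * d2 (Rot θ (e i)) b (Rot θ x - y) s := fun i => by
    refine ((φ.integrable (μ := volume)).norm.mul_const M).mono' (Measurable.aestronglyMeasurable
      (by fun_prop)) (Eventually.of_forall fun x => ?_)
    rw [norm_mul]
    exact mul_le_mul (PiLp.norm_apply_le _ _) (b2 i x) (norm_nonneg _) (norm_nonneg _)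
  have hi' : ∀ i : Fin 2, Integrable fun x => (∂_{e i} φ x) i * d1 b (Rot θ x - y) s := fun i => by
    refine (((∂_{e i} φ).integrable (μ := volume)).norm.mul_const M).mono'
      (Measurable.aestronglyMeasurable (by fun_prop)) (Eventually.of_forall fun x => ?_)
    rw [norm_mul]
    exact mul_le_mul (PiLp.norm_apply_le _ _) (b1 x) (norm_nonneg _) (norm_nonneg _)
  have e1 : ∀ x, d2 (Rot θ (φ x)) b (Rot θ x - y) s = φ x 0 * d2 (Rot θ (e 0)) b (Rot θ x - y) s +
      φ x 1 * d2 (Rot θ (e 1)) b (Rot θ x - y) s := fun x => by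
    rw [Rot_expand, d2_lin_left]
  have e2 : ∀ x, divS φ x * d1 b (Rot θ x - y) s = (∂_{e 0} φ x) 0 * d1 b (Rot θ x - y) s +
      (∂_{e 1} φ x) 1 * d1 b (Rot θ x - y) s := fun x => by rw [divS_apply_eq, add_mul]
  rw [convD1]
  simp_rw [e1, e2]
  rw [integral_add (hi 0) (hi 1), integral_add (hi' 0) (hi' 1), key, key]
  ring

theorem integral_comp_of_measurePreserving {E : Type*} [NormedAddCommGroup E] [NormedSpace ℝ E]
    {τ : Plane → Plane} (hτ : MeasurePreserving τ volume volume) {H : Plane → E}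
    (hH : AEStronglyMeasurable H volume) : ∫ x, H (τ x) = ∫ x, H x := by
  have hm : AEStronglyMeasurable H (Measure.map τ volume) := by rwa [hτ.map_eq]
  conv_rhs => rw [← hτ.map_eq]
  rw [integral_map hτ.measurable.aemeasurable hm]

/-! ### The initial value of the semigroup -/

/-- The local and nonlocal parts of K are separated: the first becomes an approximate identity as t
tends to 0, and the second depends on φ through div φ only. -/
theorem integral_kap_eq (α : ℝ) (φ : 𝓢(Plane, Plane)) (y b : Plane) {t : ℝ} (ht : 0 < t) :
    ∫ x, kap α x y (φ x) b t = (∫ x, gauss (Rot (α * t) x - y) t * ⟪Rot (α * t) (φ x), b⟫) -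
      ∫ s in Ioi t, convD1 (divS φ) y b (α * t) s := by
  have hC := CK_pos
  have hm : Measurable (Function.uncurry fun (x : Plane) (s : ℝ) =>
      d2 (Rot (α * t) (φ x)) b (Rot (α * t) x - y) s) := by
    unfold Function.uncurry; fun_prop
  have hprod : Integrable (Function.uncurry fun (x : Plane) (s : ℝ) =>
      d2 (Rot (α * t) (φ x)) b (Rot (α * t) x - y) s) (volume.prod (volume.restrict (Ioi t))) := by
    have h2 : Integrable (fun s => CK * ‖b‖ * sg 0 s ^ 4) (volume.restrict (Ioi t)) :=
      (integrableOn_sg_pow 0 1 ht.le (by positivity)).1.const_mul _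
    refine ((φ.integrable (μ := volume)).norm.mul_prod h2).mono' hm.aestronglyMeasurable ?_
    have : ∀ᵐ q ∂(volume.prod (volume.restrict (Ioi t)) : Measure (Plane × ℝ)), q.2 ∈ Ioi t :=
      Measure.quasiMeasurePreserving_snd.ae (ae_restrict_mem measurableSet_Ioi)
    filter_upwards [this] with q hq
    have hq : t < q.2 := hq
    refine (abs_d2_le _ _ _ (ht.trans hq)).trans ?_
    rw [norm_Rot]
    calc _ ≤ CK * (‖φ q.1‖ * ‖b‖) * sg 0 q.2 ^ 4 := by
          gcongr
          · exact sg_nonneg _ _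
          · exact sg_le_sg_zero _ (ht.trans hq)
      _ = _ := by ring
  have hg : Integrable fun x => gauss (Rot (α * t) x - y) t * ⟪Rot (α * t) (φ x), b⟫ := by
    refine ((φ.integrable (μ := volume)).norm.mul_const (CK * sg 0 t ^ 2 * ‖b‖)).mono'
      (Measurable.aestronglyMeasurable ?_) (Eventually.of_forall fun x => ?_)
    · exact (Measurable.gauss (by fun_prop) measurable_const).mul (by fun_prop)
    · rw [norm_mul, Real.norm_of_nonneg (gauss_nonneg _ ht.le)]
      have h1 := gauss_le (Rot (α * t) x - y) ht
      have h2 := norm_inner_le_norm (𝕜 := ℝ) (Rot (α * t) (φ x)) b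
      have h3 := sg_le_sg_zero (Rot (α * t) x - y) ht
      have h4 := sg_nonneg (Rot (α * t) x - y) t
      rw [norm_Rot] at h2
      calc _ ≤ CK * sg 0 t ^ 2 * (‖φ x‖ * ‖b‖) := by
            refine mul_le_mul (h1.trans ?_) h2 (norm_nonneg _) (by positivity)
            gcongr
        _ = _ := by ring
  simp only [kap, Kk]
  have hI := hprod.integral_prod_left
  simp only [Function.uncurry] at hI
  rw [integral_add hg hI, sub_eq_add_neg, ← integral_neg]
  congr 1
  rw [integral_integral_swap hprod]
  exact setIntegral_congr_fun measurableSet_Ioi fun s hs =>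
    integral_d2_schwartz φ y b (α * t) (ht.trans hs)

theorem continuous_convD1 {g : Plane → ℝ} (hgm : Measurable g) (hg : Integrable g) (y b : Plane)
    {s : ℝ} (hs : 0 < s) : Continuous fun θ => convD1 g y b θ s := by
  have hC := CK_pos
  unfold convD1
  refine continuous_of_dominated (bound := fun x => ‖g x‖ * (CK * ‖b‖ * sg 0 s ^ 3)) ?_ ?_
    (hg.norm.mul_const _) ?_
  · exact fun θ => Measurable.aestronglyMeasurable (by fun_prop)
  · refine fun θ => Eventually.of_forall fun x => ?_
    rw [norm_mul]
    gcongr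
    refine (abs_d1_le _ _ hs).trans ?_
    gcongr
    · exact sg_nonneg _ _
    · exact sg_le_sg_zero _ hs
  · refine Eventually.of_forall fun x => continuous_const.mul ?_
    exact (contDiff_d1 b s).continuous.comp (by fun_prop)

/-- Both the lower limit and the rotation angle vary with t. An indicator fixes the domain, and the
bounds are uniform in the angle, so dominated convergence applies. -/
theorem tendsto_integral_convD1 {g : Plane → ℝ} (hgm : Measurable g) (hg : Integrable g) {A : ℝ}
    (hA : ∀ x, |g x| ≤ A) (α : ℝ) (y b : Plane) :
    Tendsto (fun t => ∫ s in Ioi t, convD1 g y b (α * t) s) (𝓝[>] 0)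
      (𝓝 (∫ s in Ioi (0 : ℝ), convD1 g y b 0 s)) := by
  have hC := CK_pos
  have hA0 : 0 ≤ A := (abs_nonneg _).trans (hA 0)
  have hb := (integrableOn_min_sg (A := A * Jc 3) (B := ∫ x, |g x|) (mul_nonneg hA0 (Jc_nonneg 3))
    (integral_nonneg fun _ => abs_nonneg _)).const_mul (CK * ‖b‖)
  have h : Tendsto (fun t => ∫ s in Ioi (0 : ℝ), (Ioi t).indicator (fun s => convD1 g y b (α * t) s) s)
      (𝓝[>] 0) (𝓝 (∫ s in Ioi (0 : ℝ), convD1 g y b 0 s)) := by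
    refine tendsto_integral_filter_of_dominated_convergence _ ?_ ?_ hb ?_
    · exact Eventually.of_forall fun t =>
        ((Measurable.convD1 hgm measurable_const measurable_const measurable_const
          measurable_id).indicator measurableSet_Ioi).aestronglyMeasurable
    · refine Eventually.of_forall fun t => ?_
      filter_upwards [ae_restrict_mem measurableSet_Ioi] with s hs
      refine (norm_indicator_le_norm_self _ _).trans ?_
      exact abs_convD1_le hg hA y b (α * t) hs
    · filter_upwards [ae_restrict_mem measurableSet_Ioi] with s hs
      have hs : 0 < s := hs
      have h1 : Tendsto (fun t => convD1 g y b (α * t) s) (𝓝[>] 0) (𝓝 (convD1 g y b 0 s)) := by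
        have := ((continuous_convD1 hgm hg y b hs).comp (continuous_const_mul α)).tendsto 0
        simp only [Function.comp_apply, mul_zero] at this
        exact this.mono_left nhdsWithin_le_nhds
      refine h1.congr' ?_
      filter_upwards [Ioo_mem_nhdsGT hs] with t ht
      rw [indicator_of_mem (show s ∈ Ioi t from ht.2)]
  refine h.congr' ?_
  filter_upwards [self_mem_nhdsWithin] with t ht
  rw [setIntegral_indicator measurableSet_Ioi, inter_eq_right.2 (Ioi_subset_Ioi (le_of_lt ht))]

theorem integral_gauss_one : Integrable (fun z : Plane => gauss z 1) ∧ ∫ z : Plane, gauss z 1 = 1 := by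
  have hC := CK_pos
  constructor
  · refine ((integrable_sg_one (n := 4) (by norm_num)).const_mul (CK / 12)).mono'
      (contDiff_gauss 1).continuous.aestronglyMeasurable (Eventually.of_forall fun z => ?_)
    have := norm_pow_mul_gauss_le z one_pos (a := 0) (k := 1) (n := 4) (by norm_num) (by norm_num)
    rw [Real.norm_of_nonneg (gauss_nonneg z zero_le_one)]
    simpa using this
  · have h := GaussianFourier.integral_rexp_neg_mul_sq_norm (V := Plane) (b := 1 / 4) (by norm_num)
    have e1 : ∀ z : Plane, gauss z 1 = 1 / (4 * Real.pi) * Real.exp (-(1 / 4) * ‖z‖ ^ 2) := fun z => by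
      rw [gauss]; congr 2 <;> ring
    simp_rw [e1]
    rw [integral_const_mul, h]
    have := Real.pi_pos
    simp
    field_simp

theorem gauss_smul {t : ℝ} (ht : 0 < t) (z : Plane) : t * gauss (√t • z) t = gauss z 1 := by
  simp only [gauss, norm_smul, Real.norm_of_nonneg (Real.sqrt_nonneg t), mul_pow, Real.sq_sqrt ht.le]
  rw [← mul_assoc]
  congr 1
  · field_simp
  · congr 1; field_simp

theorem integral_gauss_mul_eq (φ : Plane → Plane) (hφ : Continuous φ) (y b : Plane) (θ : ℝ) {t : ℝ}
    (ht : 0 < t) : ∫ x, gauss (Rot θ x - y) t * ⟪Rot θ (φ x), b⟫ =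
      ∫ z, gauss z 1 * ⟪Rot θ (φ (Rot (-θ) (√t • z + y))), b⟫ := by
  set H : Plane → ℝ := fun w => gauss w t * ⟪Rot θ (φ (Rot (-θ) (w + y))), b⟫ with hH
  have hHc : Continuous H := (contDiff_gauss t).continuous.mul (by fun_prop)
  have h1 := integral_comp_of_measurePreserving (measurePreserving_Rot_sub' θ y)
    hHc.aestronglyMeasurable
  have h2 := Measure.integral_comp_smul_of_nonneg volume H (√t) (hR := Real.sqrt_nonneg t)
  have e1 : ∀ x, H (Rot θ x - y) = gauss (Rot θ x - y) t * ⟪Rot θ (φ x), b⟫ := fun x => by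
    simp only [hH, sub_add_cancel, Rot_neg_Rot]
  simp_rw [e1] at h1
  have e2 : ∫ z, gauss z 1 * ⟪Rot θ (φ (Rot (-θ) (√t • z + y))), b⟫ = t * ∫ z, H (√t • z) := by
    rw [← integral_const_mul]
    refine integral_congr_ae (Eventually.of_forall fun z => ?_)
    simp only [hH]
    rw [← mul_assoc, gauss_smul ht]
  rw [e2, h2, h1]
  simp [Real.sq_sqrt ht.le]
  field_simp

/-- After rotating and rescaling by √t the Gaussian is fixed at time 1, and the argument of the
bounded continuous field converges to y. -/
theorem tendsto_integral_gauss_mul (φ : 𝓢(Plane, Plane)) (α : ℝ) (y b : Plane) :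
    Tendsto (fun t => ∫ x, gauss (Rot (α * t) x - y) t * ⟪Rot (α * t) (φ x), b⟫) (𝓝[>] 0)
      (𝓝 ⟪φ y, b⟫) := by
  set A := SchwartzMap.seminorm ℝ 0 0 φ
  have hA : ∀ x, ‖φ x‖ ≤ A := SchwartzMap.norm_le_seminorm ℝ φ
  obtain ⟨g1, g2⟩ := integral_gauss_one
  have hφ := φ.continuous
  have h : Tendsto (fun t => ∫ z, gauss z 1 * ⟪Rot (α * t) (φ (Rot (-(α * t)) (√t • z + y))), b⟫)
      (𝓝[>] 0) (𝓝 (∫ z, gauss z 1 * ⟪φ y, b⟫)) := by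
    refine tendsto_integral_filter_of_dominated_convergence (fun z => gauss z 1 * (A * ‖b‖))
      ?_ ?_ (g1.mul_const _) ?_
    · refine Eventually.of_forall fun t => Continuous.aestronglyMeasurable ?_
      exact (contDiff_gauss 1).continuous.mul (by fun_prop)
    · refine Eventually.of_forall fun t => Eventually.of_forall fun z => ?_
      rw [norm_mul, Real.norm_of_nonneg (gauss_nonneg z zero_le_one)]
      refine mul_le_mul_of_nonneg_left ((norm_inner_le_norm _ _).trans ?_) (gauss_nonneg z zero_le_one)
      rw [norm_Rot]
      exact mul_le_mul_of_nonneg_right (hA _) (norm_nonneg b)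
    · refine Eventually.of_forall fun z => ?_
      have hc : Continuous fun t : ℝ =>
        gauss z 1 * ⟪Rot (α * t) (φ (Rot (-(α * t)) (√t • z + y))), b⟫ := by fun_prop
      have := hc.tendsto 0
      simp only [mul_zero, neg_zero, Real.sqrt_zero, zero_smul, zero_add, Rot_zero] at this
      exact this.mono_left nhdsWithin_le_nhds
  rw [integral_mul_const, g2, one_mul] at h
  refine h.congr' ?_
  filter_upwards [self_mem_nhdsWithin] with t ht
  exact (integral_gauss_mul_eq φ hφ y b (α * t) ht).symm

theorem tendsto_integral_Ioc_zero {f : ℝ → ℝ} {T : ℝ} (hT : 0 < T) (hf : IntegrableOn f (Ioc 0 T)) :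
    Tendsto (fun t => ∫ τ in t..T, f τ) (𝓝[>] 0) (𝓝 (∫ t in Ioc 0 T, f t)) := by
  have hi : IntegrableOn ((Iic T).indicator f) (Ioi 0) := by
    rw [IntegrableOn, integrable_indicator_iff measurableSet_Iic, IntegrableOn,
      Measure.restrict_restrict measurableSet_Iic, inter_comm, Ioi_inter_Iic]
    exact hf
  have hl := tendsto_integral_Ioi_zero hi
  simp only [setIntegral_indicator measurableSet_Iic, Ioi_inter_Iic] at hl
  refine hl.congr' ?_
  filter_upwards [Ioc_mem_nhdsGT hT] with t₀ ht₀
  rw [← intervalIntegral.integral_of_le ht₀.2]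

theorem adm_schwartz (φ : 𝓢(Plane, Plane)) : Adm φ := by
  refine ⟨φ.memLp 2, ?_⟩
  have hi : Integrable fun x => (2 + ‖x‖) * ‖φ x‖ := by
    simp_rw [add_mul]
    exact (φ.integrable.norm.const_mul 2).add (integrable_norm_mul φ)
  refine lt_of_le_of_lt (lintegral_mono fun x => ?_) hi.2
  rw [enorm_mul, enorm_norm, Real.enorm_eq_ofReal (by positivity), wt]
  refine mul_le_mul' (ENNReal.ofReal_le_ofReal ?_) le_rfl
  have h := Real.sq_sqrt (norm_nonneg x)
  nlinarith [sq_nonneg (√‖x‖ - 1)]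

/-! ### The weak form of the equation -/

/-- The limit c → 0 in the telescoped identity. The initial value is φ(y)·b plus a gradient term,
that is, K starts from a Helmholtz projection rather than from the identity. -/
theorem integral_Ioc_kap_rotS (α : ℝ) (φ : 𝓢(Plane, Plane)) (y b : Plane) {T : ℝ} (hT : 0 < T) :
    ∫ t in Ioc 0 T, ∫ x, kap α x y (rotS (-α) φ x) b t =
      ⟪φ y, b⟫ + newton (divS φ) y b - ∫ x, kap α x y (φ x) b T := by
  have hi : IntegrableOn (fun t => ∫ x, kap α x y (rotS (-α) φ x) b t) (Ioc 0 T) :=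
    (integrable_kap_right ((rotS (-α) φ).memLp 2) α y b hT.le).integral_prod_left
  have h1 := tendsto_integral_Ioc_zero hT hi
  have h2 := (tendsto_integral_gauss_mul φ α y b).sub (tendsto_integral_convD1
    (divS φ).continuous.measurable (divS φ).integrable
    (SchwartzMap.norm_le_seminorm ℝ (divS φ)) α y b)
  refine tendsto_nhds_unique h1 ((h2.sub_const (∫ x, kap α x y (φ x) b T)).congr' ?_)
  filter_upwards [Ioc_mem_nhdsGT hT] with t ht
  rw [integral_kap_rotS α φ y b ht.1 ht.2, integral_kap_eq α φ y b ht.1]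

theorem tendsto_integral_kap_atTop (α : ℝ) (φ : 𝓢(Plane, Plane)) (y b : Plane) :
    Tendsto (fun T => ∫ x, kap α x y (φ x) b T) atTop (𝓝 0) := by
  have hC := CK_pos
  refine squeeze_zero_norm' (a := fun T => (∫ x, ‖φ x‖) * (2 * CK * ‖b‖) * sg 0 T ^ 2) ?_ ?_
  · filter_upwards [eventually_gt_atTop 0] with T hT
    refine (norm_integral_le_of_norm_le
      ((φ.integrable (μ := volume)).norm.mul_const (2 * CK * ‖b‖ * sg 0 T ^ 2)) ?_).trans
      (le_of_eq ?_)
    · refine Eventually.of_forall fun x => (abs_kap_le_of_le α x y (φ x) b hT le_rfl).trans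
        (le_of_eq (by ring))
    · rw [integral_mul_const]; ring
  · simpa using (tendsto_sg_pow 0 (n := 2) (by norm_num)).const_mul ((∫ x, ‖φ x‖) * (2 * CK * ‖b‖))

/-- The contribution of time T is O(1/T) and disappears. What remains is the fundamental solution
property in its adjoint form, up to a gradient. -/
theorem integral_Gam_rotS {α : ℝ} (hα : α ≠ 0) (φ : 𝓢(Plane, Plane)) (y b : Plane) :
    ∫ x, Gam α x y (rotS (-α) φ x) b = ⟪φ y, b⟫ + newton (divS φ) y b := by
  have h1 := (adm_schwartz (rotS (-α) φ)).tendsto_right hα y b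
  have h2 := ((tendsto_integral_kap_atTop α φ y b).comp (tendsto_natCast_atTop_atTop (R := ℝ))).const_sub
    (⟪φ y, b⟫ + newton (divS φ) y b)
  rw [sub_zero] at h2
  refine tendsto_nhds_unique h1 (h2.congr' ?_)
  filter_upwards [eventually_gt_atTop 0] with n hn
  exact (integral_Ioc_kap_rotS α φ y b (by exact_mod_cast hn)).symm

theorem integrable_newton {g : Plane → ℝ} (hgm : Measurable g) (hg : Integrable g) {A : ℝ}
    (hA : ∀ x, |g x| ≤ A) {h : Plane → Plane} (hh : Integrable h) :
    Integrable fun y => newton g y (h y) := by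
  refine (hh.norm.const_mul (newtonC A (∫ x, |g x|))).mono' ?_
    (Eventually.of_forall fun y => abs_newton_le hg hA y (h y))
  refine ⟨fun y => newton g y (hh.1.mk h y), ?_, ?_⟩
  · exact (Measurable.newton hgm measurable_id hh.1.stronglyMeasurable_mk.measurable).stronglyMeasurable
  · filter_upwards [hh.1.ae_eq_mk] with y hy
    rw [hy]

theorem integrable_newton_divS (φ : 𝓢(Plane, Plane)) {h : Plane → Plane} (hh : Integrable h) :
    Integrable fun y => newton (divS φ) y (h y) :=
  integrable_newton (divS φ).continuous.measurable (divS φ).integrable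
    (SchwartzMap.norm_le_seminorm ℝ (divS φ)) hh

theorem integrable_inner_schwartz (φ : 𝓢(Plane, Plane)) {h : Plane → Plane} (hh : MemLp h 2 volume) :
    Integrable fun y => ⟪h y, φ y⟫ :=
  (hh.norm.integrable_mul (φ.memLp 2).norm).mono' (hh.1.inner φ.continuous.aestronglyMeasurable)
    (Eventually.of_forall fun y => norm_inner_le_norm _ _)

/-- The weak equation for admissible densities. The last integral is a functional of div φ and is
later rewritten as integration of a pressure against div φ. -/
theorem Adm.integral_inner_vel_rotOp {α : ℝ} (hα : α ≠ 0) {h : Plane → Plane} (hh : Adm h)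
    (φ : 𝓢(Plane, Plane)) :
    ∫ x, ⟪vel α h x, rotOp (-α) φ x⟫ = (∫ y, ⟪h y, φ y⟫) + ∫ y, newton (divS φ) y (h y) := by
  simp_rw [← rotS_apply]
  rw [hh.integral_inner_vel hα (adm_schwartz _), ← integral_add (integrable_inner_schwartz φ hh.memLp)
    (integrable_newton_divS φ hh.integrable)]
  refine integral_congr_ae (Eventually.of_forall fun y => ?_)
  simp only [integral_Gam_rotS hα, real_inner_comm]

/-! ### The divergence of the velocity -/

/-- The gradient of a Schwartz function. -/
def gradS (ψ : 𝓢(Plane, ℝ)) : 𝓢(Plane, Plane) :=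
  ∂_{e 0} (SchwartzMap.postcompCLM (ContinuousLinearMap.toSpanSingleton ℝ (e 0)) ψ) +
    ∂_{e 1} (SchwartzMap.postcompCLM (ContinuousLinearMap.toSpanSingleton ℝ (e 1)) ψ)

theorem gradS_apply (ψ : 𝓢(Plane, ℝ)) (x : Plane) (i : Fin 2) : gradS ψ x i = pderiv i ψ x := by
  have h : ∀ j, ∂_{e j} (SchwartzMap.postcompCLM (ContinuousLinearMap.toSpanSingleton ℝ (e j)) ψ) x =
      fderiv ℝ ψ x (e j) • e j := fun j => by
    have h3 : HasFDerivAt (SchwartzMap.postcompCLM (ContinuousLinearMap.toSpanSingleton ℝ (e j)) ψ)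
      _ x := (ContinuousLinearMap.toSpanSingleton ℝ (e j)).hasFDerivAt.comp x (ψ.hasFDerivAt x)
    rw [SchwartzMap.lineDerivOp_apply_eq_fderiv, h3.fderiv]
    simp
  rw [gradS, add_apply, h, h, pderiv]
  fin_cases i <;> simp [e]

/-- K is solenoidal: the divergence of the local part is the derivative of G along b, and that of
the nonlocal part is the time integral of its heat derivative, which telescopes to the opposite
value. -/
theorem sum_K1_Rot (θ : ℝ) (b z : Plane) {t : ℝ} (ht : 0 < t) :
    K1 (Rot θ (e 0)) (Rot θ (e 0)) b z t + K1 (Rot θ (e 1)) (Rot θ (e 1)) b z t = 0 := by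
  have h := Real.sin_sq_add_cos_sq θ
  have h1 : ∀ u v : Plane, ⟪Rot θ (e 0), u⟫ * ⟪Rot θ (e 0), v⟫ + ⟪Rot θ (e 1), u⟫ * ⟪Rot θ (e 1), v⟫ =
      ⟪u, v⟫ := fun u v => by
    simp [inner_eq, e]
    linear_combination (u 0 * v 0 + u 1 * v 1) * h
  have h2 : ∀ i, ⟪Rot θ (e i), Rot θ (e i)⟫ = 1 := fun i => by
    rw [inner_Rot_Rot, real_inner_self_eq_norm_sq, norm_e, one_pow]
  have h3 : ∀ s, 0 < s → d3 (Rot θ (e 0)) (Rot θ (e 0)) b z s + d3 (Rot θ (e 1)) (Rot θ (e 1)) b z s =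
      dt1 b z s := fun s hs => by
    simp only [d3, dt1, h2]
    have k1 := h1 z z
    have k2 := h1 b z
    rw [real_inner_self_eq_norm_sq] at k1
    have : s ≠ 0 := hs.ne'
    have k3 : ‖z‖ ^ 2 = ⟪Rot θ (e 0), z⟫ ^ 2 + ⟪Rot θ (e 1), z⟫ ^ 2 := by rw [← k1]; ring
    rw [k3, ← k2]
    field_simp
    ring
  have h4 := (integral_dt1 b z ht).2
  rw [← setIntegral_congr_fun measurableSet_Ioi (fun s hs => h3 s (ht.trans hs)),
    integral_add (integrableOn_d3 _ _ _ _ ht).1 (integrableOn_d3 _ _ _ _ ht).1] at h4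
  have h5 : d1 (Rot θ (e 0)) z t * ⟪Rot θ (e 0), b⟫ + d1 (Rot θ (e 1)) z t * ⟪Rot θ (e 1), b⟫ =
      d1 b z t := by
    simp only [d1]
    rw [← h1 b z]
    ring
  rw [K1, K1]
  linear_combination h4 + h5

theorem integral_kap_gradS (α : ℝ) (ψ : 𝓢(Plane, ℝ)) (y b : Plane) {t : ℝ} (ht : 0 < t) :
    ∫ x, kap α x y (gradS ψ x) b t = 0 := by
  set X : Fin 2 → 𝓢(Plane, Plane) := fun j =>
    SchwartzMap.postcompCLM (ContinuousLinearMap.toSpanSingleton ℝ (e j)) ψ with hX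
  have e1 : ∀ x, kap α x y (gradS ψ x) b t =
      kap α x y (∂_{e 0} (X 0) x) b t + kap α x y (∂_{e 1} (X 1) x) b t := fun x => by
    have hl := fun p => kap_lin α x y p b ht
    rw [hl (gradS ψ x), hl (∂_{e 0} (X 0) x), hl (∂_{e 1} (X 1) x)]
    simp only [Fin.sum_univ_two]
    simp [gradS, hX]
    ring
  have e2 : ∀ j x, kap1 α x y (e j) (X j x) b t = ψ x * kap1 α x y (e j) (e j) b t := fun j x => by
    rw [kap1_lin _ _ _ _ _ _ ht]
    fin_cases j <;> simp [hX, e]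
  simp_rw [e1]
  rw [integral_add (integrable_kap_schwartz α (∂_{e 0} (X 0)) y b ht)
    (integrable_kap_schwartz α (∂_{e 1} (X 1)) y b ht), integral_kap_lineDeriv _ _ _ _ _ ht,
    integral_kap_lineDeriv _ _ _ _ _ ht, ← neg_add, ← integral_add
    (integrable_kap1_schwartz α (X 0) y b 0 ht) (integrable_kap1_schwartz α (X 1) y b 1 ht)]
  simp_rw [e2, ← mul_add, kap1, sum_K1_Rot _ _ _ ht]
  simp

theorem Adm.integral_inner_vel_gradS {α : ℝ} (hα : α ≠ 0) {h : Plane → Plane} (hh : Adm h)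
    (ψ : 𝓢(Plane, ℝ)) : ∫ x, ⟪vel α h x, gradS ψ x⟫ = 0 := by
  rw [hh.integral_inner_vel hα (adm_schwartz _)]
  have : ∀ y b, ∫ x, Gam α x y (gradS ψ x) b = 0 := fun y b => by
    refine tendsto_nhds_unique ((adm_schwartz (gradS ψ)).tendsto_right hα y b) ?_
    refine tendsto_const_nhds.congr fun n => ?_
    rw [setIntegral_congr_fun measurableSet_Ioc (fun t ht => integral_kap_gradS α ψ y b ht.1)]
    simp
  simp [this]

/-! ### Integrability from decay -/

theorem sg_one_le_one (z : Plane) : sg z 1 ≤ 1 := by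
  have := sg_le_sg_zero z (s := 1) one_pos
  simpa [sg_zero_left] using this

/-- By the triangle inequality at least one of |y| and |x-y| is no smaller than |x|/2. -/
theorem min_sg_le (x y : Plane) : min (sg (x - y) 1) (sg y 1) ≤ 2 * sg x 1 := by
  have hx := norm_sub_norm_le x y
  rcases le_total (‖x‖) (2 * ‖y‖) with h | h
  · refine (min_le_right _ _).trans (sg_le_sg one_pos two_pos ?_)
    nlinarith [norm_nonneg x]
  · refine (min_le_left _ _).trans (sg_le_sg one_pos two_pos ?_)
    nlinarith [norm_nonneg x, norm_nonneg (x - y)]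

theorem sg_mul_sg_le (x y : Plane) : sg (x - y) 1 * sg y 1 ≤ 2 * sg x 1 := by
  refine le_trans ?_ (min_sg_le x y)
  have h1 := sg_nonneg (x - y) 1
  have h2 := sg_nonneg y 1
  exact le_min (mul_le_of_le_one_right h1 (sg_one_le_one _)) (mul_le_of_le_one_left h2 (sg_one_le_one _))

theorem memLp_of_pow_le {E : Type*} [NormedAddCommGroup E] {v : Plane → E}
    (hv : AEStronglyMeasurable v volume) {k : ℕ} (hk : k ≠ 0) {C : ℝ}
    (h : ∀ᵐ x, ‖v x‖ ^ k ≤ C * sg x 1 ^ 3) : MemLp v k volume := by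
  refine (integrable_norm_rpow_iff hv (by exact_mod_cast hk) (ENNReal.natCast_ne_top k)).1 ?_
  simp only [ENNReal.toReal_natCast, Real.rpow_natCast]
  refine ((integrable_sg_one le_rfl).const_mul C).mono' (hv.norm.pow k) ?_
  filter_upwards [h] with x hx
  rwa [Real.norm_of_nonneg (by positivity)]

/-! ### The near part of the pressure -/

theorem lintegral_mul_sq_le {X : Type*} [MeasurableSpace X] {μ : Measure X} {f g : X → ℝ≥0∞}
    (hf : AEMeasurable f μ) (hg : AEMeasurable g μ) :
    (∫⁻ x, f x * g x ∂μ) ^ 2 ≤ (∫⁻ x, f x ^ 2 ∂μ) * ∫⁻ x, g x ^ 2 ∂μ := by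
  have h := ENNReal.lintegral_mul_le_Lp_mul_Lq μ Real.HolderConjugate.two_two hf hg
  simp only [Pi.mul_apply, ENNReal.rpow_two] at h
  refine (pow_le_pow_left' h 2).trans (le_of_eq ?_)
  rw [mul_pow, ← ENNReal.rpow_natCast, ← ENNReal.rpow_natCast, ← ENNReal.rpow_mul,
    ← ENNReal.rpow_mul]
  norm_num

/-- The potential of `k` with respect to the kernel `(s + |z|²)^{-3/2}`. -/
@[irreducible] def pot (k : Plane → ℝ≥0∞) (s : ℝ) (x : Plane) : ℝ≥0∞ :=
  ∫⁻ y, ENNReal.ofReal (sg (x - y) s ^ 3) * k y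

theorem measurable_pot {k : Plane → ℝ≥0∞} (hk : Measurable k) :
    Measurable fun q : ℝ × Plane => pot k q.1 q.2 := by
  unfold pot
  exact Measurable.lintegral_prod_right' (f := fun q : (ℝ × Plane) × Plane =>
    ENNReal.ofReal (sg (q.1.2 - q.2) q.1.1 ^ 3) * k q.2) (by fun_prop)

theorem pot_sq_le {k : Plane → ℝ≥0∞} (hk : Measurable k) {s : ℝ} (hs : 0 < s) (x : Plane) :
    pot k s x ^ 2 ≤ ENNReal.ofReal (Jc 6 * sg 0 s ^ 4) * ∫⁻ y, k y ^ 2 := by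
  rw [pot]
  refine (lintegral_mul_sq_le (by fun_prop) hk.aemeasurable).trans (le_of_eq ?_)
  rw [← lintegral_sg (volume.measurePreserving_sub_left x) 4 (by norm_num) hs]
  congr 1
  refine lintegral_congr fun y => ?_
  have := sg_nonneg (x - y) s
  rw [← ENNReal.ofReal_pow (by positivity), ← pow_mul]

/-- Cauchy–Schwarz with the kernel split into two square roots. Unlike the sup bound preceding it,
the result can be integrated over the plane. -/
theorem pot_sq_le' {k : Plane → ℝ≥0∞} (hk : Measurable k) {s : ℝ} (hs : 0 < s) (x : Plane) :
    pot k s x ^ 2 ≤ ENNReal.ofReal (Jc 3 * sg 0 s) * pot (fun y => k y ^ 2) s x := by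
  have e1 : ∀ y, ENNReal.ofReal (√(sg (x - y) s ^ 3)) ^ 2 = ENNReal.ofReal (sg (x - y) s ^ 3) :=
    fun y => by
      rw [← ENNReal.ofReal_pow (by positivity), Real.sq_sqrt (pow_nonneg (sg_nonneg _ _) _)]
  have h := lintegral_mul_sq_le (μ := volume) (f := fun y => ENNReal.ofReal (√(sg (x - y) s ^ 3)))
    (g := fun y => ENNReal.ofReal (√(sg (x - y) s ^ 3)) * k y) (by fun_prop) (by fun_prop)
  simp only [← mul_assoc, ← sq, e1, mul_pow] at h
  rw [pot, pot]
  refine h.trans (le_of_eq ?_)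
  rw [lintegral_sg (volume.measurePreserving_sub_left x) 1 le_rfl hs, pow_one]

theorem lintegral_pot {k : Plane → ℝ≥0∞} (hk : Measurable k) {s : ℝ} (hs : 0 < s) :
    ∫⁻ x, pot k s x = ENNReal.ofReal (Jc 3 * sg 0 s) * ∫⁻ y, k y := by
  unfold pot
  rw [lintegral_lintegral_swap (by fun_prop), ← lintegral_const_mul _ hk]
  refine lintegral_congr fun y => ?_
  rw [lintegral_mul_const _ (by fun_prop),
    lintegral_sg (measurePreserving_sub_right volume y) 1 le_rfl hs, pow_one]

/-- One factor is bounded in sup norm by a multiple of s^{-1}; the other two are integrated by the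
second Cauchy–Schwarz bound, which gives another s^{-1}. Altogether the growth is s^{-2}. -/
theorem lintegral_pot_cube_le {k : Plane → ℝ≥0∞} (hk : Measurable k) {s : ℝ} (hs : 0 < s) :
    ∫⁻ x, pot k s x ^ 3 ≤ (1 + ENNReal.ofReal (Jc 6) * ∫⁻ y, k y ^ 2) *
      (ENNReal.ofReal (Jc 3) ^ 2 * ∫⁻ y, k y ^ 2) * ENNReal.ofReal (sg 0 s ^ 4) := by
  have h0 := sg_pos 0 hs
  set B := ∫⁻ y, k y ^ 2
  -- Dividing the squared bound by the potential itself, when it exceeds 1/s, avoids a square root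
  -- of the L² norm.
  have h1 : ∀ x, pot k s x ≤ (1 + ENNReal.ofReal (Jc 6) * B) * ENNReal.ofReal (sg 0 s ^ 2) := by
    intro x
    rcases le_total (pot k s x) (ENNReal.ofReal (sg 0 s ^ 2)) with H | H
    · exact H.trans (le_mul_of_one_le_left' (by simp))
    · have h2 : ENNReal.ofReal (sg 0 s ^ 2) * pot k s x ≤
          ENNReal.ofReal (sg 0 s ^ 2) * (ENNReal.ofReal (Jc 6) * B * ENNReal.ofReal (sg 0 s ^ 2)) := by
        calc _ ≤ pot k s x ^ 2 := by rw [sq (pot k s x)]; exact mul_le_mul_left H _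
          _ ≤ _ := pot_sq_le hk hs x
          _ = _ := by
            rw [ENNReal.ofReal_mul (Jc_nonneg 6), show (4 : ℕ) = 2 + 2 from rfl, pow_add,
              ENNReal.ofReal_mul (by positivity)]
            ring
      have h3 := (ENNReal.mul_le_mul_iff_right (by positivity) ENNReal.ofReal_ne_top).1 h2
      refine h3.trans ?_
      exact mul_le_mul_left le_add_self _
  calc ∫⁻ x, pot k s x ^ 3
      ≤ ∫⁻ x, (1 + ENNReal.ofReal (Jc 6) * B) * ENNReal.ofReal (sg 0 s ^ 2) *
          (ENNReal.ofReal (Jc 3 * sg 0 s) * pot (fun y => k y ^ 2) s x) := by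
        refine lintegral_mono fun x => ?_
        rw [pow_succ' (pot k s x) 2]
        exact mul_le_mul' (h1 x) (pot_sq_le' hk hs x)
    _ = _ := by
        have hm : Measurable fun x => pot (fun y => k y ^ 2) s x :=
          (measurable_pot (hk.pow_const 2)).comp measurable_prodMk_left
        rw [lintegral_const_mul _ (hm.const_mul _), lintegral_const_mul _ hm,
          lintegral_pot (hk.pow_const 2) hs, ENNReal.ofReal_mul (Jc_nonneg 3),
          ENNReal.ofReal_pow h0.le, ENNReal.ofReal_pow h0.le]
        ring

theorem lintegral_Ioc_rpow_lt_top {r : ℝ} (hr : -1 < r) :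
    ∫⁻ s in Ioc (0 : ℝ) 1, ENNReal.ofReal (s ^ r) < ⊤ := by
  have h := (intervalIntegrable_iff_integrableOn_Ioc_of_le zero_le_one).1
    (intervalIntegral.intervalIntegrable_rpow' (a := 0) (b := 1) hr)
  exact h.lintegral_lt_top

/-- Hölder in time with exponents 3/2 and 3 and the splitting 1 = s^{-1/2}·s^{1/2}. The first factor
integrates s^{-3/4}; in the second, s^{3/2} reduces the growth s^{-2} of the cubes to s^{-1/2}. Both
are integrable on (0,1]. -/
theorem lintegral_pot_near_lt_top {k : Plane → ℝ≥0∞} (hk : Measurable k) (hB : ∫⁻ y, k y ^ 2 < ⊤) :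
    ∫⁻ x, (∫⁻ s in Ioc (0 : ℝ) 1, pot k s x) ^ 3 < ⊤ := by
  have hm := measurable_pot hk
  have hpq : Real.HolderConjugate (3 / 2) 3 := Real.holderConjugate_iff.2 (by norm_num)
  set A := ∫⁻ s in Ioc (0 : ℝ) 1, ENNReal.ofReal (s ^ (-(3 / 4) : ℝ)) with hA
  have hAt : A < ⊤ := lintegral_Ioc_rpow_lt_top (by norm_num)
  have h1 : ∀ x, (∫⁻ s in Ioc (0 : ℝ) 1, pot k s x) ^ 3 ≤
      A ^ 2 * ∫⁻ s in Ioc (0 : ℝ) 1, ENNReal.ofReal (s ^ (3 / 2 : ℝ)) * pot k s x ^ 3 := fun x => by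
    have hmx : Measurable fun s => pot k s x := hm.comp measurable_prodMk_right
    have h := ENNReal.lintegral_mul_le_Lp_mul_Lq (volume.restrict (Ioc (0 : ℝ) 1)) hpq
      (f := fun s => ENNReal.ofReal (s ^ (-(1 / 2) : ℝ)))
      (g := fun s => ENNReal.ofReal (s ^ (1 / 2 : ℝ)) * pot k s x) (by fun_prop) (by fun_prop)
    have e1 : ∫⁻ s in Ioc (0 : ℝ) 1, ((fun s => ENNReal.ofReal (s ^ (-(1 / 2) : ℝ))) *
        fun s => ENNReal.ofReal (s ^ (1 / 2 : ℝ)) * pot k s x) s = ∫⁻ s in Ioc (0 : ℝ) 1, pot k s x := by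
      refine setLIntegral_congr_fun measurableSet_Ioc fun s hs => ?_
      have := hs.1
      simp only [Pi.mul_apply, ← mul_assoc]
      rw [← ENNReal.ofReal_mul (by positivity), ← Real.rpow_add hs.1]
      simp
    have e2 : ∫⁻ s in Ioc (0 : ℝ) 1, (fun s => ENNReal.ofReal (s ^ (-(1 / 2) : ℝ))) s ^ (3 / 2 : ℝ) = A := by
      refine setLIntegral_congr_fun measurableSet_Ioc fun s hs => ?_
      have := hs.1
      simp only
      rw [ENNReal.ofReal_rpow_of_pos (by positivity), ← Real.rpow_mul hs.1.le]
      norm_num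
    have e3 : ∫⁻ s in Ioc (0 : ℝ) 1, (fun s => ENNReal.ofReal (s ^ (1 / 2 : ℝ)) * pot k s x) s ^ (3 : ℝ) =
        ∫⁻ s in Ioc (0 : ℝ) 1, ENNReal.ofReal (s ^ (3 / 2 : ℝ)) * pot k s x ^ 3 := by
      refine setLIntegral_congr_fun measurableSet_Ioc fun s hs => ?_
      have := hs.1
      simp only
      rw [ENNReal.mul_rpow_of_nonneg _ _ (by norm_num), ENNReal.ofReal_rpow_of_pos (by positivity),
        ← Real.rpow_mul hs.1.le]
      norm_num
    rw [e1, e2, e3] at h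
    refine (pow_le_pow_left' h 3).trans (le_of_eq ?_)
    rw [mul_pow, ← ENNReal.rpow_natCast, ← ENNReal.rpow_natCast, ← ENNReal.rpow_mul,
      ← ENNReal.rpow_mul]
    norm_num
  set D := (1 + ENNReal.ofReal (Jc 6) * ∫⁻ y, k y ^ 2) *
      (ENNReal.ofReal (Jc 3) ^ 2 * ∫⁻ y, k y ^ 2)
  have hm3 : Measurable fun q : Plane × ℝ => ENNReal.ofReal (q.2 ^ (3 / 2 : ℝ)) * pot k q.2 q.1 ^ 3 := by
    have := hm.comp measurable_swap
    simp only [Function.comp_def, Prod.swap] at this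
    fun_prop
  calc _ ≤ ∫⁻ x, A ^ 2 * ∫⁻ s in Ioc (0 : ℝ) 1, ENNReal.ofReal (s ^ (3 / 2 : ℝ)) * pot k s x ^ 3 :=
        lintegral_mono h1
    _ = A ^ 2 * ∫⁻ s in Ioc (0 : ℝ) 1, ENNReal.ofReal (s ^ (3 / 2 : ℝ)) * ∫⁻ x, pot k s x ^ 3 := by
        rw [lintegral_const_mul _ hm3.lintegral_prod_right', lintegral_lintegral_swap hm3.aemeasurable]
        congr 1
        refine lintegral_congr fun s => ?_
        simp only
        rw [lintegral_const_mul]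
        exact (hm.comp measurable_prodMk_left).pow_const 3
    _ ≤ A ^ 2 * ∫⁻ s in Ioc (0 : ℝ) 1, D * ENNReal.ofReal (s ^ (-(1 / 2) : ℝ)) := by
        refine mul_le_mul_right (setLIntegral_mono
          (g := fun s => D * ENNReal.ofReal (s ^ (-(1 / 2) : ℝ))) (by fun_prop) fun s hs => ?_) _
        refine (mul_le_mul_right (lintegral_pot_cube_le hk hs.1) _).trans (le_of_eq ?_)
        rw [mul_comm, mul_assoc, ← ENNReal.ofReal_mul (pow_nonneg (sg_nonneg _ _) _), sg_pow_eq _ _ _ hs.1.le]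
        congr 2
        simp only [norm_zero]
        norm_num
        rw [← Real.rpow_natCast, ← Real.rpow_neg hs.1.le, ← Real.rpow_add hs.1]
        norm_num
    _ < ⊤ := by
        rw [lintegral_const_mul _ (by fun_prop)]
        have := lintegral_Ioc_rpow_lt_top (r := -(1 / 2)) (by norm_num)
        have : D < ⊤ := by finiteness
        finiteness

/-! ### The pressure -/

/-- The flux `∫ ∂_{h(y)} G(x - y, s) dy`. -/
def dfl (h : Plane → Plane) (x : Plane) (s : ℝ) : ℝ := ∫ y, d1 (h y) (x - y) s

/-- The contribution of the times `s ≤ 1` to the pressure. -/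
def nearP (h : Plane → Plane) (x : Plane) : ℝ := -∫ s in Ioc (0 : ℝ) 1, dfl h x s

/-- The contribution of the times `s > 1` to the pressure. -/
def farP (h : Plane → Plane) (x : Plane) : ℝ := -∫ s in Ioi (1 : ℝ), dfl h x s

theorem dfl_congr {h h' : Plane → Plane} (H : h =ᵐ[volume] h') : dfl h = dfl h' := by
  funext x s
  refine integral_congr_ae ?_
  filter_upwards [H] with y hy
  rw [hy]

theorem measurable_dfl {h : Plane → Plane} (hh : AEStronglyMeasurable h volume) :
    Measurable fun q : Plane × ℝ => dfl h q.1 q.2 := by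
  rw [dfl_congr hh.ae_eq_mk]
  have hm := hh.stronglyMeasurable_mk.measurable
  unfold dfl
  refine (StronglyMeasurable.integral_prod_right
    (f := fun (q : Plane × ℝ) y => d1 (hh.mk h y) (q.1 - y) q.2) ?_).measurable
  refine Measurable.stronglyMeasurable ?_
  simp only [Function.uncurry_def]
  fun_prop

theorem measurable_nearP {h : Plane → Plane} (hh : AEStronglyMeasurable h volume) :
    Measurable (nearP h) :=
  (StronglyMeasurable.integral_prod_right (f := fun x s => dfl h x s)
    (measurable_dfl hh).stronglyMeasurable).measurable.neg

theorem measurable_farP {h : Plane → Plane} (hh : AEStronglyMeasurable h volume) :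
    Measurable (farP h) :=
  (StronglyMeasurable.integral_prod_right (f := fun x s => dfl h x s)
    (measurable_dfl hh).stronglyMeasurable).measurable.neg

theorem enorm_d1_le (b z : Plane) {s : ℝ} (hs : 0 < s) :
    ‖d1 b z s‖ₑ ≤ ENNReal.ofReal CK * (ENNReal.ofReal (sg z s ^ 3) * ‖b‖ₑ) := by
  rw [Real.enorm_eq_ofReal_abs, ← ofReal_norm b, ← ENNReal.ofReal_mul (pow_nonneg (sg_nonneg _ _) _),
    ← ENNReal.ofReal_mul CK_pos.le]
  exact ENNReal.ofReal_le_ofReal ((abs_d1_le b z hs).trans (le_of_eq (by ring)))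

theorem enorm_dfl_le (h : Plane → Plane) (x : Plane) {s : ℝ} (hs : 0 < s) :
    ‖dfl h x s‖ₑ ≤ ENNReal.ofReal CK * pot (fun y => ‖h y‖ₑ) s x := by
  rw [pot, ← lintegral_const_mul' _ _ ENNReal.ofReal_ne_top]
  exact (enorm_integral_le_lintegral_enorm _).trans
    (lintegral_mono fun y => enorm_d1_le (h y) (x - y) hs)

theorem pot_congr {k k' : Plane → ℝ≥0∞} (H : k =ᵐ[volume] k') : pot k = pot k' := by
  funext s x
  rw [pot, pot]
  refine lintegral_congr_ae ?_
  filter_upwards [H] with y hy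
  rw [hy]

theorem enorm_nearP_le (h : Plane → Plane) (x : Plane) :
    ‖nearP h x‖ₑ ≤ ENNReal.ofReal CK * ∫⁻ s in Ioc (0 : ℝ) 1, pot (fun y => ‖h y‖ₑ) s x := by
  rw [nearP, enorm_neg, ← lintegral_const_mul' _ _ ENNReal.ofReal_ne_top]
  refine (enorm_integral_le_lintegral_enorm _).trans (lintegral_mono_ae ?_)
  filter_upwards [ae_restrict_mem measurableSet_Ioc] with s hs
  exact enorm_dfl_le h x hs.1

theorem enorm_farP_le (h : Plane → Plane) (x : Plane) :
    ‖farP h x‖ₑ ≤ ENNReal.ofReal CK * ∫⁻ s in Ioi (1 : ℝ), pot (fun y => ‖h y‖ₑ) s x := by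
  rw [farP, enorm_neg, ← lintegral_const_mul' _ _ ENNReal.ofReal_ne_top]
  refine (enorm_integral_le_lintegral_enorm _).trans (lintegral_mono_ae ?_)
  filter_upwards [ae_restrict_mem measurableSet_Ioi] with s hs
  exact enorm_dfl_le h x (zero_lt_one.trans hs)

theorem memLp_nearP {h : Plane → Plane} (hh : MemLp h 2 volume) : MemLp (nearP h) 3 volume := by
  refine ⟨(measurable_nearP hh.1).aestronglyMeasurable,
    (eLpNorm_lt_top_iff_lintegral_rpow_enorm_lt_top (by norm_num) (by norm_num)).2 ?_⟩
  have hk := hh.1.ae_eq_mk.mono fun y hy => congrArg (‖·‖ₑ) hy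
  have hm := hh.1.stronglyMeasurable_mk.measurable.enorm
  have hB : ∫⁻ y, ‖hh.1.mk h y‖ₑ ^ 2 < ⊤ :=
    (lintegral_congr_ae (hk.mono fun y hy => congrArg (· ^ 2) hy)).symm.trans_lt
      (lintegral_enorm_sq_lt_top hh)
  have key := lintegral_pot_near_lt_top hm hB
  rw [← pot_congr hk] at key
  have e : ∀ x, ‖nearP h x‖ₑ ^ (3 : ℝ≥0∞).toReal ≤ ENNReal.ofReal CK ^ 3 *
      (∫⁻ s in Ioc (0 : ℝ) 1, pot (fun y => ‖h y‖ₑ) s x) ^ 3 := fun x => by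
    rw [← mul_pow, ENNReal.toReal_ofNat]
    have : ‖nearP h x‖ₑ ^ (3 : ℝ) = ‖nearP h x‖ₑ ^ 3 := by
      exact_mod_cast ENNReal.rpow_natCast _ 3
    rw [this]
    exact pow_le_pow_left' (enorm_nearP_le h x) 3
  refine (lintegral_mono e).trans_lt ?_
  rw [lintegral_const_mul' _ _ (by finiteness)]
  finiteness

theorem pot_le {k : Plane → ℝ≥0∞} (x : Plane) {s : ℝ} (hs : 0 < s) :
    pot k s x ≤ ENNReal.ofReal (sg 0 s ^ 3) * ∫⁻ y, k y := by
  rw [pot, ← lintegral_const_mul' _ _ ENNReal.ofReal_ne_top]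
  gcongr with y
  · exact sg_nonneg _ _
  · exact sg_le_sg_zero _ hs

theorem lintegral_pot_far {k : Plane → ℝ≥0∞} (hk : AEMeasurable k) (x : Plane) :
    ∫⁻ s in Ioi (1 : ℝ), pot k s x = ∫⁻ y, ENNReal.ofReal (2 * sg (x - y) 1) * k y := by
  simp only [pot]
  have hm : AEMeasurable (Function.uncurry fun s y => ENNReal.ofReal (sg (x - y) s ^ 3) * k y)
      (((volume : Measure ℝ).restrict (Ioi 1)).prod volume) :=
    (Measurable.aemeasurable (by fun_prop)).mul hk.comp_snd
  rw [lintegral_lintegral_swap hm]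
  refine lintegral_congr fun y => ?_
  obtain ⟨h1, h2⟩ := integrableOn_sg_pow (x - y) 0 zero_le_one (by positivity)
  rw [lintegral_mul_const _ (by fun_prop), ← ofReal_integral_eq_lintegral_ofReal h1
    (Eventually.of_forall fun s => pow_nonneg (sg_nonneg _ _) _), h2]
  norm_num

theorem lintegral_mul_pot_le {g : Plane → ℝ} (hgm : Measurable g) (hg : Integrable g) {A : ℝ}
    (hA : ∀ x, |g x| ≤ A) {k : Plane → ℝ≥0∞} (hk : Measurable k) {s : ℝ} (hs : 0 < s) :
    ∫⁻ x, ‖g x‖ₑ * pot k s x ≤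
      ENNReal.ofReal (min (A * Jc 3 * sg 0 s) ((∫ x, |g x|) * sg 0 s ^ 3)) * ∫⁻ y, k y := by
  have hA0 : 0 ≤ A := (abs_nonneg _).trans (hA 0)
  rcases min_choice (A * Jc 3 * sg 0 s) ((∫ x, |g x|) * sg 0 s ^ 3) with h | h <;> rw [h]
  · calc ∫⁻ x, ‖g x‖ₑ * pot k s x ≤ ∫⁻ x, ENNReal.ofReal A * pot k s x := by
          gcongr with x
          rw [Real.enorm_eq_ofReal_abs]
          exact ENNReal.ofReal_le_ofReal (hA x)
      _ = _ := by
          rw [lintegral_const_mul' _ _ ENNReal.ofReal_ne_top, lintegral_pot hk hs, ← mul_assoc,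
            ← ENNReal.ofReal_mul hA0, mul_assoc]
  · calc ∫⁻ x, ‖g x‖ₑ * pot k s x ≤ ∫⁻ x, ‖g x‖ₑ * (ENNReal.ofReal (sg 0 s ^ 3) * ∫⁻ y, k y) := by
          gcongr with x
          exact pot_le x hs
      _ = _ := by
          rw [lintegral_mul_const _ hgm.enorm, ENNReal.ofReal_mul (integral_nonneg fun _ => abs_nonneg _),
            ← mul_assoc]
          congr 2
          simp_rw [← Real.norm_eq_abs]
          rw [ofReal_integral_norm_eq_lintegral_enorm hg]

/-- Fubini in the three variables s, x and y identifies the pressure. Absolute integrability comes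
from the minimum of the sup and L¹ bounds of g in time, together with integrability of h. -/
theorem integral_newton {g : Plane → ℝ} (hgm : Measurable g) (hg : Integrable g) {A : ℝ}
    (hA : ∀ x, |g x| ≤ A) {h : Plane → Plane} (hh : Integrable h) :
    ∫ y, newton g y (h y) = ∫ x, (nearP h x + farP h x) * g x := by
  -- Replacing h by a measurable representative changes the integrands only on null sets.
  wlog hm : Measurable h generalizing h
  · have H := hh.1.ae_eq_mk
    have := this (hh.congr H) hh.1.stronglyMeasurable_mk.measurable
    simp only [nearP, farP, dfl_congr H] at this ⊢
    rw [← this]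
    refine integral_congr_ae ?_
    filter_upwards [H] with y hy
    rw [← hy]
  have hA0 : 0 ≤ A := (abs_nonneg _).trans (hA 0)
  set μ := (volume : Measure ℝ).restrict (Ioi 0) with hμ
  set Φ : (ℝ × Plane) × Plane → ℝ := fun q => g q.1.2 * d1 (h q.2) (q.1.2 - q.2) q.1.1 with hΦ
  have mΦ : Measurable Φ := by fun_prop
  have iΦ : Integrable Φ ((μ.prod volume).prod volume) := by
    refine ⟨mΦ.aestronglyMeasurable, ?_⟩
    rw [HasFiniteIntegral, lintegral_prod _ mΦ.enorm.aemeasurable,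
      lintegral_prod _ mΦ.enorm.lintegral_prod_right'.aemeasurable]
    have hmin := integrableOn_min_sg (A := A * Jc 3) (B := ∫ x, |g x|) (mul_nonneg hA0 (Jc_nonneg 3))
      (integral_nonneg fun _ => abs_nonneg _)
    calc ∫⁻ s, (∫⁻ x, ∫⁻ y, ‖Φ ((s, x), y)‖ₑ) ∂μ
        ≤ ∫⁻ s, ENNReal.ofReal CK * (ENNReal.ofReal (min (A * Jc 3 * sg 0 s)
            ((∫ x, |g x|) * sg 0 s ^ 3)) * ∫⁻ y, ‖h y‖ₑ) ∂μ := by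
          refine lintegral_mono_ae ?_
          filter_upwards [ae_restrict_mem measurableSet_Ioi] with s hs
          refine le_trans ?_ (mul_le_mul_right (lintegral_mul_pot_le hgm hg hA hm.enorm hs) _)
          rw [← lintegral_const_mul' _ _ ENNReal.ofReal_ne_top]
          refine lintegral_mono fun x => ?_
          rw [pot, ← lintegral_const_mul' _ _ (by finiteness), ← lintegral_const_mul' _ _ (by finiteness)]
          refine lintegral_mono fun y => ?_
          simp only [hΦ, enorm_mul]
          refine (mul_le_mul_right (enorm_d1_le _ _ hs) _).trans (le_of_eq (by ring))
      _ < ⊤ := by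
          have h1 : ∫⁻ y, ‖h y‖ₑ < ⊤ := hh.2
          have h2 := Integrable.lintegral_lt_top hmin
          rw [lintegral_const_mul' _ _ ENNReal.ofReal_ne_top, lintegral_mul_const' _ _ h1.ne]
          finiteness
  have e1 : ∀ᵐ y, newton g y (h y) = -∫ q, Φ (q, y) ∂(μ.prod volume) := by
    filter_upwards [iΦ.prod_left_ae] with y hy
    rw [integral_prod _ hy, newton]
    simp only [convD1, hΦ, hμ, Rot_zero]
  have e2 : ∀ᵐ x, (nearP h x + farP h x) * g x = -∫ s, (∫ y, Φ ((s, x), y)) ∂μ := by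
    filter_upwards [iΦ.integral_prod_left.prod_left_ae] with x hx
    have e3 : ∀ s, ∫ y, Φ ((s, x), y) = g x * dfl h x s := fun s => by
      rw [dfl, ← integral_const_mul]
    simp only [e3] at hx ⊢
    have hx' : IntegrableOn (fun s => g x * dfl h x s) (Ioi 0) := hx
    rw [hμ, ← Ioc_union_Ioi_eq_Ioi zero_le_one, setIntegral_union Ioc_disjoint_Ioi_same
      measurableSet_Ioi (hx'.mono_set Ioc_subset_Ioi_self) (hx'.mono_set (Ioi_subset_Ioi zero_le_one)),
      integral_const_mul, integral_const_mul, nearP, farP]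
    ring
  rw [integral_congr_ae e1, integral_congr_ae e2, integral_neg, integral_neg,
    ← integral_integral_swap iΦ, integral_prod _ iΦ.integral_prod_left,
    ← integral_integral_swap (f := fun s x => ∫ y, Φ ((s, x), y)) iΦ.integral_prod_left]

/-! ### Compactly supported forces -/

theorem measurableSet_ballCompl (r : ℝ) : MeasurableSet (ballCompl r) :=
  measurableSet_le measurable_const measurable_norm

theorem ae_le_wNorm {E : Type*} [NormedAddCommGroup E] {s : ℝ} {S : Set Plane}
    (hS : MeasurableSet S) {g : Plane → E} (hg : wNorm s S g < ⊤) :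
    ∀ᵐ x, x ∈ S → (1 + ‖x‖) ^ s * ‖g x‖ ≤ (wNorm s S g).toReal := by
  have h := ae_le_eLpNormEssSup (f := fun x => (1 + ‖x‖) ^ s * ‖g x‖) (μ := volume.restrict S)
  rw [ae_restrict_iff' hS] at h
  filter_upwards [h] with x hx hxS
  have h1 := hx hxS
  rw [← eLpNorm_exponent_top] at h1
  have h2 := ENNReal.toReal_mono hg.ne h1
  rwa [toReal_enorm, Real.norm_of_nonneg (by positivity)] at h2

theorem inv_norm_le_sg {x : Plane} (hx : 1 ≤ ‖x‖) : ‖x‖⁻¹ ≤ 2 * sg x 1 := by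
  rw [sg, ← div_eq_mul_inv, le_div_iff₀ (by positivity), ← div_eq_inv_mul,
    div_le_iff₀ (by positivity)]
  exact Real.sqrt_le_iff.2 ⟨by positivity, by nlinarith⟩

/-- Decay like |x|^{-1/2} suffices, because its sixth power is |x|^{-3}, integrable at infinity in
the plane. The exponent 6 thus tolerates crude decay estimates. -/
theorem memLp_six {v : Plane → Plane} (hv : AEStronglyMeasurable v volume) {r A B : ℝ} (hr : 1 ≤ r)
    (hB : 0 ≤ B) (hn : ∀ x, ‖x‖ < r → ‖v x‖ ≤ A) (hf : ∀ᵐ x, r ≤ ‖x‖ → ‖v x‖ ^ 2 * ‖x‖ ≤ B) :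
    MemLp v 6 volume := by
  have h6 := memLp_of_pow_le hv (k := 6) (by norm_num)
    (C := (A ^ 2 * (2 * r)) ^ 3 + (B * 2) ^ 3) ?_
  · exact_mod_cast h6
  filter_upwards [hf] with x hx
  have h0 := sg_nonneg x 1
  have e : (A ^ 2 * (2 * r)) ^ 3 * sg x 1 ^ 3 = (A ^ 2 * (2 * r * sg x 1)) ^ 3 := by ring
  have e' : (B * 2) ^ 3 * sg x 1 ^ 3 = (B * (2 * sg x 1)) ^ 3 := by ring
  rw [show 6 = 2 * 3 from rfl, pow_mul, add_mul, e, e']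
  rcases lt_or_ge ‖x‖ r with h | h
  · have h1 : 1 ≤ 2 * r * sg x 1 := by
      rw [sg, ← div_eq_mul_inv, le_div_iff₀ (by positivity), one_mul]
      exact Real.sqrt_le_iff.2 ⟨by positivity, by nlinarith [norm_nonneg x]⟩
    have h2 : ‖v x‖ ^ 2 ≤ A ^ 2 * (2 * r * sg x 1) :=
      (pow_le_pow_left₀ (norm_nonneg _) (hn x h) 2).trans (le_mul_of_one_le_right (sq_nonneg _) h1)
    have h3 := pow_le_pow_left₀ (by positivity) h2 3
    have h4 : 0 ≤ (B * (2 * sg x 1)) ^ 3 := by positivity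
    linarith
  · have hx0 : 0 < ‖x‖ := by linarith
    have h1 : ‖v x‖ ^ 2 ≤ B * (2 * sg x 1) := by
      calc ‖v x‖ ^ 2 = (‖v x‖ ^ 2 * ‖x‖) * ‖x‖⁻¹ := by field_simp
        _ ≤ B * (2 * sg x 1) := by
          gcongr
          · exact hx h
          · exact inv_norm_le_sg (hr.trans h)
    have h2 := pow_le_pow_left₀ (by positivity) h1 3
    have h3 : 0 ≤ (A ^ 2 * (2 * r * sg x 1)) ^ 3 := by positivity
    linarith

theorem norm_vortex (x : Plane) : ‖vortex x‖ ≤ ‖x‖⁻¹ := by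
  have hp : ‖perp x‖ = ‖x‖ := by
    rw [← sq_eq_sq₀ (norm_nonneg _) (norm_nonneg _), norm_sq_eq, norm_sq_eq]
    simp [perp]; ring
  rcases eq_or_ne x 0 with rfl | hx
  · simp [vortex]
  have hx0 : 0 < ‖x‖ := norm_pos_iff.2 hx
  rw [vortex, norm_smul, hp, Real.norm_of_nonneg (by positivity), div_mul_eq_mul_div,
    div_le_iff₀ (by positivity)]
  have := Real.pi_gt_three
  field_simp
  nlinarith

theorem weak_div_of_gradS {u : Plane → Plane} (hu : ∀ ψ : 𝓢(Plane, ℝ), ∫ x, ⟪u x, gradS ψ x⟫ = 0)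
    (ψ : Plane → ℝ) (hψ : ContDiff ℝ (⊤ : ℕ∞) ψ) (hc : HasCompactSupport ψ) :
    ∫ x, ∑ i : Fin 2, u x i * pderiv i ψ x = 0 := by
  rw [← hu (hc.toSchwartzMap hψ)]
  refine integral_congr_ae (Eventually.of_forall fun x => ?_)
  simp only [inner_eq, gradS_apply, Fin.sum_univ_two]
  rfl

/-- On the support the weight at y is at least (1+R²)^{-1/2}. It may therefore be inserted at that
cost, and the product of the weights at x-y and y is controlled by the weight at x. -/
theorem farP_bound {h : Plane → Plane} (hh : Integrable h) {R : ℝ}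
    (h0 : ∀ᵐ y ∂(volume : Measure Plane), R ≤ ‖y‖ → h y = 0) (x : Plane) :
    ‖farP h x‖ ≤ (CK * (4 * √(1 + R ^ 2)) * ∫ y, ‖h y‖) * sg x 1 := by
  have hC := CK_pos
  have hs := sg_nonneg x 1
  have h1 := (enorm_farP_le h x).trans (mul_le_mul_right (lintegral_pot_far hh.1.enorm x).le _)
  have h2 : ∫⁻ y, ENNReal.ofReal (2 * sg (x - y) 1) * ‖h y‖ₑ ≤
      ENNReal.ofReal (4 * √(1 + R ^ 2) * sg x 1) * ∫⁻ y, ‖h y‖ₑ := by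
    rw [← lintegral_const_mul' _ _ ENNReal.ofReal_ne_top]
    refine lintegral_mono_ae ?_
    filter_upwards [h0] with y hy
    rcases le_or_gt R ‖y‖ with H | H
    · simp [hy H]
    · gcongr ENNReal.ofReal ?_ * _
      have h3 := sg_mul_sg_le x y
      have h4 : 1 ≤ √(1 + R ^ 2) * sg y 1 := by
        rw [sg, ← div_eq_mul_inv, le_div_iff₀ (by positivity), one_mul]
        exact Real.sqrt_le_sqrt (by nlinarith [norm_nonneg y])
      have h5 : sg (x - y) 1 ≤ sg (x - y) 1 * (√(1 + R ^ 2) * sg y 1) :=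
        le_mul_of_one_le_right (sg_nonneg _ _) h4
      nlinarith [Real.sqrt_nonneg (1 + R ^ 2)]
  have h3 := h1.trans (mul_le_mul_right h2 _)
  rw [← ofReal_integral_norm_eq_lintegral_enorm hh, ← ENNReal.ofReal_mul (by positivity),
    ← ENNReal.ofReal_mul hC.le, ← ofReal_norm,
    ENNReal.ofReal_le_ofReal_iff (by positivity)] at h3
  exact h3.trans (le_of_eq (by ring))

theorem memLp_pressure {h : Plane → Plane} (hh : MemLp h 2 volume) {q : Plane → ℝ} (hq : Measurable q)
    {C : ℝ} (hb : ∀ x, ‖q x‖ ≤ C * sg x 1) : MemLp (fun x => nearP h x + q x) 3 volume := by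
  refine (memLp_nearP hh).add ?_
  have := memLp_of_pow_le (v := q) hq.aestronglyMeasurable (k := 3) (by norm_num) (C := C ^ 3)
    (Eventually.of_forall fun x => by
      rw [← mul_pow]
      exact pow_le_pow_left₀ (norm_nonneg _) (hb x) 3)
  exact_mod_cast this

theorem compact_support_case {α γ R : ℝ} (hα : α ≠ 0) (hγ : 0 ≤ γ) (hγ' : γ < 1) (hR : 1 ≤ R)
    {f : Plane → Plane} (hf : MemLp f 2 volume)
    (h0 : ∀ᵐ y ∂(volume : Measure Plane), R ≤ ‖y‖ → f y = 0) :
    LConverges α f ∧ Tendsto (regTorque f) (𝓝[>] (0 : ℝ)) (𝓝 (c f)) ∧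
      (∃ p : Plane → ℝ, IsWeakSolution α f (L α f) p) ∧
      ∃ Rem : Plane → Plane, (∀ x : Plane, x ≠ 0 → L α f x = c f • vortex x + Rem x) ∧
        wNorm (1 + γ) (ballCompl (2 * R)) Rem ≤ ((192 * CK).toNNReal : ℝ≥0∞) *
          (ENNReal.ofReal (|α| ^ (-(1 + γ) / 2)) * eLpNorm f 1 (volume.restrict (Metric.ball 0 R)) +
            eLpNorm (fun y => ‖y‖ ^ (1 + γ) * ‖f y‖) 1 (volume.restrict (Metric.ball 0 R))) := by
  have ha := adm_of_support hf h0
  obtain ⟨hL, hv⟩ := LConverges_of_tendsto hα hf (ha.tendsto_vel hα)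
  have ht := tendsto_regTorque hf h0
  have hc : c f = ∫ y, ⟪perp y, f y⟫ := ht.limUnder_eq
  have hi := ha.integrable
  refine ⟨hL, hc ▸ ht, ⟨fun x => nearP f x + farP f x, ⟨6, ?_, ?_, ?_⟩, ⟨3, ?_, ?_, ?_⟩, ?_, ?_⟩,
    fun x => vel α f x - c f • vortex x, fun x _ => by rw [hv]; module, ?_⟩
  · norm_num
  · norm_num
  · rw [hv]
    -- The remainder bound at γ = 0, where the theorem's γ plays no role, already gives decay 1/|x|
    -- and hence integrability of the velocity.
    have hw := wNorm_rem_le hα le_rfl zero_lt_one hR hf h0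
    have hw' := hw.trans_lt (ENNReal.mul_lt_top ENNReal.coe_lt_top (by
      have h1 : eLpNorm f 1 (volume.restrict (Metric.ball 0 R)) < ⊤ :=
        (memLp_one_iff_integrable.2 hi.integrableOn).2
      have h2 : eLpNorm (fun y => ‖y‖ ^ ((1 : ℝ) + 0) * ‖f y‖) 1 (volume.restrict (Metric.ball 0 R)) < ⊤ := by
        refine lt_of_le_of_lt (eLpNorm_mono_ae (g := fun y => R * ‖f y‖) ?_)
          (memLp_one_iff_integrable.2 (hi.norm.const_mul R).integrableOn).2
        filter_upwards [ae_restrict_mem Metric.isOpen_ball.measurableSet] with y hy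
        rw [mem_ball_zero_iff] at hy
        simp only [norm_mul, norm_norm, add_zero, Real.rpow_one]
        gcongr
        exact hy.le.trans (le_abs_self R)
      finiteness))
    have hb := ae_le_wNorm (measurableSet_ballCompl _) hw'
    set W := (wNorm (1 + 0) (ballCompl (2 * R))
      (fun x => vel α f x - (∫ y, ⟪perp y, f y⟫) • vortex x)).toReal
    have hA := ha.admC_lt_top α
    refine memLp_six (ha.measurable_vel hα).aestronglyMeasurable (r := 2 * R)
      (A := (1 + √(2 * R)) * (admC α f).toReal) (B := (W + |∫ y, ⟪perp y, f y⟫|) ^ 2) (by linarith) (sq_nonneg _) ?_ ?_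
    · intro x hx
      have h1 := ENNReal.toReal_mono (by have := wt_ne_top x; finiteness) (ha.enorm_vel_le hα x)
      rw [toReal_enorm, ENNReal.toReal_mul, wt, ENNReal.toReal_ofReal (by positivity)] at h1
      refine h1.trans ?_
      gcongr
    · filter_upwards [hb] with x hx hxR
      have hx0 : 1 ≤ ‖x‖ := by linarith
      have h1 := hx hxR
      rw [add_zero, Real.rpow_one] at h1
      set k := ∫ y, ⟪perp y, f y⟫
      have h2 : ‖vel α f x‖ ≤ ‖vel α f x - k • vortex x‖ + |k| * ‖x‖⁻¹ := by
        have h3 : ‖k • vortex x‖ ≤ |k| * ‖x‖⁻¹ := by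
          rw [norm_smul, Real.norm_eq_abs]
          exact mul_le_mul_of_nonneg_left (norm_vortex x) (abs_nonneg _)
        have := norm_le_norm_sub_add (vel α f x) (k • vortex x)
        linarith
      have h4 : ‖vel α f x‖ * ‖x‖ ≤ W + |k| := by
        have h5 := mul_le_mul_of_nonneg_right h2 (norm_nonneg x)
        have h6 : |k| * ‖x‖⁻¹ * ‖x‖ = |k| := by field_simp
        have h7 := norm_nonneg (vel α f x - k • vortex x)
        nlinarith
      calc ‖vel α f x‖ ^ 2 * ‖x‖ ≤ (‖vel α f x‖ * ‖x‖) ^ 2 := by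
            rw [mul_pow]
            have := sq_nonneg ‖vel α f x‖
            gcongr
            nlinarith
        _ ≤ _ := pow_le_pow_left₀ (by positivity) h4 2
  · norm_num
  · norm_num
  · exact memLp_pressure hf (measurable_farP hf.1) (farP_bound hi h0)
  · rw [hv]
    exact weak_div_of_gradS fun ψ => ha.integral_inner_vel_gradS hα ψ
  · intro φ
    have h1 := ha.integral_inner_vel_rotOp hα φ
    have h2 := integral_newton (divS φ).continuous.measurable (divS φ).integrable
      (SchwartzMap.norm_le_seminorm ℝ (divS φ)) hi
    simp only [divS_apply] at h2
    rw [hv, h1, ← h2]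
    ring_nf
  · rw [hc]
    exact wNorm_rem_le hα hγ hγ' hR hf h0

/-! ### Potentials of slowly decaying densities -/

/-- The integral of `(1 + |z|²)^{-5/4}`. -/
def Jh : ℝ := ∫ z : Plane, sg z 1 ^ 2 * √(sg z 1)

theorem integrable_sg_half_one : Integrable fun z : Plane => sg z 1 ^ 2 * √(sg z 1) := by
  have h := integrable_rpow_neg_one_add_norm_sq (E := Plane) (μ := volume) (r := 5 / 2)
    (by simp; norm_num)
  refine h.congr (Eventually.of_forall fun z => ?_)
  have h0 : 0 ≤ 1 + ‖z‖ ^ 2 := by positivity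
  have h2 : sg z 1 ^ 2 * √(sg z 1) = sg z 1 ^ (5 / 2 : ℝ) := by
    rw [Real.sqrt_eq_rpow, ← Real.rpow_two, ← Real.rpow_add (sg_pos z one_pos)]
    norm_num
  simp only
  rw [h2, sg, Real.sqrt_eq_rpow, ← Real.rpow_neg h0, ← Real.rpow_mul h0]
  norm_num

theorem lintegral_sg_half {τ : Plane → Plane} (hτ : MeasurePreserving τ volume volume) {t : ℝ}
    (ht : 0 < t) : ∫⁻ y, ENNReal.ofReal (sg (τ y) t ^ 2 * √(sg (τ y) t)) =
      ENNReal.ofReal (Jh * √(sg 0 t)) := by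
  have h0 := sg_pos 0 ht
  have e : ∀ z : Plane, sg z t ^ 2 * √(sg z t) = sg 0 t ^ 2 * √(sg 0 t) *
      (fun w => sg w 1 ^ 2 * √(sg w 1)) (sg 0 t • z) := fun z => by
    simp only
    rw [sg_eq_smul z ht, Real.sqrt_mul h0.le]; ring
  have hi : Integrable fun z : Plane => sg z t ^ 2 * √(sg z t) := by
    rw [funext e]
    exact (integrable_sg_half_one.comp_smul h0.ne').const_mul _
  rw [hτ.lintegral_comp (f := fun z => ENNReal.ofReal (sg z t ^ 2 * √(sg z t))) (by fun_prop),
    ← ofReal_integral_eq_lintegral_ofReal hi (Eventually.of_forall fun z => by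
      have := sg_nonneg z t; positivity)]
  congr 1
  have h2 := Measure.integral_comp_smul_of_nonneg volume (fun w : Plane => sg w 1 ^ 2 * √(sg w 1))
    (sg 0 t) (hR := h0.le)
  rw [funext e, integral_const_mul, h2, Jh]
  simp
  field_simp

theorem Jh_nonneg : 0 ≤ Jh := integral_nonneg fun z => by
  have := sg_nonneg z 1
  positivity

/-- A form of Young's inequality: a quadratic density is borderline nonintegrable in the plane, and
a square root taken from the kernel lifts it to the integrable exponent 5/2. -/
theorem sqrt_mul_sq_le {a b : ℝ} (hb : 0 ≤ b) :
    √a * b ^ 2 ≤ a ^ 2 * √a + b ^ 2 * √b := by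
  have h1 := Real.sqrt_nonneg a
  have h2 := Real.sqrt_nonneg b
  rcases le_total a b with h | h
  · have := Real.sqrt_le_sqrt h
    nlinarith [sq_nonneg a, mul_le_mul_of_nonneg_right this (sq_nonneg b), mul_nonneg (sq_nonneg a) h1]
  · have : b ^ 2 ≤ a ^ 2 := pow_le_pow_left₀ hb h 2
    nlinarith [mul_le_mul_of_nonneg_right this h1, mul_nonneg (sq_nonneg b) h2]

/-- The potential `∫₀^∞ ∫ (t + |O(αt)x - y|²)^{-3/2} k(y) dy dt`. -/
@[irreducible] def rpot (α : ℝ) (k : Plane → ℝ≥0∞) (x : Plane) : ℝ≥0∞ :=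
  ∫⁻ t in Ioi (0 : ℝ), ∫⁻ y, ENNReal.ofReal (sg (Rot (α * t) x - y) t ^ 3) * k y

theorem rpot_mono {α : ℝ} {k k' : Plane → ℝ≥0∞} (h : ∀ᵐ y, k y ≤ k' y) (x : Plane) :
    rpot α k x ≤ rpot α k' x := by
  rw [rpot, rpot]
  refine lintegral_mono fun t => lintegral_mono_ae ?_
  filter_upwards [h] with y hy
  exact mul_le_mul_right hy _

theorem rpot_const_mul {α : ℝ} {c : ℝ≥0∞} (hc : c ≠ ⊤) (k : Plane → ℝ≥0∞) (x : Plane) :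
    rpot α (fun y => c * k y) x = c * rpot α k x := by
  rw [rpot, rpot, ← lintegral_const_mul' _ _ hc]
  refine lintegral_congr fun t => ?_
  rw [← lintegral_const_mul' _ _ hc]
  exact lintegral_congr fun y => mul_left_comm _ _ _

theorem integrableOn_Ioi_sg_half {τ : ℝ} (hτ : 0 < τ) :
    ∫⁻ t in Ioi τ, ENNReal.ofReal (sg 0 t ^ 2 * √(sg 0 t)) = ENNReal.ofReal (4 * √(sg 0 τ)) := by
  have e : ∀ t, 0 < t → √(sg 0 t) = t ^ (-(1 / 4) : ℝ) := fun t ht => by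
    rw [sg_zero_left, Real.sqrt_eq_rpow, Real.sqrt_eq_rpow, ← Real.rpow_neg ht.le, ← Real.rpow_mul ht.le]
    norm_num
  have e' : ∀ t ∈ Ioi τ, ENNReal.ofReal (sg 0 t ^ 2 * √(sg 0 t)) = ENNReal.ofReal (t ^ (-(5 / 4) : ℝ)) :=
    fun t ht => by
      have h0 : 0 < t := hτ.trans ht
      rw [e t h0, sg_pow_eq _ _ _ h0.le]
      simp only [norm_zero]
      norm_num
      rw [← Real.rpow_add h0]
      norm_num
  rw [setLIntegral_congr_fun measurableSet_Ioi e', ← ofReal_integral_eq_lintegral_ofReal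
    (integrableOn_Ioi_rpow_of_lt (by norm_num) hτ), integral_Ioi_rpow_of_lt (by norm_num) hτ, e τ hτ]
  · congr 1; norm_num; ring
  · filter_upwards [ae_restrict_mem measurableSet_Ioi] with t ht
    have : 0 < t := hτ.trans ht
    simp only [Pi.zero_apply]
    positivity

/-- The constant in the bound of `rpot` for densities decaying quadratically. -/
def farC : ℝ := 2 * Jc 3 + 8 * Jh

theorem farC_nonneg : 0 ≤ farC := by
  have := Jc_nonneg 3
  have := Jh_nonneg
  unfold farC; positivity

/-- For t ≤ τ the density is at most 1/τ and the kernel has mass of order t^{-1/2}. For t > τ half a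
power of the kernel is retained in space and the rest becomes t^{-5/4}. Each range contributes a
multiple of τ^{-1/2}, uniformly in x. -/
theorem rpot_sg_le (α : ℝ) (x : Plane) {τ : ℝ} (hτ : 0 < τ) :
    rpot α (fun y => ENNReal.ofReal (sg y τ ^ 2)) x ≤ ENNReal.ofReal (farC * sg 0 τ) := by
  have h0 := sg_pos 0 hτ
  have hJ := Jc_nonneg 3
  have hJ' := Jh_nonneg
  rw [rpot, ← Ioc_union_Ioi_eq_Ioi hτ.le, lintegral_union measurableSet_Ioi Ioc_disjoint_Ioi_same,
    farC, add_mul, ENNReal.ofReal_add (by positivity) (by positivity)]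
  refine add_le_add ?_ ?_
  · calc ∫⁻ t in Ioc 0 τ, ∫⁻ y, ENNReal.ofReal (sg (Rot (α * t) x - y) t ^ 3) * ENNReal.ofReal (sg y τ ^ 2)
        ≤ ∫⁻ t in Ioc 0 τ, ENNReal.ofReal (sg 0 τ ^ 2 * Jc 3) * ENNReal.ofReal (sg 0 t) := by
          refine setLIntegral_mono (by fun_prop) fun t ht => ?_
          calc _ ≤ ∫⁻ y, ENNReal.ofReal (sg (Rot (α * t) x - y) t ^ 3) * ENNReal.ofReal (sg 0 τ ^ 2) := by
                gcongr with y
                · exact sg_nonneg _ _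
                · exact sg_le_sg_zero _ hτ
            _ = _ := by
                rw [lintegral_mul_const _ (by fun_prop),
                  lintegral_sg (measurePreserving_Rot_sub _ x) 1 le_rfl ht.1, pow_one,
                  ← ENNReal.ofReal_mul (mul_nonneg hJ (sg_nonneg _ _)),
                  ← ENNReal.ofReal_mul (by positivity)]
                congr 1; ring
      _ = _ := by
          rw [lintegral_const_mul _ (by fun_prop), lintegral_sg_zero_Ioc _ hτ.le,
            ← ENNReal.ofReal_mul (by positivity)]
          congr 1
          have : 0 < √τ := Real.sqrt_pos.2 hτ
          rw [sg_zero_left]; field_simp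
  · calc ∫⁻ t in Ioi τ, ∫⁻ y, ENNReal.ofReal (sg (Rot (α * t) x - y) t ^ 3) * ENNReal.ofReal (sg y τ ^ 2)
        ≤ ∫⁻ t in Ioi τ, ENNReal.ofReal (2 * (Jh * √(sg 0 τ))) * ENNReal.ofReal (sg 0 t ^ 2 * √(sg 0 t)) := by
          refine setLIntegral_mono (by fun_prop) fun t ht => ?_
          have ht0 : 0 < t := hτ.trans ht
          have hs0 := sg_nonneg 0 t
          calc _ ≤ ∫⁻ y, ENNReal.ofReal (sg 0 t ^ 2 * √(sg 0 t)) *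
                (ENNReal.ofReal (sg (Rot (α * t) x - y) τ ^ 2 * √(sg (Rot (α * t) x - y) τ)) +
                  ENNReal.ofReal (sg y τ ^ 2 * √(sg y τ))) := by
                refine lintegral_mono fun y => ?_
                set z := Rot (α * t) x - y
                have hz := sg_nonneg z t
                have hz' := sg_nonneg z τ
                have hy := sg_nonneg y τ
                rw [← ENNReal.ofReal_mul (by positivity), ← ENNReal.ofReal_add (by positivity) (by positivity),
                  ← ENNReal.ofReal_mul (by positivity)]
                refine ENNReal.ofReal_le_ofReal ?_
                have k1 : sg z t ^ 3 ≤ sg 0 t ^ 2 * (√(sg 0 t) * √(sg z τ)) := by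
                  have : sg z t = √(sg z t) * √(sg z t) := (Real.mul_self_sqrt hz).symm
                  rw [pow_succ]
                  nth_rewrite 2 [this]
                  gcongr
                  · exact sg_le_sg_zero _ ht0
                  · exact sg_le_sg_zero _ ht0
                  · exact sg_anti z hτ (le_of_lt ht)
                refine (mul_le_mul_of_nonneg_right k1 (sq_nonneg _)).trans ?_
                rw [mul_assoc, mul_assoc, mul_assoc]
                gcongr
                exact sqrt_mul_sq_le hy
            _ = _ := by
                have hid := lintegral_sg_half (MeasurePreserving.id volume) hτ
                simp only [id] at hid
                rw [lintegral_const_mul _ (by fun_prop), lintegral_add_left (by fun_prop),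
                  lintegral_sg_half (measurePreserving_Rot_sub _ x) hτ,
                  hid, ← two_mul, mul_comm,
                  ENNReal.ofReal_mul zero_le_two, ENNReal.ofReal_ofNat]
      _ = _ := by
          rw [lintegral_const_mul _ (by fun_prop), integrableOn_Ioi_sg_half hτ,
            ← ENNReal.ofReal_mul (by positivity)]
          congr 1
          have := Real.mul_self_sqrt h0.le
          linear_combination (8 * Jh) * this

/-- For |y| < |x|/2 the whole rotating orbit of x stays at distance at least |x|/2 from y, so the
kernel is at most 8 times its value at x, with time integral 16/|x|. -/
theorem rpot_near_le (α : ℝ) {x : Plane} (hx : x ≠ 0) (k : Plane → ℝ≥0∞) :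
    rpot α ((Metric.ball 0 (‖x‖ / 2)).indicator k) x ≤
      ENNReal.ofReal (16 / ‖x‖) * ∫⁻ y in Metric.ball 0 (‖x‖ / 2), k y := by
  have hr : 0 < ‖x‖ := norm_pos_iff.2 hx
  obtain ⟨h1, h2⟩ := integrableOn_sg_pow x 0 le_rfl (by positivity)
  have h3 : ∫⁻ t in Ioi (0 : ℝ), ENNReal.ofReal (8 * sg x t ^ 3) = ENNReal.ofReal (16 / ‖x‖) := by
    rw [← ofReal_integral_eq_lintegral_ofReal (h1.const_mul 8)
      (Eventually.of_forall fun t => by have := sg_nonneg x t; positivity), integral_const_mul, h2,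
      sg_zero_right]
    congr 1; norm_num; ring
  rw [rpot, ← h3, ← lintegral_mul_const _ (by fun_prop)]
  refine setLIntegral_mono (by fun_prop) fun t ht => ?_
  rw [← lintegral_indicator Metric.isOpen_ball.measurableSet,
    ← lintegral_const_mul' _ _ ENNReal.ofReal_ne_top]
  refine lintegral_mono fun y => ?_
  by_cases hy : y ∈ Metric.ball 0 (‖x‖ / 2)
  · rw [indicator_of_mem hy]
    gcongr ENNReal.ofReal ?_ * _
    have h5 : sg (Rot (α * t) x - y) t ≤ 2 * sg x t := by
      refine sg_le_sg ht two_pos ?_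
      have := norm_sub_norm_le (Rot (α * t) x) y
      rw [norm_Rot] at this
      rw [mem_ball_zero_iff] at hy
      have ht' : (0 : ℝ) < t := ht
      nlinarith [norm_nonneg y]
    calc _ ≤ (2 * sg x t) ^ 3 := pow_le_pow_left₀ (sg_nonneg _ _) h5 3
      _ = _ := by ring
  · rw [indicator_of_notMem hy, mul_zero]; exact zero_le

theorem rpot_split {α : ℝ} {k : Plane → ℝ≥0∞} (S : Set Plane) (hS : MeasurableSet S)
    (hk : Measurable k) (x : Plane) :
    rpot α k x = rpot α (S.indicator k) x + rpot α (Sᶜ.indicator k) x := by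
  have hm : Measurable fun q : ℝ × Plane =>
      ENNReal.ofReal (sg (Rot (α * q.1) x - q.2) q.1 ^ 3) * S.indicator k q.2 :=
    (by fun_prop : Measurable fun q : ℝ × Plane =>
      ENNReal.ofReal (sg (Rot (α * q.1) x - q.2) q.1 ^ 3)).mul ((hk.indicator hS).comp measurable_snd)
  rw [rpot, rpot, rpot, ← lintegral_add_left hm.lintegral_prod_right']
  refine lintegral_congr fun t => ?_
  refine Eq.trans (lintegral_congr fun y => ?_) (lintegral_add_left (hm.comp measurable_prodMk_left) _)
  simp only [Function.comp_apply]
  rw [← mul_add]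
  by_cases hy : y ∈ S <;> simp [hy]

/-- The uniform bound is applied at τ = |x|². On the region considered |x|² ≤ 4|y|², so |y|^{-2} is
at most 5/(|x|²+|y|²). -/
theorem rpot_far_le (α : ℝ) {x : Plane} (hx : x ≠ 0) :
    rpot α ((Metric.ball 0 (‖x‖ / 2))ᶜ.indicator fun y => ENNReal.ofReal (sg y 0 ^ 2)) x ≤
      ENNReal.ofReal (5 * farC / ‖x‖) := by
  have hr : 0 < ‖x‖ := norm_pos_iff.2 hx
  have h := rpot_sg_le α x (τ := ‖x‖ ^ 2) (by positivity)
  rw [sg_zero_left, Real.sqrt_sq hr.le] at h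
  have h2 := mul_le_mul_right h (ENNReal.ofReal 5)
  rw [← rpot_const_mul ENNReal.ofReal_ne_top, ← ENNReal.ofReal_mul (by norm_num)] at h2
  refine (rpot_mono (Eventually.of_forall fun y => ?_) x).trans
    (h2.trans (le_of_eq (by congr 1; ring)))
  by_cases hy : y ∈ (Metric.ball (0 : Plane) (‖x‖ / 2))ᶜ
  · rw [indicator_of_mem hy, ← ENNReal.ofReal_mul (by norm_num)]
    refine ENNReal.ofReal_le_ofReal ?_
    simp only [mem_compl_iff, mem_ball_zero_iff, not_lt] at hy
    have hy0 : 0 < ‖y‖ := by linarith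
    rw [sg_sq _ le_rfl, sg_sq _ (by positivity), ← div_eq_mul_inv, ← one_div, div_le_div_iff₀ (by positivity)
      (by positivity)]
    nlinarith
  · rw [indicator_of_notMem hy]; exact zero_le

/-! ### Matrices -/

theorem abs_entry_le (A : Mat) (i j : Fin 2) : |A i j| ≤ ‖A‖ := by
  rw [Matrix.frobenius_norm_def, ← Real.sqrt_eq_rpow]
  refine Real.le_sqrt_of_sq_le ?_
  simp only [Real.norm_eq_abs, Real.rpow_two]
  have h1 := Finset.single_le_sum (f := fun j => |A i j| ^ 2) (fun _ _ => sq_nonneg _) (Finset.mem_univ j)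
  have h2 := Finset.single_le_sum (f := fun i => ∑ j, |A i j| ^ 2)
    (fun _ _ => Finset.sum_nonneg fun _ _ => sq_nonneg _) (Finset.mem_univ i)
  exact h1.trans h2

theorem continuous_entry (i j : Fin 2) : Continuous fun A : Mat => A i j := by
  refine (LipschitzWith.of_dist_le_mul (K := 1) fun A B => ?_).continuous
  rw [Real.dist_eq, dist_eq_norm, NNReal.coe_one, one_mul]
  exact abs_entry_le (A - B) i j

theorem aestronglyMeasurable_entry {F : Plane → Mat} (hF : AEStronglyMeasurable F volume)
    (i j : Fin 2) : AEStronglyMeasurable (fun y => F y i j) volume :=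
  (continuous_entry i j).comp_aestronglyMeasurable hF

theorem memLp_entry {F : Plane → Mat} {p : ℝ≥0∞} (hF : MemLp F p volume) (i j : Fin 2) :
    MemLp (fun y => F y i j) p volume :=
  hF.of_le (aestronglyMeasurable_entry hF.1 i j) (Eventually.of_forall fun _ => abs_entry_le _ _ _)

theorem memLp_coord {f : Plane → Plane} {p : ℝ≥0∞} (hf : MemLp f p volume) (i : Fin 2) :
    MemLp (fun y => f y i) p volume :=
  hf.of_le ((EuclideanSpace.proj (𝕜 := ℝ) i).continuous.comp_aestronglyMeasurable hf.1)
    (Eventually.of_forall fun y => PiLp.norm_apply_le (f y) i)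

theorem memLp_two_of_le_sg {g : Plane → ℝ} (hg : AEStronglyMeasurable g volume) {τ : Plane → Plane}
    (hτ : MeasurePreserving τ volume volume) {s C : ℝ} (hs : 0 < s)
    (h : ∀ᵐ y, |g y| ≤ C * sg (τ y) s ^ 2) : MemLp g 2 volume := by
  refine (memLp_two_iff_integrable_sq hg).2 ?_
  refine ((integrable_sg_comp hτ 1 hs).1.const_mul (C ^ 2)).mono' (hg.pow 2) ?_
  filter_upwards [h] with y hy
  rw [Real.norm_of_nonneg (sq_nonneg _), ← sq_abs]
  exact (pow_le_pow_left₀ (abs_nonneg _) hy 2).trans (le_of_eq (by ring))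

/-! ### Distributional divergence and test functions that are not compactly supported -/

theorem integrable_mul_two {f g : Plane → ℝ} (hf : MemLp f 2 volume) (hg : MemLp g 2 volume) :
    Integrable fun y => f y * g y := hf.integrable_mul hg

theorem exists_cutoff : ∃ χ : ℕ → Plane → ℝ, ∃ C : ℝ, (∀ n, ContDiff ℝ (⊤ : ℕ∞) (χ n)) ∧
    (∀ n, HasCompactSupport (χ n)) ∧ (∀ n y, |χ n y| ≤ 1) ∧ (∀ n y j, |pderiv j (χ n) y| ≤ C) ∧
    (∀ y, ∀ᶠ n in atTop, χ n y = 1) ∧ ∀ y j, Tendsto (fun n => pderiv j (χ n) y) atTop (𝓝 0) := by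
  let χ : ContDiffBump (0 : Plane) := ⟨1, 2, one_pos, one_lt_two⟩
  have hχ : ContDiff ℝ (⊤ : ℕ∞) χ := χ.contDiff
  obtain ⟨C, hC⟩ := (hχ.continuous_fderiv (by simp)).bounded_above_of_compact_support
    (χ.hasCompactSupport.fderiv ℝ)
  have hC0 : 0 ≤ C := (norm_nonneg _).trans (hC 0)
  have hc : ∀ n : ℕ, (0 : ℝ) < ((n : ℝ) + 1)⁻¹ := fun n => by positivity
  have hd : ∀ (n : ℕ) y j, pderiv j (fun y => χ (((n : ℝ) + 1)⁻¹ • y)) y =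
      ((n : ℝ) + 1)⁻¹ * fderiv ℝ χ (((n : ℝ) + 1)⁻¹ • y) (e j) := fun n y j => by
    have h1 : HasFDerivAt χ (fderiv ℝ χ (((n : ℝ) + 1)⁻¹ • y)) (((n : ℝ) + 1)⁻¹ • y) :=
      (hχ.differentiable (by simp) _).hasFDerivAt
    have h2 := h1.comp y ((hasFDerivAt_id y).const_smul ((n : ℝ) + 1)⁻¹)
    have h3 : fderiv ℝ (fun y => χ (((n : ℝ) + 1)⁻¹ • y)) y = _ := h2.fderiv
    rw [pderiv, h3]
    simp
  have hb : ∀ (n : ℕ) y j, |pderiv j (fun y => χ (((n : ℝ) + 1)⁻¹ • y)) y| ≤ ((n : ℝ) + 1)⁻¹ * C :=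
    fun n y j => by
      rw [hd, abs_mul, abs_of_pos (hc n)]
      refine mul_le_mul_of_nonneg_left ?_ (hc n).le
      refine ((fderiv ℝ χ (((n : ℝ) + 1)⁻¹ • y)).le_opNorm (e j)).trans ?_
      rw [norm_e, mul_one]
      exact hC _
  have hl : Tendsto (fun n : ℕ => ((n : ℝ) + 1)⁻¹) atTop (𝓝 0) := by
    simpa using tendsto_one_div_add_atTop_nhds_zero_nat (𝕜 := ℝ)
  refine ⟨fun n y => χ (((n : ℝ) + 1)⁻¹ • y), C, fun n => ?_, fun n => ?_, fun n y => ?_,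
    fun n y j => ?_, fun y => ?_, fun y j => ?_⟩
  · exact hχ.comp (contDiff_const_smul _)
  · exact χ.hasCompactSupport.comp_smul (hc n).ne'
  · rw [abs_of_nonneg χ.nonneg]; exact χ.le_one
  · refine (hb n y j).trans (mul_le_of_le_one_left hC0 ?_)
    exact inv_le_one_of_one_le₀ (by linarith [(Nat.cast_nonneg n : (0 : ℝ) ≤ n)])
  · obtain ⟨N, hN⟩ := exists_nat_ge ‖y‖
    filter_upwards [eventually_ge_atTop N] with n hn
    refine χ.one_of_mem_closedBall ?_
    rw [mem_closedBall_zero_iff, norm_smul, Real.norm_of_nonneg (hc n).le, ← div_eq_inv_mul]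
    refine (div_le_one (by positivity)).2 ?_
    have : (N : ℝ) ≤ n := by exact_mod_cast hn
    linarith
  · refine squeeze_zero_norm (fun n => hb n y j) ?_
    simpa using hl.mul_const C

/-- Dilated cut-offs have uniformly bounded gradients tending to zero, so the distributional
identity extends to smooth functions that are square integrable together with their gradients. The
heat kernels are of this kind but not compactly supported. -/
theorem IsDiv.extend {f : Plane → Plane} {F : Plane → Mat} (h : IsDiv f F) (i : Fin 2)
    (hf : MemLp (fun y => f y i) 2 volume) (hF : ∀ j, MemLp (fun y => F y i j) 2 volume)
    {ψ : Plane → ℝ} (hψ : ContDiff ℝ (⊤ : ℕ∞) ψ) (h1 : MemLp ψ 2 volume)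
    (h2 : ∀ j, MemLp (pderiv j ψ) 2 volume) :
    ∫ y, f y i * ψ y = -∫ y, ∑ j, F y i j * pderiv j ψ y := by
  obtain ⟨χ, C, hs, hc, hb, hb', hl, hl'⟩ := exists_cutoff
  have hp : ∀ n j y, pderiv j (fun y => ψ y * χ n y) y = ψ y * pderiv j (χ n) y + χ n y * pderiv j ψ y :=
    fun n j y => by
      have := ((hψ.differentiable (by simp) y).hasFDerivAt.mul
        ((hs n).differentiable (by simp) y).hasFDerivAt).fderiv
      simp only [pderiv]
      erw [this]
      simp
  have t1 : Tendsto (fun n => ∫ y, f y i * (ψ y * χ n y)) atTop (𝓝 (∫ y, f y i * ψ y)) := by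
    refine tendsto_integral_of_dominated_convergence (fun y => ‖f y i * ψ y‖) (fun n => ?_)
      (integrable_mul_two hf h1).norm (fun n => Eventually.of_forall fun y => ?_)
      (Eventually.of_forall fun y => ?_)
    · exact hf.1.mul (h1.1.mul (hs n).continuous.aestronglyMeasurable)
    · rw [← mul_assoc, norm_mul]
      exact mul_le_of_le_one_right (norm_nonneg _) (hb n y)
    · refine tendsto_const_nhds.congr' ?_
      filter_upwards [hl y] with n hn
      rw [hn, mul_one]
  have t2 : Tendsto (fun n => ∫ y, ∑ j, F y i j * pderiv j (fun y => ψ y * χ n y) y) atTop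
      (𝓝 (∫ y, ∑ j, F y i j * pderiv j ψ y)) := by
    refine tendsto_integral_of_dominated_convergence
      (fun y => ∑ j, (C * ‖F y i j * ψ y‖ + ‖F y i j * pderiv j ψ y‖)) (fun n => ?_) ?_
      (fun n => Eventually.of_forall fun y => ?_) (Eventually.of_forall fun y => ?_)
    · simp only [hp]
      refine Finset.aestronglyMeasurable_fun_sum _ fun j _ => (hF j).1.mul ?_
      have hm : AEStronglyMeasurable (pderiv j (χ n)) volume :=
        (((hs n).continuous_fderiv (by simp)).clm_apply continuous_const).aestronglyMeasurable
      exact (h1.1.mul hm).add ((hs n).continuous.aestronglyMeasurable.mul (h2 j).1)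
    · exact integrable_finsetSum _ fun j _ =>
        ((integrable_mul_two (hF j) h1).norm.const_mul C).add (integrable_mul_two (hF j) (h2 j)).norm
    · refine (norm_sum_le _ _).trans (Finset.sum_le_sum fun j _ => ?_)
      rw [hp, mul_add]
      refine (norm_add_le _ _).trans (add_le_add ?_ ?_)
      · rw [← mul_assoc, norm_mul, mul_comm]
        exact mul_le_mul_of_nonneg_right (hb' n y j) (norm_nonneg _)
      · rw [mul_left_comm, norm_mul]
        exact mul_le_of_le_one_left (norm_nonneg _) (hb n y)
    · refine tendsto_finsetSum _ fun j _ => ?_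
      simp only [hp]
      have hχ : Tendsto (fun n => χ n y) atTop (𝓝 1) :=
        tendsto_const_nhds.congr' ((hl y).mono fun n hn => hn.symm)
      have := (((hl' y j).const_mul (ψ y)).add (hχ.mul_const (pderiv j ψ y))).const_mul (F y i j)
      simpa using this
  refine tendsto_nhds_unique t1 (t2.neg.congr fun n => ?_)
  exact (h _ (hψ.mul (hs n)) ((hc n).mul_left) i).symm

/-- The kernels depend on X - y, so their y-derivatives carry a minus sign; the sign in the
hypothesis cancels the one in the definition of distributional divergence. -/
theorem IsDiv.integral_form {f : Plane → Plane} {F : Plane → Mat} (h : IsDiv f F)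
    (hf : MemLp f 2 volume) (hF : MemLp F 2 volume) {κ : Plane → Plane → ℝ}
    {κ' : Fin 2 → Fin 2 → Plane → ℝ} (hl : ∀ b y, κ b y = ∑ j, b j * κ (e j) y)
    (hs : ∀ j, ContDiff ℝ (⊤ : ℕ∞) (κ (e j))) (hd : ∀ k j y, pderiv k (κ (e j)) y = -κ' k j y)
    (h1 : ∀ j, MemLp (κ (e j)) 2 volume) (h2 : ∀ k j, MemLp (κ' k j) 2 volume) :
    ∫ y, κ (f y) y = ∫ y, ∑ j, ∑ k, F y j k * κ' k j y := by
  have hp : ∀ k j, pderiv k (κ (e j)) = fun y => -κ' k j y := fun k j => funext (hd k j)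
  simp_rw [hl (f _)]
  rw [integral_finsetSum _ fun j _ => integrable_mul_two (memLp_coord hf j) (h1 j),
    integral_finsetSum _ fun j _ => integrable_finsetSum _ fun k _ =>
      integrable_mul_two (memLp_entry hF j k) (h2 k j)]
  refine Finset.sum_congr rfl fun j _ => ?_
  rw [h.extend j (memLp_coord hf j) (memLp_entry hF j) (hs j) (h1 j)
    (fun k => by rw [hp]; exact (h2 k j).neg), ← integral_neg]
  refine integral_congr_ae (Eventually.of_forall fun y => ?_)
  simp [hd]

theorem pderiv_comp_sub {g : Plane → ℝ} (hg : ContDiff ℝ (⊤ : ℕ∞) g) (X y : Plane) (k : Fin 2) :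
    pderiv k (fun y => g (X - y)) y = -fderiv ℝ g (X - y) (e k) := by
  have h1 : HasFDerivAt g (fderiv ℝ g (X - y)) (X - y) := (hg.differentiable (by simp) _).hasFDerivAt
  have h2 : fderiv ℝ (fun y => g (X - y)) y = _ := (h1.comp y ((hasFDerivAt_id y).const_sub X)).fderiv
  rw [pderiv, h2]
  simp

/-! ### Forces in divergence form -/

/-- The kernel of the velocity acting on a matrix density. -/
def kdiv (p z : Plane) (t : ℝ) (A : Mat) : ℝ := ∑ j, ∑ k, A j k * K1 (e k) p (e j) z t

/-- The kernel of the pressure acting on a matrix density. -/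
def ddiv (z : Plane) (s : ℝ) (A : Mat) : ℝ := ∑ j, ∑ k, A j k * d2 (e k) (e j) z s

theorem abs_sum_entry_le (A : Mat) {g : Fin 2 → Fin 2 → ℝ} {B : ℝ} (h : ∀ j k, |g j k| ≤ B) :
    |∑ j, ∑ k, A j k * g j k| ≤ 4 * B * ‖A‖ := by
  have h1 : ∀ j k, |A j k * g j k| ≤ ‖A‖ * B := fun j k => abs_mul_le (abs_entry_le A j k) (h j k)
  calc |∑ j, ∑ k, A j k * g j k| ≤ ∑ j, ∑ k, ‖A‖ * B :=
        (Finset.abs_sum_le_sum_abs _ _).trans (Finset.sum_le_sum fun j _ =>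
          (Finset.abs_sum_le_sum_abs _ _).trans (Finset.sum_le_sum fun k _ => h1 j k))
    _ = 4 * B * ‖A‖ := by simp; ring

theorem abs_kdiv_le (p z : Plane) {t : ℝ} (ht : 0 < t) (A : Mat) :
    |kdiv p z t A| ≤ 8 * CK * ‖p‖ * sg z t ^ 3 * ‖A‖ := by
  refine (abs_sum_entry_le A (B := 2 * CK * ‖p‖ * sg z t ^ 3) fun j k => ?_).trans (le_of_eq (by ring))
  exact (abs_K1_le _ _ _ _ ht).trans (le_of_eq (by simp only [norm_e]; ring))

theorem abs_ddiv_le (z : Plane) {s : ℝ} (hs : 0 < s) (A : Mat) :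
    |ddiv z s A| ≤ 4 * CK * sg z s ^ 4 * ‖A‖ := by
  refine (abs_sum_entry_le A (B := CK * sg z s ^ 4) fun j k => ?_).trans (le_of_eq (by ring))
  exact (abs_d2_le _ _ _ hs).trans (le_of_eq (by simp only [norm_e]; ring))

theorem memLp_sub_of_le_sg {g : Plane → ℝ} (hg : Measurable g) (X : Plane) {s C : ℝ} (hs : 0 < s)
    (h : ∀ z, |g z| ≤ C * sg z s ^ 2) : MemLp (fun y => g (X - y)) 2 volume :=
  memLp_two_of_le_sg (hg.comp (measurable_const.sub measurable_id)).aestronglyMeasurable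
    (volume.measurePreserving_sub_left X) hs (Eventually.of_forall fun y => h (X - y))

theorem le_sg_sq {C : ℝ} (hC : 0 ≤ C) (z : Plane) {s : ℝ} (hs : 0 < s) (n : ℕ) :
    C * sg z s ^ (n + 2) ≤ C * sg 0 s ^ n * sg z s ^ 2 := by
  have := sg_nonneg z s
  rw [pow_add, ← mul_assoc]
  gcongr
  exact sg_le_sg_zero z hs

theorem memLp_d1_sub (q X : Plane) {s : ℝ} (hs : 0 < s) :
    MemLp (fun y => d1 q (X - y) s) 2 volume :=
  memLp_sub_of_le_sg (g := fun z => d1 q z s) (by fun_prop) X hs fun z =>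
    (abs_d1_le q z hs).trans (le_sg_sq (by have := CK_pos; positivity) z hs 1)

theorem memLp_d2_sub (p q X : Plane) {s : ℝ} (hs : 0 < s) :
    MemLp (fun y => d2 p q (X - y) s) 2 volume :=
  memLp_sub_of_le_sg (g := fun z => d2 p q z s) (by fun_prop) X hs fun z =>
    (abs_d2_le p q z hs).trans (le_sg_sq (by have := CK_pos; positivity) z hs 2)

theorem memLp_d3_sub (p q r X : Plane) {s : ℝ} (hs : 0 < s) :
    MemLp (fun y => d3 p q r (X - y) s) 2 volume :=
  memLp_sub_of_le_sg (g := fun z => d3 p q r z s) (by fun_prop) X hs fun z =>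
    (abs_d3_le p q r z hs).trans (le_sg_sq (by have := CK_pos; positivity) z hs 3)

theorem memLp_gauss_sub (X : Plane) {s : ℝ} (hs : 0 < s) :
    MemLp (fun y => gauss (X - y) s) 2 volume :=
  memLp_sub_of_le_sg (g := fun z => gauss z s) (by fun_prop) X hs fun z => by
    rw [abs_of_nonneg (gauss_nonneg z hs.le)]; exact gauss_le z hs

theorem contDiff_comp_sub {g : Plane → ℝ} (hg : ContDiff ℝ (⊤ : ℕ∞) g) (X : Plane) :
    ContDiff ℝ (⊤ : ℕ∞) fun y => g (X - y) := hg.comp (contDiff_const.sub contDiff_id)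

theorem sum_coord_mul (b : Plane) (g : Plane → ℝ) (hg : ∀ (c c' : ℝ) (u v : Plane),
    g (c • u + c' • v) = c * g u + c' * g v) : g b = ∑ j, b j * g (e j) := by
  conv_lhs => rw [← sum_smul_e b]
  rw [Fin.sum_univ_two, Fin.sum_univ_two, hg]

theorem IsDiv.dfl_eq {h : Plane → Plane} {H : Plane → Mat} (hd : IsDiv h H) (hh : MemLp h 2 volume)
    (hH : MemLp H 2 volume) (x : Plane) {s : ℝ} (hs : 0 < s) :
    dfl h x s = ∫ y, ddiv (x - y) s (H y) := by
  refine hd.integral_form hh hH (κ := fun b y => d1 b (x - y) s)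
    (κ' := fun k j y => d2 (e k) (e j) (x - y) s) (fun b y => ?_)
    (fun j => contDiff_comp_sub (contDiff_d1 (e j) s) x) (fun k j y => ?_)
    (fun j => memLp_d1_sub _ _ hs) (fun k j => memLp_d2_sub _ _ _ hs)
  · refine sum_coord_mul b (fun b => d1 b (x - y) s) fun c c' u v => ?_
    simp only [d1, inner_add_left, real_inner_smul_left]; ring
  · rw [pderiv_comp_sub (contDiff_d1 (e j) s), fderiv_d1]

theorem IsDiv.integral_gauss {h : Plane → Plane} {H : Plane → Mat} (hd : IsDiv h H) (hh : MemLp h 2 volume)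
    (hH : MemLp H 2 volume) (p X : Plane) {t : ℝ} (ht : 0 < t) :
    ∫ y, gauss (X - y) t * ⟪p, h y⟫ =
      ∫ y, ∑ j, ∑ k, H y j k * (d1 (e k) (X - y) t * ⟪p, e j⟫) := by
  refine hd.integral_form hh hH (κ := fun b y => gauss (X - y) t * ⟪p, b⟫)
    (κ' := fun k j y => d1 (e k) (X - y) t * ⟪p, e j⟫) (fun b y => ?_)
    (fun j => (contDiff_comp_sub (contDiff_gauss t) X).mul contDiff_const) (fun k j y => ?_)
    (fun j => (memLp_gauss_sub _ ht).mul_const _) (fun k j => (memLp_d1_sub _ _ ht).mul_const _)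
  · refine sum_coord_mul b (fun b => gauss (X - y) t * ⟪p, b⟫) fun c c' u v => ?_
    simp only [inner_add_right, real_inner_smul_right]; ring
  · rw [pderiv_comp_sub ((contDiff_gauss t).mul contDiff_const) X, ← neg_mul]
    have hg : DifferentiableAt ℝ (fun z => gauss z t) (X - y) :=
      (contDiff_gauss t).differentiable (by simp) _
    rw [fderiv_mul_const hg]
    simp [fderiv_gauss, mul_comm]

theorem IsDiv.integral_d2 {h : Plane → Plane} {H : Plane → Mat} (hd : IsDiv h H) (hh : MemLp h 2 volume)
    (hH : MemLp H 2 volume) (p X : Plane) {s : ℝ} (hs : 0 < s) :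
    ∫ y, d2 p (h y) (X - y) s = ∫ y, ∑ j, ∑ k, H y j k * d3 (e k) p (e j) (X - y) s := by
  refine hd.integral_form hh hH (κ := fun b y => d2 p b (X - y) s)
    (κ' := fun k j y => d3 (e k) p (e j) (X - y) s) (fun b y => ?_)
    (fun j => contDiff_comp_sub (contDiff_d2 p (e j) s) X) (fun k j y => ?_)
    (fun j => memLp_d2_sub _ _ _ hs) (fun k j => memLp_d3_sub _ _ _ _ hs)
  · refine sum_coord_mul b (fun b => d2 p b (X - y) s) fun c c' u v => ?_
    simp only [d2, inner_add_left, inner_add_right, real_inner_smul_left, real_inner_smul_right]; ring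
  · rw [pderiv_comp_sub (contDiff_d2 p (e j) s), fderiv_d2]

theorem ae_prod_fst_mem {S : Set ℝ} (hS : MeasurableSet S) :
    ∀ᵐ q ∂(((volume : Measure ℝ).restrict S).prod (volume : Measure Plane)), q.1 ∈ S :=
  Measure.quasiMeasurePreserving_fst.ae (ae_restrict_mem hS)

theorem aestronglyMeasurable_sum_entry {H : Plane → Mat} (hH : AEStronglyMeasurable H volume)
    {μ : Measure ℝ} [SFinite μ] {g : Fin 2 → Fin 2 → ℝ × Plane → ℝ} (hg : ∀ j k, Measurable (g j k)) :
    AEStronglyMeasurable (fun q : ℝ × Plane => ∑ j, ∑ k, H q.2 j k * g j k q) (μ.prod volume) :=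
  Finset.aestronglyMeasurable_fun_sum _ fun j _ => Finset.aestronglyMeasurable_fun_sum _ fun k _ =>
    (aestronglyMeasurable_entry hH j k).comp_snd.mul (hg j k).aestronglyMeasurable

/-- The divergence is moved onto the Gauss kernel at each time and then onto its tail integral by
Fubini. The extra power of the weight on the right is what makes the full time integral absolutely
convergent. -/
theorem IsDiv.integral_Kk {h : Plane → Plane} {H : Plane → Mat} (hd : IsDiv h H)
    (hh : MemLp h 2 volume) (hi : Integrable h) (hH : MemLp H 2 volume) (p X : Plane) {t : ℝ}
    (ht : 0 < t) : ∫ y, Kk p (h y) (X - y) t = ∫ y, kdiv p (X - y) t (H y) := by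
  have hC := CK_pos
  set μ := (volume : Measure ℝ).restrict (Ioi t) with hμ
  have i1 : Integrable (fun q : ℝ × Plane => d2 p (h q.2) (X - q.2) q.1) (μ.prod volume) := by
    have hs := (integrableOn_sg_pow 0 1 ht.le (by positivity)).1
    refine ((Integrable.mul_prod (μ := μ) hs hi.norm).const_mul (CK * ‖p‖)).mono' ?_ ?_
    · have hm : Measurable fun w : Plane × ℝ × Plane => d2 p w.1 (X - w.2.2) w.2.1 := by fun_prop
      exact (hm.comp_aemeasurable
        (hi.1.aemeasurable.comp_snd.prodMk aemeasurable_id)).aestronglyMeasurable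
    · filter_upwards [ae_prod_fst_mem measurableSet_Ioi] with q hq
      have hq0 : 0 < q.1 := ht.trans hq
      refine (abs_d2_le p (h q.2) (X - q.2) hq0).trans ?_
      rw [← mul_assoc, mul_assoc, mul_comm (‖h q.2‖)]
      gcongr
      · exact sg_nonneg _ _
      · exact sg_le_sg_zero _ hq0
  -- Of the five powers of the weight, three are spent on time integrability and two on square
  -- integrability in space, paired with H in L².
  have i2 : Integrable (fun q : ℝ × Plane => ∑ j, ∑ k, H q.2 j k * d3 (e k) p (e j) (X - q.2) q.1)
      (μ.prod volume) := by
    have hs := (integrableOn_sg_pow 0 0 ht.le (by positivity)).1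
    have hw : MemLp (fun y => sg (X - y) t ^ 2) 2 volume :=
      memLp_sub_of_le_sg (g := fun z => sg z t ^ 2) (by fun_prop) X ht (C := 1) fun z => by
        rw [one_mul, abs_of_nonneg (sq_nonneg _)]
    refine ((Integrable.mul_prod (μ := μ) hs (integrable_mul_two hH.norm hw)).const_mul
      (4 * (CK * ‖p‖))).mono' (aestronglyMeasurable_sum_entry hH.1 fun j k => by fun_prop) ?_
    filter_upwards [ae_prod_fst_mem measurableSet_Ioi] with q hq
    have hq' : t < q.1 := hq
    have hq0 : 0 < q.1 := ht.trans hq'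
    have h0 := sg_nonneg (X - q.2) q.1
    refine (abs_sum_entry_le (H q.2) (B := CK * ‖p‖ * (sg 0 q.1 ^ 3 * sg (X - q.2) t ^ 2))
      fun j k => ?_).trans (le_of_eq (by ring))
    refine (abs_d3_le _ _ _ _ hq0).trans ?_
    simp only [norm_e, one_mul, mul_one]
    rw [show 5 = 3 + 2 from rfl, pow_add]
    have h0' := sg_nonneg 0 q.1
    gcongr
    · exact sg_le_sg_zero _ hq0
    · exact sg_anti _ ht hq'.le
  have e1 : ∫ y, ∫ s, d2 p (h y) (X - y) s ∂μ =
      ∫ y, ∑ j, ∑ k, H y j k * ∫ s, d3 (e k) p (e j) (X - y) s ∂μ := by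
    rw [← integral_integral_swap i1, setIntegral_congr_fun measurableSet_Ioi
      fun s hs => hd.integral_d2 hh hH p X (ht.trans hs), integral_integral_swap i2]
    refine integral_congr_ae (Eventually.of_forall fun y => ?_)
    have i3 := fun j k => (integrableOn_d3 (e k) p (e j) (X - y) ht).1.const_mul (H y j k)
    simp only
    rw [integral_finsetSum _ fun j _ => integrable_finsetSum _ fun k _ => i3 j k]
    refine Finset.sum_congr rfl fun j _ => ?_
    rw [integral_finsetSum _ fun k _ => i3 j k]
    exact Finset.sum_congr rfl fun k _ => integral_const_mul _ _
  have i4 : Integrable fun y => gauss (X - y) t * ⟪p, h y⟫ :=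
    integrable_mul_two (memLp_gauss_sub X ht) ((innerSL ℝ p).comp_memLp' hh)
  have i5 : ∀ j k, Integrable fun y => H y j k * (d1 (e k) (X - y) t * ⟪p, e j⟫) := fun j k =>
    integrable_mul_two (memLp_entry hH j k) ((memLp_d1_sub _ _ ht).mul_const _)
  have i6 : Integrable fun y => ∑ j, ∑ k, H y j k * ∫ s, d3 (e k) p (e j) (X - y) s ∂μ := by
    have hm : ∀ j k, MemLp (fun y => ∫ s, d3 (e k) p (e j) (X - y) s ∂μ) 2 volume := fun j k => by
      have hK : MemLp (fun y => K1 (e k) p (e j) (X - y) t) 2 volume :=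
        memLp_sub_of_le_sg (g := fun z => K1 (e k) p (e j) z t) (by fun_prop) X ht fun z =>
          (abs_K1_le _ _ _ z ht).trans (le_sg_sq (by positivity) z ht 1)
      have he : (fun y => ∫ s, d3 (e k) p (e j) (X - y) s ∂μ) =
          (fun y => K1 (e k) p (e j) (X - y) t) - fun y => d1 (e k) (X - y) t * ⟪p, e j⟫ := by
        funext y
        simp [K1, hμ]
      rw [he]
      exact hK.sub ((memLp_d1_sub (e k) X ht).mul_const ⟪p, e j⟫)
    exact integrable_finsetSum _ fun j _ => integrable_finsetSum _ fun k _ =>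
      integrable_mul_two (memLp_entry hH j k) (hm j k)
  calc ∫ y, Kk p (h y) (X - y) t
      = (∫ y, gauss (X - y) t * ⟪p, h y⟫) + ∫ y, ∫ s, d2 p (h y) (X - y) s ∂μ := by
        rw [← integral_add i4 i1.integral_prod_right]; rfl
    _ = ∫ y, ((∑ j, ∑ k, H y j k * (d1 (e k) (X - y) t * ⟪p, e j⟫)) +
          ∑ j, ∑ k, H y j k * ∫ s, d3 (e k) p (e j) (X - y) s ∂μ) := by
        rw [e1, hd.integral_gauss hh hH p X ht, ← integral_add _ i6]
        exact integrable_finsetSum _ fun j _ => integrable_finsetSum _ fun k _ => i5 j k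
    _ = _ := by
        refine integral_congr_ae (Eventually.of_forall fun y => ?_)
        simp only [kdiv, K1, ← Finset.sum_add_distrib, mul_add, hμ]

/-! ### The velocity of a force in divergence form -/

/-- The `a`-component of the velocity generated by `div H`. -/
def velI (α : ℝ) (H : Plane → Mat) (x a : Plane) : ℝ :=
  ∫ q, kdiv (Rot (α * q.1) a) (Rot (α * q.1) x - q.2) q.1 (H q.2)
    ∂(((volume : Measure ℝ).restrict (Ioi 0)).prod (volume : Measure Plane))

/-- The velocity generated by `div H`. -/
def velD (α : ℝ) (H : Plane → Mat) (x : Plane) : Plane :=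
  WithLp.toLp 2 fun i => velI α H x (e i)

theorem lintegral_kdiv_le (α : ℝ) (H : Plane → Mat) (x a : Plane) :
    ∫⁻ t in Ioi (0 : ℝ), ∫⁻ y, ‖kdiv (Rot (α * t) a) (Rot (α * t) x - y) t (H y)‖ₑ ≤
      ENNReal.ofReal (8 * CK * ‖a‖) * rpot α (fun y => ‖H y‖ₑ) x := by
  have hC := CK_pos
  rw [rpot, ← lintegral_const_mul' _ _ ENNReal.ofReal_ne_top]
  refine lintegral_mono_ae ?_
  filter_upwards [ae_restrict_mem measurableSet_Ioi] with t ht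
  rw [← lintegral_const_mul' _ _ ENNReal.ofReal_ne_top]
  refine lintegral_mono fun y => ?_
  rw [Real.enorm_eq_ofReal_abs, ← ofReal_norm (H y),
    ← ENNReal.ofReal_mul (pow_nonneg (sg_nonneg _ _) _), ← ENNReal.ofReal_mul (by positivity)]
  refine ENNReal.ofReal_le_ofReal ((abs_kdiv_le _ _ ht _).trans (le_of_eq ?_))
  rw [norm_Rot]; ring

theorem aestronglyMeasurable_kdiv (α : ℝ) {H : Plane → Mat} (hH : AEStronglyMeasurable H volume)
    (x a : Plane) {μ : Measure ℝ} [SFinite μ] :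
    AEStronglyMeasurable (fun q : ℝ × Plane =>
      kdiv (Rot (α * q.1) a) (Rot (α * q.1) x - q.2) q.1 (H q.2)) (μ.prod volume) :=
  aestronglyMeasurable_sum_entry hH fun j k => by fun_prop

theorem integrable_kdiv {α : ℝ} {H : Plane → Mat} (hH : AEStronglyMeasurable H volume) {x : Plane}
    (hf : rpot α (fun y => ‖H y‖ₑ) x < ⊤) (a : Plane) :
    Integrable (fun q : ℝ × Plane => kdiv (Rot (α * q.1) a) (Rot (α * q.1) x - q.2) q.1 (H q.2))
      (((volume : Measure ℝ).restrict (Ioi 0)).prod volume) := by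
  have hm := aestronglyMeasurable_kdiv α hH x a (μ := (volume : Measure ℝ).restrict (Ioi 0))
  refine ⟨hm, ?_⟩
  rw [HasFiniteIntegral, lintegral_prod _ hm.enorm]
  exact (lintegral_kdiv_le α H x a).trans_lt (by finiteness)

theorem enorm_velI_le (α : ℝ) {H : Plane → Mat} (hH : AEStronglyMeasurable H volume) (x a : Plane) :
    ‖velI α H x a‖ₑ ≤ ENNReal.ofReal (8 * CK * ‖a‖) * rpot α (fun y => ‖H y‖ₑ) x := by
  refine (enorm_integral_le_lintegral_enorm _).trans ?_
  rw [lintegral_prod _ (aestronglyMeasurable_kdiv α hH x a).enorm]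
  exact lintegral_kdiv_le α H x a

/-- The truncated time integrals agree for every finite T. On the left they converge conditionally,
on the right absolutely. -/
theorem IsDiv.inner_vel {h : Plane → Plane} {H : Plane → Mat} (hd : IsDiv h H) (hh : Adm h)
    (hH : MemLp H 2 volume) {α : ℝ} (hα : α ≠ 0) {x : Plane}
    (hf : rpot α (fun y => ‖H y‖ₑ) x < ⊤) (a : Plane) : ⟪a, vel α h x⟫ = velI α H x a := by
  have hi := integrable_kdiv hH.1 hf a
  have h1 := hh.tendsto_left hα x a
  have h2 : Tendsto (fun n : ℕ => ∫ t in (0 : ℝ)..n, ∫ y,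
      kdiv (Rot (α * t) a) (Rot (α * t) x - y) t (H y)) atTop (𝓝 (velI α H x a)) := by
    rw [velI, integral_prod _ hi]
    exact intervalIntegral_tendsto_integral_Ioi 0 hi.integral_prod_left tendsto_natCast_atTop_atTop
  refine tendsto_nhds_unique (h1.congr fun n => ?_) h2
  rw [intervalIntegral.integral_of_le n.cast_nonneg]
  exact setIntegral_congr_fun measurableSet_Ioc fun t ht =>
    hd.integral_Kk hh.memLp hh.integrable hH _ _ ht.1

theorem IsDiv.vel_eq {h : Plane → Plane} {H : Plane → Mat} (hd : IsDiv h H) (hh : Adm h)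
    (hH : MemLp H 2 volume) {α : ℝ} (hα : α ≠ 0) {x : Plane}
    (hf : rpot α (fun y => ‖H y‖ₑ) x < ⊤) : vel α h x = velD α H x := by
  ext i
  rw [← inner_e_left, hd.inner_vel hh hH hα hf]
  rfl

/-! ### Regularisation of forces in divergence form -/

theorem norm_smul_mat (c : ℝ) (A : Mat) : ‖c • A‖ = |c| * ‖A‖ := by
  let _ : NormedSpace ℝ Mat := Matrix.frobeniusNormedSpace
  exact norm_smul c A

/-- The force is square integrable and the divergence of a matrix field decaying quadratically. -/
structure DivForm (f : Plane → Plane) (F : Plane → Mat) (M : ℝ) : Prop where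
  memLp : MemLp f 2 volume
  isDiv : IsDiv f F
  meas : AEStronglyMeasurable F volume
  nonneg : 0 ≤ M
  bound : ∀ᵐ y, ‖F y‖ ≤ M * sg y 1 ^ 2

/-- The regularised matrix field `e^{-ε|y|²} F`. -/
def regM (ε : ℝ) (F : Plane → Mat) (y : Plane) : Mat := Real.exp (-(ε * ‖y‖ ^ 2)) • F y

/-- The commutator `e^{-ε|y|²} div F - div (e^{-ε|y|²} F)`. -/
def corr (ε : ℝ) (F : Plane → Mat) (y : Plane) : Plane :=
  (2 * ε * Real.exp (-(ε * ‖y‖ ^ 2))) • mulVec (F y) y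

theorem norm_le_add_abs (v : Plane) : ‖v‖ ≤ |v 0| + |v 1| := by
  rw [← abs_norm, ← sq_le_sq₀ (abs_nonneg _) (by positivity), sq_abs, norm_sq_eq]
  nlinarith [sq_abs (v 0), sq_abs (v 1), abs_nonneg (v 0), abs_nonneg (v 1)]

theorem mulVec_coord (A : Mat) (v : Plane) (i : Fin 2) :
    mulVec A v i = A i 0 * v 0 + A i 1 * v 1 := by
  fin_cases i <;> simp [mulVec]

theorem norm_mulVec_le_mat (A : Mat) (v : Plane) : ‖mulVec A v‖ ≤ 4 * ‖A‖ * ‖v‖ := by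
  have h : ∀ i, |mulVec A v i| ≤ 2 * (‖A‖ * ‖v‖) := fun i => by
    rw [mulVec_coord]
    have h0 := abs_mul_le (abs_entry_le A i 0) (PiLp.norm_apply_le v 0)
    have h1 := abs_mul_le (abs_entry_le A i 1) (PiLp.norm_apply_le v 1)
    linarith [abs_add_le (A i 0 * v 0) (A i 1 * v 1)]
  linarith [norm_le_add_abs (mulVec A v), h 0, h 1]

/-- For ε ≤ 1 one has ε(1+|y|²) ≤ 1+ε|y|² ≤ 2 exp(ε|y|²). Hence the factor ε buys two powers of
decay uniformly in ε, and the additional |y| gives one of them back to the growth. -/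
theorem norm_corr_le {ε M : ℝ} (hε : 0 ≤ ε) (hε1 : ε ≤ 1) (hM : 0 ≤ M) {F : Plane → Mat} {y : Plane}
    (h : ‖F y‖ ≤ M * sg y 1 ^ 2) : ‖corr ε F y‖ ≤ 16 * M * sg y 1 ^ 3 := by
  have h0 := sg_nonneg y 1
  have h1 := norm_mul_sg_le y zero_le_one
  have h2 : ε * Real.exp (-(ε * ‖y‖ ^ 2)) ≤ 2 * sg y 1 ^ 2 := by
    rw [sg_sq y zero_le_one, ← div_eq_mul_inv, le_div_iff₀ (by positivity), Real.exp_neg, mul_assoc,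
      mul_comm _ (1 + ‖y‖ ^ 2), ← mul_assoc, ← div_eq_mul_inv, div_le_iff₀ (Real.exp_pos _)]
    have := Real.add_one_le_exp (ε * ‖y‖ ^ 2)
    nlinarith [Real.one_le_exp (show 0 ≤ ε * ‖y‖ ^ 2 by positivity)]
  rw [corr, norm_smul, Real.norm_of_nonneg (by positivity)]
  calc 2 * ε * Real.exp (-(ε * ‖y‖ ^ 2)) * ‖mulVec (F y) y‖
      ≤ 2 * (2 * sg y 1 ^ 2) * (4 * (M * sg y 1 ^ 2) * ‖y‖) := by
        rw [mul_assoc 2 ε]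
        gcongr
        exact (norm_mulVec_le_mat _ _).trans (by gcongr)
    _ = 16 * M * sg y 1 ^ 3 * (‖y‖ * sg y 1) := by ring
    _ ≤ _ := mul_le_of_le_one_right (by positivity) h1

theorem tendsto_corr (F : Plane → Mat) (y : Plane) :
    Tendsto (fun ε => corr ε F y) (𝓝[>] 0) (𝓝 0) := by
  have : Continuous fun ε => corr ε F y := by unfold corr; fun_prop
  simpa [corr] using (this.tendsto 0).mono_left nhdsWithin_le_nhds

theorem aestronglyMeasurable_corr (ε : ℝ) {F : Plane → Mat} (hF : AEStronglyMeasurable F volume) :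
    AEStronglyMeasurable (corr ε F) volume := by
  have hm : ∀ i, AEMeasurable (fun y => mulVec (F y) y i) volume := fun i => by
    simp only [mulVec_coord]
    have h0 := (aestronglyMeasurable_entry hF i 0).aemeasurable
    have h1 := (aestronglyMeasurable_entry hF i 1).aemeasurable
    exact (h0.mul (Measurable.aemeasurable (by fun_prop))).add
      (h1.mul (Measurable.aemeasurable (by fun_prop)))
  have hv : AEMeasurable (fun y => mulVec (F y) y) volume :=
    (WithLp.measurable_toLp 2 (Fin 2 → ℝ)).comp_aemeasurable (aemeasurable_pi_lambda _ hm)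
  have hE : Continuous fun y : Plane => 2 * ε * Real.exp (-(ε * ‖y‖ ^ 2)) := by fun_prop
  exact hE.aestronglyMeasurable.smul hv.aestronglyMeasurable

/-- Cubic decay is compatible with the weight 1+√|y|: the product decays like |y|^{-5/2}, which is
integrable in the plane. -/
theorem adm_of_le_sg {h : Plane → Plane} (hm : AEStronglyMeasurable h volume) {C : ℝ} (hC : 0 ≤ C)
    (hb : ∀ᵐ y, ‖h y‖ ≤ C * sg y 1 ^ 3) : Adm h := by
  constructor
  · have h1 : MemLp (fun y => C * sg y 1 ^ 3) 2 volume :=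
      memLp_two_of_le_sg (Measurable.aestronglyMeasurable (by fun_prop)) (MeasurePreserving.id volume)
        one_pos (C := C) (Eventually.of_forall fun y => by
          have h0 := sg_nonneg y 1
          have h1 := sg_one_le_one y
          rw [abs_of_nonneg (by positivity), id]
          exact mul_le_mul_of_nonneg_left (pow_le_pow_of_le_one h0 h1 (by norm_num)) hC)
    exact h1.of_le hm (hb.mono fun y hy => hy.trans (le_abs_self _))
  · refine lt_of_le_of_lt (lintegral_mono_ae (g := fun y =>
      ENNReal.ofReal (2 * C * (sg y 1 ^ 2 * √(sg y 1)))) ?_)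
      (Integrable.lintegral_lt_top (integrable_sg_half_one.const_mul (2 * C)))
    filter_upwards [hb] with y hy
    have h0 := sg_nonneg y 1
    have h1 : √(sg y 1) ≤ 1 := Real.sqrt_le_one.2 (sg_one_le_one y)
    have h2 : √‖y‖ * √(sg y 1) ≤ 1 := by
      rw [← Real.sqrt_mul (norm_nonneg y)]
      exact Real.sqrt_le_one.2 (norm_mul_sg_le y zero_le_one)
    have h3 := Real.mul_self_sqrt h0
    rw [wt, ← ofReal_norm, ← ENNReal.ofReal_mul (by positivity)]
    refine ENNReal.ofReal_le_ofReal ?_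
    calc (1 + √‖y‖) * ‖h y‖ ≤ (1 + √‖y‖) * (C * sg y 1 ^ 3) := by gcongr
      _ = (√(sg y 1) + √‖y‖ * √(sg y 1)) * (C * (sg y 1 ^ 2 * √(sg y 1))) := by
        linear_combination -(1 + √‖y‖) * C * sg y 1 ^ 2 * h3
      _ ≤ 2 * (C * (sg y 1 ^ 2 * √(sg y 1))) := by gcongr; linarith
      _ = _ := by ring

theorem Adm.sub {h h' : Plane → Plane} (hh : Adm h) (hh' : Adm h') : Adm fun y => h y - h' y := by
  refine ⟨hh.memLp.sub hh'.memLp, ?_⟩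
  calc ∫⁻ y, wt y * ‖h y - h' y‖ₑ ≤ ∫⁻ y, (wt y * ‖h y‖ₑ + wt y * ‖h' y‖ₑ) := by
        gcongr with y
        rw [← mul_add]
        exact mul_le_mul_right enorm_sub_le _
    _ = _ := lintegral_add_left' (measurable_wt.aemeasurable.mul hh.memLp.1.enorm) _
    _ < ⊤ := ENNReal.add_lt_top.2 ⟨hh.weighted, hh'.weighted⟩

theorem mulVec_sub (A : Mat) (v w : Plane) : mulVec A (v - w) = mulVec A v - mulVec A w := by
  ext i
  simp only [mulVec_coord, PiLp.sub_apply]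
  ring

theorem Adm.vel_sub {α : ℝ} (hα : α ≠ 0) {h h' : Plane → Plane} (hh : Adm h) (hh' : Adm h')
    (x : Plane) : vel α (fun y => h y - h' y) x = vel α h x - vel α h' x := by
  simp only [vel, mulVec_sub]
  exact integral_sub (hh.integrable_mulVec hα x) (hh'.integrable_mulVec hα x)

/-- Dominated convergence. The majorant uses the kernel applied to the basis vectors times the
radial bound, which are themselves admissible densities. -/
theorem tendsto_vel_zero {α : ℝ} (hα : α ≠ 0) {h : ℝ → Plane → Plane} {C : ℝ} (hC : 0 ≤ C)
    (hm : ∀ ε, AEStronglyMeasurable (h ε) volume)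
    (hb : ∀ᶠ ε in 𝓝[>] 0, ∀ᵐ y, ‖h ε y‖ ≤ C * sg y 1 ^ 3)
    (hl : ∀ y, Tendsto (fun ε => h ε y) (𝓝[>] 0) (𝓝 0)) (x : Plane) :
    Tendsto (fun ε => vel α (h ε) x) (𝓝[>] 0) (𝓝 0) := by
  have hD : ∀ i, Integrable fun y => mulVec (fundSol α x y) ((C * sg y 1 ^ 3) • e i) := fun i =>
    (adm_of_le_sg (h := fun y => (C * sg y 1 ^ 3) • e i)
      (Measurable.aestronglyMeasurable (by fun_prop)) hC (Eventually.of_forall fun y => by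
        have h0 := sg_nonneg y 1
        rw [norm_smul, norm_e, mul_one, Real.norm_of_nonneg (by positivity)])).integrable_mulVec hα x
  rw [← integral_zero Plane Plane (μ := volume)]
  refine tendsto_integral_filter_of_dominated_convergence
    (fun y => ∑ i, ‖mulVec (fundSol α x y) ((C * sg y 1 ^ 3) • e i)‖) ?_ ?_
    (integrable_finsetSum _ fun i _ => (hD i).norm) ?_
  · filter_upwards [hb] with ε hε
    exact ((adm_of_le_sg (hm ε) hC hε).integrable_mulVec hα x).1
  · filter_upwards [hb] with ε hε
    filter_upwards [hε] with y hy
    have h0 := sg_nonneg y 1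
    have e1 : mulVec (fundSol α x y) (h ε y) = ∑ i, h ε y i • mulVec (fundSol α x y) (e i) := by
      conv_lhs => rw [← sum_smul_e (h ε y)]
      ext i
      simp only [mulVec_coord, Fin.sum_univ_two, PiLp.add_apply, PiLp.smul_apply, smul_eq_mul]
      ring
    rw [e1]
    refine (norm_sum_le _ _).trans (Finset.sum_le_sum fun i _ => ?_)
    rw [mulVec_smul, norm_smul, norm_smul, Real.norm_of_nonneg (r := C * sg y 1 ^ 3) (by positivity)]
    exact mul_le_mul_of_nonneg_right ((PiLp.norm_apply_le _ i).trans hy) (norm_nonneg _)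
  · refine Eventually.of_forall fun y => ?_
    refine squeeze_zero_norm (fun ε => norm_mulVec_le_mat (fundSol α x y) (h ε y)) ?_
    simpa using (hl y).norm.const_mul (4 * ‖fundSol α x y‖)

theorem pderiv_exp_mul {ψ : Plane → ℝ} (hψ : ContDiff ℝ (⊤ : ℕ∞) ψ) (ε : ℝ) (y : Plane) (j : Fin 2) :
    pderiv j (fun y => Real.exp (-(ε * ‖y‖ ^ 2)) * ψ y) y =
      Real.exp (-(ε * ‖y‖ ^ 2)) * pderiv j ψ y - 2 * ε * Real.exp (-(ε * ‖y‖ ^ 2)) * y j * ψ y := by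
  have h1 : HasFDerivAt (fun y : Plane => ‖y‖ ^ 2) (2 • innerSL ℝ y) y :=
    (hasStrictFDerivAt_norm_sq y).hasFDerivAt
  have h2 := ((h1.const_mul ε).neg.exp).mul (hψ.differentiable (by simp) y).hasFDerivAt
  have h3 : fderiv ℝ (fun y => Real.exp (-(ε * ‖y‖ ^ 2)) * ψ y) y = _ := h2.fderiv
  rw [pderiv, h3, pderiv]
  simp [inner_e_right]
  ring

theorem DivForm.memLp_two {f : Plane → Plane} {F : Plane → Mat} {M : ℝ} (h : DivForm f F M) :
    MemLp F 2 volume := by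
  have hs := memLp_two_of_le_sg (g := fun y => ‖F y‖) h.meas.norm (MeasurePreserving.id volume) one_pos
    (C := M) (by filter_upwards [h.bound] with y hy; rwa [abs_norm])
  exact (memLp_norm_iff h.meas).1 hs

/-- The Gaussian is absorbed into the test function; the derivative falling on it produces the
commutator. -/
theorem DivForm.isDiv_reg {f : Plane → Plane} {F : Plane → Mat} {M : ℝ} (h : DivForm f F M) (ε : ℝ) :
    IsDiv (fun y => reg ε f y - corr ε F y) (regM ε F) := by
  intro ψ hψ hc i
  set E : Plane → ℝ := fun y => Real.exp (-(ε * ‖y‖ ^ 2)) with hE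
  have hEs : ContDiff ℝ (⊤ : ℕ∞) E := ((contDiff_const.mul (contDiff_norm_sq ℝ)).neg).exp
  have key := h.isDiv (fun y => E y * ψ y) (hEs.mul hψ) hc.mul_left i
  have hp : ∀ j y, pderiv j (fun y => E y * ψ y) y = E y * pderiv j ψ y - 2 * ε * E y * y j * ψ y :=
    fun j y => pderiv_exp_mul hψ ε y j
  have hcp : ∀ j, HasCompactSupport (pderiv j ψ) := fun j => hc.fderiv_apply ℝ (e j)
  have hpc : ∀ j, Continuous (pderiv j ψ) := fun j =>
    (hψ.continuous_fderiv (by simp)).clm_apply continuous_const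
  have m1 : MemLp (fun y => E y * ψ y) 2 volume :=
    (hEs.mul hψ).continuous.memLp_of_hasCompactSupport hc.mul_left
  have m2 : ∀ j, MemLp (fun y => E y * pderiv j ψ y) 2 volume := fun j =>
    (hEs.continuous.mul (hpc j)).memLp_of_hasCompactSupport (hcp j).mul_left
  have m3 : ∀ j : Fin 2, MemLp (fun y => 2 * ε * E y * y j * ψ y) 2 volume := fun j =>
    Continuous.memLp_of_hasCompactSupport
      (by have := hEs.continuous; have := hψ.continuous; fun_prop) hc.mul_left
  have hF := fun j => memLp_entry h.memLp_two i j
  have i1 : Integrable fun y => f y i * (E y * ψ y) := integrable_mul_two (memLp_coord h.memLp i) m1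
  have i2 : Integrable fun y => ∑ j, F y i j * (E y * pderiv j ψ y) :=
    integrable_finsetSum _ fun j _ => integrable_mul_two (hF j) (m2 j)
  have i3 : Integrable fun y => ∑ j, F y i j * (2 * ε * E y * y j * ψ y) :=
    integrable_finsetSum _ fun j _ => integrable_mul_two (hF j) (m3 j)
  have e1 : ∀ y, (reg ε f y - corr ε F y) i * ψ y =
      f y i * (E y * ψ y) - ∑ j, F y i j * (2 * ε * E y * y j * ψ y) := fun y => by
    simp [reg, corr, hE, mulVec_coord, Fin.sum_univ_two]
    ring
  have e2 : ∀ y, ∑ j, regM ε F y i j * pderiv j ψ y = ∑ j, F y i j * (E y * pderiv j ψ y) := fun y => by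
    simp [regM, hE, Fin.sum_univ_two]
    ring
  simp only [hp, mul_sub, Finset.sum_sub_distrib] at key
  simp only [e1, e2]
  rw [integral_sub i1 i3, key, integral_sub i2 i3]
  ring

/-! ### The limit of the regularised velocities -/

variable {f : Plane → Plane} {F : Plane → Mat} {M : ℝ}

theorem abs_exp_le_one {ε : ℝ} (hε : 0 ≤ ε) (y : Plane) : |Real.exp (-(ε * ‖y‖ ^ 2))| ≤ 1 := by
  rw [abs_of_pos (Real.exp_pos _)]
  exact exp_reg_le_one hε y

theorem norm_regM_le {ε : ℝ} (hε : 0 ≤ ε) (F : Plane → Mat) (y : Plane) : ‖regM ε F y‖ ≤ ‖F y‖ := by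
  rw [regM, norm_smul_mat]
  exact mul_le_of_le_one_left (norm_nonneg _) (abs_exp_le_one hε y)

theorem aestronglyMeasurable_regM (ε : ℝ) (hF : AEStronglyMeasurable F volume) :
    AEStronglyMeasurable (regM ε F) volume := by
  let _ : NormedSpace ℝ Mat := Matrix.frobeniusNormedSpace
  have hE : Continuous fun y : Plane => Real.exp (-(ε * ‖y‖ ^ 2)) := by fun_prop
  exact hE.aestronglyMeasurable.smul hF

theorem rpot_le_of_bound (hM : 0 ≤ M) (hb : ∀ᵐ y, ‖F y‖ ≤ M * sg y 1 ^ 2) (α : ℝ) (x : Plane) :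
    rpot α (fun y => ‖F y‖ₑ) x ≤
      ENNReal.ofReal M * rpot α (fun y => ENNReal.ofReal (sg y 1 ^ 2)) x := by
  rw [← rpot_const_mul ENNReal.ofReal_ne_top]
  refine rpot_mono (hb.mono fun y hy => ?_) x
  rw [← ofReal_norm, ← ENNReal.ofReal_mul hM]
  exact ENNReal.ofReal_le_ofReal hy

theorem rpot_le_const (hM : 0 ≤ M) (hb : ∀ᵐ y, ‖F y‖ ≤ M * sg y 1 ^ 2) (α : ℝ) (x : Plane) :
    rpot α (fun y => ‖F y‖ₑ) x ≤ ENNReal.ofReal (M * farC) := by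
  refine (rpot_le_of_bound hM hb α x).trans ?_
  have := rpot_sg_le α x one_pos
  rw [sg_zero_left, Real.sqrt_one, inv_one, mul_one] at this
  rw [ENNReal.ofReal_mul hM]
  exact mul_le_mul_right this _

/-- The inner integral of the quadratic density grows logarithmically. Inserting 1 ≤ 2√|x|·√sg on
the ball replaces the logarithm by √|x|, so that only decay |x|^{-1/2} is obtained. -/
theorem rpot_sg_one_le (α : ℝ) {x : Plane} (hx : 1 ≤ ‖x‖) :
    rpot α (fun y => ENNReal.ofReal (sg y 1 ^ 2)) x ≤
      ENNReal.ofReal ((32 * Jh + 5 * farC) / √‖x‖) := by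
  have hr : 0 < ‖x‖ := by linarith
  have hx0 : x ≠ 0 := norm_pos_iff.1 hr
  have hs : 0 < √‖x‖ := Real.sqrt_pos.2 hr
  have hs2 := Real.mul_self_sqrt hr.le
  have hs1 : 1 ≤ √‖x‖ := Real.one_le_sqrt.2 hx
  have hJ := Jh_nonneg
  have hf := farC_nonneg
  rw [rpot_split (Metric.ball 0 (‖x‖ / 2)) Metric.isOpen_ball.measurableSet (by fun_prop), add_div,
    ENNReal.ofReal_add (by positivity) (by positivity)]
  refine add_le_add ((rpot_near_le α hx0 _).trans ?_) ?_
  · have h1 : ∫⁻ y in Metric.ball 0 (‖x‖ / 2), ENNReal.ofReal (sg y 1 ^ 2) ≤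
        ENNReal.ofReal (2 * √‖x‖) * ENNReal.ofReal Jh := by
      have hid := lintegral_sg_half (MeasurePreserving.id volume) one_pos
      simp only [id, sg_zero_left, Real.sqrt_one, inv_one, mul_one] at hid
      rw [← hid, ← lintegral_const_mul _ (by fun_prop)]
      refine le_trans ?_ (setLIntegral_le_lintegral (Metric.ball 0 (‖x‖ / 2)) _)
      refine setLIntegral_mono (by fun_prop) fun y hy => ?_
      rw [mem_ball_zero_iff] at hy
      rw [← ENNReal.ofReal_mul (by positivity)]
      refine ENNReal.ofReal_le_ofReal ?_
      have h2 : 1 ≤ 2 * √‖x‖ * √(sg y 1) := by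
        have h3 : 1 ≤ ‖x‖ * (2 * 2 * sg y 1) := by
          rw [sg]
          have : √(1 + ‖y‖ ^ 2) ≤ 2 * ‖x‖ := Real.sqrt_le_iff.2 ⟨by positivity, by nlinarith [norm_nonneg y]⟩
          rw [← mul_assoc, ← div_eq_mul_inv, le_div_iff₀ (by positivity)]
          linarith
        have h4 := Real.one_le_sqrt.2 h3
        rw [Real.sqrt_mul hr.le, Real.sqrt_mul (by norm_num), Real.sqrt_mul_self (by norm_num)] at h4
        linarith
      nlinarith [sq_nonneg (sg y 1)]
    refine (mul_le_mul_right h1 _).trans (le_of_eq ?_)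
    rw [← ENNReal.ofReal_mul (by positivity), ← ENNReal.ofReal_mul (by positivity)]
    congr 1
    nth_rewrite 1 [← hs2]
    field_simp
    ring
  · refine (rpot_mono (Eventually.of_forall fun y => ?_) x).trans ((rpot_far_le α hx0).trans ?_)
    · refine indicator_le_indicator' fun hy => ENNReal.ofReal_le_ofReal ?_
      simp only [mem_compl_iff, mem_ball_zero_iff, not_lt] at hy
      have hy0 : 0 < ‖y‖ := by linarith
      rw [sg_sq _ le_rfl, sg_sq _ zero_le_one]
      gcongr
      linarith
    · refine ENNReal.ofReal_le_ofReal ?_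
      gcongr
      exact Real.sqrt_le_iff.2 ⟨hr.le, by nlinarith⟩

theorem norm_velD_le {α : ℝ} {x : Plane} (hF : AEStronglyMeasurable F volume) {B : ℝ} (hB : 0 ≤ B)
    (h : rpot α (fun y => ‖F y‖ₑ) x ≤ ENNReal.ofReal B) : ‖velD α F x‖ ≤ 16 * CK * B := by
  have hC := CK_pos
  have h1 : ∀ i, |velI α F x (e i)| ≤ 8 * CK * B := fun i => by
    have h2 := (enorm_velI_le α hF x (e i)).trans (mul_le_mul_right h _)
    rw [norm_e, mul_one, ← ENNReal.ofReal_mul (by positivity), Real.enorm_eq_ofReal_abs,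
      ENNReal.ofReal_le_ofReal_iff (by positivity)] at h2
    exact h2
  have h3 := norm_le_add_abs (velD α F x)
  have h4 : ∀ i, velD α F x i = velI α F x (e i) := fun i => rfl
  rw [h4, h4] at h3
  linarith [h1 0, h1 1]

theorem tendsto_velD_regM {α : ℝ} {x : Plane} (hF : AEStronglyMeasurable F volume)
    (hf : rpot α (fun y => ‖F y‖ₑ) x < ⊤) :
    Tendsto (fun ε => velD α (regM ε F) x) (𝓝[>] 0) (𝓝 (velD α F x)) := by
  refine ((PiLp.continuous_toLp 2 fun _ : Fin 2 => ℝ).tendsto _).comp (tendsto_pi_nhds.2 fun i => ?_)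
  have e1 : ∀ (ε : ℝ) (q : ℝ × Plane), kdiv (Rot (α * q.1) (e i)) (Rot (α * q.1) x - q.2) q.1 (regM ε F q.2) =
      Real.exp (-(ε * ‖q.2‖ ^ 2)) * kdiv (Rot (α * q.1) (e i)) (Rot (α * q.1) x - q.2) q.1 (F q.2) :=
    fun ε q => by simp [kdiv, regM, mul_assoc]; ring
  simp only [velI, e1]
  have hi := integrable_kdiv hF hf (e i)
  refine tendsto_integral_filter_of_dominated_convergence _ ?_ ?_ hi.norm ?_
  · refine Eventually.of_forall fun ε => ?_
    exact (Continuous.aestronglyMeasurable (by fun_prop)).mul hi.1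
  · filter_upwards [self_mem_nhdsWithin] with ε hε
    refine Eventually.of_forall fun q => ?_
    rw [norm_mul]
    exact mul_le_of_le_one_left (norm_nonneg _) (abs_exp_le_one (le_of_lt hε) q.2)
  · refine Eventually.of_forall fun q => ?_
    simpa using (tendsto_exp_reg q.2).mul_const
      (kdiv (Rot (α * q.1) (e i)) (Rot (α * q.1) x - q.2) q.1 (F q.2))

/-- The part of `e^{-ε|y|²} div F` in divergence form. -/
def regD (ε : ℝ) (f : Plane → Plane) (F : Plane → Mat) (y : Plane) : Plane := reg ε f y - corr ε F y

namespace DivForm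

theorem rpot_lt_top (h : DivForm f F M) (α : ℝ) (x : Plane) : rpot α (fun y => ‖F y‖ₑ) x < ⊤ :=
  (rpot_le_const h.nonneg h.bound α x).trans_lt ENNReal.ofReal_lt_top

theorem bound_regM (h : DivForm f F M) {ε : ℝ} (hε : 0 ≤ ε) :
    ∀ᵐ y, ‖regM ε F y‖ ≤ M * sg y 1 ^ 2 :=
  h.bound.mono fun y hy => (norm_regM_le hε F y).trans hy

theorem adm_corr (h : DivForm f F M) {ε : ℝ} (hε : 0 ≤ ε) (hε1 : ε ≤ 1) : Adm (corr ε F) :=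
  adm_of_le_sg (aestronglyMeasurable_corr ε h.meas) (C := 16 * M) (by have := h.nonneg; positivity)
    (h.bound.mono fun _ hy => norm_corr_le hε hε1 h.nonneg hy)

theorem adm_regD (h : DivForm f F M) {ε : ℝ} (hε : 0 < ε) (hε1 : ε ≤ 1) : Adm (regD ε f F) :=
  (adm_reg hε h.memLp).sub (h.adm_corr hε.le hε1)

theorem regD_form (h : DivForm f F M) {ε : ℝ} (hε : 0 < ε) (hε1 : ε ≤ 1) :
    DivForm (regD ε f F) (regM ε F) M :=
  ⟨(h.adm_regD hε hε1).memLp, h.isDiv_reg ε, aestronglyMeasurable_regM ε h.meas, h.nonneg,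
    h.bound_regM hε.le⟩

theorem vel_regD (h : DivForm f F M) {α : ℝ} (hα : α ≠ 0) {ε : ℝ} (hε : 0 < ε) (hε1 : ε ≤ 1)
    (x : Plane) : vel α (regD ε f F) x = velD α (regM ε F) x :=
  have h' := h.regD_form hε hε1
  h'.isDiv.vel_eq (h.adm_regD hε hε1) h'.memLp_two hα (h'.rpot_lt_top α x)

/-- The regularised force splits into a divergence, handled by the absolutely convergent formula,
and the commutator, whose velocity vanishes in the limit. -/
theorem tendsto_vel (h : DivForm f F M) {α : ℝ} (hα : α ≠ 0) (x : Plane) :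
    Tendsto (fun ε => vel α (reg ε f) x) (𝓝[>] 0) (𝓝 (velD α F x)) := by
  have h1 := tendsto_velD_regM h.meas (h.rpot_lt_top α x)
  have h2 := tendsto_vel_zero hα (h := fun ε => corr ε F) (C := 16 * M)
    (by have := h.nonneg; positivity) (fun ε => aestronglyMeasurable_corr ε h.meas)
    (by
      filter_upwards [Ioc_mem_nhdsGT one_pos] with ε hε
      exact h.bound.mono fun _ hy => norm_corr_le hε.1.le hε.2 h.nonneg hy)
    (tendsto_corr F) x
  have h3 := h1.add h2
  rw [add_zero] at h3
  refine h3.congr' ?_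
  filter_upwards [Ioc_mem_nhdsGT one_pos] with ε hε
  rw [← h.vel_regD hα hε.1 hε.2]
  have := (adm_reg hε.1 h.memLp).vel_sub hα (h.adm_corr hε.1.le hε.2) x
  rw [show regD ε f F = fun y => reg ε f y - corr ε F y from rfl, this]
  abel

theorem memLp_velD (h : DivForm f F M) {α : ℝ} (hα : α ≠ 0) : MemLp (velD α F) 6 volume := by
  have hC := CK_pos
  have hM := h.nonneg
  have hf := farC_nonneg
  have hJ := Jh_nonneg
  -- Measurability is inherited from the regularised velocities along ε = 1/(n+1).
  have hm : AEStronglyMeasurable (velD α F) volume := by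
    have hs : Tendsto (fun n : ℕ => 1 / ((n : ℝ) + 1)) atTop (𝓝[>] 0) :=
      tendsto_nhdsWithin_iff.2 ⟨tendsto_one_div_add_atTop_nhds_zero_nat,
        Eventually.of_forall fun n => by simp only [mem_Ioi]; positivity⟩
    refine aestronglyMeasurable_of_tendsto_ae atTop (f := fun (n : ℕ) x => vel α (reg (1 / ((n : ℝ) + 1)) f) x)
      (fun n => ((adm_reg (by positivity) h.memLp).measurable_vel hα).aestronglyMeasurable)
      (Eventually.of_forall fun x => (h.tendsto_vel hα x).comp hs)
  refine memLp_six hm (r := 1) (A := 16 * CK * (M * farC))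
    (B := (16 * CK * (M * (32 * Jh + 5 * farC))) ^ 2) le_rfl (sq_nonneg _)
    (fun x _ => norm_velD_le h.meas (by positivity) (rpot_le_const hM h.bound α x))
    (Eventually.of_forall fun x hx => ?_)
  have hr : 0 < ‖x‖ := by linarith
  have hs : 0 < √‖x‖ := Real.sqrt_pos.2 hr
  have h1 := (rpot_le_of_bound hM h.bound α x).trans (mul_le_mul_right (rpot_sg_one_le α hx) _)
  rw [← ENNReal.ofReal_mul hM] at h1
  have h2 := norm_velD_le h.meas (by positivity) h1
  have h3 : ‖velD α F x‖ * √‖x‖ ≤ 16 * CK * (M * (32 * Jh + 5 * farC)) := by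
    refine (mul_le_mul_of_nonneg_right h2 hs.le).trans (le_of_eq ?_)
    field_simp
  calc ‖velD α F x‖ ^ 2 * ‖x‖ = (‖velD α F x‖ * √‖x‖) ^ 2 := by rw [mul_pow, Real.sq_sqrt hr.le]
    _ ≤ _ := pow_le_pow_left₀ (by positivity) h3 2

end DivForm

/-! ### The pressure of a force in divergence form -/

theorem pot_mono {k k' : Plane → ℝ≥0∞} (h : ∀ᵐ y, k y ≤ k' y) (s : ℝ) (x : Plane) :
    pot k s x ≤ pot k' s x := by
  rw [pot, pot]
  refine lintegral_mono_ae ?_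
  filter_upwards [h] with y hy
  exact mul_le_mul_right hy _

theorem lintegral_prod_snd_ae {S : Set ℝ} {p : Plane → Prop} (h : ∀ᵐ y, p y) :
    ∀ᵐ q ∂(((volume : Measure ℝ).restrict S).prod (volume : Measure Plane)), p q.2 :=
  Measure.quasiMeasurePreserving_snd.ae h

theorem integrable_near_majorant {D : Plane → ℝ} (hD : Measurable D) {x : Plane}
    (hx : ∫⁻ s in Ioc (0 : ℝ) 1, pot (fun y => ‖D y‖ₑ) s x < ⊤) :
    Integrable (fun q : ℝ × Plane => CK * (sg (x - q.2) q.1 ^ 3 * D q.2))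
      (((volume : Measure ℝ).restrict (Ioc 0 1)).prod volume) := by
  have hm : Measurable fun q : ℝ × Plane => sg (x - q.2) q.1 ^ 3 * D q.2 := by fun_prop
  refine Integrable.const_mul ⟨hm.aestronglyMeasurable, ?_⟩ CK
  rw [HasFiniteIntegral, lintegral_prod _ hm.enorm.aemeasurable]
  simp only [pot] at hx
  refine lt_of_eq_of_lt (lintegral_congr fun s => lintegral_congr fun y => ?_) hx
  rw [enorm_mul, Real.enorm_eq_ofReal (pow_nonneg (sg_nonneg _ _) _)]

theorem aestronglyMeasurable_d1 {h : Plane → Plane} (hh : AEStronglyMeasurable h volume) (x : Plane)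
    (μ : Measure ℝ) [SFinite μ] :
    AEStronglyMeasurable (fun q : ℝ × Plane => d1 (h q.2) (x - q.2) q.1) (μ.prod volume) := by
  have hm : Measurable fun w : Plane × ℝ × Plane => d1 w.1 (x - w.2.2) w.2.1 := by fun_prop
  exact (hm.comp_aemeasurable
    (hh.aemeasurable.comp_snd.prodMk aemeasurable_id)).aestronglyMeasurable

theorem abs_d1_ae_le {D : Plane → ℝ} {h : Plane → Plane} (hb : ∀ᵐ y, ‖h y‖ ≤ D y) (x : Plane) :
    ∀ᵐ q ∂(((volume : Measure ℝ).restrict (Ioc 0 1)).prod (volume : Measure Plane)),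
      ‖d1 (h q.2) (x - q.2) q.1‖ ≤ CK * (sg (x - q.2) q.1 ^ 3 * D q.2) := by
  filter_upwards [ae_prod_fst_mem measurableSet_Ioc, lintegral_prod_snd_ae hb] with q hq hq'
  refine (abs_d1_le _ _ hq.1).trans ?_
  have := sg_nonneg (x - q.2) q.1
  rw [mul_assoc, mul_comm ‖h q.2‖]
  have := CK_pos
  gcongr

theorem nearP_eq_prod {D : Plane → ℝ} (hD : Measurable D) {h : Plane → Plane}
    (hh : AEStronglyMeasurable h volume) (hb : ∀ᵐ y, ‖h y‖ ≤ D y) {x : Plane}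
    (hx : ∫⁻ s in Ioc (0 : ℝ) 1, pot (fun y => ‖D y‖ₑ) s x < ⊤) :
    nearP h x = -∫ q, d1 (h q.2) (x - q.2) q.1
      ∂(((volume : Measure ℝ).restrict (Ioc 0 1)).prod (volume : Measure Plane)) := by
  rw [integral_prod _ ((integrable_near_majorant hD hx).mono' (aestronglyMeasurable_d1 hh x _)
    (abs_d1_ae_le hb x))]
  rfl

theorem continuous_d1_left (z : Plane) (s : ℝ) : Continuous fun b => d1 b z s := by
  unfold d1; fun_prop

theorem tendsto_nearP {D : Plane → ℝ} (hD : Measurable D) {h : ℝ → Plane → Plane}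
    (hh : ∀ ε, AEStronglyMeasurable (h ε) volume) (hb : ∀ᶠ ε in 𝓝[>] 0, ∀ᵐ y, ‖h ε y‖ ≤ D y)
    (hf : AEStronglyMeasurable f volume) (hfb : ∀ᵐ y, ‖f y‖ ≤ D y)
    (hl : ∀ y, Tendsto (fun ε => h ε y) (𝓝[>] 0) (𝓝 (f y))) {x : Plane}
    (hx : ∫⁻ s in Ioc (0 : ℝ) 1, pot (fun y => ‖D y‖ₑ) s x < ⊤) :
    Tendsto (fun ε => nearP (h ε) x) (𝓝[>] 0) (𝓝 (nearP f x)) := by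
  rw [nearP_eq_prod hD hf hfb hx]
  have key := tendsto_integral_filter_of_dominated_convergence
    (F := fun ε (q : ℝ × Plane) => d1 (h ε q.2) (x - q.2) q.1)
    (f := fun q => d1 (f q.2) (x - q.2) q.1) (l := 𝓝[>] 0) _
    (Eventually.of_forall fun ε => aestronglyMeasurable_d1 (hh ε) x _)
    (hb.mono fun ε hε => abs_d1_ae_le hε x) (integrable_near_majorant hD hx)
    (Eventually.of_forall fun q => ((continuous_d1_left _ _).tendsto _).comp (hl q.2))
  refine key.neg.congr' ?_
  filter_upwards [hb] with ε hε
  rw [nearP_eq_prod hD (hh ε) hε hx]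

/-- The near pressures are dominated by the potential N of the majorant. Only its cube is known to
be integrable, so N|g| is bounded by means of N ≤ 1+N³, with g both integrable and bounded. -/
theorem tendsto_integral_pressure {D : Plane → ℝ} (hD : Measurable D) (hD2 : MemLp D 2 volume)
    {h : ℝ → Plane → Plane}
    (hh : ∀ ε, AEStronglyMeasurable (h ε) volume) (hb : ∀ᶠ ε in 𝓝[>] 0, ∀ᵐ y, ‖h ε y‖ ≤ D y)
    (hf : AEStronglyMeasurable f volume) (hfb : ∀ᵐ y, ‖f y‖ ≤ D y)
    (hl : ∀ y, Tendsto (fun ε => h ε y) (𝓝[>] 0) (𝓝 (f y)))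
    {r : ℝ → Plane → ℝ} {r₀ : Plane → ℝ} (hr : ∀ᶠ ε in 𝓝[>] 0, Measurable (r ε)) {B : ℝ}
    (hrB : ∀ᶠ ε in 𝓝[>] 0, ∀ x, |r ε x| ≤ B)
    (hrl : ∀ x, Tendsto (fun ε => r ε x) (𝓝[>] 0) (𝓝 (r₀ x)))
    {g : Plane → ℝ} (hgm : Measurable g) (hg : Integrable g) {A : ℝ} (hA : ∀ x, |g x| ≤ A) :
    Tendsto (fun ε => ∫ x, (nearP (h ε) x + r ε x) * g x) (𝓝[>] 0)
      (𝓝 (∫ x, (nearP f x + r₀ x) * g x)) := by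
  have hC := CK_pos
  have hA0 : 0 ≤ A := (abs_nonneg _).trans (hA 0)
  set N : Plane → ℝ≥0∞ := fun x => ∫⁻ s in Ioc (0 : ℝ) 1, pot (fun y => ‖D y‖ₑ) s x with hN
  have hNm : Measurable N := by
    have := measurable_pot hD.enorm
    exact Measurable.lintegral_prod_left' (f := fun q : ℝ × Plane => pot (fun y => ‖D y‖ₑ) q.1 q.2) this
  have hN3 : ∫⁻ x, N x ^ 3 < ⊤ := lintegral_pot_near_lt_top hD.enorm (lintegral_enorm_sq_lt_top hD2)
  have hNt : ∀ᵐ x, N x < ⊤ := by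
    filter_upwards [ae_lt_top (hNm.pow_const 3) hN3.ne] with x hx
    by_contra h0
    simp [not_lt_top_iff.1 h0] at hx
  have hI : Integrable (fun x => (N x).toReal ^ 3) := by
    have := integrable_toReal_of_lintegral_ne_top (hNm.pow_const 3).aemeasurable hN3.ne
    simpa only [ENNReal.toReal_pow] using this
  refine tendsto_integral_filter_of_dominated_convergence
    (fun x => (CK + B) * |g x| + CK * A * (N x).toReal ^ 3) ?_ ?_
    ((hg.abs.const_mul _).add (hI.const_mul _)) ?_
  · filter_upwards [hr] with ε hε
    exact (((measurable_nearP (hh ε)).add hε).mul hgm).aestronglyMeasurable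
  · filter_upwards [hb, hrB] with ε hε hε'
    filter_upwards [hNt] with x hx
    have h1 : |nearP (h ε) x| ≤ CK * (N x).toReal := by
      have h2 := (enorm_nearP_le (h ε) x).trans (mul_le_mul_right (lintegral_mono fun s =>
        pot_mono (k' := fun y => ‖D y‖ₑ) (hε.mono fun y hy =>
          enorm_le_iff_norm_le.2 (hy.trans (le_abs_self _))) s x) _)
      have h3 := ENNReal.toReal_mono (by finiteness) h2
      rwa [toReal_enorm, ENNReal.toReal_mul, ENNReal.toReal_ofReal hC.le] at h3
    set n := (N x).toReal
    have hn : 0 ≤ n := ENNReal.toReal_nonneg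
    have h4 : n ≤ 1 + n ^ 3 := by nlinarith [sq_nonneg (n - 1), mul_nonneg hn (sq_nonneg (n - 1))]
    rw [norm_mul, Real.norm_eq_abs, Real.norm_eq_abs]
    have h5 := abs_nonneg (g x)
    have h6 := abs_add_le (nearP (h ε) x) (r ε x)
    have h7 : CK * n ^ 3 * |g x| ≤ CK * n ^ 3 * A := mul_le_mul_of_nonneg_left (hA x) (by positivity)
    calc |nearP (h ε) x + r ε x| * |g x| ≤ (CK * (1 + n ^ 3) + B) * |g x| := by
          gcongr
          have := mul_le_mul_of_nonneg_left h4 hC.le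
          linarith [hε' x]
      _ ≤ _ := by linarith
  · filter_upwards [hNt] with x hx
    exact ((tendsto_nearP hD hh hb hf hfb hl hx).add (hrl x)).mul_const _

/-- The contribution of the times `s > 1` to the pressure, for a force in divergence form. -/
def farD (H : Plane → Mat) (x : Plane) : ℝ :=
  -∫ q, ddiv (x - q.2) q.1 (H q.2) ∂(((volume : Measure ℝ).restrict (Ioi 1)).prod (volume : Measure Plane))

theorem aestronglyMeasurable_ddiv (hF : AEStronglyMeasurable F volume) (x : Plane) (μ : Measure ℝ)
    [SFinite μ] :
    AEStronglyMeasurable (fun q : ℝ × Plane => ddiv (x - q.2) q.1 (F q.2)) (μ.prod volume) :=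
  aestronglyMeasurable_sum_entry hF fun j k => by fun_prop

namespace DivForm

/-- For late times the divergence is moved onto the kernel, giving the fourth power of the weight;
its time integral is the square of the weight at x - y, to be paired with the quadratic decay of F.
-/
theorem lintegral_ddiv_le (h : DivForm f F M) (x : Plane) :
    ∫⁻ q, ‖ddiv (x - q.2) q.1 (F q.2)‖ₑ
        ∂(((volume : Measure ℝ).restrict (Ioi 1)).prod (volume : Measure Plane)) ≤
      ENNReal.ofReal (16 * CK * M * (∫ y : Plane, sg y 1 ^ 3) * sg x 1) := by
  have hC := CK_pos
  have hM := h.nonneg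
  have h0 := sg_nonneg x 1
  have hi := integrable_sg_one le_rfl
  have hi' : Integrable fun y => sg (x - y) 1 ^ 3 := hi.comp_sub_left x
  have e1 : ∫ y, sg (x - y) 1 ^ 3 = ∫ y : Plane, sg y 1 ^ 3 :=
    integral_sub_left_eq_self (fun y => sg y 1 ^ 3) volume x
  calc ∫⁻ q, ‖ddiv (x - q.2) q.1 (F q.2)‖ₑ ∂(((volume : Measure ℝ).restrict (Ioi 1)).prod volume)
      ≤ ∫⁻ q, ENNReal.ofReal (4 * CK * M * sg q.2 1 ^ 2 * sg (x - q.2) q.1 ^ 4)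
          ∂(((volume : Measure ℝ).restrict (Ioi 1)).prod volume) := by
        refine lintegral_mono_ae ?_
        filter_upwards [ae_prod_fst_mem measurableSet_Ioi, lintegral_prod_snd_ae h.bound] with q hq hq'
        have := sg_nonneg (x - q.2) q.1
        rw [Real.enorm_eq_ofReal_abs]
        refine ENNReal.ofReal_le_ofReal ((abs_ddiv_le _ (zero_lt_one.trans hq) _).trans ?_)
        calc _ ≤ 4 * CK * sg (x - q.2) q.1 ^ 4 * (M * sg q.2 1 ^ 2) := by gcongr
          _ = _ := by ring
    _ = ∫⁻ y, ENNReal.ofReal (4 * CK * M * sg y 1 ^ 2 * sg (x - y) 1 ^ 2) := by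
        rw [lintegral_prod_symm _ (by fun_prop)]
        refine lintegral_congr fun y => ?_
        obtain ⟨i1, i2⟩ := integrableOn_sg_pow (x - y) 1 zero_le_one (by positivity)
        norm_num only at i1 i2
        simp only
        rw [← ofReal_integral_eq_lintegral_ofReal (i1.const_mul _)
          (Eventually.of_forall fun s => by have := sg_nonneg (x - y) s; positivity),
          integral_const_mul, i2, one_mul]
    _ ≤ ∫⁻ y, ENNReal.ofReal (8 * CK * M * sg x 1 * (sg (x - y) 1 ^ 3 + sg y 1 ^ 3)) := by
        refine lintegral_mono fun y => ENNReal.ofReal_le_ofReal ?_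
        have h1 := sg_nonneg (x - y) 1
        have h2 := sg_nonneg y 1
        have h3 := sg_one_le_one (x - y)
        have h4 := sg_one_le_one y
        -- The smaller of the two weights yields the decay in x, and the three remaining factors are
        -- bounded by the cube of the larger one, which is integrable in y.
        have key : sg y 1 ^ 2 * sg (x - y) 1 ^ 2 ≤ 2 * sg x 1 * (sg (x - y) 1 ^ 3 + sg y 1 ^ 3) := by
          have h5 := min_sg_le x y
          generalize sg (x - y) 1 = a at *
          generalize sg y 1 = b at *
          rcases le_total a b with hab | hab
          · rw [min_eq_left hab] at h5
            calc b ^ 2 * a ^ 2 = a * (b ^ 2 * a) := by ring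
              _ ≤ 2 * sg x 1 * (b ^ 2 * b) := by gcongr
              _ ≤ _ := by
                gcongr
                nlinarith [pow_nonneg h1 3]
          · rw [min_eq_right hab] at h5
            calc b ^ 2 * a ^ 2 = b * (a ^ 2 * b) := by ring
              _ ≤ 2 * sg x 1 * (a ^ 2 * a) := by gcongr
              _ ≤ _ := by
                gcongr
                nlinarith [pow_nonneg h2 3]
        have := mul_le_mul_of_nonneg_left key (show 0 ≤ 4 * CK * M by positivity)
        linarith
    _ = _ := by
        have hs : Integrable fun y => sg (x - y) 1 ^ 3 + sg y 1 ^ 3 := hi'.add hi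
        rw [← ofReal_integral_eq_lintegral_ofReal (hs.const_mul _)
          (Eventually.of_forall fun y => by
            have := sg_nonneg (x - y) 1
            have := sg_nonneg y 1
            positivity), integral_const_mul, integral_add hi' hi, e1]
        congr 1
        ring

theorem integrable_ddiv (h : DivForm f F M) (x : Plane) :
    Integrable (fun q : ℝ × Plane => ddiv (x - q.2) q.1 (F q.2))
      (((volume : Measure ℝ).restrict (Ioi 1)).prod volume) :=
  ⟨aestronglyMeasurable_ddiv h.meas x _, (h.lintegral_ddiv_le x).trans_lt ENNReal.ofReal_lt_top⟩

theorem norm_farD_le (h : DivForm f F M) (x : Plane) :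
    ‖farD F x‖ ≤ 16 * CK * M * (∫ y : Plane, sg y 1 ^ 3) * sg x 1 := by
  have hC := CK_pos
  have hM := h.nonneg
  have h0 := sg_nonneg x 1
  have hI : 0 ≤ ∫ y : Plane, sg y 1 ^ 3 := integral_nonneg fun y => pow_nonneg (sg_nonneg _ _) _
  have h1 := h.lintegral_ddiv_le x
  have h2 : 0 ≤ 16 * CK * M * (∫ y : Plane, sg y 1 ^ 3) * sg x 1 :=
    mul_nonneg (mul_nonneg (by positivity) hI) h0
  have h3 : ENNReal.ofReal ‖farD F x‖ ≤ _ :=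
    (ofReal_norm (farD F x)).trans_le ((enorm_neg _).trans_le
      ((enorm_integral_le_lintegral_enorm _).trans h1))
  exact (ENNReal.ofReal_le_ofReal_iff h2).1 h3

theorem farP_eq (h : DivForm f F M) (x : Plane) : farP f x = farD F x := by
  rw [farP, farD, integral_prod _ (h.integrable_ddiv x)]
  congr 1
  exact setIntegral_congr_fun measurableSet_Ioi fun s hs =>
    h.isDiv.dfl_eq h.memLp h.memLp_two x (zero_lt_one.trans hs)

theorem tendsto_farD (h : DivForm f F M) (x : Plane) :
    Tendsto (fun ε => farD (regM ε F) x) (𝓝[>] 0) (𝓝 (farD F x)) := by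
  have e1 : ∀ (ε : ℝ) (q : ℝ × Plane), ddiv (x - q.2) q.1 (regM ε F q.2) =
      Real.exp (-(ε * ‖q.2‖ ^ 2)) * ddiv (x - q.2) q.1 (F q.2) :=
    fun ε q => by simp [ddiv, regM, mul_assoc]; ring
  simp only [farD, e1]
  have hi := h.integrable_ddiv x
  refine (tendsto_integral_filter_of_dominated_convergence _ ?_ ?_ hi.norm ?_).neg
  · refine Eventually.of_forall fun ε => ?_
    exact (Continuous.aestronglyMeasurable (by fun_prop)).mul hi.1
  · filter_upwards [self_mem_nhdsWithin] with ε hε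
    refine Eventually.of_forall fun q => ?_
    rw [norm_mul]
    exact mul_le_of_le_one_left (norm_nonneg _) (abs_exp_le_one (le_of_lt hε) q.2)
  · refine Eventually.of_forall fun q => ?_
    simpa using (tendsto_exp_reg q.2).mul_const (ddiv (x - q.2) q.1 (F q.2))

theorem measurable_farD (h : DivForm f F M) : Measurable (farD F) := by
  rw [show farD F = farP f from funext fun x => (h.farP_eq x).symm]
  exact measurable_farP h.memLp.1

end DivForm

/-! ### The velocity of a force in divergence form is a weak solution -/

namespace DivForm

theorem aestronglyMeasurable_regD (h : DivForm f F M) (ε : ℝ) :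
    AEStronglyMeasurable (regD ε f F) volume := by
  have hE : Continuous fun y : Plane => Real.exp (-(ε * ‖y‖ ^ 2)) := by fun_prop
  exact (hE.aestronglyMeasurable.smul h.memLp.1).sub (aestronglyMeasurable_corr ε h.meas)

theorem tendsto_regD (f : Plane → Plane) (F : Plane → Mat) (y : Plane) :
    Tendsto (fun ε => regD ε f F y) (𝓝[>] 0) (𝓝 (f y)) := by
  have := ((tendsto_exp_reg y).smul_const (f y)).sub (tendsto_corr F y)
  rwa [one_smul, sub_zero] at this

/-- The Gaussian part is dominated by |f| and the commutator by a multiple of the cubed weight; both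
are square integrable, independently of ε ≤ 1. -/
theorem exists_majorant (h : DivForm f F M) : ∃ D : Plane → ℝ, Measurable D ∧ MemLp D 2 volume ∧
    (∀ᵐ y, ‖f y‖ ≤ D y) ∧ ∀ᶠ ε in 𝓝[>] 0, ∀ᵐ y, ‖regD ε f F y‖ ≤ D y := by
  have hM := h.nonneg
  have hae := h.memLp.1.ae_eq_mk
  have hm := h.memLp.1.stronglyMeasurable_mk.measurable
  have h3 : MemLp (fun y => 16 * M * sg y 1 ^ 3) 2 volume :=
    memLp_two_of_le_sg (Measurable.aestronglyMeasurable (by fun_prop)) (MeasurePreserving.id volume)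
      one_pos (C := 16 * M) (Eventually.of_forall fun y => by
        have h0 := sg_nonneg y 1
        have h1 := sg_one_le_one y
        rw [abs_of_nonneg (by positivity), id]
        exact mul_le_mul_of_nonneg_left (pow_le_pow_of_le_one h0 h1 (by norm_num)) (by positivity))
  refine ⟨fun y => ‖h.memLp.1.mk f y‖ + 16 * M * sg y 1 ^ 3, by fun_prop,
    ((h.memLp.ae_eq hae).norm).add h3, ?_, ?_⟩
  · filter_upwards [hae] with y hy
    have h0 := sg_nonneg y 1
    rw [← hy]
    exact le_add_of_nonneg_right (by positivity)
  · filter_upwards [Ioc_mem_nhdsGT one_pos] with ε hε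
    filter_upwards [hae, h.bound] with y hy hy'
    rw [← hy]
    exact (norm_sub_le _ _).trans (add_le_add (norm_reg_le hε.1.le f y)
      (norm_corr_le hε.1.le hε.2 h.nonneg hy'))

theorem tendsto_integral_inner (h : DivForm f F M) {α : ℝ} (hα : α ≠ 0) (φ : 𝓢(Plane, Plane)) :
    Tendsto (fun ε => ∫ x, ⟪vel α (regD ε f F) x, φ x⟫) (𝓝[>] 0) (𝓝 (∫ x, ⟪velD α F x, φ x⟫)) := by
  have hC := CK_pos
  have hM := h.nonneg
  have hf := farC_nonneg
  have hi : Integrable fun x => 16 * CK * (M * farC) * ‖φ x‖ := φ.integrable.norm.const_mul _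
  refine tendsto_integral_filter_of_dominated_convergence _ ?_ ?_ hi ?_
  · filter_upwards [Ioc_mem_nhdsGT one_pos] with ε hε
    exact ((h.adm_regD hε.1 hε.2).measurable_vel hα).aestronglyMeasurable.inner
      φ.continuous.aestronglyMeasurable
  · filter_upwards [Ioc_mem_nhdsGT one_pos] with ε hε
    refine Eventually.of_forall fun x => (norm_inner_le_norm _ _).trans ?_
    have h' := h.regD_form hε.1 hε.2
    rw [h.vel_regD hα hε.1 hε.2]
    exact mul_le_mul_of_nonneg_right
      (norm_velD_le h'.meas (by positivity) (rpot_le_const hM h'.bound α x)) (norm_nonneg _)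
  · refine Eventually.of_forall fun x => Tendsto.inner ?_ tendsto_const_nhds
    refine (tendsto_velD_regM h.meas (h.rpot_lt_top α x)).congr' ?_
    filter_upwards [Ioc_mem_nhdsGT one_pos] with ε hε
    rw [h.vel_regD hα hε.1 hε.2]

theorem integral_inner_velD_gradS (h : DivForm f F M) {α : ℝ} (hα : α ≠ 0) (ψ : 𝓢(Plane, ℝ)) :
    ∫ x, ⟪velD α F x, gradS ψ x⟫ = 0 := by
  refine tendsto_nhds_unique (h.tendsto_integral_inner hα (gradS ψ))
    (tendsto_const_nhds.congr' ?_)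
  filter_upwards [Ioc_mem_nhdsGT one_pos] with ε hε
  rw [(h.adm_regD hε.1 hε.2).integral_inner_vel_gradS hα]

/-- The weak identity holds for the regularised admissible forces and passes to the limit term by
term. The far pressure needs its divergence form here, because f itself need not be integrable. -/
theorem integral_inner_velD_rotOp (h : DivForm f F M) {α : ℝ} (hα : α ≠ 0) (φ : 𝓢(Plane, Plane)) :
    ∫ x, ⟪velD α F x, rotOp (-α) φ x⟫ =
      (∫ y, ⟪f y, φ y⟫) + ∫ x, (nearP f x + farD F x) * divS φ x := by
  have hC := CK_pos
  have hM := h.nonneg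
  have hI : 0 ≤ ∫ y : Plane, sg y 1 ^ 3 := integral_nonneg fun y => pow_nonneg (sg_nonneg _ _) _
  obtain ⟨D, hD, hD2, hfD, hbD⟩ := h.exists_majorant
  have h1 : Tendsto (fun ε => ∫ y, ⟪regD ε f F y, φ y⟫) (𝓝[>] 0) (𝓝 (∫ y, ⟪f y, φ y⟫)) := by
    refine tendsto_integral_filter_of_dominated_convergence (fun y => D y * ‖φ y‖) ?_ ?_
      (integrable_mul_two hD2 (φ.memLp 2).norm) ?_
    · exact Eventually.of_forall fun ε =>
        (h.aestronglyMeasurable_regD ε).inner φ.continuous.aestronglyMeasurable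
    · filter_upwards [hbD] with ε hε
      filter_upwards [hε] with y hy
      exact (norm_inner_le_norm _ _).trans (mul_le_mul_of_nonneg_right hy (norm_nonneg _))
    · exact Eventually.of_forall fun y => (tendsto_regD f F y).inner tendsto_const_nhds
  have h2 := tendsto_integral_pressure hD hD2 h.aestronglyMeasurable_regD hbD h.memLp.1 hfD
    (tendsto_regD f F) (r := fun ε => farD (regM ε F)) (r₀ := farD F)
    (B := 16 * CK * M * (∫ y : Plane, sg y 1 ^ 3))
    (by
      filter_upwards [Ioc_mem_nhdsGT one_pos] with ε hε
      exact (h.regD_form hε.1 hε.2).measurable_farD)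
    (by
      filter_upwards [Ioc_mem_nhdsGT one_pos] with ε hε
      exact fun x => ((h.regD_form hε.1 hε.2).norm_farD_le x).trans
        (mul_le_of_le_one_right (mul_nonneg (by positivity) hI) (sg_one_le_one x)))
    h.tendsto_farD (divS φ).continuous.measurable (divS φ).integrable
    (SchwartzMap.norm_le_seminorm ℝ (divS φ))
  simp_rw [← rotS_apply]
  refine tendsto_nhds_unique (h.tendsto_integral_inner hα _) ((h1.add h2).congr' ?_)
  filter_upwards [Ioc_mem_nhdsGT one_pos] with ε hε
  have ha := h.adm_regD hε.1 hε.2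
  have h' := h.regD_form hε.1 hε.2
  have h3 := ha.integral_inner_vel_rotOp hα φ
  simp_rw [← rotS_apply] at h3
  rw [h3, integral_newton (divS φ).continuous.measurable (divS φ).integrable
    (SchwartzMap.norm_le_seminorm ℝ (divS φ)) ha.integrable]
  simp only [h'.farP_eq]

theorem isWeakSolution (h : DivForm f F M) {α : ℝ} (hα : α ≠ 0) :
    IsWeakSolution α f (velD α F) fun x => nearP f x + farD F x := by
  refine ⟨⟨6, ?_, ?_, h.memLp_velD hα⟩, ⟨3, ?_, ?_, memLp_pressure h.memLp h.measurable_farD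
    h.norm_farD_le⟩, weak_div_of_gradS (h.integral_inner_velD_gradS hα), fun φ => ?_⟩
  · norm_num
  · norm_num
  · norm_num
  · norm_num
  · rw [h.integral_inner_velD_rotOp hα φ]
    simp only [divS_apply]
    ring

end DivForm

/-! ### The asymptotics of the velocity of a force in divergence form -/

theorem kdiv_add (p z : Plane) (t : ℝ) (A B : Mat) :
    kdiv p z t (A + B) = kdiv p z t A + kdiv p z t B := by
  simp [kdiv]
  ring

theorem enorm_zero_mat : ‖(0 : Mat)‖ₑ = 0 := by
  rw [← ofReal_norm, norm_zero, ENNReal.ofReal_zero]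

theorem rpot_indicator_le (α : ℝ) (F : Plane → Mat) (S : Set Plane) (x : Plane) :
    rpot α (fun y => ‖S.indicator F y‖ₑ) x ≤ rpot α (fun y => ‖F y‖ₑ) x :=
  rpot_mono (Eventually.of_forall fun y => by
    by_cases hy : y ∈ S
    · rw [indicator_of_mem hy]
    · rw [indicator_of_notMem hy, enorm_zero_mat]
      exact zero_le) x

theorem velI_split {α : ℝ} (hF : AEStronglyMeasurable F volume) {x : Plane}
    (hf : rpot α (fun y => ‖F y‖ₑ) x < ⊤) (a : Plane) {S : Set Plane} (hS : MeasurableSet S) :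
    velI α F x a = velI α (S.indicator F) x a + velI α (Sᶜ.indicator F) x a := by
  have i1 := integrable_kdiv (hF.indicator hS) ((rpot_indicator_le α F S x).trans_lt hf) a
  have i2 := integrable_kdiv (hF.indicator hS.compl) ((rpot_indicator_le α F Sᶜ x).trans_lt hf) a
  rw [velI, velI, velI, ← integral_add i1 i2]
  congr 1
  ext q
  rw [← kdiv_add, ← Pi.add_apply, indicator_self_add_compl]

/-- Of the decay |y|^{-(2+γ)} the factor |y|^{-γ} is frozen at its largest value on the region, and
the quadratic part is left for the potential estimate. -/
theorem abs_velI_far_le (α : ℝ) {γ : ℝ} (hγ : 0 ≤ γ) (hF : AEStronglyMeasurable F volume)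
    {x : Plane} (hx : x ≠ 0) (a : Plane) {w : ℝ} (hw : 0 ≤ w)
    (hb : ∀ᵐ y, ‖x‖ / 2 ≤ ‖y‖ → ‖y‖ ^ (2 + γ) * ‖F y‖ ≤ w) :
    |velI α ((Metric.ball 0 (‖x‖ / 2))ᶜ.indicator F) x a| ≤
      8 * CK * ‖a‖ * (w / (‖x‖ / 2) ^ γ * (5 * farC / ‖x‖)) := by
  have hr : 0 < ‖x‖ := norm_pos_iff.2 hx
  have hC := CK_pos
  have hf := farC_nonneg
  have hp : 0 < (‖x‖ / 2) ^ γ := by positivity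
  have hB : MeasurableSet (Metric.ball (0 : Plane) (‖x‖ / 2)) := Metric.isOpen_ball.measurableSet
  have h1 := enorm_velI_le α (hF.indicator hB.compl) x a
  have h2 : rpot α (fun y => ‖(Metric.ball 0 (‖x‖ / 2))ᶜ.indicator F y‖ₑ) x ≤
      ENNReal.ofReal (w / (‖x‖ / 2) ^ γ * (5 * farC / ‖x‖)) := by
    rw [ENNReal.ofReal_mul (by positivity)]
    refine le_trans ?_ (mul_le_mul_right (rpot_far_le α hx) _)
    rw [← rpot_const_mul ENNReal.ofReal_ne_top]
    refine rpot_mono ?_ x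
    filter_upwards [hb] with y hy
    by_cases hyB : y ∈ (Metric.ball (0 : Plane) (‖x‖ / 2))ᶜ
    · rw [indicator_of_mem hyB, indicator_of_mem hyB, ← ofReal_norm,
        ← ENNReal.ofReal_mul (by positivity)]
      refine ENNReal.ofReal_le_ofReal ?_
      simp only [mem_compl_iff, mem_ball_zero_iff, not_lt] at hyB
      have hy0 : 0 < ‖y‖ := by linarith
      have h3 := hy hyB
      have h4 : (‖x‖ / 2) ^ γ ≤ ‖y‖ ^ γ := Real.rpow_le_rpow (by positivity) hyB hγ
      rw [Real.rpow_add hy0, Real.rpow_two] at h3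
      rw [sg_zero_right, inv_pow, div_mul_eq_mul_div, le_div_iff₀ hp, ← div_eq_mul_inv,
        le_div_iff₀ (by positivity)]
      calc ‖F y‖ * (‖x‖ / 2) ^ γ * ‖y‖ ^ 2 ≤ ‖F y‖ * ‖y‖ ^ γ * ‖y‖ ^ 2 := by gcongr
        _ ≤ w := by linarith
    · rw [indicator_of_notMem hyB, indicator_of_notMem hyB, mul_zero, enorm_zero_mat]
  have h3 := h1.trans (mul_le_mul_right h2 _)
  rwa [← ENNReal.ofReal_mul (by positivity), Real.enorm_eq_ofReal_abs,
    ENNReal.ofReal_le_ofReal_iff (by positivity)] at h3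

theorem abs_kdiv_sub_le (p : Plane) {z y : Plane} {t : ℝ} (ht : 0 < t) (hy : ‖y‖ ≤ ‖z‖ / 2) (A : Mat) :
    |kdiv p (z - y) t A - kdiv p z t A| ≤ 192 * CK * ‖p‖ * (sg z t ^ 4 * (‖y‖ * ‖A‖)) := by
  have e1 : kdiv p (z - y) t A - kdiv p z t A =
      ∑ j, ∑ k, A j k * (K1 (e k) p (e j) (z - y) t - K1 (e k) p (e j) z t) := by
    simp only [kdiv, mul_sub, Finset.sum_sub_distrib]
  rw [e1]
  refine (abs_sum_entry_le A (B := 48 * CK * ‖p‖ * ‖y‖ * sg z t ^ 4) fun j k => ?_).trans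
    (le_of_eq (by ring))
  exact (abs_K1_sub_le _ _ _ ht hy).trans (le_of_eq (by simp only [norm_e]; ring))

/-- The leading part of the velocity. -/
def velLead (α : ℝ) (H : Plane → Mat) (x a : Plane) : ℝ :=
  ∑ j, ∑ k, (∫ y, H y j k) * ∫ t in Ioi 0, rotK1 α (e k) a (e j) x t

theorem integrable_entry {H : Plane → Mat} (hm : AEStronglyMeasurable H volume)
    (hH : Integrable fun y => ‖H y‖) (j k : Fin 2) :
    Integrable fun y => H y j k :=
  hH.mono' (aestronglyMeasurable_entry hm j k) (Eventually.of_forall fun _ => abs_entry_le _ _ _)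

theorem kdiv_Rot (α : ℝ) (x a : Plane) (t : ℝ) (A : Mat) :
    kdiv (Rot (α * t) a) (Rot (α * t) x) t A = ∑ j, ∑ k, A j k * rotK1 α (e k) a (e j) x t := by
  have h : ∀ q b, K1 q (Rot (α * t) a) b (Rot (α * t) x) t = rotK1 α q a b x t := fun q b => by
    have := K1_Rot_left (α * t) q a b x 0 t
    rwa [sub_zero, show Rot (-(α * t)) 0 = 0 from norm_eq_zero.1 (by rw [norm_Rot, norm_zero]), sub_zero] at this
  simp only [kdiv, h]

theorem velLead_eq (α : ℝ) {H : Plane → Mat} (hm : AEStronglyMeasurable H volume)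
    (hH : Integrable fun y => ‖H y‖) {x : Plane} (hx : x ≠ 0) (a : Plane) :
    Integrable (fun q : ℝ × Plane => kdiv (Rot (α * q.1) a) (Rot (α * q.1) x) q.1 (H q.2))
        (((volume : Measure ℝ).restrict (Ioi 0)).prod volume) ∧
      ∫ q, kdiv (Rot (α * q.1) a) (Rot (α * q.1) x) q.1 (H q.2)
        ∂(((volume : Measure ℝ).restrict (Ioi 0)).prod (volume : Measure Plane)) = velLead α H x a := by
  have hi : ∀ j k, Integrable (fun q : ℝ × Plane => H q.2 j k * rotK1 α (e k) a (e j) x q.1)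
      (((volume : Measure ℝ).restrict (Ioi 0)).prod volume) := fun j k => by
    simpa only [mul_comm] using
      Integrable.mul_prod (integrableOn_rotK1 α (e k) a (e j) hx) (integrable_entry hm hH j k)
  simp only [kdiv_Rot]
  refine ⟨integrable_finsetSum _ fun j _ => integrable_finsetSum _ fun k _ => hi j k, ?_⟩
  rw [integral_finsetSum _ fun j _ => integrable_finsetSum _ fun k _ => hi j k, velLead]
  refine Finset.sum_congr rfl fun j _ => ?_
  rw [integral_finsetSum _ fun k _ => hi j k]
  refine Finset.sum_congr rfl fun k _ => ?_
  rw [mul_comm, ← integral_prod_mul]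
  simp only [mul_comm]

/-- The kernel is frozen at y = 0. The Lipschitz error is |y| times the fourth power of the weight
at x, whose time integral is |x|^{-2}. -/
theorem abs_velI_near_le (α : ℝ) {H : Plane → Mat} (hm : AEStronglyMeasurable H volume)
    (hH : Integrable fun y => ‖H y‖) {x : Plane} (hx : x ≠ 0)
    (h0 : ∀ y, ‖x‖ / 2 < ‖y‖ → H y = 0) (hf : rpot α (fun y => ‖H y‖ₑ) x < ⊤) (a : Plane) :
    |velI α H x a - velLead α H x a| ≤ 192 * CK * ‖a‖ * (‖x‖ ^ 2)⁻¹ * ∫ y, ‖y‖ * ‖H y‖ := by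
  have hr : 0 < ‖x‖ := norm_pos_iff.2 hx
  have hC := CK_pos
  obtain ⟨i1, e1⟩ := velLead_eq α hm hH hx a
  obtain ⟨i2, e2⟩ := integrableOn_sg_pow x 1 le_rfl (t := 0) (by positivity)
  have e3 : ∫ t in Ioi 0, sg x t ^ 4 = (‖x‖ ^ 2)⁻¹ := by
    rw [← inv_pow, ← sg_zero_right]
    norm_num at e2
    exact e2
  have i3 : Integrable fun y => ‖y‖ * ‖H y‖ := by
    refine (hH.const_mul (‖x‖ / 2)).mono' (continuous_norm.aestronglyMeasurable.mul hm.norm)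
      (Eventually.of_forall fun y => ?_)
    rw [Real.norm_of_nonneg (by positivity)]
    rcases le_or_gt ‖y‖ (‖x‖ / 2) with h | h
    · exact mul_le_mul_of_nonneg_right h (norm_nonneg _)
    · simp [h0 y h]
  rw [velI, ← e1, ← integral_sub (integrable_kdiv hm hf a) i1, ← Real.norm_eq_abs]
  refine (norm_integral_le_of_norm_le ((Integrable.mul_prod i2 i3).const_mul (192 * CK * ‖a‖)) ?_).trans
    (le_of_eq ?_)
  · filter_upwards [ae_prod_fst_mem measurableSet_Ioi] with q hq
    rw [Real.norm_eq_abs]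
    rcases le_or_gt ‖q.2‖ (‖x‖ / 2) with h | h
    · refine (abs_kdiv_sub_le _ hq (by rwa [norm_Rot]) _).trans (le_of_eq ?_)
      rw [norm_Rot, sg_Rot]
    · simp [h0 _ h, kdiv]
  · rw [integral_const_mul, integral_prod_mul (fun t => sg x t ^ (1 + 3)) fun y => ‖y‖ * ‖H y‖, ← mul_assoc]
    norm_num only
    rw [e3]

/-- In the leading term H_jk is paired with -(e_j·e_k^⊥), which vanishes for j = k and changes sign
under exchange. Hence only the antisymmetric part generates the circular flow. -/
theorem abs_velLead_le {α : ℝ} (hα : α ≠ 0) {H : Plane → Mat} (hm : AEStronglyMeasurable H volume)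
    (hH : Integrable fun y => ‖H y‖) {x : Plane} (hx : x ≠ 0)
    (a : Plane) :
    |velLead α H x a - (∫ y, (H y 0 1 - H y 1 0)) * ⟪a, vortex x⟫| ≤
      32 * CK * ‖a‖ * min (1 / (|α| * ‖x‖ ^ 3)) (1 / ‖x‖) * ∫ y, ‖H y‖ := by
  have hC := CK_pos
  have hr : 0 < ‖x‖ := norm_pos_iff.2 hx
  set m := min (1 / (|α| * ‖x‖ ^ 3)) (1 / ‖x‖)
  have hm0 : 0 ≤ m := le_min (by positivity) (by positivity)
  set κ := 1 / (4 * Real.pi * ‖x‖ ^ 2)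
  have h1 : ∀ j k, |(∫ y, H y j k) * ((∫ t in Ioi 0, rotK1 α (e k) a (e j) x t) +
      ⟪a, perp x⟫ * ⟪e j, perp (e k)⟫ * κ)| ≤ (∫ y, ‖H y‖) * (8 * CK * ‖a‖ * m) := fun j k => by
    have h2 := abs_lead_le hα (e k) a (e j) hx
    simp only [norm_e, one_mul, mul_one] at h2
    refine abs_mul_le ?_ h2
    exact norm_integral_le_of_norm_le hH (f := fun y => H y j k)
      (Eventually.of_forall fun y => abs_entry_le (H y) j k)
  have e1 : velLead α H x a - (∫ y, (H y 0 1 - H y 1 0)) * ⟪a, vortex x⟫ =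
      ∑ j, ∑ k, (∫ y, H y j k) * ((∫ t in Ioi 0, rotK1 α (e k) a (e j) x t) +
        ⟪a, perp x⟫ * ⟪e j, perp (e k)⟫ * κ) := by
    rw [integral_sub (integrable_entry hm hH 0 1) (integrable_entry hm hH 1 0), inner_vortex, velLead]
    simp [Fin.sum_univ_two, inner_eq, e, perp]
    ring
  rw [e1]
  calc _ ≤ ∑ j : Fin 2, ∑ k : Fin 2, (∫ y, ‖H y‖) * (8 * CK * ‖a‖ * m) :=
        (Finset.abs_sum_le_sum_abs _ _).trans (Finset.sum_le_sum fun j _ =>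
          (Finset.abs_sum_le_sum_abs _ _).trans (Finset.sum_le_sum fun k _ => h1 j k))
    _ = _ := by simp; ring

/-! ### The main estimate for forces in divergence form -/

/-- The off-diagonal antisymmetric part of a matrix field. -/
def skew (F : Plane → Mat) (y : Plane) : ℝ := F y 0 1 - F y 1 0

theorem abs_skew_le (F : Plane → Mat) (y : Plane) : |skew F y| ≤ 2 * ‖F y‖ := by
  have := abs_sub (F y 0 1) (F y 1 0)
  have := abs_entry_le (F y) 0 1
  have := abs_entry_le (F y) 1 0
  rw [skew]
  linarith

theorem aestronglyMeasurable_skew (hF : AEStronglyMeasurable F volume) :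
    AEStronglyMeasurable (skew F) volume :=
  (aestronglyMeasurable_entry hF 0 1).sub (aestronglyMeasurable_entry hF 1 0)

namespace DivForm

theorem integrableOn_norm (h : DivForm f F M) (r : ℝ) :
    IntegrableOn (fun y => ‖F y‖) (Metric.ball 0 r) := by
  have : IsFiniteMeasure ((volume : Measure Plane).restrict (Metric.ball 0 r)) :=
    isFiniteMeasure_restrict.2 measure_ball_lt_top.ne
  exact (h.memLp_two.norm.restrict _).integrable one_le_two

theorem integrableOn_skew (h : DivForm f F M) (r : ℝ) : IntegrableOn (skew F) (Metric.ball 0 r) :=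
  ((h.integrableOn_norm r).const_mul 2).mono' (aestronglyMeasurable_skew h.meas).restrict
    (Eventually.of_forall fun y => abs_skew_le F y)

theorem integrable_exp_skew (h : DivForm f F M) {ε : ℝ} (hε : 0 < ε) :
    Integrable fun y => Real.exp (-(ε * ‖y‖ ^ 2)) * skew F y := by
  obtain ⟨C, hC, hexp⟩ := exists_exp_le hε
  have hE : Continuous fun y : Plane => Real.exp (-(ε * ‖y‖ ^ 2)) := by fun_prop
  have hM := h.nonneg
  refine ((integrable_sg_one (n := 8) (by norm_num)).const_mul (C * (2 * M))).mono'
    (hE.aestronglyMeasurable.mul (aestronglyMeasurable_skew h.meas)) ?_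
  filter_upwards [h.bound] with y hy
  have h0 := sg_nonneg y 1
  rw [norm_mul, Real.norm_of_nonneg (Real.exp_pos _).le, Real.norm_eq_abs]
  calc Real.exp (-(ε * ‖y‖ ^ 2)) * |skew F y|
      ≤ C * sg y 1 ^ 6 * (2 * (M * sg y 1 ^ 2)) := by
        gcongr
        · exact hexp y
        · exact (abs_skew_le F y).trans (by gcongr)
    _ = _ := by ring

theorem regSkew_ballCompl (h : DivForm f F M) (r : ℝ) {ε : ℝ} (hε : 0 < ε) :
    regSkew F (ballCompl r) ε = regSkew F univ ε - regSkew F (Metric.ball 0 r) ε := by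
  have e1 : ballCompl r = (Metric.ball 0 r)ᶜ := by
    ext y
    simp [ballCompl]
  have := integral_add_compl (Metric.isOpen_ball (x := (0 : Plane)) (ε := r)).measurableSet
    (h.integrable_exp_skew hε)
  simp only [skew] at this
  rw [regSkew, regSkew, regSkew, setIntegral_univ, ← this, e1]
  ring

theorem tendsto_regSkew_ballCompl (h : DivForm f F M) {a : ℝ}
    (ha : Tendsto (regSkew F univ) (𝓝[>] 0) (𝓝 a)) (r : ℝ) :
    Tendsto (regSkew F (ballCompl r)) (𝓝[>] 0) (𝓝 (a - ∫ y in Metric.ball 0 r, skew F y)) := by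
  refine (ha.sub (tendsto_integral_reg (h.integrableOn_skew r))).congr' ?_
  filter_upwards [self_mem_nhdsWithin] with ε hε
  rw [h.regSkew_ballCompl r hε]
  rfl

/-- On a ball the skew part is integrable and the regularisation is harmless, so the total limit
splits into an ordinary integral and an outer limit. -/
theorem skewLim_ballCompl (h : DivForm f F M) {a : ℝ}
    (ha : Tendsto (regSkew F univ) (𝓝[>] 0) (𝓝 a)) (r : ℝ) :
    ctilde F = (∫ y in Metric.ball 0 r, skew F y) + skewLim F (ballCompl r) := by
  rw [ctilde, skewLim, skewLim, ha.limUnder_eq, (h.tendsto_regSkew_ballCompl ha r).limUnder_eq]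
  ring

/-- Four errors at the splitting radius |x|/2: freezing the kernel, oscillation of the leading term,
the outer part of F, and replacing the skew mass of the ball by the total one. -/
theorem abs_velI_sub_le (h : DivForm f F M) {a : ℝ}
    (ha : Tendsto (regSkew F univ) (𝓝[>] 0) (𝓝 a)) {α γ : ℝ} (hα : α ≠ 0) (hγ : 0 ≤ γ)
    {x : Plane} (hx : x ≠ 0) {w : ℝ} (hw : 0 ≤ w)
    (hb : ∀ᵐ y, ‖x‖ / 2 ≤ ‖y‖ → ‖y‖ ^ (2 + γ) * ‖F y‖ ≤ w) (i : Fin 2) :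
    |velI α F x (e i) - ctilde F * ⟪e i, vortex x⟫| ≤
      192 * CK * (‖x‖ ^ 2)⁻¹ * (∫ y in Metric.ball 0 (‖x‖ / 2), ‖y‖ * ‖F y‖) +
      32 * CK * min (1 / (|α| * ‖x‖ ^ 3)) (1 / ‖x‖) * (∫ y in Metric.ball 0 (‖x‖ / 2), ‖F y‖) +
      8 * CK * (w / (‖x‖ / 2) ^ γ * (5 * farC / ‖x‖)) +
      ‖x‖⁻¹ * |skewLim F (ballCompl (‖x‖ / 2))| := by
  set B := Metric.ball (0 : Plane) (‖x‖ / 2) with hB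
  have hBm : MeasurableSet B := Metric.isOpen_ball.measurableSet
  set H := B.indicator F with hH
  have hHB : ∀ y ∈ B, H y = F y := fun y hy => indicator_of_mem hy F
  have hHB' : ∀ y, y ∉ B → H y = 0 := fun y hy => indicator_of_notMem hy F
  have ind : ∀ (g : Plane → Mat → ℝ), (∀ y, g y 0 = 0) →
      (fun y => g y (H y)) = B.indicator fun y => g y (F y) := fun g hg => by
    ext y
    by_cases hy : y ∈ B
    · rw [hHB y hy, indicator_of_mem hy]
    · rw [hHB' y hy, indicator_of_notMem hy, hg]
  have hi : Integrable fun y => ‖H y‖ := by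
    rw [ind (fun y A => ‖A‖) fun y => norm_zero]
    exact (h.integrableOn_norm _).integrable_indicator hBm
  have e1 : ∫ y, ‖H y‖ = ∫ y in B, ‖F y‖ := by
    rw [ind (fun y A => ‖A‖) fun y => norm_zero, integral_indicator hBm]
  have e2 : ∫ y, ‖y‖ * ‖H y‖ = ∫ y in B, ‖y‖ * ‖F y‖ := by
    rw [ind (fun y A => ‖y‖ * ‖A‖) fun y => by rw [norm_zero, mul_zero], integral_indicator hBm]
  have e3 : ∫ y, (H y 0 1 - H y 1 0) = ∫ y in B, skew F y := by
    rw [ind (fun y A => A 0 1 - A 1 0) fun y => sub_self _, integral_indicator hBm]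
    rfl
  have hm : AEStronglyMeasurable H volume := h.meas.indicator hBm
  have hr : rpot α (fun y => ‖H y‖ₑ) x < ⊤ := (rpot_indicator_le α F B x).trans_lt (h.rpot_lt_top α x)
  have h1 := abs_velI_near_le α hm hi hx (fun y hy => hHB' y fun hy' => by
    rw [hB, mem_ball_zero_iff] at hy'
    linarith) hr (e i)
  have h2 := abs_velLead_le hα hm hi hx (e i)
  have h3 := abs_velI_far_le α hγ h.meas hx (e i) hw hb
  have h4 : |skewLim F (ballCompl (‖x‖ / 2)) * ⟪e i, vortex x⟫| ≤
      ‖x‖⁻¹ * |skewLim F (ballCompl (‖x‖ / 2))| := by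
    rw [abs_mul, mul_comm]
    refine mul_le_mul_of_nonneg_right ?_ (abs_nonneg _)
    have := abs_real_inner_le_norm (e i) (vortex x)
    rw [norm_e, one_mul] at this
    exact this.trans (norm_vortex x)
  rw [norm_e, mul_one, e2] at h1
  rw [norm_e, mul_one, e1, e3] at h2
  rw [norm_e, mul_one] at h3
  rw [velI_split h.meas (h.rpot_lt_top α x) (e i) hBm, h.skewLim_ballCompl ha (‖x‖ / 2)]
  rw [abs_le] at *
  constructor <;> linarith [h1.1, h1.2, h2.1, h2.2, h3.1, h3.2, h4.1, h4.2]

/-- Multiplication by |x|^{1+γ} turns the four errors into the four terms of the estimate. The sum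
of two components accounts for the factor 2. -/
theorem norm_rem_le (h : DivForm f F M) {a : ℝ}
    (ha : Tendsto (regSkew F univ) (𝓝[>] 0) (𝓝 a)) {α γ : ℝ} (hα : α ≠ 0) (hγ : 0 ≤ γ) (hγ' : γ < 1)
    {x : Plane} (hx : x ≠ 0) {w : ℝ} (hw : 0 ≤ w)
    (hb : ∀ᵐ y, ‖x‖ / 2 ≤ ‖y‖ → ‖y‖ ^ (2 + γ) * ‖F y‖ ≤ w) :
    ‖x‖ ^ (1 + γ) * ‖velD α F x - ctilde F • vortex x‖ ≤
      2 * (192 * CK + 1 + 80 * CK * farC) *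
      (w + ‖x‖ ^ (-1 + γ) * (∫ y in Metric.ball 0 (‖x‖ / 2), ‖y‖ * ‖F y‖) +
      min (1 / (|α| * ‖x‖ ^ (2 - γ))) (‖x‖ ^ γ) * (∫ y in Metric.ball 0 (‖x‖ / 2), ‖F y‖) +
      ‖x‖ ^ γ * |skewLim F (ballCompl (‖x‖ / 2))|) := by
  have hr : 0 < ‖x‖ := norm_pos_iff.2 hx
  have hC := CK_pos
  have hf := farC_nonneg
  have hα' : 0 < |α| := abs_pos.2 hα
  have key := fun i => h.abs_velI_sub_le ha hα hγ hx hw hb i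
  have e1 : ∀ i, (velD α F x - ctilde F • vortex x) i =
      velI α F x (e i) - ctilde F * ⟪e i, vortex x⟫ := fun i => by
    rw [inner_e_left]
    rfl
  have h1 := norm_le_add_abs (velD α F x - ctilde F • vortex x)
  rw [e1, e1] at h1
  have h0 := key 0
  have h2 := key 1
  set I1 := ∫ y in Metric.ball 0 (‖x‖ / 2), ‖y‖ * ‖F y‖
  set I0 := ∫ y in Metric.ball 0 (‖x‖ / 2), ‖F y‖
  set σ := |skewLim F (ballCompl (‖x‖ / 2))|
  set m := min (1 / (|α| * ‖x‖ ^ 3)) (1 / ‖x‖) with hm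
  have hI1 : 0 ≤ I1 := integral_nonneg fun y => by positivity
  have hI0 : 0 ≤ I0 := integral_nonneg fun y => by positivity
  have hσ : 0 ≤ σ := abs_nonneg _
  clear_value I1 I0 σ
  set P := ‖x‖ ^ (1 + γ) with hP
  have hP0 : 0 < P := by positivity
  have p1 : P * (‖x‖ ^ 2)⁻¹ = ‖x‖ ^ (-1 + γ) := by
    rw [← Real.rpow_two, ← Real.rpow_neg hr.le, hP, ← Real.rpow_add hr]
    congr 1
    ring
  have p2 : P * ‖x‖⁻¹ = ‖x‖ ^ γ := by
    rw [hP, Real.rpow_add hr, Real.rpow_one]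
    field_simp
  have p3 : P * m = min (1 / (|α| * ‖x‖ ^ (2 - γ))) (‖x‖ ^ γ) := by
    rw [hm, mul_min_of_nonneg _ _ hP0.le, one_div ‖x‖, p2]
    congr 1
    rw [mul_one_div, div_eq_div_iff (by positivity) (by positivity), hP, one_mul, mul_left_comm,
      ← Real.rpow_add hr, ← Real.rpow_natCast]
    congr 2
    push_cast
    ring
  -- The powers of |x| cancel exactly; the half radius leaves 2^γ ≤ 2, which keeps the constant free
  -- of γ.
  have p4 : P * (w / (‖x‖ / 2) ^ γ * (5 * farC / ‖x‖)) ≤ 10 * farC * w := by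
    have h2γ : (2 : ℝ) ^ γ ≤ 2 := by
      simpa using Real.rpow_le_rpow_of_exponent_le one_le_two hγ'.le
    have hxg : 0 < ‖x‖ ^ γ := by positivity
    calc P * (w / (‖x‖ / 2) ^ γ * (5 * farC / ‖x‖))
        = P * ‖x‖⁻¹ / (‖x‖ / 2) ^ γ * (5 * farC * w) := by ring
      _ = 2 ^ γ * (5 * farC * w) := by
        rw [p2, Real.div_rpow hr.le zero_le_two]
        field_simp
      _ ≤ 2 * (5 * farC * w) := by gcongr
      _ = _ := by ring
  have h3 : ‖velD α F x - ctilde F • vortex x‖ ≤ 2 * (192 * CK * (‖x‖ ^ 2)⁻¹ * I1 + 32 * CK * m * I0 +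
      8 * CK * (w / (‖x‖ / 2) ^ γ * (5 * farC / ‖x‖)) + ‖x‖⁻¹ * σ) := by linarith
  set X := ‖x‖ ^ (-1 + γ) * I1 with hX
  set Y := min (1 / (|α| * ‖x‖ ^ (2 - γ))) (‖x‖ ^ γ) * I0 with hY
  set Z := ‖x‖ ^ γ * σ with hZ
  have hX0 : 0 ≤ X := by positivity
  have hY0 : 0 ≤ Y := mul_nonneg (le_min (by positivity) (by positivity)) hI0
  have hZ0 : 0 ≤ Z := by positivity
  calc P * ‖velD α F x - ctilde F • vortex x‖
      ≤ P * (2 * (192 * CK * (‖x‖ ^ 2)⁻¹ * I1 + 32 * CK * m * I0 +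
      8 * CK * (w / (‖x‖ / 2) ^ γ * (5 * farC / ‖x‖)) + ‖x‖⁻¹ * σ)) := mul_le_mul_of_nonneg_left h3 hP0.le
    _ = 2 * (192 * CK * X + 32 * CK * Y + 8 * CK * (P * (w / (‖x‖ / 2) ^ γ * (5 * farC / ‖x‖))) + Z) := by
        rw [hX, hY, hZ, ← p1, ← p3, ← p2]
        ring
    _ ≤ 2 * (192 * CK * X + 32 * CK * Y + 8 * CK * (10 * farC * w) + Z) := by
        have := mul_le_mul_of_nonneg_left p4 (show 0 ≤ 8 * CK by positivity)
        linarith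
    _ ≤ 2 * ((192 * CK + 1 + 80 * CK * farC) * (w + X + Y + Z)) := by
        have : 0 ≤ CK * X := by positivity
        have : 0 ≤ CK * Y := by positivity
        have : 0 ≤ CK * Z := by positivity
        have : 0 ≤ CK * w := by positivity
        have : 0 ≤ CK * farC * X := by positivity
        have : 0 ≤ CK * farC * Y := by positivity
        have : 0 ≤ CK * farC * Z := by positivity
        nlinarith
    _ = _ := by ring

end DivForm

/-! ### Forces in divergence form: the theorem -/

theorem ae_bound_of_memWeighted {γ : ℝ} (hF : MemWeighted (2 + γ) F) :
    ∀ᵐ y, (1 + ‖y‖) ^ (2 + γ) * ‖F y‖ ≤ (wNorm (2 + γ) univ F).toReal := by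
  filter_upwards [ae_le_wNorm MeasurableSet.univ hF.2] with y hy using hy (mem_univ y)

/-- Qualitative statements only need quadratic decay, so the extra γ is dropped here by 1+|y|² ≤
(1+|y|)^{2+γ}. -/
theorem divForm_of_memWeighted {γ : ℝ} (hγ : 0 ≤ γ) (hf : MemLp f 2 volume)
    (hF : MemWeighted (2 + γ) F) (hd : IsDiv f F) :
    DivForm f F (wNorm (2 + γ) univ F).toReal := by
  refine ⟨hf, hd, hF.1.1, ENNReal.toReal_nonneg, ?_⟩
  filter_upwards [ae_bound_of_memWeighted hF] with y hy
  rw [sg_sq y zero_le_one, ← div_eq_mul_inv, le_div_iff₀ (by positivity), mul_comm]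
  refine le_trans (mul_le_mul_of_nonneg_right ?_ (norm_nonneg _)) hy
  have h1 : (1 + ‖y‖) ^ (2 : ℝ) ≤ (1 + ‖y‖) ^ (2 + γ) :=
    Real.rpow_le_rpow_of_exponent_le (by linarith [norm_nonneg y]) (by linarith)
  rw [Real.rpow_two] at h1
  nlinarith [norm_nonneg y]

/-- For γ > 0 the skew part is integrable and dominated convergence applies. Quadratic decay alone
is borderline in the plane, which is why existence of the limit is assumed when γ = 0. -/
theorem exists_tendsto_regSkew {γ : ℝ} (hγ : 0 < γ) (hF : MemWeighted (2 + γ) F) :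
    ∃ a : ℝ, Tendsto (regSkew F univ) (𝓝[>] (0 : ℝ)) (𝓝 a) := by
  set W := (wNorm (2 + γ) univ F).toReal
  have hi : Integrable (skew F) := by
    have h1 : Integrable fun y : Plane => (1 + ‖y‖) ^ (-(2 + γ)) :=
      integrable_one_add_norm (by simp [hγ])
    refine (h1.const_mul (2 * W)).mono' (aestronglyMeasurable_skew hF.1.1) ?_
    filter_upwards [ae_bound_of_memWeighted hF] with y hy
    have h2 : 0 < 1 + ‖y‖ := by positivity
    refine (abs_skew_le F y).trans ?_
    rw [Real.rpow_neg h2.le, mul_assoc, ← div_eq_mul_inv]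
    refine mul_le_mul_of_nonneg_left ?_ zero_le_two
    rw [le_div_iff₀ (by positivity), mul_comm]
    exact hy
  refine ⟨_, (tendsto_integral_reg hi).congr fun ε => ?_⟩
  rw [regSkew, setIntegral_univ]
  rfl

theorem ofReal_setIntegral_norm {E : Type*} [NormedAddCommGroup E] {g : Plane → E} {S : Set Plane}
    (hg : IntegrableOn (fun y => ‖g y‖) S) :
    ENNReal.ofReal (∫ y in S, ‖g y‖) = eLpNorm g 1 (volume.restrict S) := by
  rw [← eLpNorm_norm, eLpNorm_one_eq_lintegral_enorm, ← ofReal_integral_norm_eq_lintegral_enorm hg]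
  simp only [norm_norm]

/-- For |x| ≥ 2R the region |y| ≥ |x|/2 lies outside B_R, so the norm of F on that exterior controls
the outer part. The pointwise estimate is then bounded by the suprema. -/
theorem wNorm_rem_div_le {α γ R : ℝ} (hα : α ≠ 0) (hγ : 0 ≤ γ) (hγ' : γ < 1) (hR : 1 ≤ R)
    (hf : MemLp f 2 volume) (hF : MemWeighted (2 + γ) F) (hd : IsDiv f F) {a : ℝ}
    (ha : Tendsto (regSkew F univ) (𝓝[>] 0) (𝓝 a)) :
    wNorm (1 + γ) (ballCompl (2 * R)) (fun x => velD α F x - ctilde F • vortex x) ≤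
      ((8 * (192 * CK + 1 + 80 * CK * farC)).toNNReal : ℝ≥0∞) *
        (wNorm (2 + γ) (ballCompl R) F +
          (⨆ x ∈ ballCompl (2 * R), ENNReal.ofReal (‖x‖ ^ (-1 + γ)) *
            eLpNorm (fun y => ‖y‖ * ‖F y‖) 1 (volume.restrict (Metric.ball 0 (‖x‖ / 2)))) +
          (⨆ x ∈ ballCompl (2 * R),
            ENNReal.ofReal (min (1 / (|α| * ‖x‖ ^ (2 - γ))) (‖x‖ ^ γ)) *
              eLpNorm F 1 (volume.restrict (Metric.ball 0 (‖x‖ / 2)))) +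
          (⨆ x ∈ ballCompl (2 * R),
            ENNReal.ofReal (‖x‖ ^ γ * |skewLim F (ballCompl (‖x‖ / 2))|))) := by
  have hC := CK_pos
  have hfC := farC_nonneg
  have h := divForm_of_memWeighted hγ hf hF hd
  set K := 2 * (192 * CK + 1 + 80 * CK * farC) with hK
  have hK0 : 0 ≤ K := by positivity
  have e4 : ((8 * (192 * CK + 1 + 80 * CK * farC)).toNNReal : ℝ≥0∞) = 4 * ENNReal.ofReal K := by
    rw [show 8 * (192 * CK + 1 + 80 * CK * farC) = 4 * K by rw [hK]; ring, ← ENNReal.ofReal,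
      ENNReal.ofReal_mul (by norm_num)]
    norm_num
  have hwt : wNorm (2 + γ) (ballCompl R) F < ⊤ :=
    (eLpNorm_mono_measure _ (Measure.restrict_mono (subset_univ _) le_rfl)).trans_lt hF.2
  rw [e4, mul_assoc]
  refine wNorm_le_of_forall hγ hγ' hR fun x hx => ?_
  have hx0 : x ≠ 0 := norm_pos_iff.1 (by linarith)
  have hr : 0 < ‖x‖ := norm_pos_iff.2 hx0
  have hα' : 0 < |α| := abs_pos.2 hα
  set w := (wNorm (2 + γ) (ballCompl R) F).toReal with hw
  have hw0 : 0 ≤ w := ENNReal.toReal_nonneg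
  have hb : ∀ᵐ y, ‖x‖ / 2 ≤ ‖y‖ → ‖y‖ ^ (2 + γ) * ‖F y‖ ≤ w := by
    filter_upwards [ae_le_wNorm (measurableSet_ballCompl R) hwt] with y hy hxy
    refine le_trans ?_ (hy (show R ≤ ‖y‖ by linarith))
    gcongr
    linarith
  have key := h.norm_rem_le ha hα hγ hγ' hx0 hw0 hb
  have i0 := h.integrableOn_norm (‖x‖ / 2)
  have i1 : IntegrableOn (fun y => ‖‖y‖ * ‖F y‖‖) (Metric.ball 0 (‖x‖ / 2)) := by
    refine (i0.const_mul (‖x‖ / 2)).mono'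
      (continuous_norm.aestronglyMeasurable.mul h.meas.norm).norm.restrict ?_
    filter_upwards [ae_restrict_mem Metric.isOpen_ball.measurableSet] with y hy
    rw [mem_ball_zero_iff] at hy
    rw [norm_norm, norm_mul, norm_norm, norm_norm]
    gcongr
  have t1 : ENNReal.ofReal (‖x‖ ^ (-1 + γ) * ∫ y in Metric.ball 0 (‖x‖ / 2), ‖y‖ * ‖F y‖) =
      ENNReal.ofReal (‖x‖ ^ (-1 + γ)) *
        eLpNorm (fun y => ‖y‖ * ‖F y‖) 1 (volume.restrict (Metric.ball 0 (‖x‖ / 2))) := by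
    rw [← ofReal_setIntegral_norm i1, ← ENNReal.ofReal_mul (by positivity)]
    simp only [norm_mul, norm_norm]
  have t2 : ENNReal.ofReal (min (1 / (|α| * ‖x‖ ^ (2 - γ))) (‖x‖ ^ γ) *
      ∫ y in Metric.ball 0 (‖x‖ / 2), ‖F y‖) =
      ENNReal.ofReal (min (1 / (|α| * ‖x‖ ^ (2 - γ))) (‖x‖ ^ γ)) *
        eLpNorm F 1 (volume.restrict (Metric.ball 0 (‖x‖ / 2))) := by
    rw [← ofReal_setIntegral_norm i0, ← ENNReal.ofReal_mul (le_min (by positivity) (by positivity))]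
  rw [← ofReal_norm, ← ENNReal.ofReal_mul (by positivity)]
  refine (ENNReal.ofReal_le_ofReal key).trans ?_
  rw [ENNReal.ofReal_mul hK0]
  refine mul_le_mul_right ?_ _
  refine ENNReal.ofReal_add_le.trans (add_le_add (ENNReal.ofReal_add_le.trans (add_le_add
    (ENNReal.ofReal_add_le.trans (add_le_add ?_ ?_)) ?_)) ?_)
  · rw [hw, ENNReal.ofReal_toReal hwt.ne]
  · rw [t1]
    exact le_iSup₂ (f := fun x (_ : x ∈ ballCompl (2 * R)) => ENNReal.ofReal (‖x‖ ^ (-1 + γ)) *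
      eLpNorm (fun y => ‖y‖ * ‖F y‖) 1 (volume.restrict (Metric.ball 0 (‖x‖ / 2)))) x hx
  · rw [t2]
    exact le_iSup₂ (f := fun x (_ : x ∈ ballCompl (2 * R)) =>
      ENNReal.ofReal (min (1 / (|α| * ‖x‖ ^ (2 - γ))) (‖x‖ ^ γ)) *
        eLpNorm F 1 (volume.restrict (Metric.ball 0 (‖x‖ / 2)))) x hx
  · exact le_iSup₂ (f := fun x (_ : x ∈ ballCompl (2 * R)) =>
      ENNReal.ofReal (‖x‖ ^ γ * |skewLim F (ballCompl (‖x‖ / 2))|)) x hx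

theorem divergence_form_case {α γ : ℝ} (hα : α ≠ 0) (hγ : 0 ≤ γ) (hγ' : γ < 1)
    (hf : MemLp f 2 volume) (hF : MemWeighted (2 + γ) F) (hd : IsDiv f F)
    (hs : γ = 0 → ∃ a : ℝ, Tendsto (regSkew F univ) (𝓝[>] (0 : ℝ)) (𝓝 a)) :
    LConverges α f ∧
      (∀ r : ℝ, Tendsto (regSkew F (ballCompl r)) (𝓝[>] (0 : ℝ)) (𝓝 (skewLim F (ballCompl r)))) ∧
      Tendsto (regSkew F univ) (𝓝[>] (0 : ℝ)) (𝓝 (ctilde F)) ∧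
      (∃ p : Plane → ℝ, IsWeakSolution α f (L α f) p) ∧
      ∃ Rem : Plane → Plane,
        (∀ x : Plane, x ≠ 0 → L α f x = ctilde F • vortex x + Rem x) ∧
        ∀ R : ℝ, 1 ≤ R → wNorm (1 + γ) (ballCompl (2 * R)) Rem ≤
          ((8 * (192 * CK + 1 + 80 * CK * farC)).toNNReal : ℝ≥0∞) *
            (wNorm (2 + γ) (ballCompl R) F +
              (⨆ x ∈ ballCompl (2 * R), ENNReal.ofReal (‖x‖ ^ (-1 + γ)) *
                eLpNorm (fun y => ‖y‖ * ‖F y‖) 1 (volume.restrict (Metric.ball 0 (‖x‖ / 2)))) +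
              (⨆ x ∈ ballCompl (2 * R),
                ENNReal.ofReal (min (1 / (|α| * ‖x‖ ^ (2 - γ))) (‖x‖ ^ γ)) *
                  eLpNorm F 1 (volume.restrict (Metric.ball 0 (‖x‖ / 2)))) +
              (⨆ x ∈ ballCompl (2 * R),
                ENNReal.ofReal (‖x‖ ^ γ * |skewLim F (ballCompl (‖x‖ / 2))|))) := by
  have h := divForm_of_memWeighted hγ hf hF hd
  obtain ⟨hL, hv⟩ := LConverges_of_tendsto hα hf (h.tendsto_vel hα)
  obtain ⟨a, ha⟩ : ∃ a : ℝ, Tendsto (regSkew F univ) (𝓝[>] (0 : ℝ)) (𝓝 a) := by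
    rcases hγ.eq_or_lt with h0 | h0
    · exact hs h0.symm
    · exact exists_tendsto_regSkew h0 hF
  refine ⟨hL, fun r => tendsto_nhds_limUnder ⟨_, h.tendsto_regSkew_ballCompl ha r⟩,
    tendsto_nhds_limUnder ⟨a, ha⟩, ⟨_, hv ▸ h.isWeakSolution hα⟩,
    fun x => velD α F x - ctilde F • vortex x, fun x _ => ?_,
    fun R hR => wNorm_rem_div_le hα hγ hγ' hR hf hF hd ha⟩
  rw [hv, add_sub_cancel]

end RotStokes

end

/-! ### The full statement with explicit constants -/

theorem mainTheorem5 :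
    -- the improper integral defining the fundamental solution converges off the diagonal
    (∀ α : ℝ, α ≠ 0 → ∀ x y : RotStokes.Plane, x ≠ y → ∀ i j : Fin 2,
      Tendsto (fun T : ℝ => ∫ t in (0 : ℝ)..T, RotStokes.gammaIntegrand α x y t i j) atTop
        (𝓝 (RotStokes.fundSol α x y i j))) ∧
    -- (i)
    (∃ C₁ : ℝ≥0, ∀ (α γ R : ℝ) (f : RotStokes.Plane → RotStokes.Plane),
      α ≠ 0 → 0 ≤ γ → γ < 1 → 1 ≤ R →
      MemLp f 2 volume → (∀ᵐ y ∂(volume : Measure RotStokes.Plane), R ≤ ‖y‖ → f y = 0) →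
      RotStokes.LConverges α f ∧
      Tendsto (RotStokes.regTorque f) (𝓝[>] (0 : ℝ)) (𝓝 (RotStokes.c f)) ∧
      (∃ p : RotStokes.Plane → ℝ, RotStokes.IsWeakSolution α f (RotStokes.L α f) p) ∧
      ∃ Rem : RotStokes.Plane → RotStokes.Plane,
        (∀ x : RotStokes.Plane, x ≠ 0 →
          RotStokes.L α f x = RotStokes.c f • RotStokes.vortex x + Rem x) ∧
        RotStokes.wNorm (1 + γ) (RotStokes.ballCompl (2 * R)) Rem ≤
          C₁ * (ENNReal.ofReal (|α| ^ (-(1 + γ) / 2)) *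
                eLpNorm f 1 (volume.restrict (Metric.ball 0 R)) +
              eLpNorm (fun y => ‖y‖ ^ (1 + γ) * ‖f y‖) 1
                (volume.restrict (Metric.ball 0 R)))) ∧
    -- (ii)
    (∃ C₂ : ℝ≥0, ∀ (α γ : ℝ) (f : RotStokes.Plane → RotStokes.Plane)
        (F : RotStokes.Plane → RotStokes.Mat),
      α ≠ 0 → 0 ≤ γ → γ < 1 →
      MemLp f 2 volume → RotStokes.MemWeighted (2 + γ) F → RotStokes.IsDiv f F →
      (γ = 0 → ∃ a : ℝ, Tendsto (RotStokes.regSkew F univ) (𝓝[>] (0 : ℝ)) (𝓝 a)) →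
      RotStokes.LConverges α f ∧
      (∀ r : ℝ, Tendsto (RotStokes.regSkew F (RotStokes.ballCompl r)) (𝓝[>] (0 : ℝ))
        (𝓝 (RotStokes.skewLim F (RotStokes.ballCompl r)))) ∧
      Tendsto (RotStokes.regSkew F univ) (𝓝[>] (0 : ℝ)) (𝓝 (RotStokes.ctilde F)) ∧
      (∃ p : RotStokes.Plane → ℝ, RotStokes.IsWeakSolution α f (RotStokes.L α f) p) ∧
      ∃ Rem : RotStokes.Plane → RotStokes.Plane,
        (∀ x : RotStokes.Plane, x ≠ 0 →
          RotStokes.L α f x = RotStokes.ctilde F • RotStokes.vortex x + Rem x) ∧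
        ∀ R : ℝ, 1 ≤ R →
          RotStokes.wNorm (1 + γ) (RotStokes.ballCompl (2 * R)) Rem ≤
            C₂ * (RotStokes.wNorm (2 + γ) (RotStokes.ballCompl R) F +
              (⨆ x ∈ RotStokes.ballCompl (2 * R),
                ENNReal.ofReal (‖x‖ ^ (-1 + γ)) *
                  eLpNorm (fun y => ‖y‖ * ‖F y‖) 1
                    (volume.restrict (Metric.ball 0 (‖x‖ / 2)))) +
              (⨆ x ∈ RotStokes.ballCompl (2 * R),
                ENNReal.ofReal (min (1 / (|α| * ‖x‖ ^ (2 - γ))) (‖x‖ ^ γ)) *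
                  eLpNorm F 1 (volume.restrict (Metric.ball 0 (‖x‖ / 2)))) +
              (⨆ x ∈ RotStokes.ballCompl (2 * R),
                ENNReal.ofReal (‖x‖ ^ γ *
                  |RotStokes.skewLim F (RotStokes.ballCompl (‖x‖ / 2))|)))) := by
  refine ⟨fun α hα x y hxy i j => RotStokes.tendsto_gammaIntegrand hα hxy i j,
    ⟨(192 * RotStokes.CK).toNNReal, fun α γ R f hα hγ hγ' hR hf h0 =>
      RotStokes.compact_support_case hα hγ hγ' hR hf h0⟩,
    ⟨(8 * (192 * RotStokes.CK + 1 + 80 * RotStokes.CK * RotStokes.farC)).toNNReal,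
      fun α γ f F hα hγ hγ' hf hF hd hs =>
        RotStokes.divergence_form_case hα hγ hγ' hf hF hd hs⟩⟩
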